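/- **Setting.** Let $n,p\ge 1$, $X=(x_1,\dots,x_p)\in\mathbb R^{n\times p}$, $y\in\mathbb R^n$, $\gamma>0$, $\Sigma=X'X/n$ with columns $\chi_1,\dots,\chi_p$, and $\tilde z=X'y/n$. The MCP is $\rho(t;\lambda)=\lambda\int_0^t(1-x/(\gamma\lambda))_+\,dx$, with derivative $\dot\rho(t;\lambda)=\lambda(1-t/(\gamma\lambda))_+$, and the penalized loss is $L(b;\lambda)=\|y-Xb\|^2/(2n)+\sum_j\rho(|b_j|;\lambda)$. A *solution* is $\lambda\oplus\beta$, $\lambda>0$, with $x_j'(y-X\beta)/n=\mathrm{sgn}(\beta_j)\dot\rho(|\beta_j|;\lambda)$ if $\beta_j\ne0$ and $|x_j'(y-X\beta)/n|\le\lambda$ if $\beta_j=0$. A *main branch* is a continuous path $\lambda^{(x)}\oplus\beta^{(x)}$, $x\in[0,\infty)$, of solutions with $\beta^{(0)}=0$ and $\lambda^{(x)}\to0$ as $x\to\infty$. A *perfect fit* is $\beta$ with $X'(y-X\beta)=0$. For $i\in\{\pm1,\pm2\}$ let $u(i)=1$, $v(i)=1/\gamma$ if $|i|=1$ and $u(i)=v(i)=0$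 if $|i|=2$; let $t(-2)=-\infty$, $t(-1)=-\gamma$, $t(0)=t(1)=0$, $t(2)=\gamma$, $t(3)=\infty$. For $\eta\in\{-2,\dots,2\}^p$ let $S(\eta)\subset\mathbb R^p\oplus\mathbb R^p$ be the set of all $z\oplus b$ with $z_j-\chi_j'b=\mathrm{sgn}(\eta_j)u(\eta_j)-b_jv(\eta_j)$ and $t(\eta_j)\le b_j\le t(\eta_j+1)$ if $\eta_j\neq0$, and $|z_j-\chi_j'b|\le1$, $b_j=0$ if $\eta_j=0$. Let $\ell(\eta|z)=S(\eta)\cap\{(\tau z)\oplus b:\tau>0\}$ and $Q(\eta)=(\Sigma_{ij})_{\eta_i,\eta_j\ne0}-\mathrm{diag}(v(\eta_j):\eta_j\neq0)$. A *PLUS path* consists of $k^*$, $\eta^{(k)}\in\{-2,\dots,2\}^p$, $\tau^{(k)}>0$, $b^{(k)}\in\mathbb R^p$, $0\le k\le k^*$, with $\eta^{(0)}=b^{(0)}=0$, $\tau^{(0)}=1/\max_j|\tilde z_j|$, such that for $1\le k\le k^*$, $\ell(\eta^{(k)}|\tilde z)$ is a new segment (different from all the earlier ones), with the end points $(\tau^{(k-1)}\tilde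 z)\oplus b^{(k-1)}$ and $(\tau^{(k)}\tilde z)\oplus b^{(k)}$, $\tau^{(k)}\ne\tau^{(k-1)}$, and $\ell(\eta^{(k-1)}|\tilde z)\cap\ell(\eta^{(k)}|\tilde z)=\{(\tau^{(k-1)}\tilde z)\oplus b^{(k-1)}\}$. With $\tau^{(x)}\oplus b^{(x)}$ the linear interpolation on $[0,k^*]$, its curve is $\lambda^{(x)}\oplus\hat\beta^{(x)}=(1\oplus b^{(x)})/\tau^{(x)}$ for $0\le x\le k^*$, and $\hat\beta^{(x)}=\hat\beta^{(k^*)}$, $\lambda^{(x)}=(k^*/x)\lambda^{(k^*)}$ for $x>k^*$. $X$ is *nondegenerate* if for all $A\subset\{1,\dots,p\}$ with $|A|=\min(n,p)-1$ and all $\eta_k\in\{-1,0,1\}$, not all zero for $k\notin A$, the $\min(n,p)$ vectors $x_j$ $(j\in A)$ and $\sum_{k\notin A}\eta_kx_k$ are linearly independent. **Theorem 3.** For all $n,p\ge1$ there is a map $X\mapsto\Gamma_0(X)\subset\mathbb R$ such that: (i) If $X$ is nondegenerate, then $\Gamma_0(X)$ is finite, and for all $\gamma>0$ with $\gamma\notin\Gamma_0(X)$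 and all $y$ with $X'y\ne0$ there is a PLUS path whose curve is a main branch, with $\det Q(\eta^{(k)})\ne0$ for $0\le k\le k^*$, and with a perfect fit $\hat\beta^{(k^*)}$ at the finite final step $k^*$ (and at no earlier turning point). (ii) For each fixed $\gamma>0$, $X$ is nondegenerate and $\gamma\notin\Gamma_0(X)$ for Lebesgue-almost every $X\in\mathbb R^{n\times p}$. (iii) If $n\ge2$ or $p=1$, then for each fixed positive $\gamma\ne1$, $X$ is nondegenerate and $\gamma\notin\Gamma_0(X)$ for almost every $X$ under the product of the $p$ rotation-invariant measures on the sphere $\{x\in\mathbb R^n:\|x\|^2=n\}$. (iv) Let $X$ be nondegenerate and $0<\gamma\notin\Gamma_0(X)$. Then for almost every $\tilde z$ (that is, outside a Lebesgue-null set $H_0\subset\mathbb R^p$ for which also $\{y\in\mathbb R^n:X'y/n\in H_0\}$ is Lebesgue-null) there is a PLUS path as in (i) which is the output of the PLUS algorithm, and which is one-at-a-time. That is, for $1\le k\le k^*$, with $g_j^{(k-1)}=\tau^{(k-1)}\tilde z_j-\chi_j'b^{(k-1)}$: - there is exactly one index $j=j^{(k-1)}$ with ($|b_j^{(k-1)}|\in\{0,\gamma\}$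 and $\eta_j^{(k-1)}\ne0$) or $|g_j^{(k-1)}|=1$; $\eta^{(k)}_l=\eta^{(k-1)}_l$ for $l\neq j$; and $\eta_j^{(k)}=\mathrm{sgn}(g_j^{(k-1)})$ if $\eta_j^{(k-1)}=0$, $\eta_j^{(k)}=\eta_j^{(k-1)}+\mathrm{sgn}(b_j^{(k-1)}-b_j^{(k-2)})$ otherwise; - there is exactly one $s=s^{(k)}$ with $Q(\eta^{(k)})(s_l)_{\eta^{(k)}_l\ne0}=(\tilde z_l)_{\eta^{(k)}_l\neq0}$ and $s_l=0$ whenever $\eta_l^{(k)}=0$; - $\xi^{(k)}=\mathrm{sgn}(\tau^{(k)}-\tau^{(k-1)})$ equals $(\eta_j^{(k)}-\eta_j^{(k-1)})\,\mathrm{sgn}(s_j)$ if $\eta_j^{(k)}\neq0$ and $\eta_j^{(k-1)}\mathrm{sgn}(\chi_j's-\tilde z_j)$ if $\eta_j^{(k)}=0$; - $\tau^{(k)}=\tau^{(k-1)}+\xi^{(k)}\Delta^{(k)}>0$ and $b^{(k)}=b^{(k-1)}+(\tau^{(k)}-\tau^{(k-1)})s$, where $\Delta^{(k)}=\min_l\Delta_l^{(k)}>0$;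 here, for $\eta_l^{(k)}\ne0$, $\Delta_l^{(k)}$ is $\xi^{(k)}\{t(\eta^{(k)}_l+1)-b_l^{(k-1)}\}/s_l$ if $\xi^{(k)}s_l>0$ and $\xi^{(k)}\{t(\eta^{(k)}_l)-b_l^{(k-1)}\}/s_l$ if $\xi^{(k)}s_l<0$; for $\eta_l^{(k)}=0$ and $d_l=\tilde z_l-\chi_l's$ it is $\xi^{(k)}\{\pm1-g_l^{(k-1)}\}/d_l$ if $\pm\xi^{(k)}d_l>0$; and it is $\infty$ in all other cases. Every index $l$ attaining the minimum satisfies ($|b_l^{(k)}|\in\{0,\gamma\}$ and $\eta_l^{(k)}\neq0$) or $|g_l^{(k)}|=1$. Moreover the main branch is unique: up to the trivial solutions $\lambda\oplus0$, $\lambda\ge\max_j|\tilde z_j|$, every main branch reaches a perfect fit, and its graph up to the first perfect fit is the graph $\{\lambda^{(x)}\oplus\hat\beta^{(x)}:0\le x\le k^*\}$ of the PLUS path; and if the columns $x_j$ with $\hat\beta_j^{(k^*)}\neq0$ are linearly independent (in particular if $p\le n$), its whole graph is $\{\lambda^{(x)}\oplus\hat\beta^{(x)}:x\ge0\}$. (v)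 For all $X$, $y$, $\gamma>0$, every PLUS path and $1\le k\le k^*$: if $Q(\eta^{(k)})$ is positive definite and $\ell(\eta^{(k)}|\tilde z)$ is not contained in the (relative) boundary of $S(\eta^{(k)})$, then $\hat\beta^{(x)}$ is a local minimizer of $L(\cdot;\lambda^{(x)})$ for all $k-1<x<k$. -/

import Mathlib

open Set Filter Topology MeasureTheory

namespace MCPlus

noncomputable section

/-! ### The penalty, the penalized loss and its critical points -/

/-- The minimax concave penalty `ρ(t; lam) = lam ∫₀ᵗ (1 - x / (γ lam))₊ dx`. -/
def mcp (γ lam t : ℝ) : ℝ := lam * ∫ x in (0 : ℝ)..t, max (1 - x / (γ * lam)) 0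

/-- The derivative `lam (1 - t / (γ lam))₊` of the minimax concave penalty. -/
def mcpDeriv (γ lam t : ℝ) : ℝ := lam * max (1 - t / (γ * lam)) 0

theorem hasDerivAt_mcp (γ lam t : ℝ) : HasDerivAt (mcp γ lam) (mcpDeriv γ lam t) t := by
  have hc : Continuous fun x : ℝ => max (1 - x / (γ * lam)) 0 := by fun_prop
  exact (hc.integral_hasStrictDerivAt 0 t).hasDerivAt.const_mul lam

variable {n p : ℕ}

/-- The normalized Gram matrix `Σ = X'X / n`. -/
def gram (X : Matrix (Fin n) (Fin p) ℝ) : Matrix (Fin p) (Fin p) ℝ :=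
  (1 / (n : ℝ)) • (X.transpose * X)

/-- The vector `z̃ = X'y / n`. -/
def zTilde (X : Matrix (Fin n) (Fin p) ℝ) (y : Fin n → ℝ) : Fin p → ℝ :=
  (1 / (n : ℝ)) • X.transpose.mulVec y

/-- The penalized loss `L(b; lam) = ‖y - Xb‖² / (2n) + ∑ⱼ ρ(|bⱼ|; lam)`. -/
def loss (X : Matrix (Fin n) (Fin p) ℝ) (y : Fin n → ℝ) (γ lam : ℝ) (b : Fin p → ℝ) : ℝ :=
  (∑ i, (y i - X.mulVec b i) ^ 2) / (2 * (n : ℝ)) + ∑ j, mcp γ lam |b j|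

/-- `lam ⊕ β` solves the estimating equation of the penalized loss:
`xⱼ'(y - Xβ)/n = sgn(βⱼ) ρ̇(|βⱼ|; lam)` if `βⱼ ≠ 0`, and `|xⱼ'(y - Xβ)/n| ≤ lam` if `βⱼ = 0`. -/
def IsCritical (X : Matrix (Fin n) (Fin p) ℝ) (y : Fin n → ℝ) (γ lam : ℝ) (β : Fin p → ℝ) :
    Prop :=
  ∀ j, (β j ≠ 0 → X.transpose.mulVec (y - X.mulVec β) j / (n : ℝ)
          = Real.sign (β j) * mcpDeriv γ lam |β j|) ∧
       (β j = 0 → |X.transpose.mulVec (y - X.mulVec β) j / (n : ℝ)| ≤ lam)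

/-- The perfect (global least squares) fit `X'(y - Xβ) = 0`. -/
def PerfectFit (X : Matrix (Fin n) (Fin p) ℝ) (y : Fin n → ℝ) (β : Fin p → ℝ) : Prop :=
  X.transpose.mulVec (y - X.mulVec β) = 0

/-- `v(x) = lam(x) ⊕ β(x)`, `x ∈ [0, ∞)`, is a continuous path of solutions of the estimating
equation (at positive penalty levels) with `β(0) = 0` and `lam(x) → 0`. -/
structure IsSolutionPath (X : Matrix (Fin n) (Fin p) ℝ) (y : Fin n → ℝ) (γ : ℝ)
    (v : ℝ → ℝ × (Fin p → ℝ)) : Prop where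
  continuousOn : ContinuousOn v (Ici 0)
  pos : ∀ x, 0 ≤ x → 0 < (v x).1
  critical : ∀ x, 0 ≤ x → IsCritical X y γ (v x).1 (v x).2
  start : (v 0).2 = 0
  lim : Tendsto (fun x => (v x).1) atTop (𝓝 0)

/-! ### Indicators, parallelepipeds, segments -/

/-- `u(i) = u_{|i|}` for the MCP, where `u₁ = 1` and `u₂ = 0`. -/
def uCoef (i : ℤ) : ℝ := if |i| = 1 then 1 else 0

/-- `v(i) = v_{|i|}` for the MCP, where `v₁ = 1/γ` and `v₂ = 0`. -/
def vCoef (γ : ℝ) (i : ℤ) : ℝ := if |i| = 1 then 1 / γ else 0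

/-- `t(i) = t_i` for `0 < i ≤ 3` and `t(i) = -t_{|i|+1}` for `-2 ≤ i ≤ 0`, where for the MCP
`t₁ = 0`, `t₂ = γ` and `t₃ = ∞`. -/
def knot (γ : ℝ) (i : ℤ) : EReal :=
  if i ≤ -2 then ⊥
  else if i = -1 then ((-γ : ℝ) : EReal)
  else if i ≤ 1 then 0
  else if i = 2 then (γ : EReal)
  else ⊤

/-- The parallelepiped `S(η)`, a subset of `H ⊕ H* = ℝ^p × ℝ^p`, for an indicator
`η ∈ {-2, -1, 0, 1, 2}^p`. -/
def S (X : Matrix (Fin n) (Fin p) ℝ) (γ : ℝ) (η : Fin p → ℤ) :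
    Set ((Fin p → ℝ) × (Fin p → ℝ)) :=
  {q | ∀ j,
    (η j ≠ 0 →
      q.1 j - (gram X).mulVec q.2 j
          = ((η j).sign : ℝ) * uCoef (η j) - q.2 j * vCoef γ (η j) ∧
      knot γ (η j) ≤ (q.2 j : EReal) ∧ (q.2 j : EReal) ≤ knot γ (η j + 1)) ∧
    (η j = 0 →
      -1 ≤ q.1 j - (gram X).mulVec q.2 j ∧ q.1 j - (gram X).mulVec q.2 j ≤ 1 ∧ q.2 j = 0)}

/-- `ℓ(η | z) = S(η) ∩ {(τz) ⊕ b : τ > 0, b ∈ H*}`. -/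
def ell (X : Matrix (Fin n) (Fin p) ℝ) (γ : ℝ) (η : Fin p → ℤ) (z : Fin p → ℝ) :
    Set ((Fin p → ℝ) × (Fin p → ℝ)) :=
  S X γ η ∩ {q | ∃ τ : ℝ, 0 < τ ∧ q.1 = τ • z}

/-- `Q(η) = Σ_{A(η)} - diag(v(ηⱼ), ηⱼ ≠ 0)`, a matrix indexed by `A(η) = {j : ηⱼ ≠ 0}`. -/
def Q (X : Matrix (Fin n) (Fin p) ℝ) (γ : ℝ) (η : Fin p → ℤ) :
    Matrix {j // η j ≠ 0} {j // η j ≠ 0} ℝ :=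
  (gram X).submatrix Subtype.val Subtype.val - Matrix.diagonal fun j => vCoef γ (η j.1)

/-! ### The PLUS path -/

/-- The number `K` of steps, the indicators `η k`, and the turning points `τ k ⊕ b k`,
`k = 0, …, K`.  Values at `k > K` are irrelevant. -/
structure PathData (p : ℕ) where
  K : ℕ
  η : ℕ → Fin p → ℤ
  τ : ℕ → ℝ
  b : ℕ → Fin p → ℝ

/-- The linear interpolation `τ(x) ⊕ b(x)`,
`(k - x)(τ (k-1) ⊕ b (k-1)) + (x - k + 1)(τ k ⊕ b k)` for `k - 1 < x ≤ k`.
(At `x = 0` one has `k = 0`; the first coefficient vanishes and the value is `τ 0 ⊕ b 0`.) -/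
def PathData.interp (D : PathData p) (x : ℝ) : ℝ × (Fin p → ℝ) :=
  ((⌈x⌉₊ : ℝ) - x) • (D.τ (⌈x⌉₊ - 1), D.b (⌈x⌉₊ - 1))
    + (x - (⌈x⌉₊ : ℝ) + 1) • (D.τ ⌈x⌉₊, D.b ⌈x⌉₊)

/-- The estimate `β k = b k / τ k` at the turning point `k`. -/
def PathData.beta (D : PathData p) (k : ℕ) : Fin p → ℝ := (1 / D.τ k) • D.b k

/-- The path `lam(x) ⊕ β(x) = (1 ⊕ b(x)) / τ(x)` for `0 ≤ x ≤ K`, continued by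
`(K/x) lam(K) ⊕ β(K)` for `x > K`. -/
def PathData.curve (D : PathData p) (x : ℝ) : ℝ × (Fin p → ℝ) :=
  if x ≤ D.K then (1 / (D.interp x).1, (1 / (D.interp x).1) • (D.interp x).2)
  else ((D.K / x) * (1 / D.τ D.K), D.beta D.K)

/-- The point `(τ k z̃) ⊕ b k` of `H ⊕ H*`. -/
def PathData.vertex (D : PathData p) (z : Fin p → ℝ) (k : ℕ) : (Fin p → ℝ) × (Fin p → ℝ) :=
  (D.τ k • z, D.b k)

/-- `D` describes a piecewise linear path through the solution surface: it starts with
`η 0 = 0`, `b 0 = 0`, `τ 0 = 1 / maxⱼ |z̃ⱼ|`; for `1 ≤ k ≤ K` its `k`-th segment is a new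
segment `ℓ(η k | z̃)` with the two distinct end points `(τ (k-1) z̃) ⊕ b (k-1)` and
`(τ k z̃) ⊕ b k`, and it meets the preceding one exactly in the former point. -/
structure IsPath (X : Matrix (Fin n) (Fin p) ℝ) (y : Fin n → ℝ) (γ : ℝ) (D : PathData p) :
    Prop where
  eta_range : ∀ k ≤ D.K, ∀ j, |D.η k j| ≤ 2
  eta_zero : D.η 0 = 0
  b_zero : D.b 0 = 0
  tau_zero : D.τ 0 = 1 / ⨆ j, |zTilde X y j|
  tau_pos : ∀ k ≤ D.K, 0 < D.τ k
  tau_ne : ∀ k < D.K, D.τ k ≠ D.τ (k + 1)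
  isSegment : ∀ k < D.K, ell X γ (D.η (k + 1)) (zTilde X y)
    = segment ℝ (D.vertex (zTilde X y) k) (D.vertex (zTilde X y) (k + 1))
  connected : ∀ k < D.K, ell X γ (D.η k) (zTilde X y) ∩ ell X γ (D.η (k + 1)) (zTilde X y)
    = {D.vertex (zTilde X y) k}
  isNew : ∀ k ≤ D.K, ∀ i < k, ell X γ (D.η i) (zTilde X y) ≠ ell X γ (D.η k) (zTilde X y)

/-- The path ends with a perfect fit at step `K`, and not before. -/
def EndsInPerfectFit (X : Matrix (Fin n) (Fin p) ℝ) (y : Fin n → ℝ) (D : PathData p) : Prop :=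
  PerfectFit X y (D.beta D.K) ∧ ∀ k < D.K, ¬ PerfectFit X y (D.beta k)

/-! ### The PLUS algorithm in the one-at-a-time scenario -/

/-- `gⱼ = τ z̃ⱼ - χⱼ' b` at the turning point `k`. -/
def gAt (X : Matrix (Fin n) (Fin p) ℝ) (y : Fin n → ℝ) (D : PathData p) (k : ℕ) (j : Fin p) :
    ℝ :=
  D.τ k * zTilde X y j - (gram X).mulVec (D.b k) j

/-- The indices `j` whose inequality is hit at the turning point `k`: either `ηⱼ ≠ 0` and `|bⱼ|`
is one of the knots `0`, `γ`, or `|τ z̃ⱼ - χⱼ' b| = 1`. -/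
def hitSet (X : Matrix (Fin n) (Fin p) ℝ) (y : Fin n → ℝ) (γ : ℝ) (D : PathData p) (k : ℕ) :
    Set (Fin p) :=
  {j | ((|D.b k j| = 0 ∨ |D.b k j| = γ) ∧ D.η k j ≠ 0) ∨ |gAt X y D k j| = 1}

/-- The new indicator `η (k+1) j` at the hit index `j`. (If `k = 0` then `η k j = 0`, so that
`k - 1` is used only for `k ≥ 1`.) -/
def nextEta (X : Matrix (Fin n) (Fin p) ℝ) (y : Fin n → ℝ) (D : PathData p) (k : ℕ)
    (j : Fin p) : ℤ :=
  if D.η k j = 0 then ((SignType.sign (gAt X y D k j) : SignType) : ℤ)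
  else D.η k j + ((SignType.sign (D.b k j - D.b (k - 1) j) : SignType) : ℤ)

/-- The slope equations `Q(η) P(η) s = P(η) z̃`, and `sⱼ = 0` if `ηⱼ = 0`. -/
def IsSlope (X : Matrix (Fin n) (Fin p) ℝ) (y : Fin n → ℝ) (γ : ℝ) (η : Fin p → ℤ)
    (s : Fin p → ℝ) : Prop :=
  (Q X γ η).mulVec (fun j => s j.1) = (fun j => zTilde X y j.1) ∧ ∀ j, η j = 0 → s j = 0

/-- The sign `ξ` of `dτ` on the segment with indicator `η'` and slope `s`, entered from `η`
through the side with index `j`. -/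
def xiOf (X : Matrix (Fin n) (Fin p) ℝ) (y : Fin n → ℝ) (η η' : Fin p → ℤ) (s : Fin p → ℝ)
    (j : Fin p) : ℝ :=
  if η' j ≠ 0 then ((η' j - η j : ℤ) : ℝ) * Real.sign (s j)
  else (η j : ℝ) * Real.sign ((gram X).mulVec s j - zTilde X y j)

/-- The length `Δⱼ` of the segment from the turning point `k`, with indicator `η'`, slope `s` and
sign `ξ`, if it first hits the boundary in the `j`-th coordinate (`∞` if that never happens). -/
def deltaOf (X : Matrix (Fin n) (Fin p) ℝ) (y : Fin n → ℝ) (γ : ℝ) (D : PathData p) (k : ℕ)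
    (η' : Fin p → ℤ) (s : Fin p → ℝ) (ξ : ℝ) (j : Fin p) : EReal :=
  if η' j ≠ 0 then
    if 0 < ξ * s j then ((ξ / s j : ℝ) : EReal) * (knot γ (η' j + 1) - (D.b k j : EReal))
    else if ξ * s j < 0 then ((ξ / s j : ℝ) : EReal) * (knot γ (η' j) - (D.b k j : EReal))
    else ⊤
  else
    if 0 < ξ * (zTilde X y j - (gram X).mulVec s j) then
      ((ξ * (1 - gAt X y D k j) / (zTilde X y j - (gram X).mulVec s j) : ℝ) : EReal)
    else if ξ * (zTilde X y j - (gram X).mulVec s j) < 0 then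
      ((ξ * (-1 - gAt X y D k j) / (zTilde X y j - (gram X).mulVec s j) : ℝ) : EReal)
    else ⊤

/-- Step `k + 1` of the PLUS algorithm, leading from the turning point `k` to the turning point
`k + 1`, is valid and unambiguous, with slope `s`, sign `ξ` and length `Δ`. -/
structure IsPlusStep (X : Matrix (Fin n) (Fin p) ℝ) (y : Fin n → ℝ) (γ : ℝ) (D : PathData p)
    (k : ℕ) (j : Fin p) (s : Fin p → ℝ) (ξ Δ : ℝ) : Prop where
  /-- the hit index is unique -/
  hit : hitSet X y γ D k = {j}
  eta_same : ∀ l, l ≠ j → D.η (k + 1) l = D.η k l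
  eta_next : D.η (k + 1) j = nextEta X y D k j
  /-- the slope equations have exactly one solution -/
  slope : ∀ s', IsSlope X y γ (D.η (k + 1)) s' ↔ s' = s
  xi_eq : ξ = xiOf X y (D.η k) (D.η (k + 1)) s j
  xi_sign : ξ = Real.sign (D.τ (k + 1) - D.τ k)
  delta_eq : (Δ : EReal) = ⨅ l, deltaOf X y γ D k (D.η (k + 1)) s ξ l
  /-- the minimum is attained at indices which are hit at the next turning point -/
  delta_hit : ∀ l, deltaOf X y γ D k (D.η (k + 1)) s ξ l = (Δ : EReal) →
    l ∈ hitSet X y γ D (k + 1)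
  delta_pos : 0 < Δ
  tau_eq : D.τ (k + 1) = D.τ k + ξ * Δ
  b_eq : D.b (k + 1) = D.b k + (D.τ (k + 1) - D.τ k) • s

/-- `D` is the output of the PLUS algorithm, and all its steps are one-at-a-time. -/
structure IsPlusOutput (X : Matrix (Fin n) (Fin p) ℝ) (y : Fin n → ℝ) (γ : ℝ) (D : PathData p) :
    Prop where
  eta_zero : D.η 0 = 0
  b_zero : D.b 0 = 0
  tau_zero : D.τ 0 = 1 / ⨆ j, |zTilde X y j|
  step : ∀ k < D.K, ∃ j s ξ Δ, IsPlusStep X y γ D k j s ξ Δ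
  tau_pos : ∀ k ≤ D.K, 0 < D.τ k

/-! ### Uniqueness of the main branch -/

/-- The trivial solutions `lam ⊕ 0`, `lam ≥ maxⱼ |z̃ⱼ|`. -/
def trivialRay (X : Matrix (Fin n) (Fin p) ℝ) (y : Fin n → ℝ) : Set (ℝ × (Fin p → ℝ)) :=
  {q | (⨆ j, |zTilde X y j|) ≤ q.1 ∧ q.2 = 0}

/-- Every continuous path `v` of solutions from `β = 0` to penalty level `0` has, up to the trivial
solutions, the same graph as the path of `D`: it reaches a perfect fit, and until then it traces
exactly the segments of `D`; and if the columns of the final support of `D` are linearly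
independent, then the whole graphs are the same. -/
def IsUniqueBranch (X : Matrix (Fin n) (Fin p) ℝ) (y : Fin n → ℝ) (γ : ℝ) (D : PathData p) :
    Prop :=
  ∀ v, IsSolutionPath X y γ v →
    (∃ T, 0 ≤ T ∧ PerfectFit X y (v T).2 ∧ (∀ x, 0 ≤ x → x < T → ¬ PerfectFit X y (v x).2) ∧
      v '' Icc 0 T ∪ trivialRay X y = D.curve '' Icc 0 (D.K : ℝ) ∪ trivialRay X y) ∧
    ((LinearIndependent ℝ fun (j : {j // D.b D.K j ≠ 0}) (i : Fin n) => X i j.1) →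
      v '' Ici 0 ∪ trivialRay X y = D.curve '' Ici 0 ∪ trivialRay X y)

/-! ### Designs -/

/-- The design `X` is nondegenerate: for all `A` of size `min n p - 1` and all signs
`ηₖ ∈ {-1, 0, 1}` that do not all vanish off `A`, the `min n p` vectors `xⱼ`, `j ∈ A`, and
`∑_{k ∉ A} ηₖ xₖ` are linearly independent. -/
def Nondegenerate (X : Matrix (Fin n) (Fin p) ℝ) : Prop :=
  ∀ A : Finset (Fin p), A.card = min n p - 1 →
    ∀ η : Fin p → ℤ, (∀ j, η j = -1 ∨ η j = 0 ∨ η j = 1) → (∃ k, k ∉ A ∧ η k ≠ 0) →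
      LinearIndependent ℝ fun o : Option {j // j ∈ A} =>
        o.elim (fun i : Fin n => ∑ k ∈ Aᶜ, (η k : ℝ) * X i k) (fun j i => X i j.1)

/-- The design with columns `xⱼ = √n uⱼ`, where the `uⱼ` are on the unit sphere of `ℝⁿ`, so that
the `xⱼ` are on the sphere `{x : ‖x‖² = n}`. -/
def sphereDesign (u : Fin p → Metric.sphere (0 : EuclideanSpace ℝ (Fin n)) 1) :
    Matrix (Fin n) (Fin p) ℝ :=
  Matrix.of fun i j => Real.sqrt n * (u j : EuclideanSpace ℝ (Fin n)) i

end

end MCPlus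

open MCPlus

/-! Put τ = 1/λ and b = β/λ. After division by λ the estimating equation says that each pair (g_j,
b_j), where g = τz̃ - Σb, lies on one polygonal curve in the plane that does not depend on λ. This
curve is a copy of ℝ. Parametrizing it by u gives a continuous, piecewise affine map `surf`, u ↦
g(u) + Σb(u), of ℝ^p into itself. It is affine on every `Box η`, and the solutions for y are exactly
the preimages of the open ray {τz̃ : τ > 0} (`isCritical_iff`). A main branch is a path in this
preimage, so the theorem is about following a path through a piecewise linear map.

Where Q(η) is nonsingular, the preimage within `Box η` is a segment. The exceptional set Γ₀(X)
consists of the γ for which some η with fewer than min(n,p) entries ±2 has a singular Q(η). Over a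
generic direction a segment meets facets transversally and, before a perfect fit, one at a time, and
exactly two boxes meet at such a point. Hence the path continues in exactly one way and never
returns to an old box. It cannot reach τ = 0, since only u = 0 lies over the origin
(`eq_zero_of_surf_eq_zero`), and there are finitely many boxes, so it must end, which is possible
only at a perfect fit. Nondegeneracy enters because a residual orthogonal to min(n,p) columns is
orthogonal to all of them. Therefore the number of entries ±2 can become too large (`Good.update`),
or two facets can be hit together (`Generic.gVec_eq_zero`), only at a perfect fit.

An arbitrary y is the limit of generic y + εy₁. An ultrafilter fixes the finite sequence of
indicators, and the turning points converge, unless one escapes to infinity. In that case the limit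
segment consists of perfect fits (`gVec_eq_zero_of_unbounded`), and the path may stop before it
(`Walk.limit`). Removal of loops turns the limit into a legitimate path (`Walk.exists_trail`,
`Trail.isPath`).

For uniqueness, a continuous solution path is lifted to parameters. A connectedness argument keeps
it in the boxes of the chain until the first perfect fit, and the intermediate value theorem,
applied to a coordinate along the chain, shows that it covers the chain (`Chain.exists_coord`,
`image_union_eq`).

The almost-everywhere statements hold because the conditions on X amount to the nonvanishing of
polynomials, for which one good design suffices (`IsPolyFun.ae_ne_zero`), together with a fibrewise
argument for the signed sums of columns. The sphere is reached by radial projection. Local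
minimality holds because a positive definite Q(η) outweighs the concavity of the penalty in the
active coordinates, while the kink of the penalty at 0 controls the inactive ones. -/

namespace MCPlus
noncomputable section

/-! ### A parametrization of the graph of the penalty's derivative -/

/-- Truncation to `[-c, c]`. -/
def clip (c u : ℝ) : ℝ := max (-c) (min c u)

/-- The gradient coordinate of the point with parameter `u` on the solution curve. -/
def gFun (u : ℝ) : ℝ := 2 * clip 1 u - clip 2 u

/-- The coefficient coordinate of the point with parameter `u` on the solution curve. -/
def bFun (γ u : ℝ) : ℝ := γ * (u - clip 1 u)

/-- The parameter of the point `(g, b)` of the solution curve. -/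
def coordOf (γ g b : ℝ) : ℝ := g + b / γ + clip 1 (b / γ)

/-- The parameter interval on which the indicator is `i`. -/
def cell (i : ℤ) : Set ℝ :=
  if i = 0 then Icc (-1) 1 else if i = 1 then Icc 1 2 else if i = 2 then Ici 2
  else if i = -1 then Icc (-2) (-1) else if i = -2 then Iic (-2) else ∅

/-- The slope of `gFun` on `cell i`. -/
def gSlope (i : ℤ) : ℝ := if i = 0 then 1 else if |i| = 1 then -1 else 0

/-- The intercept of `gFun` on `cell i`. -/
def gConst (i : ℤ) : ℝ := if |i| = 1 then 2 * i else 0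

/-- The slope of `bFun` on `cell i`. -/
def bSlope (γ : ℝ) (i : ℤ) : ℝ := if i = 0 then 0 else γ

/-- The intercept of `bFun` on `cell i`. -/
def bConst (γ : ℝ) (i : ℤ) : ℝ := -γ * (i.sign : ℝ)

/-- The parameters at which the indicator changes. -/
def IsTie (u : ℝ) : Prop := |u| = 1 ∨ |u| = 2

theorem continuous_clip (c : ℝ) : Continuous (clip c) := by unfold clip; fun_prop
theorem continuous_gFun : Continuous gFun := by
  unfold gFun; exact (continuous_const.mul (continuous_clip 1)).sub (continuous_clip 2)
theorem continuous_bFun (γ : ℝ) : Continuous (bFun γ) := by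
  unfold bFun; exact continuous_const.mul (continuous_id.sub (continuous_clip 1))

theorem clip_of_le {c u : ℝ} (hc : 0 ≤ c) (h : u ≤ -c) : clip c u = -c := by
  unfold clip; rw [min_eq_right (by linarith), max_eq_left h]
theorem clip_of_ge {c u : ℝ} (hc : 0 ≤ c) (h : c ≤ u) : clip c u = c := by
  unfold clip; rw [min_eq_left h, max_eq_right (by linarith)]
theorem clip_of_mem {c u : ℝ} (h₁ : -c ≤ u) (h₂ : u ≤ c) : clip c u = u := by
  unfold clip; rw [min_eq_right h₂, max_eq_right h₁]

theorem mem_cell_iff {i : ℤ} {u : ℝ} : u ∈ cell i ↔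
    (i = 0 ∧ -1 ≤ u ∧ u ≤ 1) ∨ (i = 1 ∧ 1 ≤ u ∧ u ≤ 2) ∨ (i = 2 ∧ 2 ≤ u) ∨
    (i = -1 ∧ -2 ≤ u ∧ u ≤ -1) ∨ (i = -2 ∧ u ≤ -2) := by
  unfold cell
  split_ifs <;> simp_all

theorem abs_le_two_of_mem_cell {i : ℤ} {u : ℝ} (h : u ∈ cell i) : |i| ≤ 2 := by
  rcases mem_cell_iff.1 h with ⟨rfl, _⟩ | ⟨rfl, _⟩ | ⟨rfl, _⟩ | ⟨rfl, _⟩ | ⟨rfl, _⟩ <;> decide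

theorem isClosed_cell (i : ℤ) : IsClosed (cell i) := by
  unfold cell
  split_ifs <;> first | exact isClosed_Icc | exact isClosed_Ici | exact isClosed_Iic | exact isClosed_empty

theorem convex_cell (i : ℤ) : Convex ℝ (cell i) := by
  unfold cell
  split_ifs <;> first
    | exact convex_Icc _ _ | exact convex_Ici _ | exact convex_Iic _ | exact convex_empty

theorem exists_mem_cell (u : ℝ) : ∃ i, u ∈ cell i := by
  simp only [mem_cell_iff]
  by_cases h1 : u ≤ -2
  · exact ⟨-2, by simp [h1]⟩
  by_cases h2 : u ≤ -1
  · exact ⟨-1, by push Not at h1; simp [h2, h1.le]⟩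
  by_cases h3 : u ≤ 1
  · exact ⟨0, by push Not at h2; simp [h3, h2.le]⟩
  by_cases h4 : u ≤ 2
  · exact ⟨1, by push Not at h3; simp [h4, h3.le]⟩
  · exact ⟨2, by push Not at h4; simp [h4.le]⟩

theorem gFun_of_mem {i : ℤ} {u : ℝ} (h : u ∈ cell i) : gFun u = gSlope i * u + gConst i := by
  unfold gFun
  rcases mem_cell_iff.1 h with ⟨rfl, h⟩ | ⟨rfl, h⟩ | ⟨rfl, h⟩ | ⟨rfl, h⟩ | ⟨rfl, h⟩
  · rw [clip_of_mem h.1 h.2, clip_of_mem (by linarith) (by linarith)]; simp [gSlope, gConst]; ring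
  · rw [clip_of_ge (by norm_num) h.1, clip_of_mem (by linarith) (by linarith)]
    simp [gSlope, gConst]; ring
  · rw [clip_of_ge (by norm_num) (by linarith), clip_of_ge (by norm_num) h]
    simp [gSlope, gConst]
  · rw [clip_of_le (by norm_num) h.2, clip_of_mem (by linarith) (by linarith)]
    simp [gSlope, gConst]; ring
  · rw [clip_of_le (by norm_num) (by linarith), clip_of_le (by norm_num) h]
    simp [gSlope, gConst]

theorem bFun_of_mem {γ : ℝ} {i : ℤ} {u : ℝ} (h : u ∈ cell i) :
    bFun γ u = bSlope γ i * u + bConst γ i := by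
  unfold bFun
  rcases mem_cell_iff.1 h with ⟨rfl, h⟩ | ⟨rfl, h⟩ | ⟨rfl, h⟩ | ⟨rfl, h⟩ | ⟨rfl, h⟩
  · rw [clip_of_mem h.1 h.2]; simp [bSlope, bConst]
  · rw [clip_of_ge (by norm_num) h.1]; simp [bSlope, bConst]; ring
  · rw [clip_of_ge (by norm_num) (by linarith)]
    rw [bSlope, bConst, show (Int.sign 2) = 1 from rfl]; simp; ring
  · rw [clip_of_le (by norm_num) h.2]; simp [bSlope, bConst]; ring
  · rw [clip_of_le (by norm_num) (by linarith)]
    rw [bSlope, bConst, show (Int.sign (-2)) = -1 from rfl]; simp; ring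

/-- This continuous left inverse makes the parametrization injective and lets continuous solution
paths be lifted to continuous parameters. The clipped term counts b/γ twice on the penalized cells,
which compensates the decrease of g there. -/
theorem coordOf_gFun_bFun {γ : ℝ} (hγ : 0 < γ) (u : ℝ) : coordOf γ (gFun u) (bFun γ u) = u := by
  unfold coordOf bFun gFun
  rw [mul_div_cancel_left₀ _ hγ.ne']
  obtain ⟨i, hi⟩ := exists_mem_cell u
  rcases mem_cell_iff.1 hi with ⟨rfl, h⟩ | ⟨rfl, h⟩ | ⟨rfl, h⟩ | ⟨rfl, h⟩ | ⟨rfl, h⟩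
  · rw [clip_of_mem h.1 h.2, clip_of_mem (c := 2) (by linarith) (by linarith), sub_self,
      clip_of_mem (by norm_num) (by norm_num)]; ring
  · rw [clip_of_ge (by norm_num) h.1, clip_of_mem (c := 2) (by linarith) (by linarith),
      clip_of_mem (by linarith) (by linarith)]; ring
  · rw [clip_of_ge (c := 1) (by norm_num) (by linarith), clip_of_ge (c := 2) (by norm_num) h,
      clip_of_ge (by norm_num) (by linarith)]; ring
  · rw [clip_of_le (c := 1) (by norm_num) h.2, clip_of_mem (c := 2) (by linarith) (by linarith),
      clip_of_mem (by linarith) (by linarith)]; ring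
  · rw [clip_of_le (c := 1) (by norm_num) (by linarith), clip_of_le (c := 2) (by norm_num) h,
      clip_of_le (by norm_num) (by linarith)]; ring

theorem continuous_coordOf (γ : ℝ) : Continuous fun q : ℝ × ℝ => coordOf γ q.1 q.2 := by
  unfold coordOf
  have := continuous_clip 1
  fun_prop

theorem abs_gFun_le (u : ℝ) : |gFun u| ≤ 1 := by
  obtain ⟨i, hi⟩ := exists_mem_cell u
  rw [gFun_of_mem hi, abs_le]
  rcases mem_cell_iff.1 hi with ⟨rfl, h⟩ | ⟨rfl, h⟩ | ⟨rfl, h⟩ | ⟨rfl, h⟩ | ⟨rfl, h⟩ <;>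
    simp [gSlope, gConst] <;> first | exact h | (constructor <;> linarith)

/-- The gradient never has the sign opposite to the coefficient. With Σ positive semidefinite this
forces g = 0 and Xb = 0 whenever g + Σb = 0. -/
theorem bFun_mul_gFun_nonneg {γ : ℝ} (hγ : 0 < γ) (u : ℝ) : 0 ≤ bFun γ u * gFun u := by
  obtain ⟨i, hi⟩ := exists_mem_cell u
  rw [gFun_of_mem hi, bFun_of_mem hi]
  rcases mem_cell_iff.1 hi with ⟨rfl, h⟩ | ⟨rfl, h⟩ | ⟨rfl, h⟩ | ⟨rfl, h⟩ | ⟨rfl, h⟩ <;>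
    simp [gSlope, gConst, bSlope, bConst]
  · nlinarith [mul_nonneg (mul_nonneg hγ.le (sub_nonneg.2 h.1)) (sub_nonneg.2 h.2)]
  · have h1 : 0 ≤ -1 - u := by linarith
    have h2 : 0 ≤ u + 2 := by linarith
    nlinarith [mul_nonneg (mul_nonneg hγ.le h1) h2]

/-! ### Cells near a tie. -/

theorem not_isTie_imp_eq {i i' : ℤ} {u : ℝ} (h : u ∈ cell i) (ht : ¬ IsTie u) (h' : u ∈ cell i') :
    i' = i := by
  have h1 : u ≠ 1 := by rintro rfl; exact ht (Or.inl (by simp))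
  have h2 : u ≠ -1 := by rintro rfl; exact ht (Or.inl (by simp))
  have h3 : u ≠ 2 := by rintro rfl; exact ht (Or.inr (by simp))
  have h4 : u ≠ -2 := by rintro rfl; exact ht (Or.inr (by simp))
  rw [mem_cell_iff] at h h'
  grind

theorem eventually_mem_cell {i : ℤ} {u : ℝ} (h : u ∈ cell i) (ht : ¬ IsTie u) :
    ∀ᶠ u' in 𝓝 u, u' ∈ cell i := by
  have h1 : u ≠ 1 := by rintro rfl; exact ht (Or.inl (by simp))
  have h2 : u ≠ -1 := by rintro rfl; exact ht (Or.inl (by simp))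
  have h3 : u ≠ 2 := by rintro rfl; exact ht (Or.inr (by simp))
  have h4 : u ≠ -2 := by rintro rfl; exact ht (Or.inr (by simp))
  rcases mem_cell_iff.1 h with ⟨rfl, h⟩ | ⟨rfl, h⟩ | ⟨rfl, h⟩ | ⟨rfl, h⟩ | ⟨rfl, h⟩
  · filter_upwards [Ioo_mem_nhds (lt_of_le_of_ne h.1 h2.symm) (lt_of_le_of_ne h.2 h1)] with v hv
    simp [mem_cell_iff, hv.1.le, hv.2.le]
  · filter_upwards [Ioo_mem_nhds (lt_of_le_of_ne h.1 h1.symm) (lt_of_le_of_ne h.2 h3)] with v hv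
    simp [mem_cell_iff, hv.1.le, hv.2.le]
  · filter_upwards [Ioi_mem_nhds (lt_of_le_of_ne h h3.symm)] with v hv
    simpa [mem_cell_iff] using (mem_Ioi.1 hv).le
  · filter_upwards [Ioo_mem_nhds (lt_of_le_of_ne h.1 h4.symm) (lt_of_le_of_ne h.2 h2)] with v hv
    simp [mem_cell_iff, hv.1.le, hv.2.le]
  · filter_upwards [Iio_mem_nhds (lt_of_le_of_ne h h4)] with v hv
    simpa [mem_cell_iff] using (mem_Iio.1 hv).le

/-- At a tie exactly two consecutive cells meet: `cell i` on the side `-σ` and `cell (i + σ)` on the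
side `σ`. -/
structure Crossing (i σ : ℤ) (u : ℝ) : Prop where
  sign : σ = 1 ∨ σ = -1
  mem : u ∈ cell i
  mem_next : u ∈ cell (i + σ)
  side : ∀ u' ∈ cell i, (σ : ℝ) * (u' - u) ≤ 0
  side_next : ∀ u' ∈ cell (i + σ), 0 ≤ (σ : ℝ) * (u' - u)
  near : ∀ᶠ u' in 𝓝 u, (σ : ℝ) * (u' - u) ≤ 0 → u' ∈ cell i
  near_next : ∀ᶠ u' in 𝓝 u, 0 ≤ (σ : ℝ) * (u' - u) → u' ∈ cell (i + σ)
  only : ∀ i', u ∈ cell i' → i' = i ∨ i' = i + σ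

theorem Crossing.symm {i σ : ℤ} {u : ℝ} (h : Crossing i σ u) : Crossing (i + σ) (-σ) u where
  sign := by rcases h.sign with rfl | rfl <;> simp
  mem := h.mem_next
  mem_next := by simpa using h.mem
  side := by
    intro u' hu'; have := h.side_next u' hu'; push_cast; linarith
  side_next := by
    intro u' hu'; have := h.side u' (by simpa using hu'); push_cast; linarith
  near := by
    filter_upwards [h.near_next] with u' hu' h'; push_cast at h'; exact hu' (by linarith)
  near_next := by
    filter_upwards [h.near] with u' hu' h'; push_cast at h'; simpa using hu' (by linarith)
  only := by
    intro i' hi'; rcases h.only i' hi' with h | h <;> simp [h]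

/-- Only the four upward crossings are checked by hand; the downward ones follow by `Crossing.symm`.
-/
theorem crossing_of_eq {i : ℤ} {u : ℝ} (h : (i = 0 ∧ u = 1) ∨ (i = 1 ∧ u = 2) ∨
    (i = -1 ∧ u = -1) ∨ (i = -2 ∧ u = -2)) : Crossing i 1 u := by
  have key : ∀ v : ℝ, (∀ i', v ∈ cell i' ↔ (i' = 0 ∧ -1 ≤ v ∧ v ≤ 1) ∨ (i' = 1 ∧ 1 ≤ v ∧ v ≤ 2) ∨
    (i' = 2 ∧ 2 ≤ v) ∨ (i' = -1 ∧ -2 ≤ v ∧ v ≤ -1) ∨ (i' = -2 ∧ v ≤ -2)) := fun v i' => mem_cell_iff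
  rcases h with ⟨rfl, rfl⟩ | ⟨rfl, rfl⟩ | ⟨rfl, rfl⟩ | ⟨rfl, rfl⟩
  · refine ⟨Or.inl rfl, ?_, ?_, ?_, ?_, ?_, ?_, ?_⟩
    · norm_num [key]
    · norm_num [key]
    · intro v hv; norm_num [key] at hv ⊢; exact hv.2
    · intro v hv; norm_num [key] at hv ⊢; exact hv.1
    · filter_upwards [Ioi_mem_nhds (show (-1 : ℝ) < 1 by norm_num)] with v hv h
      norm_num [key] at h ⊢; exact ⟨(mem_Ioi.1 hv).le, h⟩
    · filter_upwards [Iio_mem_nhds (show (1 : ℝ) < 2 by norm_num)] with v hv h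
      norm_num [key] at h ⊢; exact ⟨h, (mem_Iio.1 hv).le⟩
    · intro i' hi'; rw [key] at hi'; norm_num at hi'; omega
  · refine ⟨Or.inl rfl, ?_, ?_, ?_, ?_, ?_, ?_, ?_⟩
    · norm_num [key]
    · norm_num [key]
    · intro v hv; norm_num [key] at hv ⊢; exact hv.2
    · intro v hv; norm_num [key] at hv ⊢; exact hv
    · filter_upwards [Ioi_mem_nhds (show (1 : ℝ) < 2 by norm_num)] with v hv h
      norm_num [key] at h ⊢; exact ⟨(mem_Ioi.1 hv).le, h⟩
    · filter_upwards with v h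
      norm_num [key] at h ⊢; exact h
    · intro i' hi'; rw [key] at hi'; norm_num at hi'; omega
  · refine ⟨Or.inl rfl, ?_, ?_, ?_, ?_, ?_, ?_, ?_⟩
    · norm_num [key]
    · norm_num [key]
    · intro v hv; norm_num [key] at hv ⊢; linarith [hv.2]
    · intro v hv; norm_num [key] at hv ⊢; linarith [hv.1]
    · filter_upwards [Ioi_mem_nhds (show (-2 : ℝ) < -1 by norm_num)] with v hv h
      norm_num [key] at h ⊢; exact ⟨(mem_Ioi.1 hv).le, by linarith⟩
    · filter_upwards [Iio_mem_nhds (show (-1 : ℝ) < 1 by norm_num)] with v hv h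
      norm_num [key] at h ⊢; exact ⟨by linarith, (mem_Iio.1 hv).le⟩
    · intro i' hi'; rw [key] at hi'; norm_num at hi'; omega
  · refine ⟨Or.inl rfl, ?_, ?_, ?_, ?_, ?_, ?_, ?_⟩
    · norm_num [key]
    · norm_num [key]
    · intro v hv; norm_num [key] at hv ⊢; linarith [hv]
    · intro v hv; norm_num [key] at hv ⊢; linarith [hv.1]
    · filter_upwards with v h
      norm_num [key] at h ⊢; linarith
    · filter_upwards [Iio_mem_nhds (show (-2 : ℝ) < -1 by norm_num)] with v hv h
      norm_num [key] at h ⊢; exact ⟨by linarith, (mem_Iio.1 hv).le⟩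
    · intro i' hi'; rw [key] at hi'; norm_num at hi'; omega

theorem exists_crossing {i : ℤ} {u : ℝ} (h : u ∈ cell i) (ht : IsTie u) :
    ∃ σ, Crossing i σ u := by
  have ht' : u = 1 ∨ u = -1 ∨ u = 2 ∨ u = -2 := by
    rcases ht with h | h
    · rcases (abs_eq (by norm_num)).1 h with h | h <;> simp [h]
    · rcases (abs_eq (by norm_num)).1 h with h | h <;> simp [h]
  rcases ht' with rfl | rfl | rfl | rfl <;> norm_num [mem_cell_iff] at h <;>
    rcases h with rfl | rfl
  · exact ⟨1, crossing_of_eq (by norm_num)⟩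
  · exact ⟨-1, (crossing_of_eq (i := 0) (u := 1) (by norm_num)).symm⟩
  · exact ⟨-1, (crossing_of_eq (i := -1) (u := -1) (by norm_num)).symm⟩
  · exact ⟨1, crossing_of_eq (by norm_num)⟩
  · exact ⟨1, crossing_of_eq (by norm_num)⟩
  · exact ⟨-1, (crossing_of_eq (i := 1) (u := 2) (by norm_num)).symm⟩
  · exact ⟨-1, (crossing_of_eq (i := -2) (u := -2) (by norm_num)).symm⟩
  · exact ⟨1, crossing_of_eq (by norm_num)⟩

theorem Crossing.isTie {i σ : ℤ} {u : ℝ} (h : Crossing i σ u) : IsTie u := by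
  by_contra ht
  have := not_isTie_imp_eq h.mem ht h.mem_next
  rcases h.sign with rfl | rfl <;> omega

/-! ### The solution surface as a graph over the parameter space -/

/-- The coefficients of the point of the solution surface with parameter `u`. -/
def bVec {p : ℕ} (γ : ℝ) (u : Fin p → ℝ) : Fin p → ℝ := fun j => bFun γ (u j)

/-- The gradient of the point of the solution surface with parameter `u`. -/
def gVec {p : ℕ} (u : Fin p → ℝ) : Fin p → ℝ := fun j => gFun (u j)

/-- The `z`-component of the point of the solution surface with parameter `u`. -/
def surf {n p : ℕ} (X : Matrix (Fin n) (Fin p) ℝ) (γ : ℝ) (u : Fin p → ℝ) : Fin p → ℝ :=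
  gVec u + (gram X).mulVec (bVec γ u)

/-- The parameters of `S η`. -/
def Box {p : ℕ} (η : Fin p → ℤ) : Set (Fin p → ℝ) := {u | ∀ j, u j ∈ cell (η j)}

/-- The parameter of a point with gradient `g` and coefficients `b`. -/
def paramOf {p : ℕ} (γ : ℝ) (g b : Fin p → ℝ) : Fin p → ℝ := fun j => coordOf γ (g j) (b j)

variable {n p : ℕ} {X : Matrix (Fin n) (Fin p) ℝ} {y : Fin n → ℝ} {γ : ℝ} {η : Fin p → ℤ}

theorem continuous_bVec : Continuous (bVec γ : (Fin p → ℝ) → _) :=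
  continuous_pi fun j => (continuous_bFun γ).comp (continuous_apply j)

theorem continuous_gVec : Continuous (gVec : (Fin p → ℝ) → _) :=
  continuous_pi fun j => continuous_gFun.comp (continuous_apply j)

theorem continuous_mulVec_const {m k : ℕ} (M : Matrix (Fin m) (Fin k) ℝ) :
    Continuous fun v : Fin k → ℝ => M.mulVec v :=
  (Matrix.mulVecLin M).continuous_of_finiteDimensional

theorem paramOf_gVec_bVec (hγ : 0 < γ) (u : Fin p → ℝ) : paramOf γ (gVec u) (bVec γ u) = u :=
  funext fun j => coordOf_gFun_bFun hγ (u j)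

theorem continuous_paramOf : Continuous fun q : (Fin p → ℝ) × (Fin p → ℝ) => paramOf γ q.1 q.2 := by
  refine continuous_pi fun j => ?_
  exact (continuous_coordOf γ).comp (f := fun q : (Fin p → ℝ) × (Fin p → ℝ) => (q.1 j, q.2 j))
    (((continuous_apply j).comp continuous_fst).prodMk ((continuous_apply j).comp continuous_snd))

theorem isClosed_Box (η : Fin p → ℤ) : IsClosed (Box η) := by
  rw [Box, ofPred_forall]
  exact isClosed_iInter fun j => (isClosed_cell _).preimage (continuous_apply j)

theorem convex_Box (η : Fin p → ℤ) : Convex ℝ (Box η) := by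
  intro u hu v hv a b ha hb hab j
  exact convex_cell _ (hu j) (hv j) ha hb hab

theorem range_of_mem_Box {u : Fin p → ℝ} (h : u ∈ Box η) (j : Fin p) : |η j| ≤ 2 :=
  abs_le_two_of_mem_cell (h j)

theorem exists_mem_Box (u : Fin p → ℝ) : ∃ η, u ∈ Box η := by
  choose η hη using fun j => exists_mem_cell (u j)
  exact ⟨η, hη⟩

theorem eq_of_gVec_bVec (hγ : 0 < γ) {u v : Fin p → ℝ} (hg : gVec u = gVec v)
    (hb : bVec γ u = bVec γ v) : u = v := by
  rw [← paramOf_gVec_bVec hγ u, ← paramOf_gVec_bVec hγ v, hg, hb]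

theorem int_abs_le_two {i : ℤ} (h : |i| ≤ 2) : i = 0 ∨ i = 1 ∨ i = 2 ∨ i = -1 ∨ i = -2 := by
  rw [abs_le] at h; omega

/-- One coordinate of the dictionary between S(η) and parameters. For η ≠ 0 the parameter is
recovered from b = γ(u - sgn η), and for η = 0 it is g itself. -/
theorem mem_cell_iff_curve (hγ : 0 < γ) {i : ℤ} (hi : |i| ≤ 2) {g b : ℝ} :
    ((i ≠ 0 → g = ((i.sign : ℤ) : ℝ) * uCoef i - b * vCoef γ i ∧
      knot γ i ≤ (b : EReal) ∧ (b : EReal) ≤ knot γ (i + 1)) ∧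
      (i = 0 → -1 ≤ g ∧ g ≤ 1 ∧ b = 0)) ↔
    ∃ u ∈ cell i, gFun u = g ∧ bFun γ u = b := by
  have conv : (∃ u ∈ cell i, gFun u = g ∧ bFun γ u = b) ↔
      ∃ u ∈ cell i, gSlope i * u + gConst i = g ∧ bSlope γ i * u + bConst γ i = b := by
    constructor
    · rintro ⟨u, hu, h1, h2⟩
      exact ⟨u, hu, by rw [← gFun_of_mem hu, h1], by rw [← bFun_of_mem hu, h2]⟩
    · rintro ⟨u, hu, h1, h2⟩
      exact ⟨u, hu, by rw [gFun_of_mem hu, h1], by rw [bFun_of_mem hu, h2]⟩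
  rw [conv]
  have s2 : Int.sign 2 = 1 := rfl
  have s3 : Int.sign (-2) = -1 := rfl
  have hne := hγ.ne'
  rcases int_abs_le_two hi with rfl | rfl | rfl | rfl | rfl <;>
    simp [mem_cell_iff, gSlope, gConst, bSlope, bConst, uCoef, vCoef, knot, s2, s3]
  · constructor
    · rintro ⟨h1, h2, h3⟩; exact ⟨⟨h1, h2⟩, h3.symm⟩
    · rintro ⟨⟨h1, h2⟩, h3⟩; exact ⟨h1, h2, h3.symm⟩
  · constructor
    · rintro ⟨h1, h2, h3⟩
      refine ⟨1 + b / γ, ⟨?_, ?_⟩, ?_, ?_⟩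
      · have := div_nonneg h2 hγ.le; linarith
      · have : b / γ ≤ 1 := by rw [div_le_one hγ]; exact h3
        linarith
      · rw [h1]; field_simp; ring
      · field_simp; ring
    · rintro ⟨u, ⟨h1, h2⟩, h3, h4⟩
      refine ⟨?_, ?_, ?_⟩
      · rw [← h3, ← h4]; field_simp; ring
      · rw [← h4]; nlinarith
      · rw [← h4]; nlinarith
  · constructor
    · rintro ⟨h1, h2⟩
      refine ⟨1 + b / γ, ?_, h1.symm, ?_⟩
      · have : 1 ≤ b / γ := by rw [le_div_iff₀ hγ]; linarith
        linarith
      · field_simp; ring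
    · rintro ⟨u, h1, h3, h4⟩
      refine ⟨h3.symm, ?_⟩
      · rw [← h4]; nlinarith
  · rw [← EReal.coe_neg]
    simp only [EReal.coe_le_coe_iff]
    constructor
    · rintro ⟨h1, h2, h3⟩
      refine ⟨-1 + b / γ, ⟨?_, ?_⟩, ?_, ?_⟩
      · have : -1 ≤ b / γ := by rw [le_div_iff₀ hγ]; linarith
        linarith
      · have := div_nonpos_of_nonpos_of_nonneg h3 hγ.le; linarith
      · rw [h1]; field_simp; ring
      · field_simp; ring
    · rintro ⟨u, ⟨h1, h2⟩, h3, h4⟩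
      refine ⟨?_, ?_, ?_⟩
      · rw [← h3, ← h4]; field_simp; ring
      · rw [← h4]; nlinarith
      · rw [← h4]; nlinarith
  · rw [← EReal.coe_neg]
    simp only [EReal.coe_le_coe_iff]
    constructor
    · rintro ⟨h1, h2⟩
      refine ⟨-1 + b / γ, ?_, h1.symm, ?_⟩
      · have : b / γ ≤ -1 := by rw [div_le_iff₀ hγ]; linarith
        linarith
      · field_simp; ring
    · rintro ⟨u, h1, h3, h4⟩
      refine ⟨h3.symm, ?_⟩
      · rw [← h4]; nlinarith

/-- All parallelepipeds are images of boxes under one and the same map, so their adjacency can be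
read off from cells of the real line. -/
theorem mem_S_iff (hγ : 0 < γ) (hη : ∀ j, |η j| ≤ 2) {q : (Fin p → ℝ) × (Fin p → ℝ)} :
    q ∈ S X γ η ↔ ∃ u ∈ Box η, q = (surf X γ u, bVec γ u) := by
  have h1 : q ∈ S X γ η ↔ ∀ j, ∃ u ∈ cell (η j), gFun u = q.1 j - (gram X).mulVec q.2 j ∧
      bFun γ u = q.2 j := by
    simp only [S, mem_ofPred_eq]
    refine forall_congr' fun j => ?_
    exact mem_cell_iff_curve hγ (hη j)
  rw [h1]
  constructor
  · intro h
    choose u hu hg hb using h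
    have hb' : bVec γ u = q.2 := funext hb
    refine ⟨u, hu, Prod.ext ?_ hb'.symm⟩
    funext j
    simp only [surf, Pi.add_apply, hb', gVec, hg j]
    ring
  · rintro ⟨u, hu, rfl⟩ j
    refine ⟨u j, hu j, ?_, rfl⟩
    simp [surf, gVec]

theorem mem_ell_iff (hγ : 0 < γ) (hη : ∀ j, |η j| ≤ 2) {z : Fin p → ℝ}
    {q : (Fin p → ℝ) × (Fin p → ℝ)} :
    q ∈ ell X γ η z ↔ ∃ τ : ℝ, 0 < τ ∧ ∃ u ∈ Box η, surf X γ u = τ • z ∧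
      q = (τ • z, bVec γ u) := by
  rw [ell, mem_inter_iff, mem_S_iff hγ hη]
  constructor
  · rintro ⟨⟨u, hu, rfl⟩, τ, hτ, h⟩
    exact ⟨τ, hτ, u, hu, h, by simp only at h; rw [h]⟩
  · rintro ⟨τ, hτ, u, hu, h, rfl⟩
    exact ⟨⟨u, hu, by rw [h]⟩, τ, hτ, rfl⟩

/-- The gradient is recovered as z - Σb, so z and b together determine the parameter, although z
alone need not. -/
theorem surf_injective_pair (hγ : 0 < γ) {u v : Fin p → ℝ} (hs : surf X γ u = surf X γ v)
    (hb : bVec γ u = bVec γ v) : u = v := by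
  refine eq_of_gVec_bVec hγ ?_ hb
  simpa [surf, hb] using hs

/-! ### Perfect fits and critical points in terms of parameters. -/

theorem zTilde_sub (β : Fin p → ℝ) (j : Fin p) :
    X.transpose.mulVec (y - X.mulVec β) j / (n : ℝ) =
      zTilde X y j - (gram X).mulVec β j := by
  simp only [zTilde, gram, Matrix.mulVec_sub, Matrix.mulVec_mulVec, Matrix.smul_mulVec,
    Pi.sub_apply, Pi.smul_apply, smul_eq_mul]
  ring

theorem perfectFit_iff (hn : 0 < n) {β : Fin p → ℝ} :
    PerfectFit X y β ↔ zTilde X y = (gram X).mulVec β := by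
  have hn' : (n : ℝ) ≠ 0 := by positivity
  unfold PerfectFit
  constructor
  · intro h
    funext j
    have := zTilde_sub (X := X) (y := y) β j
    rw [h] at this
    simp at this
    linarith
  · intro h
    funext j
    have := zTilde_sub (X := X) (y := y) β j
    rw [h, sub_self, div_eq_zero_iff] at this
    simpa [hn'] using this

/-- For β = b/τ the correlations of the columns with the residual are z̃ - Σβ = g/τ. -/
theorem perfectFit_iff_gVec (hn : 0 < n) {τ : ℝ} (hτ : 0 < τ) {u : Fin p → ℝ}
    (h : surf X γ u = τ • zTilde X y) :
    PerfectFit X y ((1 / τ) • bVec γ u) ↔ gVec u = 0 := by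
  rw [perfectFit_iff hn, Matrix.mulVec_smul]
  have hz : zTilde X y = (1 / τ) • surf X γ u := by
    rw [h, smul_smul, one_div_mul_cancel hτ.ne', one_smul]
  rw [hz, surf, smul_add, add_eq_right, smul_eq_zero_iff_right (one_div_ne_zero hτ.ne')]

theorem curve_exists (hγ : 0 < γ) {l : ℝ} (hl : 0 < l) {r β : ℝ}
    (h1 : β ≠ 0 → r = Real.sign β * mcpDeriv γ l |β|) (h2 : β = 0 → |r| ≤ l) :
    ∃ u, gFun u = r / l ∧ bFun γ u = β / l := by
  suffices ∃ i : ℤ, |i| ≤ 2 ∧ ∃ u ∈ cell i, gFun u = r / l ∧ bFun γ u = β / l by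
    obtain ⟨i, _, u, _, h⟩ := this
    exact ⟨u, h⟩
  by_cases hβ : β = 0
  · refine ⟨0, by simp, (mem_cell_iff_curve hγ (by simp)).1 ?_⟩
    have := abs_le.1 (h2 hβ)
    simp only [ne_eq, not_true_eq_false, IsEmpty.forall_iff, forall_const, true_and, hβ, zero_div,
      and_true]
    rw [le_div_iff₀ hl, div_le_iff₀ hl]
    constructor <;> linarith
  · have h := h1 hβ
    unfold mcpDeriv at h
    have hgl : 0 < γ * l := mul_pos hγ hl
    have s2 : Int.sign 2 = 1 := rfl
    have s3 : Int.sign (-2) = -1 := rfl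
    rcases lt_or_gt_of_ne hβ with hneg | hpos
    · rw [Real.sign_of_neg hneg, abs_of_neg hneg] at h
      rcases le_total (-β) (γ * l) with hle | hle
      · refine ⟨-1, by simp, (mem_cell_iff_curve hγ (by simp)).1 ?_⟩
        rw [max_eq_left (by rw [sub_nonneg, div_le_one hgl]; exact hle)] at h
        simp [uCoef, vCoef, knot]
        rw [← EReal.coe_neg, EReal.coe_le_coe_iff, le_div_iff₀ hl, div_le_iff₀ hl]
        refine ⟨?_, by linarith, by linarith⟩
        rw [h]; field_simp; ring
      · refine ⟨-2, by simp, (mem_cell_iff_curve hγ (by simp)).1 ?_⟩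
        rw [max_eq_right (by rw [sub_nonpos, one_le_div hgl]; exact hle)] at h
        simp [uCoef, vCoef, knot]
        rw [← EReal.coe_neg, EReal.coe_le_coe_iff, div_le_iff₀ hl]
        refine ⟨?_, by linarith⟩
        rw [h]; simp
    · rw [Real.sign_of_pos hpos, abs_of_pos hpos] at h
      rcases le_total β (γ * l) with hle | hle
      · refine ⟨1, by simp, (mem_cell_iff_curve hγ (by simp)).1 ?_⟩
        rw [max_eq_left (by rw [sub_nonneg, div_le_one hgl]; exact hle)] at h
        simp [uCoef, vCoef, knot]
        rw [le_div_iff₀ hl, div_le_iff₀ hl]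
        refine ⟨?_, by linarith, by linarith⟩
        rw [h]; field_simp
      · refine ⟨2, by simp, (mem_cell_iff_curve hγ (by simp)).1 ?_⟩
        rw [max_eq_right (by rw [sub_nonpos, one_le_div hgl]; exact hle)] at h
        simp [uCoef, vCoef, knot]
        rw [le_div_iff₀ hl]
        refine ⟨?_, by linarith⟩
        rw [h]; simp

theorem curve_critical (hγ : 0 < γ) {l : ℝ} (hl : 0 < l) (u : ℝ) :
    (l * bFun γ u ≠ 0 → l * gFun u = Real.sign (l * bFun γ u) * mcpDeriv γ l |l * bFun γ u|) ∧
      (l * bFun γ u = 0 → |l * gFun u| ≤ l) := by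
  constructor
  · intro hne
    obtain ⟨i, hi⟩ := exists_mem_cell u
    unfold mcpDeriv
    have hgl : 0 < γ * l := mul_pos hγ hl
    rw [gFun_of_mem hi, bFun_of_mem hi] at *
    have s2 : Int.sign 2 = 1 := rfl
    have s3 : Int.sign (-2) = -1 := rfl
    rcases mem_cell_iff.1 hi with ⟨rfl, h⟩ | ⟨rfl, h⟩ | ⟨rfl, h⟩ | ⟨rfl, h⟩ | ⟨rfl, h⟩ <;>
      simp only [gSlope, gConst, bSlope, bConst, s2, s3] at hne ⊢ <;> norm_num at hne <;> norm_num [-abs_mul, -mul_eq_mul_left_iff, -zero_eq_mul, -mul_eq_zero]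
    · have hpos : 0 < l * (γ * u + -γ) := by
        refine lt_of_le_of_ne ?_ (by simp; tauto)
        have : 0 ≤ u - 1 := by linarith
        have := mul_nonneg hl.le (mul_nonneg hγ.le this)
        nlinarith
      rw [Real.sign_of_pos hpos, abs_of_pos hpos, max_eq_left]
      · field_simp; ring
      · rw [sub_nonneg, div_le_one hgl]
        have : 0 ≤ 2 - u := by linarith
        have := mul_nonneg hl.le (mul_nonneg hγ.le this)
        nlinarith
    · have hh : l * γ ≤ l * (γ * u + -γ) := by
        have : 0 ≤ u - 2 := by linarith
        have := mul_nonneg hl.le (mul_nonneg hγ.le this)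
        nlinarith
      have hpos : 0 < l * (γ * u + -γ) := lt_of_lt_of_le (mul_pos hl hγ) hh
      rw [abs_of_pos hpos, max_eq_right]
      · simp
      · rw [sub_nonpos, one_le_div hgl]; linarith
    · have hpos : l * (γ * u + γ) < 0 := by
        refine lt_of_le_of_ne ?_ (by simp; tauto)
        have : 0 ≤ -1 - u := by linarith
        have := mul_nonneg hl.le (mul_nonneg hγ.le this)
        nlinarith
      rw [Real.sign_of_neg hpos, abs_of_neg hpos, max_eq_left]
      · field_simp; ring
      · rw [sub_nonneg, div_le_one hgl]
        have : 0 ≤ 2 + u := by linarith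
        have := mul_nonneg hl.le (mul_nonneg hγ.le this)
        nlinarith
    · have hh : l * (γ * u + γ) ≤ - (l * γ) := by
        have : 0 ≤ -2 - u := by linarith
        have := mul_nonneg hl.le (mul_nonneg hγ.le this)
        nlinarith
      have hpos : l * (γ * u + γ) < 0 := lt_of_le_of_lt hh (by have := mul_pos hl hγ; linarith)
      rw [abs_of_neg hpos, max_eq_right]
      · simp
      · rw [sub_nonpos, one_le_div hgl]; linarith
  · intro _
    rw [abs_mul, abs_of_pos hl]
    have := abs_gFun_le u
    nlinarith

/-- The penalty scales: ρ̇(λt; λ) = λρ̇(t; 1). Dividing by λ therefore moves every penalty level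
onto the same curve, with λ surviving only as the position 1/λ on the ray. -/
theorem isCritical_iff (hγ : 0 < γ) {l : ℝ} (hl : 0 < l) {β : Fin p → ℝ} :
    IsCritical X y γ l β ↔ ∃ u, surf X γ u = (1 / l) • zTilde X y ∧ β = l • bVec γ u := by
  constructor
  · intro h
    choose u hg hb using fun j => curve_exists hγ hl (h j).1 (h j).2
    have hb' : β = l • bVec γ u := by
      funext j
      simp only [Pi.smul_apply, bVec, hb, smul_eq_mul]
      field_simp
    refine ⟨u, ?_, hb'⟩
    funext j
    have e : (gram X).mulVec (bVec γ u) = (1 / l) • (gram X).mulVec β := by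
      rw [hb', Matrix.mulVec_smul, smul_smul, one_div_mul_cancel hl.ne', one_smul]
    simp only [surf, Pi.add_apply, gVec, hg, zTilde_sub, e, Pi.smul_apply, smul_eq_mul]
    field_simp
    ring
  · rintro ⟨u, hs, rfl⟩ j
    have e : X.transpose.mulVec (y - X.mulVec (l • bVec γ u)) j / (n : ℝ) = l * gFun (u j) := by
      have := congrFun hs j
      simp only [surf, Pi.add_apply, gVec, Pi.smul_apply, smul_eq_mul] at this
      rw [zTilde_sub, Matrix.mulVec_smul, Pi.smul_apply, smul_eq_mul,
        eq_sub_of_add_eq this]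
      field_simp
    rw [e]
    exact curve_critical hγ hl (u j)

/-! ### Nondegenerate designs -/

/-- Nondegeneracy read as a statement on the kernel of X: the equation Xv = 0 is a linear relation
between the columns in A and the signed sum, the latter with coefficient a. -/
theorem Nondegenerate.eq_zero_of_card_eq (hX : Nondegenerate X) {A : Finset (Fin p)}
    (hA : A.card = min n p - 1) {v : Fin p → ℝ} {a : ℝ} {η : Fin p → ℤ}
    (hη : ∀ j, η j = -1 ∨ η j = 0 ∨ η j = 1) (hv : ∀ k, k ∉ A → v k = a * η k)
    (hne : ∃ k, k ∉ A ∧ η k ≠ 0) (h0 : X.mulVec v = 0) : v = 0 := by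
  have hli := hX A hA η hη hne
  rw [Fintype.linearIndependent_iff] at hli
  have key := hli (fun o => o.elim a fun j => v j.1) (by
    rw [Fintype.sum_option]
    funext i
    have := congrFun h0 i
    simp only [Matrix.mulVec, dotProduct, Pi.zero_apply] at this
    rw [← Finset.sum_add_sum_compl A] at this
    simp only [Option.elim_none, Option.elim_some, Pi.add_apply, Pi.smul_apply, smul_eq_mul,
      Finset.sum_apply, Pi.zero_apply]
    rw [← this, add_comm]
    congr 1
    · rw [← Finset.sum_coe_sort A]
      exact Finset.sum_congr rfl fun j _ => mul_comm _ _
    · rw [Finset.mul_sum]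
      refine Finset.sum_congr rfl fun k hk => ?_
      rw [hv k (Finset.mem_compl.1 hk)]; ring)
  have ha : a = 0 := key none
  funext k
  by_cases hk : k ∈ A
  · exact key (some ⟨k, hk⟩)
  · rw [hv k hk, ha, zero_mul]; rfl

/-- A is enlarged to a set B of the exact size. If all signs vanish off B, then v is supported in B,
and any single column outside B, with coefficient 0, takes the place of the signed sum. -/
theorem Nondegenerate.eq_zero (hX : Nondegenerate X) {A : Finset (Fin p)}
    (hA : A.card < min n p) {v : Fin p → ℝ} {a : ℝ} {η : Fin p → ℤ}
    (hη : ∀ j, η j = -1 ∨ η j = 0 ∨ η j = 1) (hv : ∀ k, k ∉ A → v k = a * η k)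
    (h0 : X.mulVec v = 0) : v = 0 := by
  obtain ⟨B, hAB, -, hB⟩ := Finset.exists_subsuperset_card_eq (Finset.subset_univ A)
    (n := min n p - 1) (by omega) (by simp)
  by_cases hne : ∃ k, k ∉ B ∧ η k ≠ 0
  · exact hX.eq_zero_of_card_eq hB hη (fun k hk => hv k fun h => hk (hAB h)) hne h0
  · push Not at hne
    have : ∃ k, k ∉ B := by
      by_contra hcon
      push Not at hcon
      have : B = Finset.univ := Finset.eq_univ_of_forall hcon
      rw [this, Finset.card_univ, Fintype.card_fin] at hB
      omega
    obtain ⟨k, hk⟩ := this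
    refine hX.eq_zero_of_card_eq hB (a := 0) (η := Pi.single k 1) ?_ ?_ ⟨k, hk, by simp⟩ h0
    · intro j; by_cases h : j = k
      · subst h; simp
      · simp [h]
    · intro l hl
      rw [hv l fun h => hl (hAB h), hne l hl]; simp

/-- Any min(n,p) columns are independent: one of them is regarded as the signed sum. -/
theorem Nondegenerate.eq_zero_of_support (hX : Nondegenerate X) {A : Finset (Fin p)}
    (hA : A.card ≤ min n p) {v : Fin p → ℝ} (hv : ∀ k, k ∉ A → v k = 0)
    (h0 : X.mulVec v = 0) : v = 0 := by
  rcases A.eq_empty_or_nonempty with rfl | ⟨k, hk⟩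
  · funext k; exact hv k (by simp)
  · have hc := Finset.card_erase_of_mem hk
    have hpos := Finset.card_pos.2 ⟨k, hk⟩
    refine hX.eq_zero (A := A.erase k) (by omega) (a := v k) (η := Pi.single k 1) ?_ ?_ h0
    · intro j; by_cases h : j = k
      · subst h; simp
      · simp [h]
    · intro l hl
      by_cases h : l = k
      · subst h; simp
      · rw [hv l fun h' => hl (Finset.mem_erase.2 ⟨h, h'⟩)]; simp [h]

/-- A vector outside a subspace is separated from it by a linear form, which on ℝⁿ is a dot product.
The result supplies residual directions that test one column and ignore the columns in A. -/
theorem exists_orthogonal {A : Finset (Fin p)} {x : Fin n → ℝ}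
    (h : ∀ c : Fin p → ℝ, (∀ k, k ∉ A → c k = 0) → X.mulVec c ≠ x) :
    ∃ w : Fin n → ℝ, (∀ j ∈ A, X.transpose.mulVec w j = 0) ∧ x ⬝ᵥ w = 1 := by
  let K : Submodule ℝ (Fin p → ℝ) :=
    { carrier := {c | ∀ k, k ∉ A → c k = 0}
      add_mem' := fun ha hb k hk => by simp [ha k hk, hb k hk]
      zero_mem' := fun k _ => rfl
      smul_mem' := fun a c hc k hk => by simp [hc k hk] }
  have hx : x ∉ K.map (Matrix.mulVecLin X) := by
    rintro ⟨c, hc, hcx⟩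
    exact h c hc hcx
  obtain ⟨f, hf, hK⟩ := Submodule.exists_le_ker_of_notMem hx
  have hfw : ∀ v : Fin n → ℝ, f v = v ⬝ᵥ fun i => f (Pi.single i 1) := by
    intro v
    rw [LinearMap.pi_apply_eq_sum_univ f v]
    simp [dotProduct]
    refine Finset.sum_congr rfl fun i _ => ?_
    congr 2
    funext j
    simp [Pi.single_apply, eq_comm]
  refine ⟨(f x)⁻¹ • fun i => f (Pi.single i 1), fun j hj => ?_, ?_⟩
  · have hmem : X.mulVec (Pi.single j 1) ∈ K.map (Matrix.mulVecLin X) := by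
      refine ⟨Pi.single j 1, fun k hk => ?_, rfl⟩
      rw [Pi.single_apply, if_neg]
      rintro rfl; exact hk hj
    have h0 := hK hmem
    rw [LinearMap.mem_ker, hfw, Matrix.mulVec_single_one] at h0
    rw [Matrix.mulVec_smul, Pi.smul_apply, Matrix.mulVec]
    change _ • (X.col j ⬝ᵥ _) = 0
    rw [h0, smul_zero]
  · rw [dotProduct_smul, ← hfw, smul_eq_mul, inv_mul_cancel₀ hf]

theorem transpose_mulVec_eq (w : Fin n → ℝ) (j : Fin p) :
    X.transpose.mulVec w j = X.mulVec (Pi.single j 1) ⬝ᵥ w := by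
  rw [Matrix.mulVec_single_one]; rfl

/-- A residual that is orthogonal to `min n p` columns is orthogonal to all of them. -/
theorem Nondegenerate.transpose_mulVec_eq_zero (hX : Nondegenerate X) {A : Finset (Fin p)}
    (hA : A.card = min n p) {w : Fin n → ℝ} (hw : ∀ j ∈ A, X.transpose.mulVec w j = 0) :
    X.transpose.mulVec w = 0 := by
  rcases le_total p n with hpn | hpn
  · have : A = Finset.univ := by
      apply Finset.eq_univ_of_card; rw [hA, Fintype.card_fin]; omega
    funext j; exact hw j (by simp [this])
  · rw [min_eq_left hpn] at hA
    -- Here A has n elements, and n independent columns span ℝⁿ.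
    suffices w = 0 by simp [this]
    have hli : LinearIndependent ℝ fun (j : A) => X.mulVec (Pi.single j.1 1) := by
      rw [Fintype.linearIndependent_iff]
      intro g hg
      have hz := hX.eq_zero_of_support (A := A) (by omega)
        (v := fun k => if h : k ∈ A then g ⟨k, h⟩ else 0) (by intro k hk; simp [hk]) (by
          rw [← hg]
          funext i
          simp only [Matrix.mulVec, dotProduct, Finset.sum_apply, Pi.smul_apply, smul_eq_mul]
          rw [← Finset.sum_subset (Finset.subset_univ A)
            (by intro k _ hk; simp [hk]), ← Finset.sum_coe_sort A]
          refine Finset.sum_congr rfl fun j _ => ?_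
          simp [Pi.single_apply, mul_comm])
      intro j
      simpa using congrFun hz j.1
    have hspan := hli.span_eq_top_of_card_eq_finrank' (by simp [hA])
    have hall : ∀ v : Fin n → ℝ, v ⬝ᵥ w = 0 := by
      intro v
      have hv : v ∈ Submodule.span ℝ (Set.range fun (j : A) => X.mulVec (Pi.single j.1 1)) := by
        rw [hspan]; trivial
      induction hv using Submodule.span_induction with
      | mem x hx =>
        obtain ⟨j, rfl⟩ := hx
        rw [← transpose_mulVec_eq]; exact hw j j.2
      | zero => simp
      | add x z _ _ hx hz => rw [add_dotProduct, hx, hz, add_zero]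
      | smul a x _ hx => rw [smul_dotProduct, hx, smul_zero]
    exact dotProduct_self_eq_zero.1 (hall w)

theorem dotProduct_gram_mulVec (b : Fin p → ℝ) :
    b ⬝ᵥ (gram X).mulVec b = (1 / (n : ℝ)) * (X.mulVec b ⬝ᵥ X.mulVec b) := by
  rw [gram, Matrix.smul_mulVec, dotProduct_smul, ← Matrix.mulVec_mulVec, Matrix.dotProduct_mulVec,
    Matrix.vecMul_transpose, smul_eq_mul]

theorem gram_mulVec (b : Fin p → ℝ) :
    (gram X).mulVec b = (1 / (n : ℝ)) • X.transpose.mulVec (X.mulVec b) := by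
  rw [gram, Matrix.smul_mulVec, Matrix.mulVec_mulVec]

/-! ### Good indicators, and the lines that carry their segments -/

/-- The indices at which the indicator is extreme, i.e. where there is no penalization. -/
def extremes (η : Fin p → ℤ) : Finset (Fin p) := Finset.univ.filter fun j => |η j| = 2

/-- The matrix of the affine map `surf` on `Box η`. -/
def surfMatrix (X : Matrix (Fin n) (Fin p) ℝ) (γ : ℝ) (η : Fin p → ℤ) : Matrix (Fin p) (Fin p) ℝ :=
  Matrix.diagonal (fun j => gSlope (η j)) + gram X * Matrix.diagonal (fun j => bSlope γ (η j))

/-- The constant term of the affine map `surf` on `Box η`. -/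
def surfConst (X : Matrix (Fin n) (Fin p) ℝ) (γ : ℝ) (η : Fin p → ℤ) : Fin p → ℝ :=
  (fun j => gConst (η j)) + (gram X).mulVec fun j => bConst γ (η j)

/-- The affine extension of the coefficients from `Box η`. -/
def bAff (γ : ℝ) (η : Fin p → ℤ) (u : Fin p → ℝ) : Fin p → ℝ :=
  fun j => bSlope γ (η j) * u j + bConst γ (η j)

/-- The affine extension of the gradient from `Box η`. -/
def gAff (η : Fin p → ℤ) (u : Fin p → ℝ) : Fin p → ℝ :=
  fun j => gSlope (η j) * u j + gConst (η j)

theorem surfMatrix_mulVec (u : Fin p → ℝ) : (surfMatrix X γ η).mulVec u =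
    (fun j => gSlope (η j) * u j) + (gram X).mulVec fun j => bSlope γ (η j) * u j := by
  rw [surfMatrix, Matrix.add_mulVec, ← Matrix.mulVec_mulVec]
  congr 1
  · funext j; rw [Matrix.mulVec_diagonal]
  · congr 1; funext j; rw [Matrix.mulVec_diagonal]

theorem surfMatrix_add_surfConst (u : Fin p → ℝ) : (surfMatrix X γ η).mulVec u + surfConst X γ η =
    gAff η u + (gram X).mulVec (bAff γ η u) := by
  have : bAff γ η u = (fun j => bSlope γ (η j) * u j) + fun j => bConst γ (η j) := rfl
  rw [surfMatrix_mulVec, surfConst, this, Matrix.mulVec_add]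
  have : gAff η u = (fun j => gSlope (η j) * u j) + fun j => gConst (η j) := rfl
  rw [this]
  abel

theorem bVec_of_mem {u : Fin p → ℝ} (hu : u ∈ Box η) : bVec γ u = bAff γ η u :=
  funext fun j => bFun_of_mem (hu j)

theorem gVec_of_mem {u : Fin p → ℝ} (hu : u ∈ Box η) : gVec u = gAff η u :=
  funext fun j => gFun_of_mem (hu j)

theorem surf_of_mem {u : Fin p → ℝ} (hu : u ∈ Box η) :
    surf X γ u = (surfMatrix X γ η).mulVec u + surfConst X γ η := by
  rw [surfMatrix_add_surfConst, surf, bVec_of_mem hu, gVec_of_mem hu]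

theorem Q_mulVec {s : Fin p → ℝ} (hs : ∀ j, η j = 0 → s j = 0) (i : {j // η j ≠ 0}) :
    (Q X γ η).mulVec (fun j => s j.1) i = (gram X).mulVec s i - vCoef γ (η i) * s i := by
  rw [Q, Matrix.sub_mulVec, Pi.sub_apply, Matrix.mulVec_diagonal]
  congr 1
  simp only [Matrix.mulVec, dotProduct, Matrix.submatrix_apply]
  symm
  rw [← Finset.sum_subtype (Finset.univ.filter fun j => η j ≠ 0) (by simp)
    (fun j => gram X i.1 j * s j)]
  refine (Finset.sum_filter_of_ne ?_).symm
  intro j _ hj h0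
  exact hj (by rw [hs j h0, mul_zero])

theorem gSlope_eq {γ : ℝ} (hγ : 0 < γ) {i : ℤ} (hi : i ≠ 0) : gSlope i = - (γ * vCoef γ i) := by
  unfold gSlope vCoef
  rw [if_neg hi]
  split_ifs
  · field_simp
  · simp

/-- The indicator `η` is in range, has fewer than `min n p` extreme entries, and `Q η` is
nonsingular. -/
structure Good (X : Matrix (Fin n) (Fin p) ℝ) (γ : ℝ) (η : Fin p → ℤ) : Prop where
  range : ∀ j, |η j| ≤ 2
  card : (extremes η).card < min n p
  det : (Q X γ η).det ≠ 0

/-- For u in the kernel, let s be the corresponding change of the coefficients, supported on A(η).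
The rows in A(η) say Q(η)s = 0, so s = 0. The remaining rows then give u_j = 0 where η_j = 0, and
elsewhere s_j = γu_j. -/
theorem surfMatrix_det_ne_zero (hγ : 0 < γ) (hQ : (Q X γ η).det ≠ 0) :
    (surfMatrix X γ η).det ≠ 0 := by
  intro hdet
  obtain ⟨u, hu, h0⟩ := Matrix.exists_mulVec_eq_zero_iff.2 hdet
  rw [surfMatrix_mulVec] at h0
  have hs : ∀ j, η j = 0 → bSlope γ (η j) * u j = 0 := by
    intro j hj; simp [bSlope, hj]
  have hQ0 : (Q X γ η).mulVec (fun j => bSlope γ (η j.1) * u j.1) = 0 := by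
    funext i
    rw [Q_mulVec (s := fun j => bSlope γ (η j) * u j) hs i]
    have := congrFun h0 i.1
    simp only [Pi.add_apply, Pi.zero_apply] at this
    rw [gSlope_eq hγ i.2] at this
    simp only [Pi.zero_apply, bSlope, i.2, if_false] at this ⊢
    linarith
  have hz : ∀ j, bSlope γ (η j) * u j = 0 := by
    intro j
    by_cases hj : η j = 0
    · exact hs j hj
    · by_contra hne
      refine hQ (Matrix.exists_mulVec_eq_zero_iff.1 ⟨_, ?_, hQ0⟩)
      intro h
      exact hne (congrFun h ⟨j, hj⟩)
  apply hu
  funext j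
  by_cases hj : η j = 0
  · have := congrFun h0 j
    simp only [hz, Pi.add_apply, Pi.zero_apply] at this
    change gSlope (η j) * u j + (gram X).mulVec 0 j = 0 at this
    simpa [gSlope, hj] using this
  · have := hz j
    simpa [bSlope, hj, hγ.ne'] using this

/-- The parameter, in the coordinates of `Box η`, of the point over `τ • z`. -/
def line (X : Matrix (Fin n) (Fin p) ℝ) (γ : ℝ) (η : Fin p → ℤ) (z : Fin p → ℝ) (τ : ℝ) :
    Fin p → ℝ := (surfMatrix X γ η)⁻¹.mulVec (τ • z - surfConst X γ η)

/-- The direction of `line`. -/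
def dir (X : Matrix (Fin n) (Fin p) ℝ) (γ : ℝ) (η : Fin p → ℤ) (z : Fin p → ℝ) : Fin p → ℝ :=
  (surfMatrix X γ η)⁻¹.mulVec z

/-- The base point of `line`. -/
def base (X : Matrix (Fin n) (Fin p) ℝ) (γ : ℝ) (η : Fin p → ℤ) : Fin p → ℝ :=
  -(surfMatrix X γ η)⁻¹.mulVec (surfConst X γ η)

theorem line_eq (z : Fin p → ℝ) (τ : ℝ) : line X γ η z τ = τ • dir X γ η z + base X γ η := by
  rw [line, dir, base, Matrix.mulVec_sub, Matrix.mulVec_smul, sub_eq_add_neg]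

theorem line_apply (z : Fin p → ℝ) (τ : ℝ) (j : Fin p) :
    line X γ η z τ j = τ * dir X γ η z j + base X γ η j := by
  rw [line_eq]; rfl

theorem line_sub (z : Fin p → ℝ) (τ τ' : ℝ) (j : Fin p) :
    line X γ η z τ j - line X γ η z τ' j = (τ - τ') * dir X γ η z j := by
  rw [line_apply, line_apply]; ring

theorem surfMatrix_mulVec_inv (hγ : 0 < γ) (hQ : (Q X γ η).det ≠ 0) (z : Fin p → ℝ) :
    (surfMatrix X γ η).mulVec ((surfMatrix X γ η)⁻¹.mulVec z) = z := by
  rw [Matrix.mulVec_mulVec, Matrix.mul_nonsing_inv _ (surfMatrix_det_ne_zero hγ hQ).isUnit,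
    Matrix.one_mulVec]

theorem surfMatrix_inv_mulVec (hγ : 0 < γ) (hQ : (Q X γ η).det ≠ 0) (u : Fin p → ℝ) :
    (surfMatrix X γ η)⁻¹.mulVec ((surfMatrix X γ η).mulVec u) = u := by
  rw [Matrix.mulVec_mulVec, Matrix.nonsing_inv_mul _ (surfMatrix_det_ne_zero hγ hQ).isUnit,
    Matrix.one_mulVec]

theorem gAff_line (hγ : 0 < γ) (hQ : (Q X γ η).det ≠ 0) (z : Fin p → ℝ) (τ : ℝ) :
    gAff η (line X γ η z τ) + (gram X).mulVec (bAff γ η (line X γ η z τ)) = τ • z := by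
  rw [← surfMatrix_add_surfConst, line, surfMatrix_mulVec_inv hγ hQ, sub_add_cancel]

theorem surf_line (hγ : 0 < γ) (hQ : (Q X γ η).det ≠ 0) {z : Fin p → ℝ} {τ : ℝ} (h : line X γ η z τ ∈ Box η) :
    surf X γ (line X γ η z τ) = τ • z := by
  rw [surf_of_mem h, line, surfMatrix_mulVec_inv hγ hQ, sub_add_cancel]

theorem eq_line (hγ : 0 < γ) (hQ : (Q X γ η).det ≠ 0) {z : Fin p → ℝ} {τ : ℝ} {u : Fin p → ℝ} (hu : u ∈ Box η)
    (h : surf X γ u = τ • z) : u = line X γ η z τ := by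
  rw [surf_of_mem hu] at h
  rw [line, ← h, add_sub_cancel_right, surfMatrix_inv_mulVec hγ hQ]

theorem dir_eq_of_surfMatrix (hγ : 0 < γ) (hQ : (Q X γ η).det ≠ 0) {z u : Fin p → ℝ} (h : (surfMatrix X γ η).mulVec u = z) :
    dir X γ η z = u := by
  rw [dir, ← h, surfMatrix_inv_mulVec hγ hQ]

theorem surfMatrix_dir (hγ : 0 < γ) (hQ : (Q X γ η).det ≠ 0) (z : Fin p → ℝ) : (surfMatrix X γ η).mulVec (dir X γ η z) = z :=
  surfMatrix_mulVec_inv hγ hQ z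

theorem continuous_line : Continuous fun q : ℝ × (Fin p → ℝ) => line X γ η q.2 q.1 := by
  unfold line
  refine (continuous_mulVec_const _).comp ?_
  fun_prop

theorem zTilde_eq (y : Fin n → ℝ) : zTilde X y = X.transpose.mulVec ((1 / (n : ℝ)) • y) := by
  rw [zTilde, Matrix.mulVec_smul]

theorem gram_mulVec' (b : Fin p → ℝ) : (gram X).mulVec b = zTilde X (X.mulVec b) := by
  rw [gram_mulVec, zTilde]

theorem zTilde_add (y y' : Fin n → ℝ) : zTilde X (y + y') = zTilde X y + zTilde X y' := by
  simp [zTilde, Matrix.mulVec_add]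

theorem zTilde_smul (a : ℝ) (y : Fin n → ℝ) : zTilde X (a • y) = a • zTilde X y := by
  simp [zTilde, Matrix.mulVec_smul, smul_comm a]

theorem zTilde_natCast_smul (hn : 0 < n) (w : Fin n → ℝ) :
    zTilde X ((n : ℝ) • w) = X.transpose.mulVec w := by
  have : (n : ℝ) ≠ 0 := by positivity
  rw [zTilde_eq, smul_smul, one_div_mul_cancel this, one_smul]

theorem mem_extremes {j : Fin p} : j ∈ extremes η ↔ |η j| = 2 := by simp [extremes]

theorem gSlope_of_extreme {j : Fin p} (hj : j ∈ extremes η) : gSlope (η j) = 0 := by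
  rw [mem_extremes] at hj
  unfold gSlope
  rw [if_neg (by intro h; simp [h] at hj), if_neg (by rw [hj]; decide)]

theorem gConst_of_extreme {j : Fin p} (hj : j ∈ extremes η) : gConst (η j) = 0 := by
  rw [mem_extremes] at hj
  unfold gConst
  rw [if_neg (by rw [hj]; decide)]

theorem gSlope_sq {j : Fin p} (hr : |η j| ≤ 2) (hj : j ∉ extremes η) :
    gSlope (η j) * gSlope (η j) = 1 := by
  rw [mem_extremes] at hj
  rcases int_abs_le_two hr with h | h | h | h | h <;> simp [h, gSlope] at hj ⊢

/-- On the line, g = τz̃ - Σb = X'(τy - Xb)/n. This affine identity needs no membership in the box.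
-/
theorem exists_resid_line (hγ : 0 < γ) (hQ : (Q X γ η).det ≠ 0) (y : Fin n → ℝ) (τ : ℝ) :
    ∃ w : Fin n → ℝ, gAff η (line X γ η (zTilde X y) τ) = X.transpose.mulVec w := by
  have h := gAff_line hγ hQ (zTilde X y) τ
  rw [gram_mulVec', ← zTilde_smul] at h
  refine ⟨(1 / (n : ℝ)) • (τ • y - X.mulVec (bAff γ η (line X γ η (zTilde X y) τ))), ?_⟩
  rw [← zTilde_eq, sub_eq_add_neg, ← neg_one_smul ℝ (X.mulVec _), zTilde_add, zTilde_smul (-1),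
    ← h]
  simp

theorem orthogonal_extremes {u : Fin p → ℝ} {w : Fin n → ℝ}
    (h : gAff η u = X.transpose.mulVec w) {j : Fin p} (hj : j ∈ extremes η) :
    X.transpose.mulVec w j = 0 := by
  rw [← h, gAff, gSlope_of_extreme hj, gConst_of_extreme hj]; simp

/-- Every residual direction orthogonal to the unpenalized columns is realized. -/
theorem exists_dir_eq (hn : 0 < n) (hγ : 0 < γ) (hr : ∀ j, |η j| ≤ 2) (hQ : (Q X γ η).det ≠ 0)
    {w : Fin n → ℝ} (hw : ∀ j ∈ extremes η, X.transpose.mulVec w j = 0) :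
    ∃ y' : Fin n → ℝ, ∀ j, dir X γ η (zTilde X y') j = gSlope (η j) * X.transpose.mulVec w j := by
  -- The parameter change u with u_j = (slope of g)(X'w)_j makes the gradient change by X'w, because
  -- the slope squares to 1 off the extremes and X'w vanishes on them. The response has to supply
  -- this change together with Σ times the change of b.
  refine ⟨(n : ℝ) • w +
    X.mulVec (fun j => bSlope γ (η j) * (gSlope (η j) * X.transpose.mulVec w j)), ?_⟩
  have := dir_eq_of_surfMatrix (X := X) (η := η) hγ hQ
    (u := fun j => gSlope (η j) * X.transpose.mulVec w j) rfl
  intro j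
  rw [← congrFun this j]
  congr 1
  rw [surfMatrix_mulVec, zTilde_add, gram_mulVec', zTilde_natCast_smul hn]
  congr 1
  funext k
  by_cases hk : k ∈ extremes η
  · rw [hw k hk]; simp
  · rw [← mul_assoc, gSlope_sq (hr k) hk, one_mul]

/-- Adding x_j to the response adds χ_j to z̃. An unpenalized coefficient absorbs this by growing by
1, that is, u_j grows by 1/γ, and no gradient changes. -/
theorem dir_single (hγ : 0 < γ) (hQ : (Q X γ η).det ≠ 0) {j : Fin p} (hj : j ∈ extremes η) :
    dir X γ η (zTilde X (X.mulVec (Pi.single j 1))) = Pi.single j (1 / γ) := by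
  refine dir_eq_of_surfMatrix hγ hQ ?_
  rw [surfMatrix_mulVec, gram_mulVec']
  have h1 : (fun k => gSlope (η k) * (Pi.single j (1 / γ) : Fin p → ℝ) k) = 0 := by
    funext k
    by_cases hk : k = j
    · subst hk; simp [gSlope_of_extreme hj]
    · simp [hk]
  have h2 : (fun k => bSlope γ (η k) * (Pi.single j (1 / γ) : Fin p → ℝ) k) = Pi.single j 1 := by
    funext k
    by_cases hk : k = j
    · subst hk
      rw [mem_extremes] at hj
      have : η k ≠ 0 := by intro h; simp [h] at hj
      simp [bSlope, this, hγ.ne']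
    · simp [hk]
  rw [h1, h2, zero_add]

theorem Nondegenerate.exists_orthogonal_insert (hX : Nondegenerate X) {A : Finset (Fin p)}
    (hA : A.card < min n p) {j : Fin p} (hj : j ∉ A) :
    ∃ w : Fin n → ℝ, (∀ k ∈ A, X.transpose.mulVec w k = 0) ∧ X.transpose.mulVec w j = 1 := by
  obtain ⟨w, h1, h2⟩ := exists_orthogonal (X := X) (A := A) (x := X.mulVec (Pi.single j 1)) (by
    intro c hc h
    have := hX.eq_zero_of_support (A := insert j A) (v := c - Pi.single j 1) (by
      rw [Finset.card_insert_of_notMem hj]; omega) (by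
      intro k hk
      rw [Finset.mem_insert, not_or] at hk
      simp [hc k hk.2, hk.1]) (by rw [Matrix.mulVec_sub, h, sub_self])
    have := congrFun this j
    simp [hc j hj] at this)
  exact ⟨w, h1, by rw [transpose_mulVec_eq, h2]⟩

/-- This makes the hyperplanes excluded by genericity proper, also after pulling them back to y. For
an extreme j the response x_j itself serves; otherwise x_j is independent of the extreme columns. -/
theorem exists_dir_ne_zero (hn : 0 < n) (hγ : 0 < γ) (hX : Nondegenerate X) (hη : Good X γ η)
    (j : Fin p) : ∃ y' : Fin n → ℝ, dir X γ η (zTilde X y') j ≠ 0 := by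
  by_cases hj : j ∈ extremes η
  · refine ⟨X.mulVec (Pi.single j 1), ?_⟩
    rw [dir_single hγ hη.det hj]; simp [hγ.ne']
  · obtain ⟨w, h1, h2⟩ := hX.exists_orthogonal_insert hη.card hj
    obtain ⟨y', hy'⟩ := exists_dir_eq hn hγ hη.range hη.det h1
    refine ⟨y', ?_⟩
    rw [hy', h2, mul_one]
    intro h
    have := gSlope_sq (hη.range j) hj
    simp [h] at this

/-! ### Points over the origin and over unbounded rays -/

theorem dotProduct_gram_nonneg (b : Fin p → ℝ) : 0 ≤ b ⬝ᵥ (gram X).mulVec b := by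
  rw [dotProduct_gram_mulVec]
  refine mul_nonneg (by positivity) ?_
  exact Finset.sum_nonneg fun i _ => mul_self_nonneg _

theorem mulVec_eq_zero_of_gram (hn : 0 < n) {b : Fin p → ℝ} (h : b ⬝ᵥ (gram X).mulVec b = 0) :
    X.mulVec b = 0 := by
  rw [dotProduct_gram_mulVec] at h
  have hn' : (1 / (n : ℝ)) ≠ 0 := by positivity
  exact dotProduct_self_eq_zero.1 ((mul_eq_zero.1 h).resolve_left hn')

/-- If `g + Σ b = 0` with `b'g ≥ 0` then `g = 0` and `X b = 0`. -/
theorem eq_zero_of_add_gram {g b : Fin p → ℝ} (hn : 0 < n) (h : g + (gram X).mulVec b = 0)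
    (hbg : 0 ≤ b ⬝ᵥ g) : g = 0 ∧ X.mulVec b = 0 := by
  have h1 : b ⬝ᵥ g + b ⬝ᵥ (gram X).mulVec b = 0 := by rw [← dotProduct_add, h, dotProduct_zero]
  have h2 := mulVec_eq_zero_of_gram (X := X) hn (b := b)
    (by have := dotProduct_gram_nonneg (X := X) b; linarith)
  refine ⟨?_, h2⟩
  rw [gram_mulVec, h2] at h
  simpa using h

theorem eq_two_of_gFun_eq_zero {i : ℤ} {u : ℝ} (hu : u ∈ cell i) (hi : |i| = 1)
    (h : gSlope i * u + gConst i = 0) : u = 2 * i := by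
  rcases mem_cell_iff.1 hu with ⟨rfl, _⟩ | ⟨rfl, _⟩ | ⟨rfl, _⟩ | ⟨rfl, _⟩ | ⟨rfl, _⟩ <;>
    simp at hi <;> simp [gSlope, gConst] at h ⊢ <;> linarith

/-- Over the origin g = 0 and Xb = 0. Off the extremes, g = 0 leaves only b_j ∈ {0, γ, -γ}, so b is
γ times a sign vector there, and nondegeneracy applied to Xb = 0 forces b = 0. This is why paths
stay away from τ = 0. -/
theorem eq_zero_of_surf_eq_zero (hn : 0 < n) (hγ : 0 < γ) (hX : Nondegenerate X)
    (hc : (extremes η).card < min n p) {u : Fin p → ℝ} (hu : u ∈ Box η) (h : surf X γ u = 0) :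
    u = 0 := by
  obtain ⟨hg, hb⟩ := eq_zero_of_add_gram hn h
    (Finset.sum_nonneg fun j _ => bFun_mul_gFun_nonneg hγ (u j))
  have hv : ∀ k, k ∉ extremes η → bVec γ u k = γ * ((η k : ℤ) : ℝ) := by
    intro k hk
    rw [mem_extremes] at hk
    have hgk := congrFun hg k
    rw [gVec, gFun_of_mem (hu k)] at hgk
    rw [bVec, bFun_of_mem (hu k)]
    rcases int_abs_le_two (range_of_mem_Box hu k) with h | h | h | h | h
    · simp [h, bSlope, bConst]
    · rw [eq_two_of_gFun_eq_zero (hu k) (by simp [h]) hgk]; simp [h, bSlope, bConst]; ring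
    · simp [h] at hk
    · rw [eq_two_of_gFun_eq_zero (hu k) (by simp [h]) hgk]; simp [h, bSlope, bConst]; ring
    · simp [h] at hk
  have hb0 : bVec γ u = 0 := by
    refine hX.eq_zero hc (a := γ) (η := fun k => if |η k| = 2 then 0 else η k) ?_ ?_ hb
    · intro j
      rcases int_abs_le_two (range_of_mem_Box hu j) with h | h | h | h | h <;> simp [h]
    · intro k hk
      rw [hv k hk, if_neg (by rwa [mem_extremes] at hk)]
  refine eq_of_gVec_bVec hγ ?_ ?_
  · rw [hg]; funext j; simp [gVec, gFun, clip]
  · rw [hb0]; funext j; simp [bVec, bFun, clip]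

theorem cell_bounded {i : ℤ} (hi : |i| ≠ 2) {u : ℝ} (hu : u ∈ cell i) : |u| ≤ 2 := by
  rw [abs_le]
  rcases mem_cell_iff.1 hu with ⟨rfl, h⟩ | ⟨rfl, h⟩ | ⟨rfl, h⟩ | ⟨rfl, h⟩ | ⟨rfl, h⟩ <;>
    simp at hi <;> constructor <;> linarith [h.1, h.2]

/-- A segment that extends to infinity consists of perfect fits. -/
theorem gVec_eq_zero_of_unbounded (hn : 0 < n) (hγ : 0 < γ) (hη : Good X γ η) {z : Fin p → ℝ}
    {τ₀ : ℝ} (h : ∀ τ, τ₀ ≤ τ → line X γ η z τ ∈ Box η) : gVec (line X γ η z τ₀) = 0 := by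
  -- Off the extremes |u_j| ≤ 2, so a displacement by 5 is impossible and the coordinate must stand
  -- still.
  have hd : ∀ j, j ∉ extremes η → dir X γ η z j = 0 := by
    intro j hj
    by_contra hne
    rw [mem_extremes] at hj
    have h0 := cell_bounded hj (h τ₀ le_rfl j)
    have h1 := cell_bounded hj (h (τ₀ + 5 / |dir X γ η z j|) (by simp; positivity) j)
    have h2 := line_sub (X := X) (γ := γ) (η := η) z (τ₀ + 5 / |dir X γ η z j|) τ₀ j
    rw [add_sub_cancel_left] at h2
    have h3 : |5 / |dir X γ η z j| * dir X γ η z j| = 5 := by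
      rw [abs_mul, abs_div, abs_abs, div_mul_cancel₀ _ (abs_ne_zero.2 hne)]; norm_num
    rw [← h2] at h3
    have := abs_sub (line X γ η z (τ₀ + 5 / |dir X γ η z j|) j) (line X γ η z τ₀ j)
    linarith
  have hb : ∀ j, j ∉ extremes η → line X γ η z 0 j = line X γ η z τ₀ j := by
    intro j hj; rw [line_apply, line_apply, hd j hj]; simp
  -- The affine line is continued back to τ = 0, possibly outside the box. Penalized coordinates
  -- have not moved and extreme ones have g = 0, so the sign condition b'g ≥ 0 still holds there.
  have hz := gAff_line hγ hη.det z 0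
  rw [zero_smul] at hz
  have hg := (eq_zero_of_add_gram hn hz (Finset.sum_nonneg fun j _ => by
    by_cases hj : j ∈ extremes η
    · simp [gAff, gSlope_of_extreme hj, gConst_of_extreme hj]
    · simp only [gAff, bAff]
      rw [hb j hj, ← gFun_of_mem (h τ₀ le_rfl j), ← bFun_of_mem (h τ₀ le_rfl j)]
      exact bFun_mul_gFun_nonneg hγ _)).1
  rw [gVec_of_mem (h τ₀ le_rfl)]
  funext j
  by_cases hj : j ∈ extremes η
  · simp [gAff, gSlope_of_extreme hj, gConst_of_extreme hj]
  · rw [gAff, ← hb j hj]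
    exact congrFun hg j

/-! ### Generic directions -/

/-- A linear form that vanishes at `z` if the line over `z` meets `uᵢ = c` and `uⱼ = c'` at the
same time. -/
def tieForm (X : Matrix (Fin n) (Fin p) ℝ) (γ : ℝ) (η : Fin p → ℤ) (i j : Fin p) (c c' : ℝ)
    (z : Fin p → ℝ) : ℝ :=
  (c' - base X γ η j) * dir X γ η z i - (c - base X γ η i) * dir X γ η z j

/-- The parameters at which the indicator changes. -/
def ties : Finset ℝ := {1, -1, 2, -2}

theorem mem_ties {u : ℝ} : u ∈ ties ↔ IsTie u := by
  simp only [ties, Finset.mem_insert, Finset.mem_singleton, IsTie]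
  rw [abs_eq zero_le_one, abs_eq zero_le_two]
  tauto

/-- `z` avoids the hyperplanes where a segment is parallel to, or hits simultaneously, facets of its
parallelepiped. -/
structure Generic (X : Matrix (Fin n) (Fin p) ℝ) (γ : ℝ) (z : Fin p → ℝ) : Prop where
  dir_ne : ∀ η, Good X γ η → ∀ j, dir X γ η z j ≠ 0
  tie_ne : ∀ η, Good X γ η → ∀ i j, ∀ c ∈ ties, ∀ c' ∈ ties,
    (∃ y', tieForm X γ η i j c c' (zTilde X y') ≠ 0) → tieForm X γ η i j c c' z ≠ 0

/-- If two facets are hit simultaneously in a generic direction, then the correlations of the two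
columns with the residuals are proportional. -/
theorem Generic.tie_relation (hn : 0 < n) (hγ : 0 < γ)
    (hη : Good X γ η) (hy : Generic X γ (zTilde X y)) {τ : ℝ} (hτ : τ ≠ 0) {i j : Fin p}
    (hij : i ≠ j) (hi : IsTie (line X γ η (zTilde X y) τ i))
    (hj : IsTie (line X γ η (zTilde X y) τ j)) :
    i ∉ extremes η ∧ j ∉ extremes η ∧ ∃ α β : ℝ, α ≠ 0 ∧ β ≠ 0 ∧
      ∀ w : Fin n → ℝ, (∀ k ∈ extremes η, X.transpose.mulVec w k = 0) →
        β * X.transpose.mulVec w i = α * X.transpose.mulVec w j := by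
  set u := line X γ η (zTilde X y) τ with hudef
  set D := fun y' => dir X γ η (zTilde X y') with hD
  have e : ∀ k, u k - base X γ η k = τ * D y k := by
    intro k; rw [hudef, line_apply]; ring
  have hDi : D y i ≠ 0 := hy.dir_ne η hη i
  have hDj : D y j ≠ 0 := hy.dir_ne η hη j
  -- The two simultaneous ties make the tie form vanish at z̃. By genericity it then vanishes for
  -- every response, so coordinates i and j move proportionally in all directions.
  have hφ : ∀ y', D y j * D y' i = D y i * D y' j := by
    intro y'
    by_contra hne
    refine hy.tie_ne η hη i j _ (mem_ties.2 hi) _ (mem_ties.2 hj) ⟨y', ?_⟩ ?_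
    · rw [tieForm, e, e]
      intro h0
      apply hne
      have : τ * (D y j * D y' i - D y i * D y' j) = 0 := by rw [← h0]; simp only [hD]; ring
      have := (mul_eq_zero.1 this).resolve_left hτ
      linarith
    · rw [tieForm, e, e]; simp only [hD]; ring
  -- For an extreme a, the response x_a moves coordinate a alone, which contradicts the
  -- proportionality.
  have hA : ∀ a b, a ≠ b → D y b ≠ 0 → (∀ y', D y b * D y' a = D y a * D y' b) →
      a ∉ extremes η := by
    intro a b hab hb h ha
    have := h (X.mulVec (Pi.single a 1))
    simp only [hD] at this
    rw [dir_single hγ hη.det ha] at this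
    simp [Ne.symm hab, hγ.ne'] at this
    exact hb this
  have hiA := hA i j hij hDj hφ
  have hjA := hA j i hij.symm hDi fun y' => (hφ y').symm
  have hsi := gSlope_sq (hη.range i) hiA
  have hsj := gSlope_sq (hη.range j) hjA
  set α := gSlope (η i) * D y i with hα
  set β := gSlope (η j) * D y j with hβ
  have hα0 : α ≠ 0 := mul_ne_zero (by intro h; simp [h] at hsi) hDi
  have hβ0 : β ≠ 0 := mul_ne_zero (by intro h; simp [h] at hsj) hDj
  refine ⟨hiA, hjA, α, β, hα0, hβ0, fun w hw => ?_⟩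
  obtain ⟨y', hy'⟩ := exists_dir_eq hn hγ hη.range hη.det hw
  have := hφ y'
  simp only [hD] at this
  rw [hy', hy'] at this
  simp only [hα, hβ, hD]
  linear_combination (gSlope (η i) * gSlope (η j)) * this +
    (-dir X γ η (zTilde X y) j * X.transpose.mulVec w i * gSlope (η j)) * hsi
    + dir X γ η (zTilde X y) i * X.transpose.mulVec w j * gSlope (η i) * hsj

/-- In a generic direction two facets are hit simultaneously only at a perfect fit. -/
theorem Generic.gVec_eq_zero (hn : 0 < n) (hγ : 0 < γ) (hX : Nondegenerate X)
    (hη : Good X γ η) (hy : Generic X γ (zTilde X y)) {τ : ℝ} (hτ : τ ≠ 0)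
    (hu : line X γ η (zTilde X y) τ ∈ Box η) {i j : Fin p} (hij : i ≠ j)
    (hi : IsTie (line X γ η (zTilde X y) τ i)) (hj : IsTie (line X γ η (zTilde X y) τ j)) :
    gVec (line X γ η (zTilde X y) τ) = 0 := by
  obtain ⟨hiA, hjA, α, β, hα0, hβ0, hw⟩ := hy.tie_relation hn hγ hη hτ hij hi hj
  set u := line X γ η (zTilde X y) τ with hudef
  -- With at least two columns to spare, some w would be orthogonal to the extreme columns and to
  -- x_i but not to x_j, against the proportionality.
  have hcard : (extremes η).card + 1 = min n p := by
    by_contra hne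
    have hc := hη.card
    obtain ⟨w, h1, h2⟩ := hX.exists_orthogonal_insert (A := insert i (extremes η)) (j := j)
      (by rw [Finset.card_insert_of_notMem hiA]; omega)
      (by rw [Finset.mem_insert, not_or]; exact ⟨hij.symm, hjA⟩)
    have := hw w fun k hk => h1 k (Finset.mem_insert_of_mem hk)
    rw [h1 i (Finset.mem_insert_self _ _), h2] at this
    simp at this
    exact hα0 this.symm
  obtain ⟨w, hgw⟩ := exists_resid_line hγ hη.det y τ
  have hwE : ∀ k ∈ extremes η, X.transpose.mulVec w k = 0 := fun k hk => orthogonal_extremes hgw hk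
  have hG := hw w hwE
  rw [gVec_of_mem hu, hgw]
  have hval : ∀ k, k ∉ extremes η → IsTie (u k) → X.transpose.mulVec w k = 0 ∨
      X.transpose.mulVec w k = 1 ∨ X.transpose.mulVec w k = -1 := by
    intro k hk ht
    rw [← hgw, gAff, ← hudef]
    rw [← mem_ties] at ht
    simp only [ties, Finset.mem_insert, Finset.mem_singleton] at ht
    rw [mem_extremes] at hk
    have hc := hu k
    rw [mem_cell_iff] at hc
    rcases ht with h | h | h | h <;> rw [h] at hc ⊢ <;>
      rcases hc with ⟨hc, h1⟩ | ⟨hc, h1⟩ | ⟨hc, h1⟩ | ⟨hc, h1⟩ | ⟨hc, h1⟩ <;>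
      rw [hc] at hk ⊢ <;> (try norm_num at hk) <;> (try norm_num at h1) <;>
      norm_num [gSlope, gConst]
  -- At a tie of a penalized coordinate the gradient is 0 or ±1. If it is 0 at i, the residual is
  -- orthogonal to min(n,p) columns and the fit is perfect.
  by_cases hGi : X.transpose.mulVec w i = 0
  · refine hX.transpose_mulVec_eq_zero (A := insert i (extremes η))
      (by rw [Finset.card_insert_of_notMem hiA]; exact hcard) ?_
    intro k hk
    rcases Finset.mem_insert.1 hk with rfl | hk
    · exact hGi
    · exact hwE k hk
  · exfalso
    have hGj : X.transpose.mulVec w j ≠ 0 := by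
      intro h; rw [h, mul_zero] at hG
      exact (mul_ne_zero hβ0 hGi) hG
    have toInt : ∀ k, k ∉ extremes η → IsTie (u k) → X.transpose.mulVec w k ≠ 0 →
        ∃ a : ℤ, (a = 1 ∨ a = -1) ∧ X.transpose.mulVec w k = a := by
      intro k hk ht h0
      rcases hval k hk ht with h | h | h
      · exact absurd h h0
      · exact ⟨1, Or.inl rfl, by simp [h]⟩
      · exact ⟨-1, Or.inr rfl, by simp [h]⟩
    obtain ⟨a, ha, hai⟩ := toInt i hiA hi hGi
    obtain ⟨b, hb, hbj⟩ := toInt j hjA hj hGj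
    -- With g_i = a and g_j = b in {±1}, the proportionality gives βa = αb. Then every w' orthogonal
    -- to the extreme columns satisfies α w'·(bx_i - ax_j) = 0. But bx_i - ax_j is a signed sum of
    -- columns, so by nondegeneracy some such w' has inner product 1 with it.
    obtain ⟨w', h1, h2⟩ := exists_orthogonal (X := X) (A := extremes η)
      (x := X.mulVec (Pi.single i (b : ℝ) - Pi.single j (a : ℝ))) (by
        intro c hc h
        have hz := hX.eq_zero (A := extremes η) hη.card (a := 1)
          (v := c - (Pi.single i (b : ℝ) - Pi.single j (a : ℝ)))
          (η := Pi.single j a - Pi.single i b) (by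
            intro k
            by_cases hki : k = i
            · subst hki; simp [hij]; omega
            · by_cases hkj : k = j
              · subst hkj; simp [Ne.symm hij]; omega
              · simp [hki, hkj]) (by
            intro k hk
            by_cases hki : k = i
            · subst hki; simp [hij, hc k hk]
            · by_cases hkj : k = j
              · subst hkj; simp [Ne.symm hij, hc k hk]
              · simp [hki, hkj, hc k hk]) (by rw [Matrix.mulVec_sub, h, sub_self])
        have := congrFun hz i
        simp [hc i hiA, hij] at this
        omega)
    have hw' := hw w' h1
    rw [Matrix.mulVec_sub, sub_dotProduct] at h2
    have single_smul : ∀ (k : Fin p) (c : ℝ), X.mulVec (Pi.single k c) ⬝ᵥ w' =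
        c * X.transpose.mulVec w' k := by
      intro k c
      have : (Pi.single k c : Fin p → ℝ) = c • Pi.single k 1 := by
        rw [← Pi.single_smul]; simp
      rw [this, Matrix.mulVec_smul, smul_dotProduct, ← transpose_mulVec_eq, smul_eq_mul]
    rw [single_smul, single_smul, ← hai, ← hbj] at h2
    have : α * 1 = 0 := by
      rw [← h2]
      linear_combination (-X.transpose.mulVec w' i) * hG + X.transpose.mulVec w i * hw'
    simp at this
    exact hα0 this

/-- At a perfect fit every entry ±1 of η has its coefficient at the knot ±γ. If there were none, b
would be supported on the extremes with Σb = τz, so the unpenalized coefficients alone would follow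
z and the remaining coordinates would have direction 0, contrary to genericity. -/
theorem Generic.exists_tie (hγ : 0 < γ) (hη : Good X γ η)
    {z : Fin p → ℝ} (hz : Generic X γ z) {τ : ℝ} (hτ : τ ≠ 0) (hu : line X γ η z τ ∈ Box η)
    (hg : gVec (line X γ η z τ) = 0) : ∃ j, |η j| = 1 ∧ line X γ η z τ j = 2 * η j := by
  by_contra hcon
  push Not at hcon
  have hA1 : ∀ j, |η j| ≠ 1 := by
    intro j h
    refine hcon j h (eq_two_of_gFun_eq_zero (hu j) h ?_)
    rw [← gFun_of_mem (hu j)]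
    exact congrFun hg j
  obtain ⟨j, hj⟩ : ∃ j, j ∉ extremes η := by
    by_contra hc
    push Not at hc
    have h1 : extremes η = Finset.univ := Finset.eq_univ_of_forall hc
    have h2 := hη.card
    rw [h1, Finset.card_univ, Fintype.card_fin] at h2
    omega
  set u := line X γ η z τ with hudef
  have hzero : ∀ k, k ∉ extremes η → η k = 0 := by
    intro k hk
    rw [mem_extremes] at hk
    have := hA1 k
    rcases int_abs_le_two (hη.range k) with h | h | h | h | h <;> simp [h] at hk this ⊢
  have hu0 : ∀ k, k ∉ extremes η → u k = 0 := by
    intro k hk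
    have := congrFun hg k
    rw [gVec, gFun_of_mem (hu k), hzero k hk] at this
    simpa [gSlope, gConst] using this
  have hdir : dir X γ η (τ • z) = fun k => u k + bConst γ (η k) / γ := by
    refine dir_eq_of_surfMatrix hγ hη.det ?_
    have hs := surf_line hγ hη.det hu
    rw [surf, hg, zero_add, bVec_of_mem hu] at hs
    rw [surfMatrix_mulVec, ← hs]
    have h1 : (fun k => gSlope (η k) * (u k + bConst γ (η k) / γ)) = 0 := by
      funext k
      by_cases hk : k ∈ extremes η
      · simp [gSlope_of_extreme hk]
      · simp [hu0 k hk, hzero k hk, bConst]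
    have h2 : (fun k => bSlope γ (η k) * (u k + bConst γ (η k) / γ)) = bAff γ η u := by
      funext k
      by_cases hk : η k = 0
      · simp [bAff, hk, bSlope, bConst]
      · simp only [bAff, bSlope, if_neg hk]; field_simp
    rw [h1, h2, zero_add]
  have := congrFun hdir j
  simp only [hu0 j hj, hzero j hj, bConst] at this
  rw [dir, Matrix.mulVec_smul] at this
  simp at this
  exact this.elim hτ (hz.dir_ne η hη j)

/-- The exceptional set of concavity parameters `γ`. -/
def excSet (X : Matrix (Fin n) (Fin p) ℝ) : Set ℝ :=
  {γ | ∃ η : Fin p → ℤ, (∀ j, |η j| ≤ 2) ∧ (extremes η).card < min n p ∧ (Q X γ η).det = 0}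

theorem good_of_notMem_excSet (h : γ ∉ excSet X) (hr : ∀ j, |η j| ≤ 2)
    (hc : (extremes η).card < min n p) : Good X γ η :=
  ⟨hr, hc, fun h0 => h ⟨η, hr, hc, h0⟩⟩

/-- Crossing a facet at a point that is not a perfect fit leads to a good indicator. -/
theorem Good.update (hγ : 0 < γ) (hX : Nondegenerate X) (hΓ : γ ∉ excSet X) (hη : Good X γ η)
    {τ : ℝ} (hu : line X γ η (zTilde X y) τ ∈ Box η)
    (hg : gVec (line X γ η (zTilde X y) τ) ≠ 0) {j : Fin p} {σ : ℤ}
    (hσ : Crossing (η j) σ (line X γ η (zTilde X y) τ j)) :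
    Good X γ (Function.update η j (η j + σ)) := by
  refine good_of_notMem_excSet hΓ ?_ ?_
  · intro k
    by_cases hk : k = j
    · subst hk; simpa using abs_le_two_of_mem_cell hσ.mem_next
    · simpa [hk] using hη.range k
  -- If the bound failed, the new extremes would be the old ones together with j, exactly min(n,p)
  -- columns, all orthogonal to the residual.
  · by_contra hc
    push Not at hc
    have hsub : extremes (Function.update η j (η j + σ)) ⊆ insert j (extremes η) := by
      intro k hk
      rw [mem_extremes] at hk
      by_cases hkj : k = j
      · simp [hkj]
      · rw [Function.update_of_ne hkj] at hk
        exact Finset.mem_insert_of_mem (mem_extremes.2 hk)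
    have hcard := hη.card
    have h1 := Finset.card_le_card hsub
    have h2 := Finset.card_insert_le j (extremes η)
    have heq : extremes (Function.update η j (η j + σ)) = insert j (extremes η) :=
      Finset.eq_of_subset_of_card_le hsub (by omega)
    have hj : |η j + σ| = 2 := by
      have : j ∈ extremes (Function.update η j (η j + σ)) := by rw [heq]; simp
      rw [mem_extremes] at this
      simpa using this
    obtain ⟨w, hgw⟩ := exists_resid_line hγ hη.det y τ
    apply hg
    rw [gVec_of_mem hu, hgw]
    refine hX.transpose_mulVec_eq_zero (A := insert j (extremes η)) (by omega) ?_
    intro k hk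
    rcases Finset.mem_insert.1 hk with rfl | hk
    · rw [← hgw, ← gVec_of_mem hu, gVec, gFun_of_mem hσ.mem_next]
      unfold gSlope gConst
      rw [if_neg (by intro h; simp [h] at hj), hj]
      simp
    · exact orthogonal_extremes hgw hk

/-! ### Genericity fails only on finitely many hyperplanes -/

/-- `dir` in the `j`-th coordinate, as a linear form. -/
def dirForm (X : Matrix (Fin n) (Fin p) ℝ) (γ : ℝ) (η : Fin p → ℤ) (j : Fin p) :
    (Fin p → ℝ) →ₗ[ℝ] ℝ :=
  LinearMap.proj j ∘ₗ Matrix.mulVecLin (surfMatrix X γ η)⁻¹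

theorem finite_indicators : {η : Fin p → ℤ | ∀ j, |η j| ≤ 2}.Finite := by
  have := Set.Finite.pi' (ι := Fin p) fun _ => Set.finite_Icc (-2 : ℤ) 2
  simpa only [mem_Icc, ← abs_le] using this

/-- Genericity is the avoidance of finitely many hyperplanes. A tie form enters only if it is
nonzero somewhere on the range of y ↦ z̃, which is a proper subspace when p > n; hence null sets are
obtained both in z̃ and in y. -/
theorem exists_forms (hn : 0 < n) (hγ : 0 < γ) (hX : Nondegenerate X) :
    ∃ Φ : Set ((Fin p → ℝ) →ₗ[ℝ] ℝ), Φ.Finite ∧ (∀ φ ∈ Φ, ∃ y', φ (zTilde X y') ≠ 0) ∧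
      ∀ z, Generic X γ z ↔ ∀ φ ∈ Φ, φ z ≠ 0 := by
  have hfin : {η : Fin p → ℤ | Good X γ η}.Finite :=
    finite_indicators.subset fun η hη => hη.range
  let Φ₁ := (fun q : (Fin p → ℤ) × Fin p => dirForm X γ q.1 q.2) ''
    ({η | Good X γ η} ×ˢ univ)
  let Φ₂ := (fun q : (Fin p → ℤ) × (Fin p × Fin p) × (ℝ × ℝ) =>
    (q.2.2.2 - base X γ q.1 q.2.1.2) • dirForm X γ q.1 q.2.1.1 -
      (q.2.2.1 - base X γ q.1 q.2.1.1) • dirForm X γ q.1 q.2.1.2) ''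
    ({η | Good X γ η} ×ˢ univ ×ˢ ((ties : Set ℝ) ×ˢ (ties : Set ℝ)))
  refine ⟨Φ₁ ∪ {φ ∈ Φ₂ | ∃ y', φ (zTilde X y') ≠ 0}, ?_, ?_, ?_⟩
  · refine Set.Finite.union ((hfin.prod finite_univ).image _) (Set.Finite.subset ?_ (sep_subset _ _))
    exact (hfin.prod (finite_univ.prod (ties.finite_toSet.prod ties.finite_toSet))).image _
  · rintro φ (⟨⟨η, j⟩, ⟨hη, -⟩, rfl⟩ | ⟨-, h⟩)
    · exact exists_dir_ne_zero hn hγ hX hη j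
    · exact h
  · intro z
    constructor
    · rintro hz φ (⟨⟨η, j⟩, ⟨hη, -⟩, rfl⟩ | ⟨⟨⟨η, ⟨i, j⟩, c, c'⟩, ⟨hη, -, hc, hc'⟩, rfl⟩, h⟩)
      · exact hz.dir_ne η hη j
      · exact hz.tie_ne η hη i j c hc c' hc' h
    · intro h
      refine ⟨fun η hη j => h _ (Or.inl ⟨⟨η, j⟩, ⟨hη, trivial⟩, rfl⟩), ?_⟩
      intro η hη i j c hc c' hc' hne
      exact h _ (Or.inr ⟨⟨⟨η, ⟨i, j⟩, c, c'⟩, ⟨hη, trivial, hc, hc'⟩, rfl⟩, hne⟩)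

theorem volume_ker_eq_zero {m : ℕ} {φ : (Fin m → ℝ) →ₗ[ℝ] ℝ} (h : φ ≠ 0) :
    volume {z | φ z = 0} = 0 := by
  have := Measure.addHaar_submodule (volume : Measure (Fin m → ℝ)) (LinearMap.ker φ) (by
    rwa [Ne, LinearMap.ker_eq_top])
  exact this

/-- `zTilde` as a linear map. -/
def zTildeLin (X : Matrix (Fin n) (Fin p) ℝ) : (Fin n → ℝ) →ₗ[ℝ] (Fin p → ℝ) where
  toFun := zTilde X
  map_add' := zTilde_add
  map_smul' := zTilde_smul

theorem volume_not_generic (hn : 0 < n) (hγ : 0 < γ) (hX : Nondegenerate X) :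
    volume {z | ¬ Generic X γ z} = 0 ∧ volume {y | ¬ Generic X γ (zTilde X y)} = 0 := by
  obtain ⟨Φ, hfin, hne, hiff⟩ := exists_forms hn hγ hX
  have e : {z | ¬ Generic X γ z} = ⋃ φ ∈ Φ, {z | φ z = 0} := by
    ext z; simp [hiff]
  have e' : {y | ¬ Generic X γ (zTilde X y)} = ⋃ φ ∈ Φ, {y | (φ ∘ₗ zTildeLin X) y = 0} := by
    ext z; simp [hiff, zTildeLin]
  rw [e, e', measure_biUnion_null_iff hfin.countable, measure_biUnion_null_iff hfin.countable]
  refine ⟨fun φ hφ => volume_ker_eq_zero ?_, fun φ hφ => volume_ker_eq_zero ?_⟩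
  · rintro rfl
    obtain ⟨y', hy'⟩ := hne _ hφ
    exact hy' rfl
  · intro h
    obtain ⟨y', hy'⟩ := hne _ hφ
    exact hy' (LinearMap.congr_fun h y')

theorem exists_generic (hn : 0 < n) (hγ : 0 < γ) (hX : Nondegenerate X) :
    ∃ y, Generic X γ (zTilde X y) := by
  by_contra h
  push Not at h
  have h2 := (volume_not_generic hn hγ hX).2
  have : {y | ¬ Generic X γ (zTilde X y)} = univ := eq_univ_of_forall h
  rw [this] at h2
  exact isOpen_univ.measure_ne_zero _ univ_nonempty h2

theorem eventually_generic (hn : 0 < n) (hγ : 0 < γ) (hX : Nondegenerate X) {y₁ : Fin n → ℝ}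
    (hy₁ : Generic X γ (zTilde X y₁)) (y : Fin n → ℝ) :
    ∀ᶠ ε : ℝ in 𝓝[>] 0, Generic X γ (zTilde X (y + ε • y₁)) := by
  obtain ⟨Φ, hfin, hne, hiff⟩ := exists_forms hn hγ hX
  simp only [hiff]
  rw [hfin.eventually_all]
  intro φ hφ
  have h1 : φ (zTilde X y₁) ≠ 0 := (hiff _).1 hy₁ φ hφ
  -- Each form has one root in ε. If this root is 0 it is harmless, since only ε > 0 is considered.
  have hs : ({-(φ (zTilde X y)) / φ (zTilde X y₁)} \ {0} : Set ℝ)ᶜ ∈ 𝓝 (0 : ℝ) :=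
    ((Set.finite_singleton _).sdiff.isClosed.isOpen_compl).mem_nhds (by simp)
  filter_upwards [mem_nhdsWithin_of_mem_nhds hs, self_mem_nhdsWithin] with ε hε hpos h0
  rw [zTilde_add, zTilde_smul, map_add, map_smul, smul_eq_mul] at h0
  apply hε
  refine ⟨?_, (mem_Ioi.1 hpos).ne'⟩
  rw [mem_singleton_iff, eq_div_iff h1]
  linarith

/-! ### The interval of a segment -/

/-- The values of `τ` for which the line of `η` over `z` is in `Box η`. -/
def ival (X : Matrix (Fin n) (Fin p) ℝ) (γ : ℝ) (η : Fin p → ℤ) (z : Fin p → ℝ) : Set ℝ :=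
  {τ | 0 ≤ τ ∧ line X γ η z τ ∈ Box η}

theorem isClosed_ival (z : Fin p → ℝ) : IsClosed (ival X γ η z) := by
  refine isClosed_Ici.inter ((isClosed_Box η).preimage ?_)
  exact continuous_line.comp (continuous_id.prodMk continuous_const)

theorem convex_ival (z : Fin p → ℝ) : Convex ℝ (ival X γ η z) := by
  intro τ hτ τ' hτ' a b ha hb hab
  refine ⟨add_nonneg (mul_nonneg ha hτ.1) (mul_nonneg hb hτ'.1), ?_⟩
  have : line X γ η z (a • τ + b • τ') = a • line X γ η z τ + b • line X γ η z τ' := by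
    funext j
    simp only [line_apply, Pi.add_apply, Pi.smul_apply, smul_eq_mul]
    linear_combination (-base X γ η j) * hab
  rw [this]
  exact convex_Box η hτ.2 hτ'.2 ha hb hab

theorem zero_notMem_ival (hn : 0 < n) (hγ : 0 < γ) (hX : Nondegenerate X) (hη : Good X γ η)
    (h0 : η ≠ 0) (z : Fin p → ℝ) : (0 : ℝ) ∉ ival X γ η z := by
  rintro ⟨-, h⟩
  have := eq_zero_of_surf_eq_zero hn hγ hX hη.card h (by rw [surf_line hγ hη.det h, zero_smul])
  rw [this] at h
  apply h0
  funext j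
  have := h j
  rw [mem_cell_iff] at this
  norm_num at this
  exact this

/-- Fewer than p indices are extreme, so some coordinate lives in a bounded cell, and generically it
moves at a nonzero speed. -/
theorem bddAbove_ival (hη : Good X γ η) {z : Fin p → ℝ} (hz : Generic X γ z) :
    BddAbove (ival X γ η z) := by
  obtain ⟨j, hj⟩ : ∃ j, j ∉ extremes η := by
    by_contra hc
    push Not at hc
    have h1 : extremes η = Finset.univ := Finset.eq_univ_of_forall hc
    have h2 := hη.card
    rw [h1, Finset.card_univ, Fintype.card_fin] at h2
    omega
  have hd := hz.dir_ne η hη j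
  refine ⟨(2 + |base X γ η j|) / |dir X γ η z j|, fun τ hτ => ?_⟩
  rw [mem_extremes] at hj
  have h1 := cell_bounded hj (hτ.2 j)
  rw [line_apply] at h1
  rw [le_div_iff₀ (abs_pos.2 hd)]
  have h2 := abs_sub_abs_le_abs_sub (τ * dir X γ η z j) (-base X γ η j)
  rw [sub_neg_eq_add, abs_neg, abs_mul, abs_of_nonneg hτ.1] at h2
  linarith

theorem ival_mem_nhds {z : Fin p → ℝ} {τ : ℝ} (hτ : 0 < τ) (h : τ ∈ ival X γ η z)
    (ht : ∀ j, ¬ IsTie (line X γ η z τ j)) : ival X γ η z ∈ 𝓝 τ := by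
  have h1 : ∀ j, ∀ᶠ τ' in 𝓝 τ, line X γ η z τ' j ∈ cell (η j) := by
    intro j
    have hc : Continuous fun τ' => line X γ η z τ' j := by simp only [line_apply]; fun_prop
    exact hc.continuousAt.eventually (eventually_mem_cell (h.2 j) (ht j))
  filter_upwards [Ioi_mem_nhds hτ, eventually_all.2 h1] with τ' h2 h3
  exact ⟨(mem_Ioi.1 h2).le, h3⟩

theorem Crossing.ival_side {z : Fin p → ℝ} {τ : ℝ} {j : Fin p} {σ : ℤ}
    (hσ : Crossing (η j) σ (line X γ η z τ j)) {τ' : ℝ} (h : τ' ∈ ival X γ η z) :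
    (σ : ℝ) * dir X γ η z j * (τ' - τ) ≤ 0 := by
  have := hσ.side _ (h.2 j)
  rw [line_sub] at this
  linarith

theorem Crossing.ival_near {z : Fin p → ℝ} {τ : ℝ} {j : Fin p} {σ : ℤ} (hτ : 0 < τ)
    (h : τ ∈ ival X γ η z) (ht : ∀ i, IsTie (line X γ η z τ i) → i = j)
    (hσ : Crossing (η j) σ (line X γ η z τ j)) :
    ∀ᶠ τ' in 𝓝 τ, (σ : ℝ) * dir X γ η z j * (τ' - τ) ≤ 0 → τ' ∈ ival X γ η z := by
  have hc : ∀ i, Continuous fun τ' => line X γ η z τ' i := by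
    intro i; simp only [line_apply]; fun_prop
  have h1 : ∀ i, ∀ᶠ τ' in 𝓝 τ, (σ : ℝ) * dir X γ η z j * (τ' - τ) ≤ 0 →
      line X γ η z τ' i ∈ cell (η i) := by
    intro i
    by_cases hi : i = j
    · subst hi
      filter_upwards [(hc i).continuousAt.eventually hσ.near] with τ' h2 h3
      apply h2
      rw [line_sub]; linarith
    · filter_upwards [(hc i).continuousAt.eventually
        (eventually_mem_cell (h.2 i) fun h' => hi (ht i h'))] with τ' h2 _ using h2
  filter_upwards [Ioi_mem_nhds hτ, eventually_all.2 h1] with τ' h2 h3 h4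
  exact ⟨(mem_Ioi.1 h2).le, fun i => h3 i h4⟩

theorem eq_Icc_of_compact_convex {s : Set ℝ} (hc : IsClosed s) (hb : BddBelow s) (ha : BddAbove s)
    (hconv : Convex ℝ s) (hne : s.Nonempty) : s = Icc (sInf s) (sSup s) := by
  refine Subset.antisymm (fun x hx => ⟨csInf_le hb hx, le_csSup ha hx⟩) ?_
  exact hconv.ordConnected.out (hc.csInf_mem hne hb) (hc.csSup_mem hne ha)

/-- A segment entered through a single facet, transversally, has another end point. -/
theorem exists_other_end (hn : 0 < n) (hγ : 0 < γ) (hX : Nondegenerate X) (hη : Good X γ η)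
    (h0 : η ≠ 0) {z : Fin p → ℝ} (hz : Generic X γ z) {τ : ℝ} (h : τ ∈ ival X γ η z) {j : Fin p}
    {σ : ℤ} (ht : ∀ i, IsTie (line X γ η z τ i) → i = j)
    (hσ : Crossing (η j) σ (line X γ η z τ j)) :
    ∃ τ', 0 < τ' ∧ τ ≠ τ' ∧ ival X γ η z = uIcc τ τ' := by
  have hzero := zero_notMem_ival hn hγ hX hη h0 z
  have hpos : ∀ t ∈ ival X γ η z, 0 < t := fun t ht' =>
    lt_of_le_of_ne ht'.1 (by rintro rfl; exact hzero ht')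
  have hbb : BddBelow (ival X γ η z) := ⟨0, fun t ht' => ht'.1⟩
  have hba := bddAbove_ival hη hz
  have hcl := isClosed_ival (X := X) (γ := γ) (η := η) z
  have hI := eq_Icc_of_compact_convex hcl hbb hba (convex_ival z) ⟨τ, h⟩
  have hinf := hcl.csInf_mem ⟨τ, h⟩ hbb
  have hsup := hcl.csSup_mem ⟨τ, h⟩ hba
  have hnear := hσ.ival_near (hpos τ h) h ht
  have hd : (σ : ℝ) * dir X γ η z j ≠ 0 := by
    refine mul_ne_zero ?_ (hz.dir_ne η hη j)
    rcases hσ.sign with rfl | rfl <;> simp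
  rcases lt_or_gt_of_ne hd with hneg | hpos'
  · have hle : ∀ t ∈ ival X γ η z, τ ≤ t := by
      intro t ht'
      have := hσ.ival_side ht'
      by_contra hlt
      push Not at hlt
      have := mul_pos_of_neg_of_neg hneg (sub_neg.2 hlt)
      linarith
    have hτ : sInf (ival X γ η z) = τ := le_antisymm (csInf_le hbb h) (hle _ hinf)
    refine ⟨_, hpos _ hsup, ?_, ?_⟩
    · intro heq
      obtain ⟨δ, hδ, hball⟩ := Metric.eventually_nhds_iff.1 hnear
      have hm := hball (y := τ + δ / 2) (by
        rw [Real.dist_eq, add_sub_cancel_left, abs_of_pos (by linarith)]; linarith) (by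
        rw [add_sub_cancel_left]
        exact mul_nonpos_of_nonpos_of_nonneg hneg.le (by linarith))
      have := le_csSup hba hm
      linarith
    · rw [uIcc_of_le (le_csSup hba h)]
      rw [hτ] at hI
      exact hI
  · have hle : ∀ t ∈ ival X γ η z, t ≤ τ := by
      intro t ht'
      have := hσ.ival_side ht'
      by_contra hlt
      push Not at hlt
      have := mul_pos hpos' (sub_pos.2 hlt)
      linarith
    have hτ : sSup (ival X γ η z) = τ := le_antisymm (hle _ hsup) (le_csSup hba h)
    refine ⟨_, hpos _ hinf, ?_, ?_⟩
    · intro heq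
      obtain ⟨δ, hδ, hball⟩ := Metric.eventually_nhds_iff.1 hnear
      have hm := hball (y := τ - δ / 2) (by
        rw [Real.dist_eq, sub_sub_cancel_left, abs_neg, abs_of_pos (by linarith)]; linarith) (by
        rw [sub_sub_cancel_left]
        exact mul_nonpos_of_nonneg_of_nonpos hpos'.le (by linarith))
      have := csInf_le hbb hm
      linarith
    · rw [uIcc_of_ge (csInf_le hbb h)]
      rw [hτ] at hI
      exact hI

/-- A cell lies on one side of its tie, so a coordinate moving at nonzero speed cannot attain the
tie in the interior of the interval. -/
theorem eq_end_of_crossing (hη : Good X γ η) {z : Fin p → ℝ} (hz : Generic X γ z) {τ a b : ℝ}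
    (h : τ ∈ ival X γ η z) (hab : ival X γ η z = uIcc a b) {j : Fin p} {σ : ℤ}
    (hσ : Crossing (η j) σ (line X γ η z τ j)) : τ = a ∨ τ = b := by
  have hd : (σ : ℝ) * dir X γ η z j ≠ 0 := by
    refine mul_ne_zero ?_ (hz.dir_ne η hη j)
    rcases hσ.sign with rfl | rfl <;> simp
  have ha := hσ.ival_side (τ' := a) (by rw [hab]; exact left_mem_uIcc)
  have hb := hσ.ival_side (τ' := b) (by rw [hab]; exact right_mem_uIcc)
  rw [hab, mem_uIcc] at h
  by_contra hcon
  push Not at hcon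
  rcases lt_or_gt_of_ne hd with hd | hd
  · have h1 : 0 ≤ a - τ := by nlinarith
    have h2 : 0 ≤ b - τ := by nlinarith
    rcases h with h | h
    · exact hcon.1 (by linarith)
    · exact hcon.2 (by linarith)
  · have h1 : a - τ ≤ 0 := by nlinarith
    have h2 : b - τ ≤ 0 := by nlinarith
    rcases h with h | h
    · exact hcon.2 (by linarith)
    · exact hcon.1 (by linarith)

theorem uIcc_notMem_nhds {a b : ℝ} : uIcc a b ∉ 𝓝 b := by
  intro h
  rcases le_total a b with hab | hab
  · rw [uIcc_of_le hab] at h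
    have := (mem_nhdsWithin_of_mem_nhds h : Icc a b ∈ 𝓝[>] b)
    obtain ⟨x, hx1, hx2⟩ := (inter_mem this self_mem_nhdsWithin : _ ∈ 𝓝[>] b) |> Filter.nonempty_of_mem
    exact absurd hx1.2 (not_le.2 hx2)
  · rw [uIcc_of_ge hab] at h
    have := (mem_nhdsWithin_of_mem_nhds h : Icc b a ∈ 𝓝[<] b)
    obtain ⟨x, hx1, hx2⟩ := (inter_mem this self_mem_nhdsWithin : _ ∈ 𝓝[<] b) |> Filter.nonempty_of_mem
    exact absurd hx1.1 (not_le.2 hx2)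

/-! ### The initial segment -/

theorem extremes_zero : extremes (0 : Fin p → ℤ) = ∅ := by
  ext j; simp [mem_extremes]

theorem good_zero (hn : 0 < n) (hp : 0 < p) (hΓ : γ ∉ excSet X) : Good X γ 0 :=
  good_of_notMem_excSet hΓ (by simp) (by rw [extremes_zero]; simp; omega)

theorem mem_Box_zero {u : Fin p → ℝ} : u ∈ Box 0 ↔ ∀ j, |u j| ≤ 1 := by
  refine forall_congr' fun j => ?_
  rw [mem_cell_iff, abs_le]; simp

theorem line_zero (hγ : 0 < γ) (hη : Good X γ 0) (z : Fin p → ℝ) (τ : ℝ) :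
    line X γ 0 z τ = τ • z := by
  have := dir_eq_of_surfMatrix (X := X) (η := 0) hγ hη.det (u := τ • z - surfConst X γ 0) rfl
  have h2 : surfConst X γ 0 = 0 := by
    rw [surfConst]
    have h1 : (fun j : Fin p => bConst γ ((0 : Fin p → ℤ) j)) = 0 := by funext j; simp [bConst]
    rw [h1]; funext j; simp [gConst]
  have h3 : (surfMatrix X γ 0).mulVec (τ • z) = τ • z := by
    rw [surfMatrix_mulVec]
    have h1 : (fun j : Fin p => bSlope γ ((0 : Fin p → ℤ) j) * (τ • z) j) = 0 := by
      funext j; simp [bSlope]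
    rw [h1]; funext j; simp [gSlope]
  rw [h2, sub_zero, h3] at this
  rw [line, h2, sub_zero]; exact this

theorem iSup_abs_pos {z : Fin p → ℝ} (hz : z ≠ 0) : 0 < ⨆ j, |z j| := by
  obtain ⟨j, hj⟩ := Function.ne_iff.1 hz
  exact lt_of_lt_of_le (abs_pos.2 hj) (le_ciSup (f := fun j => |z j|) (finite_range _).bddAbove j)

theorem smul_mem_Box_zero {z : Fin p → ℝ} (hz : z ≠ 0) {τ : ℝ} (hτ : 0 ≤ τ) :
    τ • z ∈ Box (0 : Fin p → ℤ) ↔ τ ≤ 1 / ⨆ j, |z j| := by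
  have hpos := iSup_abs_pos hz
  obtain ⟨i, hi⟩ := Function.ne_iff.1 hz
  have : Nonempty (Fin p) := ⟨i⟩
  rw [mem_Box_zero, le_div_iff₀ hpos]
  simp only [Pi.smul_apply, smul_eq_mul, abs_mul, abs_of_nonneg hτ]
  constructor
  · intro h
    obtain ⟨j, hj⟩ := exists_eq_ciSup_of_finite (f := fun j => |z j|)
    rw [← hj]; exact h j
  · intro h j
    exact le_trans (mul_le_mul_of_nonneg_left (le_ciSup (f := fun j => |z j|)
      (finite_range _).bddAbove j) hτ) h

theorem ival_zero (hγ : 0 < γ) (hη : Good X γ 0) {z : Fin p → ℝ} (hz : z ≠ 0) :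
    ival X γ 0 z = Icc 0 (1 / ⨆ j, |z j|) := by
  ext τ
  rw [ival, mem_ofPred_eq, line_zero hγ hη, mem_Icc]
  constructor
  · rintro ⟨h1, h2⟩; exact ⟨h1, (smul_mem_Box_zero hz h1).1 h2⟩
  · rintro ⟨h1, h2⟩; exact ⟨h1, (smul_mem_Box_zero hz h1).2 h2⟩

/-! ### Chains of segments -/

/-- A chain of adjacent segments over a generic direction, starting with the trivial solutions. -/
structure Chain (X : Matrix (Fin n) (Fin p) ℝ) (y : Fin n → ℝ) (γ : ℝ) (K : ℕ)
    (η : ℕ → Fin p → ℤ) (τ : ℕ → ℝ) : Prop where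
  eta_zero : η 0 = 0
  tau_zero : τ 0 = 1 / ⨆ j, |zTilde X y j|
  good : ∀ k ≤ K, Good X γ (η k)
  tau_pos : ∀ k ≤ K, 0 < τ k
  mem : ∀ k ≤ K, line X γ (η k) (zTilde X y) (τ k) ∈ Box (η k)
  seg : ∀ k < K, ival X γ (η (k + 1)) (zTilde X y) = uIcc (τ k) (τ (k + 1))
  tau_ne : ∀ k < K, τ k ≠ τ (k + 1)
  step : ∀ k < K, ∃ j σ, Crossing (η k j) σ (line X γ (η k) (zTilde X y) (τ k) j) ∧
    (∀ i, IsTie (line X γ (η k) (zTilde X y) (τ k) i) → i = j) ∧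
    η (k + 1) = Function.update (η k) j (η k j + σ)
  not_perfect : ∀ k < K, gVec (line X γ (η k) (zTilde X y) (τ k)) ≠ 0
  inj : ∀ i ≤ K, ∀ k ≤ K, η i = η k → i = k

/-- At a point with a single tie only two boxes meet. -/
theorem eq_or_eq_update {u : Fin p → ℝ} (hu : u ∈ Box η) {j : Fin p} {σ : ℤ}
    (ht : ∀ i, IsTie (u i) → i = j) (hσ : Crossing (η j) σ (u j)) {η' : Fin p → ℤ}
    (h : u ∈ Box η') : η' = η ∨ η' = Function.update η j (η j + σ) := by
  have hne : ∀ i, i ≠ j → η' i = η i := fun i hi =>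
    not_isTie_imp_eq (hu i) (fun h' => hi (ht i h')) (h i)
  rcases hσ.only _ (h j) with h1 | h1
  · left; funext i
    by_cases hi : i = j
    · rw [hi, h1]
    · exact hne i hi
  · right; funext i
    by_cases hi : i = j
    · rw [hi, h1]; simp
    · rw [hne i hi]; simp [hi]

theorem mem_Box_update {u : Fin p → ℝ} (hu : u ∈ Box η) {j : Fin p} {σ : ℤ}
    (hσ : Crossing (η j) σ (u j)) : u ∈ Box (Function.update η j (η j + σ)) := by
  intro i
  by_cases hi : i = j
  · subst hi; simpa using hσ.mem_next
  · simpa [hi] using hu i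

section
variable {K : ℕ} {H : ℕ → Fin p → ℤ} {τ : ℕ → ℝ}

theorem Chain.mem_next (hC : Chain X y γ K H τ) {k : ℕ} (hk : k < K) :
    line X γ (H k) (zTilde X y) (τ k) ∈ Box (H (k + 1)) := by
  obtain ⟨j, σ, h1, -, h3⟩ := hC.step k hk
  rw [h3]
  exact mem_Box_update (hC.mem k hk.le) h1

theorem Chain.line_next (hγ : 0 < γ) (hC : Chain X y γ K H τ) {k : ℕ} (hk : k < K) :
    line X γ (H (k + 1)) (zTilde X y) (τ k) = line X γ (H k) (zTilde X y) (τ k) :=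
  (eq_line hγ (hC.good (k + 1) hk).det (hC.mem_next hk)
    (surf_line hγ (hC.good k hk.le).det (hC.mem k hk.le))).symm

theorem Chain.box_cases (hC : Chain X y γ K H τ) {k : ℕ} (hk : k < K) {η' : Fin p → ℤ}
    (h : line X γ (H k) (zTilde X y) (τ k) ∈ Box η') : η' = H k ∨ η' = H (k + 1) := by
  obtain ⟨j, σ, h1, h2, h3⟩ := hC.step k hk
  rw [h3]
  exact eq_or_eq_update (hC.mem k hk.le) h2 h1 h

theorem Chain.mem_ival (hC : Chain X y γ K H τ) {k : ℕ} (hk : k ≤ K) :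
    τ k ∈ ival X γ (H k) (zTilde X y) := ⟨(hC.tau_pos k hk).le, hC.mem k hk⟩

/-- A point of the `i`-th segment that lies on a facet is one of its end points. -/
theorem Chain.eq_vertex (hγ : 0 < γ) (hC : Chain X y γ K H τ) (hy : Generic X γ (zTilde X y))
    (hz : zTilde X y ≠ 0) {i : ℕ} (hi : i ≤ K) {t : ℝ} (ht : 0 < t)
    (hu : line X γ (H i) (zTilde X y) t ∈ Box (H i)) {j : Fin p}
    (hj : IsTie (line X γ (H i) (zTilde X y) t j)) :
    t = τ i ∨ (1 ≤ i ∧ t = τ (i - 1)) := by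
  obtain ⟨σ, hσ⟩ := exists_crossing (hu j) hj
  rcases i with _ | i
  · left
    have h0 := ival_zero hγ (by simpa [hC.eta_zero] using hC.good 0 hi) hz
    rw [← hC.eta_zero, ← hC.tau_zero] at h0
    rw [← uIcc_of_le (hC.tau_pos 0 hi).le] at h0
    rcases eq_end_of_crossing (hC.good 0 hi) hy ⟨ht.le, hu⟩ h0 hσ with h | h
    · exact absurd h ht.ne'
    · exact h
  · rcases eq_end_of_crossing (hC.good _ hi) hy ⟨ht.le, hu⟩ (hC.seg i hi) hσ with h | h
    · right; exact ⟨by omega, by simpa using h⟩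
    · left; exact h

/-- Without ties the interval of the last segment would be a neighbourhood of its own end point. -/
theorem Chain.exists_tie_last (hγ : 0 < γ) (hC : Chain X y γ K H τ)
    (hz : zTilde X y ≠ 0) : ∃ j, IsTie (line X γ (H K) (zTilde X y) (τ K) j) := by
  by_contra hcon
  push Not at hcon
  have hnhds := ival_mem_nhds (hC.tau_pos K le_rfl) (hC.mem_ival le_rfl) hcon
  rcases K with _ | K
  · have h0 := ival_zero hγ (by simpa [hC.eta_zero] using hC.good 0 le_rfl) hz
    rw [← hC.eta_zero, ← hC.tau_zero, ← uIcc_of_le (hC.tau_pos 0 le_rfl).le] at h0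
    rw [h0] at hnhds
    exact uIcc_notMem_nhds hnhds
  · rw [hC.seg K (by omega)] at hnhds
    exact uIcc_notMem_nhds hnhds

/-- Away from perfect fits the last vertex has exactly one tie. Crossing it determines the next box,
whose segment is entered transversally and so has a second end. -/
theorem Chain.extend (hn : 0 < n) (hγ : 0 < γ) (hX : Nondegenerate X) (hΓ : γ ∉ excSet X)
    (hy : Generic X γ (zTilde X y)) (hz : zTilde X y ≠ 0) (hC : Chain X y γ K H τ)
    (hg : gVec (line X γ (H K) (zTilde X y) (τ K)) ≠ 0) : ∃ H' τ', Chain X y γ (K + 1) H' τ' := by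
  set u := line X γ (H K) (zTilde X y) (τ K) with hudef
  have hu : u ∈ Box (H K) := hC.mem K le_rfl
  have hpos := hC.tau_pos K le_rfl
  obtain ⟨j, hj⟩ := hC.exists_tie_last hγ hz
  have ht : ∀ i, IsTie (u i) → i = j := by
    intro i hi
    by_contra hij
    exact hg (hy.gVec_eq_zero hn hγ hX (hC.good K le_rfl) hpos.ne' hu hij hi hj)
  obtain ⟨σ, hσ⟩ := exists_crossing (hu j) hj
  have hgood := (hC.good K le_rfl).update hγ hX hΓ hu hg hσ
  have hu' := mem_Box_update hu hσ
  have hsurf : surf X γ u = τ K • zTilde X y := surf_line hγ (hC.good K le_rfl).det hu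
  set η' := Function.update (H K) j (H K j + σ) with hη'
  have hline : u = line X γ η' (zTilde X y) (τ K) := eq_line hγ hgood.det hu' hsurf
  have hσ0 : σ ≠ 0 := by rcases hσ.sign with rfl | rfl <;> decide
  -- If the new box were an old one, the last vertex would lie on a facet of that old segment and so
  -- be one of its end points. Only two boxes meet there, and both already belong to the chain,
  -- which contradicts the distinctness of the indicators or of consecutive τ.
  have hnew : ∀ i ≤ K, H i ≠ η' := by
    intro i hi heq
    have hiK : i ≠ K := by
      rintro rfl
      have := congrFun heq j
      rw [hη'] at this
      simp at this
      exact hσ0 this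
    have hlt : i < K := lt_of_le_of_ne hi hiK
    have hui : u = line X γ (H i) (zTilde X y) (τ K) := by rw [heq]; exact hline
    rcases hC.eq_vertex hγ hy hz hi hpos (j := j) (by rw [← hui, heq]; exact hu')
      (by rw [← hui]; exact hj) with h | ⟨h1, h⟩
    · have hh : u ∈ Box (H K) := hu
      rw [hui, h] at hh
      rcases hC.box_cases hlt hh with h2 | h2
      · exact hiK (hC.inj i hi K le_rfl h2.symm)
      · have := hC.inj K le_rfl (i + 1) hlt h2
        exact hC.tau_ne i hlt (by rw [← this]; exact h.symm)
    · obtain ⟨i, rfl⟩ : ∃ m, i = m + 1 := ⟨i - 1, by omega⟩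
      simp only [Nat.add_sub_cancel] at h
      have hh : u ∈ Box (H K) := hu
      rw [hui, h, hC.line_next hγ (by omega)] at hh
      rcases hC.box_cases (by omega) hh with h2 | h2
      · have := hC.inj K le_rfl i (by omega) h2; omega
      · have := hC.inj K le_rfl (i + 1) (by omega) h2; omega
  have hη0 : η' ≠ 0 := by
    rw [← hC.eta_zero]; exact (hnew 0 (Nat.zero_le _)).symm
  have hσ' : Crossing (η' j) (-σ) (line X γ η' (zTilde X y) (τ K) j) := by
    rw [← hline, hη']; simpa using hσ.symm
  obtain ⟨t, ht0, htne, hseg⟩ := exists_other_end hn hγ hX hgood hη0 hy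
    (τ := τ K) ⟨hpos.le, by rw [← hline]; exact hu'⟩ (j := j) (by rw [← hline]; exact ht) hσ'
  have e1 : ∀ k ≤ K, Function.update H (K + 1) η' k = H k := by
    intro k hk; rw [Function.update_of_ne (by omega)]
  have e2 : ∀ k ≤ K, Function.update τ (K + 1) t k = τ k := by
    intro k hk; rw [Function.update_of_ne (by omega)]
  have e3 : Function.update H (K + 1) η' (K + 1) = η' := Function.update_self ..
  have e4 : Function.update τ (K + 1) t (K + 1) = t := Function.update_self ..
  refine ⟨Function.update H (K + 1) η', Function.update τ (K + 1) t, ?_, ?_, ?_, ?_, ?_, ?_, ?_,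
    ?_, ?_, ?_⟩
  · rw [e1 0 (by omega), hC.eta_zero]
  · rw [e2 0 (by omega), hC.tau_zero]
  · intro k hk
    rcases Nat.lt_or_ge k (K + 1) with h | h
    · rw [e1 k (by omega)]; exact hC.good k (by omega)
    · obtain rfl : k = K + 1 := by omega
      rw [e3]; exact hgood
  · intro k hk
    rcases Nat.lt_or_ge k (K + 1) with h | h
    · rw [e2 k (by omega)]; exact hC.tau_pos k (by omega)
    · obtain rfl : k = K + 1 := by omega
      rw [e4]; exact ht0
  · intro k hk
    rcases Nat.lt_or_ge k (K + 1) with h | h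
    · rw [e1 k (by omega), e2 k (by omega)]; exact hC.mem k (by omega)
    · obtain rfl : k = K + 1 := by omega
      rw [e3, e4]
      have : t ∈ ival X γ η' (zTilde X y) := by rw [hseg]; exact right_mem_uIcc
      exact this.2
  · intro k hk
    rcases Nat.lt_or_ge k K with h | h
    · rw [e1 _ (by omega), e2 _ (by omega), e2 _ (by omega)]; exact hC.seg k h
    · obtain rfl : k = K := by omega
      rw [e3, e4, e2 k le_rfl]; exact hseg
  · intro k hk
    rcases Nat.lt_or_ge k K with h | h
    · rw [e2 _ (by omega), e2 _ (by omega)]; exact hC.tau_ne k h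
    · obtain rfl : k = K := by omega
      rw [e4, e2 k le_rfl]; exact htne
  · intro k hk
    rcases Nat.lt_or_ge k K with h | h
    · rw [e1 _ (by omega), e2 _ (by omega), e1 _ (by omega)]; exact hC.step k h
    · obtain rfl : k = K := by omega
      rw [e3, e1 k le_rfl, e2 k le_rfl]; exact ⟨j, σ, hσ, ht, rfl⟩
  · intro k hk
    rw [e1 _ (by omega), e2 _ (by omega)]
    rcases Nat.lt_or_ge k K with h | h
    · exact hC.not_perfect k h
    · obtain rfl : k = K := by omega
      exact hg
  · intro i hi k hk heq
    rcases Nat.lt_or_ge i (K + 1) with h | h <;> rcases Nat.lt_or_ge k (K + 1) with h' | h'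
    · rw [e1 _ (by omega), e1 _ (by omega)] at heq
      exact hC.inj i (by omega) k (by omega) heq
    · obtain rfl : k = K + 1 := by omega
      rw [e1 _ (by omega), e3] at heq
      exact absurd heq (hnew i (by omega))
    · obtain rfl : i = K + 1 := by omega
      rw [e1 k (by omega), e3] at heq
      exact absurd heq.symm (hnew k (by omega))
    · omega

theorem Chain.length_le (hC : Chain X y γ K H τ) :
    K < (finite_indicators (p := p)).toFinset.card := by
  have : (Finset.range (K + 1)).card ≤ (finite_indicators (p := p)).toFinset.card := by
    refine Finset.card_le_card_of_injOn H ?_ ?_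
    · intro k hk
      simp only [Finset.coe_range, mem_Iio] at hk
      simpa using (hC.good k (by omega)).range
    · intro i hi k hk heq
      simp only [Finset.coe_range, mem_Iio] at hi hk
      exact hC.inj i (by omega) k (by omega) heq
  simpa using this

theorem Generic.ne_zero (hn : 0 < n) (hp : 0 < p) (hΓ : γ ∉ excSet X) {z : Fin p → ℝ}
    (hz : Generic X γ z) : z ≠ 0 := by
  rintro rfl
  exact hz.dir_ne 0 (good_zero hn hp hΓ) ⟨0, hp⟩ (by simp [dir])

/-- Over a generic direction there is a chain that ends with a perfect fit. -/
theorem exists_chain (hn : 0 < n) (hp : 0 < p) (hγ : 0 < γ) (hX : Nondegenerate X)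
    (hΓ : γ ∉ excSet X) (hy : Generic X γ (zTilde X y)) :
    ∃ K H τ, Chain X y γ K H τ ∧ gVec (line X γ (H K) (zTilde X y) (τ K)) = 0 := by
  have hz := hy.ne_zero hn hp hΓ
  -- If no chain ended in a perfect fit, chains of every length would exist, although their
  -- indicators are distinct elements of a finite set.
  by_contra hcon
  push Not at hcon
  have hall : ∀ K, ∃ H τ, Chain X y γ K H τ := by
    intro K
    induction K with
    | zero =>
      have hg0 := good_zero hn hp hΓ
      have hpos : 0 < 1 / ⨆ j, |zTilde X y j| := one_div_pos.2 (iSup_abs_pos hz)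
      refine ⟨fun _ => 0, fun _ => 1 / ⨆ j, |zTilde X y j|, rfl, rfl, fun _ _ => hg0,
        fun _ _ => hpos, fun k _ => ?_, fun k hk => by omega, fun k hk => by omega,
        fun k hk => by omega, fun k hk => by omega, fun i hi k hk _ => by omega⟩
      rw [line_zero hγ hg0]
      exact (smul_mem_Box_zero hz hpos.le).2 le_rfl
    | succ K ih =>
      obtain ⟨H, τ, hC⟩ := ih
      exact hC.extend hn hγ hX hΓ hy hz (hcon K H τ hC)
  obtain ⟨H, τ, hC⟩ := hall (finite_indicators (p := p)).toFinset.card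
  exact lt_irrefl _ hC.length_le

end

/-! ### Trails of segments and the paths they define -/

/-- A sequence of adjacent segments with distinct vertices that leads from the trivial solutions to
a perfect fit. -/
structure Trail (X : Matrix (Fin n) (Fin p) ℝ) (y : Fin n → ℝ) (γ : ℝ) (K : ℕ)
    (H : ℕ → Fin p → ℤ) (τ : ℕ → ℝ) : Prop where
  eta_zero : H 0 = 0
  tau_zero : τ 0 = 1 / ⨆ j, |zTilde X y j|
  good : ∀ k ≤ K, Good X γ (H k)
  tau_pos : ∀ k ≤ K, 0 < τ k
  mem : ∀ k ≤ K, line X γ (H k) (zTilde X y) (τ k) ∈ Box (H k)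
  seg : ∀ k < K, ival X γ (H (k + 1)) (zTilde X y) = uIcc (τ k) (τ (k + 1))
  tau_ne : ∀ k < K, τ k ≠ τ (k + 1)
  join : ∀ k < K, line X γ (H (k + 1)) (zTilde X y) (τ k) = line X γ (H k) (zTilde X y) (τ k)
  inj : ∀ i ≤ K, ∀ k ≤ K, line X γ (H i) (zTilde X y) (τ i) = line X γ (H k) (zTilde X y) (τ k) →
    i = k
  not_perfect : ∀ k < K, gVec (line X γ (H k) (zTilde X y) (τ k)) ≠ 0
  perfect : gVec (line X γ (H K) (zTilde X y) (τ K)) = 0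

/-- The path data of a trail. -/
def trailData (X : Matrix (Fin n) (Fin p) ℝ) (y : Fin n → ℝ) (γ : ℝ) (K : ℕ)
    (H : ℕ → Fin p → ℤ) (τ : ℕ → ℝ) : PathData p where
  K := K
  η := H
  τ := τ
  b := fun k => bVec γ (line X γ (H k) (zTilde X y) (τ k))

theorem bVec_of_mem_Box_zero {u : Fin p → ℝ} (hu : u ∈ Box 0) : bVec γ u = 0 := by
  rw [bVec_of_mem hu]; funext j; simp [bAff, bSlope, bConst]

theorem gVec_of_mem_Box_zero {u : Fin p → ℝ} (hu : u ∈ Box 0) : gVec u = u := by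
  rw [gVec_of_mem hu]; funext j; simp [gAff, gSlope, gConst]

theorem bAff_line_combo (z : Fin p → ℝ) {a b s t : ℝ} (hab : a + b = 1) :
    bAff γ η (line X γ η z (a * s + b * t)) =
      a • bAff γ η (line X γ η z s) + b • bAff γ η (line X γ η z t) := by
  funext j
  simp only [bAff, line_apply, Pi.add_apply, Pi.smul_apply, smul_eq_mul]
  linear_combination (-(bSlope γ (η j) * base X γ η j + bConst γ (η j))) * hab

/-- A segment of which a relatively interior point is in another box is contained in that box. -/
theorem line_mem_Box_of_between {η' : Fin p → ℤ} {z : Fin p → ℝ} {s t τ : ℝ}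
    (hs : line X γ η z s ∈ Box η) (ht : line X γ η z t ∈ Box η) (h1 : s < τ) (h2 : τ < t)
    (hτ : line X γ η z τ ∈ Box η) (h : line X γ η z τ ∈ Box η') :
    line X γ η z s ∈ Box η' ∧ line X γ η z t ∈ Box η' := by
  have key : ∀ j, line X γ η z s j ∈ cell (η' j) ∧ line X γ η z t j ∈ cell (η' j) := by
    intro j
    by_cases hj : IsTie (line X γ η z τ j)
    · obtain ⟨σ, hσ⟩ := exists_crossing (hτ j) hj
      by_cases he : η' j = η j
      · rw [he]; exact ⟨hs j, ht j⟩
      · have e1 := hσ.side _ (hs j)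
        have e2 := hσ.side _ (ht j)
        rw [line_sub] at e1 e2
        -- The cell lies on one side of the tie while the two ends lie on both sides of τ, so the
        -- coordinate is constant along the segment.
        have hd : (σ : ℝ) * dir X γ η z j = 0 := by
          have h1' : 0 < τ - s := sub_pos.2 h1
          have h2' : 0 < t - τ := sub_pos.2 h2
          apply le_antisymm <;> nlinarith
        have hd' : dir X γ η z j = 0 := by
          rcases hσ.sign with rfl | rfl <;> simpa using hd
        have : ∀ r, line X γ η z r j = line X γ η z τ j := by
          intro r
          have := line_sub (X := X) (γ := γ) (η := η) z r τ j
          rw [hd', mul_zero] at this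
          linarith
        rw [this s, this t]
        exact ⟨h j, h j⟩
    · rw [not_isTie_imp_eq (hτ j) hj (h j)]
      exact ⟨hs j, ht j⟩
  exact ⟨fun j => (key j).1, fun j => (key j).2⟩

theorem mem_ell_iff_line (hγ : 0 < γ) (hr : ∀ j, |η j| ≤ 2) (hQ : (Q X γ η).det ≠ 0)
    {z : Fin p → ℝ} {q : (Fin p → ℝ) × (Fin p → ℝ)} :
    q ∈ ell X γ η z ↔ ∃ τ : ℝ, 0 < τ ∧ line X γ η z τ ∈ Box η ∧
      q = (τ • z, bVec γ (line X γ η z τ)) := by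
  rw [mem_ell_iff hγ hr]
  constructor
  · rintro ⟨τ, hτ, u, hu, hs, rfl⟩
    obtain rfl := eq_line hγ hQ hu hs
    exact ⟨τ, hτ, hu, rfl⟩
  · rintro ⟨τ, hτ, hu, rfl⟩
    exact ⟨τ, hτ, _, hu, surf_line hγ hQ hu, rfl⟩

/-- A point of a segment, given by its parameter. -/
theorem mem_Box_of_mem_ell (hγ : 0 < γ) (hr : ∀ j, |η j| ≤ 2) {z u : Fin p → ℝ} {τ : ℝ}
    (hs : surf X γ u = τ • z) (h : (τ • z, bVec γ u) ∈ ell X γ η z) : u ∈ Box η := by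
  rw [mem_ell_iff hγ hr] at h
  obtain ⟨t, ht, v, hv, hsv, he⟩ := h
  have h1 : surf X γ u = surf X γ v := by rw [hs, hsv]; exact congrArg Prod.fst he
  rw [surf_injective_pair hγ h1 (congrArg Prod.snd he)]
  exact hv

theorem eq_of_smul_eq {z : Fin p → ℝ} (hz : z ≠ 0) {s t : ℝ} (h : s • z = t • z) : s = t :=
  smul_left_injective ℝ hz h

section
variable {K : ℕ} {H : ℕ → Fin p → ℤ} {τ : ℕ → ℝ}

theorem Trail.surf_eq (hγ : 0 < γ) (hT : Trail X y γ K H τ) {k : ℕ} (hk : k ≤ K) :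
    surf X γ (line X γ (H k) (zTilde X y) (τ k)) = τ k • zTilde X y :=
  surf_line hγ (hT.good k hk).det (hT.mem k hk)

theorem Trail.mem_next (hT : Trail X y γ K H τ) {k : ℕ} (hk : k < K) :
    line X γ (H k) (zTilde X y) (τ k) ∈ Box (H (k + 1)) := by
  rw [← hT.join k hk]
  have : τ k ∈ ival X γ (H (k + 1)) (zTilde X y) := by rw [hT.seg k hk]; exact left_mem_uIcc
  exact this.2

theorem Trail.pos_of_mem (hT : Trail X y γ K H τ) {k : ℕ} (hk : k < K) {t : ℝ}
    (ht : t ∈ uIcc (τ k) (τ (k + 1))) : 0 < t := by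
  have h1 := hT.tau_pos k hk.le
  have h2 := hT.tau_pos (k + 1) hk
  rcases mem_uIcc.1 ht with h | h <;> linarith [h.1]

theorem Trail.line_mem (hT : Trail X y γ K H τ) {k : ℕ} (hk : k < K) {t : ℝ}
    (ht : t ∈ uIcc (τ k) (τ (k + 1))) : line X γ (H (k + 1)) (zTilde X y) t ∈ Box (H (k + 1)) := by
  rw [← hT.seg k hk] at ht
  exact ht.2

theorem Trail.mem_seg (hT : Trail X y γ K H τ) {k : ℕ} (hk : k < K) {t : ℝ} (h0 : 0 ≤ t)
    (ht : line X γ (H (k + 1)) (zTilde X y) t ∈ Box (H (k + 1))) : t ∈ uIcc (τ k) (τ (k + 1)) := by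
  rw [← hT.seg k hk]
  exact ⟨h0, ht⟩

theorem Trail.tau_le_zero (hγ : 0 < γ) (hT : Trail X y γ K H τ) (hz : zTilde X y ≠ 0)
    {t : ℝ} (h0 : 0 ≤ t) :
    line X γ (H 0) (zTilde X y) t ∈ Box (H 0) ↔ t ≤ τ 0 := by
  have hg := hT.good 0 (Nat.zero_le _)
  rw [hT.tau_zero]
  rw [hT.eta_zero] at hg ⊢
  rw [line_zero hγ hg]
  exact smul_mem_Box_zero hz h0

theorem Trail.eq_line_of_mem (hγ : 0 < γ) (hT : Trail X y γ K H τ) {i k : ℕ} (hi : i ≤ K)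
    (hk : k ≤ K) (h : line X γ (H k) (zTilde X y) (τ k) ∈ Box (H i)) :
    line X γ (H k) (zTilde X y) (τ k) = line X γ (H i) (zTilde X y) (τ k) :=
  eq_line hγ (hT.good i hi).det h (hT.surf_eq hγ hk)

/-- Consecutive segments do not turn back. -/
theorem Trail.notMem_prev (hγ : 0 < γ) (hT : Trail X y γ K H τ) (hz : zTilde X y ≠ 0) {k : ℕ}
    (hk : k < K) : line X γ (H (k + 1)) (zTilde X y) (τ (k + 1)) ∉ Box (H k) := by
  intro h
  have hpos := hT.tau_pos (k + 1) hk
  have e := hT.eq_line_of_mem hγ hk.le hk h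
  have hne := hT.tau_ne k hk
  rcases k with _ | k
  · rw [e] at h
    have h2 := (hT.tau_le_zero hγ hz hpos.le).1 h
    have hlt : τ 1 < τ 0 := lt_of_le_of_ne h2 hne.symm
    have hg := hT.good 0 (Nat.zero_le _)
    rw [hT.eta_zero] at hg e h
    rw [line_zero hγ hg] at e h
    have h0 := hT.mem 0 (Nat.zero_le _)
    rw [hT.eta_zero, line_zero hγ hg, mem_Box_zero] at h0
    have hmem := hT.mem 1 hk
    rw [e] at hmem
    -- For a shorter multiple of z̃ all coordinates are strictly inside [-1, 1], so no other box
    -- contains the point. But the interval of the trivial indicator reaches τ = 0, unlike that of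
    -- segment 1.
    have : H 1 = 0 := by
      funext j
      refine not_isTie_imp_eq (h j) ?_ (hmem j)
      have h3 := h0 j
      simp only [Pi.smul_apply, smul_eq_mul, abs_mul,
        abs_of_pos (hT.tau_pos 0 (Nat.zero_le _))] at h3
      have h4 : |(τ 1 • zTilde X y) j| < 1 := by
        simp only [Pi.smul_apply, smul_eq_mul, abs_mul, abs_of_pos hpos]
        rcases (abs_nonneg (zTilde X y j)).eq_or_lt with h5 | h5
        · rw [← h5]; simp
        · exact lt_of_lt_of_le (mul_lt_mul_of_pos_right hlt h5) h3
      rintro (h5 | h5) <;> linarith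
    have h6 := hT.seg 0 hk
    have h7 : (0 : ℝ) ∈ ival X γ (H 1) (zTilde X y) := by
      rw [this, ival_zero hγ hg hz, ← hT.tau_zero]
      exact ⟨le_rfl, (hT.tau_pos 0 (Nat.zero_le _)).le⟩
    rw [h6] at h7
    exact lt_irrefl _ (hT.pos_of_mem hk h7)
  · have hk' : k < K := by omega
    have hm := h
    rw [e] at h
    have h1 := hT.mem_seg hk' hpos.le h
    have n1 : τ (k + 2) ≠ τ k := by
      intro h2
      have := hT.inj _ hk _ hk'.le (e.trans (by
        change line X γ (H (k + 1)) (zTilde X y) (τ (k + 2)) = _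
        rw [h2, hT.join k hk']))
      omega
    have l0 := hT.line_mem hk' left_mem_uIcc
    have l1 := hT.line_mem hk' right_mem_uIcc
    have hB : line X γ (H (k + 1)) (zTilde X y) (τ (k + 2)) ∈ Box (H (k + 2)) := by
      rw [← e]; exact hT.mem _ hk
    -- The later vertex would be strictly inside the previous segment, which then lies entirely in
    -- the next box. Each of the two intervals would contain the far end of the other, which
    -- distinct vertices exclude.
    have h3 : line X γ (H (k + 1)) (zTilde X y) (τ k) ∈ Box (H (k + 2)) := by
      rcases mem_uIcc.1 h1 with ⟨h4, h5⟩ | ⟨h4, h5⟩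
      · exact (line_mem_Box_of_between l0 l1 (lt_of_le_of_ne h4 n1.symm)
          (lt_of_le_of_ne h5 hne.symm) h hB).1
      · exact (line_mem_Box_of_between l1 l0 (lt_of_le_of_ne h4 hne)
          (lt_of_le_of_ne h5 n1) h hB).2
    rw [hT.join k hk'] at h3
    have h6 := hT.eq_line_of_mem hγ hk hk'.le h3
    rw [h6] at h3
    have h7 := hT.mem_seg hk (hT.tau_pos k hk'.le).le h3
    rcases mem_uIcc.1 h1 with ⟨h4, h5⟩ | ⟨h4, h5⟩ <;> rcases mem_uIcc.1 h7 with ⟨h8, h9⟩ | ⟨h8, h9⟩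
    · exact hne (by linarith)
    · exact n1 (by linarith)
    · exact n1 (by linarith)
    · exact hne (by linarith)

theorem segment_eq_image_uIcc (z : Fin p → ℝ) (s t : ℝ) :
    segment ℝ (s • z, bAff γ η (line X γ η z s)) (t • z, bAff γ η (line X γ η z t)) =
      (fun r => (r • z, bAff γ η (line X γ η z r))) '' uIcc s t := by
  rw [← segment_eq_uIcc]
  ext q
  constructor
  · rintro ⟨a, b, ha, hb, hab, rfl⟩
    refine ⟨a * s + b * t, ⟨a, b, ha, hb, hab, rfl⟩, ?_⟩
    simp only [bAff_line_combo z hab]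
    ext <;> simp; ring
  · rintro ⟨r, ⟨a, b, ha, hb, hab, rfl⟩, rfl⟩
    refine ⟨a, b, ha, hb, hab, ?_⟩
    simp only [smul_eq_mul, bAff_line_combo z hab]
    ext <;> simp; ring

theorem Trail.bVec_eq (hT : Trail X y γ K H τ) {k : ℕ} (hk : k < K) {t : ℝ}
    (ht : t ∈ uIcc (τ k) (τ (k + 1))) : bVec γ (line X γ (H (k + 1)) (zTilde X y) t) =
      bAff γ (H (k + 1)) (line X γ (H (k + 1)) (zTilde X y) t) :=
  bVec_of_mem (hT.line_mem hk ht)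

theorem Trail.isPath (hγ : 0 < γ) (hT : Trail X y γ K H τ) (hz : zTilde X y ≠ 0) :
    IsPath X y γ (trailData X y γ K H τ) where
  eta_range k hk j := (hT.good k hk).range j
  eta_zero := hT.eta_zero
  b_zero := by
    have := hT.mem 0 (Nat.zero_le _)
    change bVec γ (line X γ (H 0) (zTilde X y) (τ 0)) = 0
    rw [hT.eta_zero] at this ⊢
    exact bVec_of_mem_Box_zero this
  tau_zero := hT.tau_zero
  tau_pos k hk := hT.tau_pos k hk
  tau_ne k hk := hT.tau_ne k hk
  isSegment k hk := by
    change ell X γ (H (k + 1)) (zTilde X y) = segment ℝ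
      (τ k • zTilde X y, bVec γ (line X γ (H k) (zTilde X y) (τ k)))
      (τ (k + 1) • zTilde X y, bVec γ (line X γ (H (k + 1)) (zTilde X y) (τ (k + 1))))
    rw [← hT.join k hk, hT.bVec_eq hk left_mem_uIcc, hT.bVec_eq hk right_mem_uIcc,
      segment_eq_image_uIcc]
    ext q
    rw [mem_ell_iff_line hγ (hT.good _ hk).range (hT.good _ hk).det]
    constructor
    · rintro ⟨t, ht, hu, rfl⟩
      have := hT.mem_seg hk ht.le hu
      exact ⟨t, this, by rw [hT.bVec_eq hk this]⟩
    · rintro ⟨t, ht, rfl⟩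
      exact ⟨t, hT.pos_of_mem hk ht, hT.line_mem hk ht, by rw [hT.bVec_eq hk ht]⟩
  connected k hk := by
    have hgk := hT.good k (le_of_lt hk)
    have hgk' := hT.good (k + 1) hk
    change ell X γ (H k) (zTilde X y) ∩ ell X γ (H (k + 1)) (zTilde X y) =
      {(τ k • zTilde X y, bVec γ (line X γ (H k) (zTilde X y) (τ k)))}
    ext q
    rw [mem_inter_iff, mem_singleton_iff]
    constructor
    · rintro ⟨h1, h2⟩
      rw [mem_ell_iff_line hγ hgk'.range hgk'.det] at h2
      obtain ⟨t, ht, hu, rfl⟩ := h2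
      have hB := mem_Box_of_mem_ell hγ hgk.range (surf_line hγ hgk'.det hu) h1
      suffices t = τ k by rw [this, hT.join k hk]
      by_contra hne
      have htm := hT.mem_seg hk ht.le hu
      refine hT.notMem_prev hγ hz hk ?_
      by_cases h3 : t = τ (k + 1)
      · rw [← h3]; exact hB
      have l0 := hT.line_mem hk left_mem_uIcc
      have l1 := hT.line_mem hk right_mem_uIcc
      rcases mem_uIcc.1 htm with ⟨h4, h5⟩ | ⟨h4, h5⟩
      · exact (line_mem_Box_of_between l0 l1 (lt_of_le_of_ne h4 (Ne.symm hne))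
          (lt_of_le_of_ne h5 h3) hu hB).2
      · exact (line_mem_Box_of_between l1 l0 (lt_of_le_of_ne h4 (Ne.symm h3))
          (lt_of_le_of_ne h5 hne) hu hB).1
    · rintro rfl
      constructor
      · rw [mem_ell_iff_line hγ hgk.range hgk.det]
        exact ⟨τ k, hT.tau_pos k (le_of_lt hk), hT.mem k (le_of_lt hk), rfl⟩
      · rw [mem_ell_iff hγ hgk'.range]
        exact ⟨τ k, hT.tau_pos k (le_of_lt hk), _, hT.mem_next hk, hT.surf_eq hγ (le_of_lt hk), rfl⟩
  isNew k hk i hik heq := by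
    change ell X γ (H i) (zTilde X y) = ell X γ (H k) (zTilde X y) at heq
    have hkK : k ≤ K := hk
    have hgi := hT.good i (by omega)
    have hgk := hT.good k hkK
    have hbox : ∀ l ≤ K, line X γ (H l) (zTilde X y) (τ l) ∈ Box (H k) →
        line X γ (H l) (zTilde X y) (τ l) ∈ Box (H i) := by
      intro l hl h
      refine mem_Box_of_mem_ell hγ hgi.range (hT.surf_eq hγ hl) ?_
      rw [heq, mem_ell_iff hγ hgk.range]
      exact ⟨τ l, hT.tau_pos l hl, _, h, hT.surf_eq hγ hl, rfl⟩
    obtain ⟨k, rfl⟩ : ∃ m, k = m + 1 := ⟨k - 1, by omega⟩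
    rcases i with _ | i
    -- The initial segment contains points with arbitrarily small τ; the later ones are bounded
    -- below by their ends.
    · set t := min (τ 0) (min (τ k) (τ (k + 1))) / 2 with ht
      have p0 := hT.tau_pos 0 (Nat.zero_le _)
      have p1 := hT.tau_pos k (by omega)
      have p2 := hT.tau_pos (k + 1) hkK
      have hmin : 0 < min (τ 0) (min (τ k) (τ (k + 1))) := lt_min p0 (lt_min p1 p2)
      have m1 : min (τ 0) (min (τ k) (τ (k + 1))) ≤ τ 0 := min_le_left _ _
      have m2 : min (τ 0) (min (τ k) (τ (k + 1))) ≤ τ k :=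
        (min_le_right _ _).trans (min_le_left _ _)
      have m3 : min (τ 0) (min (τ k) (τ (k + 1))) ≤ τ (k + 1) :=
        (min_le_right _ _).trans (min_le_right _ _)
      have htp : 0 < t := by positivity
      have hm : line X γ (H 0) (zTilde X y) t ∈ Box (H 0) :=
        (hT.tau_le_zero hγ hz htp.le).2 (by rw [ht]; linarith)
      have hs := surf_line hγ hgi.det hm
      have hB := mem_Box_of_mem_ell hγ hgk.range hs (by
        rw [← heq, mem_ell_iff_line hγ hgi.range hgi.det]
        exact ⟨t, htp, hm, rfl⟩)
      rw [eq_line hγ hgk.det hB hs] at hB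
      rcases mem_uIcc.1 (hT.mem_seg hkK htp.le hB) with h | h <;> linarith [h.1]
    · have a1 := hbox (k + 1) hkK (hT.mem _ hkK)
      have a2 := hbox k (by omega) (hT.mem_next (by omega))
      have e1 := hT.eq_line_of_mem hγ (i := i + 1) (by omega) hkK a1
      have e2 := hT.eq_line_of_mem hγ (i := i + 1) (k := k) (by omega) (by omega) a2
      have hiK : i < K := by omega
      have b1 : line X γ (H (i + 1)) (zTilde X y) (τ (i + 1)) ∈ Box (H (k + 1)) := by
        refine mem_Box_of_mem_ell hγ hgk.range (hT.surf_eq hγ (by omega)) ?_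
        rw [← heq, mem_ell_iff hγ hgi.range]
        exact ⟨_, hT.tau_pos _ (by omega), _, hT.mem _ (by omega), hT.surf_eq hγ (by omega), rfl⟩
      have b2 : line X γ (H i) (zTilde X y) (τ i) ∈ Box (H (k + 1)) := by
        refine mem_Box_of_mem_ell hγ hgk.range (hT.surf_eq hγ (by omega)) ?_
        rw [← heq, mem_ell_iff hγ hgi.range]
        exact ⟨_, hT.tau_pos _ (by omega), _, hT.mem_next hiK, hT.surf_eq hγ (by omega), rfl⟩
      rw [hT.eq_line_of_mem hγ hkK (by omega) b1] at b1
      rw [hT.eq_line_of_mem hγ hkK (by omega) b2] at b2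
      rw [e1] at a1
      rw [e2] at a2
      have c1 := hT.mem_seg hiK (hT.tau_pos _ hkK).le a1
      have c2 := hT.mem_seg hiK (hT.tau_pos _ (by omega)).le a2
      have d1 := hT.mem_seg hkK (hT.tau_pos _ (by omega)).le b1
      have d2 := hT.mem_seg hkK (hT.tau_pos _ (by omega)).le b2
      -- The two intervals contain each other's ends, hence coincide. Yet τ (k + 1), an end of one,
      -- differs from both ends of the other because vertices are never repeated.
      have n1 : τ (k + 1) ≠ τ (i + 1) := by
        intro h
        rw [h] at e1
        rw [← h] at e1
        have := hT.inj (k + 1) hkK (i + 1) (by omega) (by rw [e1, h]); omega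
      have n2 : τ (k + 1) ≠ τ i := by
        intro h
        have := hT.inj (k + 1) hkK i (by omega) (by rw [e1, h]; exact hT.join i hiK); omega
      rw [mem_uIcc] at c1 c2 d1 d2
      rcases lt_or_gt_of_ne n1 with h1 | h1 <;> rcases lt_or_gt_of_ne n2 with h2 | h2
      · rcases c1 with h | h <;> linarith [h.1]
      · rcases d1 with h | h <;> rcases d2 with h' | h' <;> linarith [h.1, h'.1, h.2, h'.2]
      · rcases d1 with h | h <;> rcases d2 with h' | h' <;> linarith [h.1, h'.1, h.2, h'.2]
      · rcases c1 with h | h <;> linarith [h.2]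

theorem Trail.length_pos (hγ : 0 < γ) (hT : Trail X y γ K H τ) (hz : zTilde X y ≠ 0) : 0 < K := by
  by_contra h
  obtain rfl : K = 0 := by omega
  have h1 := hT.perfect
  have h2 := hT.mem 0 le_rfl
  have hg := hT.good 0 le_rfl
  rw [hT.eta_zero] at h1 h2 hg
  rw [gVec_of_mem_Box_zero h2, line_zero hγ hg] at h1
  exact (smul_ne_zero (hT.tau_pos 0 le_rfl).ne' hz) h1

theorem Trail.endsInPerfectFit (hn : 0 < n) (hγ : 0 < γ) (hT : Trail X y γ K H τ) :
    EndsInPerfectFit X y (trailData X y γ K H τ) :=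
  ⟨(perfectFit_iff_gVec hn (hT.tau_pos K le_rfl) (hT.surf_eq hγ le_rfl)).2 hT.perfect,
    fun k hk h => hT.not_perfect k hk
      ((perfectFit_iff_gVec hn (hT.tau_pos k (le_of_lt hk)) (hT.surf_eq hγ (le_of_lt hk))).1 h)⟩

/-! ### The curve of a trail is a solution path. -/

theorem interp_eq (D : PathData p) {k : ℕ} {x : ℝ} (h1 : (k : ℝ) ≤ x) (h2 : x ≤ k + 1) :
    D.interp x = (1 - (x - k)) • (D.τ k, D.b k) + (x - k) • (D.τ (k + 1), D.b (k + 1)) := by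
  rcases h1.eq_or_lt with rfl | h1
  · simp [PathData.interp]
  · have : ⌈x⌉₊ = k + 1 := by
      rw [Nat.ceil_eq_iff (by omega)]
      simp only [Nat.add_sub_cancel]
      exact ⟨h1, by exact_mod_cast h2⟩
    rw [PathData.interp, this]
    push_cast
    congr 1
    · congr 1; ring
    · congr 1; ring

theorem continuousOn_interp (D : PathData p) (m : ℕ) : ContinuousOn D.interp (Icc 0 (m : ℝ)) := by
  induction m with
  | zero => simp
  | succ m ih =>
    have h : Icc (0 : ℝ) ((m + 1 : ℕ) : ℝ) = Icc 0 (m : ℝ) ∪ Icc (m : ℝ) (m + 1) := by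
      rw [Icc_union_Icc_eq_Icc (by positivity) (by linarith)]; push_cast; rfl
    rw [h]
    refine ih.union_of_isClosed ?_ isClosed_Icc isClosed_Icc
    have hc : ContinuousOn (fun x : ℝ => (1 - (x - m)) • (D.τ m, D.b m) +
        (x - m) • (D.τ (m + 1), D.b (m + 1))) (Icc (m : ℝ) (m + 1)) := by fun_prop
    exact hc.congr fun x hx => interp_eq D hx.1 hx.2

theorem exists_nat_between {x : ℝ} {K : ℕ} (hK : 0 < K) (h0 : 0 ≤ x) (h1 : x ≤ K) :
    ∃ k < K, (k : ℝ) ≤ x ∧ x ≤ k + 1 := by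
  rcases h1.eq_or_lt with rfl | h1
  · refine ⟨K - 1, by omega, ?_, ?_⟩
    · exact_mod_cast Nat.sub_le _ _
    · rw [Nat.cast_sub hK]; simp
  · refine ⟨⌊x⌋₊, (Nat.floor_lt h0).2 h1, Nat.floor_le h0, (Nat.lt_floor_add_one x).le⟩

theorem combo_mem_uIcc {s t r : ℝ} (h0 : 0 ≤ r) (h1 : r ≤ 1) :
    (1 - r) * s + r * t ∈ uIcc s t := by
  rw [← segment_eq_uIcc]
  exact ⟨1 - r, r, by linarith, h0, by ring, rfl⟩

/-- The interpolated path, in terms of the lines of the segments. -/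
theorem Trail.interp_eq (hT : Trail X y γ K H τ) {k : ℕ} (hk : k < K) {x : ℝ}
    (h1 : (k : ℝ) ≤ x) (h2 : x ≤ k + 1) :
    (trailData X y γ K H τ).interp x =
      ((1 - (x - k)) * τ k + (x - k) * τ (k + 1), bVec γ (line X γ (H (k + 1)) (zTilde X y)
        ((1 - (x - k)) * τ k + (x - k) * τ (k + 1)))) := by
  rw [MCPlus.interp_eq _ h1 h2, hT.bVec_eq hk (combo_mem_uIcc (by linarith) (by linarith)),
    bAff_line_combo _ (by ring), ← hT.bVec_eq hk left_mem_uIcc, ← hT.bVec_eq hk right_mem_uIcc,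
    hT.join k hk]
  rfl

/-- The parameter of the perfect fit at a larger `τ`. -/
theorem exists_scale {u : Fin p → ℝ} (hu : gVec u = 0) {c : ℝ} (hc : 1 ≤ c) :
    ∃ v, gVec v = 0 ∧ bVec γ v = c • bVec γ u := by
  have : ∀ j, ∃ v, gFun v = 0 ∧ bFun γ v = c * bFun γ (u j) := by
    intro j
    have h0 : gFun (u j) = 0 := congrFun hu j
    obtain ⟨i, hi⟩ := exists_mem_cell (u j)
    have s2 : Int.sign 2 = 1 := rfl
    have s3 : Int.sign (-2) = -1 := rfl
    -- On an extreme cell b = γ(u - sgn i), so b is multiplied by c when u is dilated about sgn i;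
    -- since c ≥ 1 the cell is not left.
    have big : ∀ i : ℤ, |i| = 2 → u j ∈ cell i →
        ∃ v, gFun v = 0 ∧ bFun γ v = c * bFun γ (u j) := by
      intro i hi2 hi
      have hv : ((i.sign : ℤ) : ℝ) + c * (u j - (i.sign : ℤ)) ∈ cell i := by
        rcases (abs_eq (by norm_num)).1 hi2 with rfl | rfl <;> norm_num [mem_cell_iff, s2, s3] at hi ⊢
        · nlinarith
        · nlinarith
      refine ⟨((i.sign : ℤ) : ℝ) + c * (u j - (i.sign : ℤ)), ?_, ?_⟩
      · rw [gFun_of_mem hv, gSlope, gConst, hi2]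
        rw [if_neg (by rintro rfl; simp at hi2)]; simp
      · rw [bFun_of_mem hv, bFun_of_mem hi, bSlope, if_neg (by rintro rfl; simp at hi2), bConst]
        ring
    rcases mem_cell_iff.1 hi with ⟨rfl, h⟩ | ⟨rfl, h⟩ | ⟨rfl, h⟩ | ⟨rfl, h⟩ | ⟨rfl, h⟩
    · refine ⟨0, by simp [gFun, clip], ?_⟩
      rw [bFun_of_mem hi]; simp [bSlope, bConst, bFun, clip]
    -- On a penalized cell the gradient vanishes only at the knot, which also belongs to the
    -- adjacent extreme cell.
    · refine big 2 rfl ?_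
      rw [eq_two_of_gFun_eq_zero hi rfl (by rw [← gFun_of_mem hi]; exact h0)]
      norm_num [mem_cell_iff]
    · exact big 2 rfl hi
    · refine big (-2) rfl ?_
      rw [eq_two_of_gFun_eq_zero hi rfl (by rw [← gFun_of_mem hi]; exact h0)]
      norm_num [mem_cell_iff]
    · exact big (-2) rfl hi
  choose v h1 h2 using this
  exact ⟨v, funext h1, funext h2⟩

theorem Trail.curve_of_le (hT : Trail X y γ K H τ) {k : ℕ} (hk : k < K) {x : ℝ}
    (h1 : (k : ℝ) ≤ x) (h2 : x ≤ k + 1) :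
    ∃ t ∈ uIcc (τ k) (τ (k + 1)), t = (1 - (x - k)) * τ k + (x - k) * τ (k + 1) ∧
      (trailData X y γ K H τ).curve x =
      (1 / t, (1 / t) • bVec γ (line X γ (H (k + 1)) (zTilde X y) t)) := by
  refine ⟨_, combo_mem_uIcc (s := τ k) (t := τ (k + 1)) (r := x - k) (by linarith) (by linarith),
    rfl, ?_⟩
  have hxK : x ≤ ((trailData X y γ K H τ).K : ℝ) := by
    have : ((k + 1 : ℕ) : ℝ) ≤ K := by exact_mod_cast hk
    push_cast at this
    exact h2.trans this
  rw [PathData.curve, if_pos hxK, hT.interp_eq hk h1 h2]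

theorem trail_curve_of_ge (hK : 0 < K) {x : ℝ} (h : (K : ℝ) ≤ x) :
    (trailData X y γ K H τ).curve x = ((K / x) * (1 / τ K),
      (1 / τ K) • bVec γ (line X γ (H K) (zTilde X y) (τ K))) := by
  have hK' : (0 : ℝ) < K := by exact_mod_cast hK
  rcases h.eq_or_lt with rfl | h
  · have : (trailData X y γ K H τ).interp (K : ℝ) =
        (τ K, bVec γ (line X γ (H K) (zTilde X y) (τ K))) := by
      rw [MCPlus.interp_eq _ le_rfl (by linarith)]
      simp [trailData]
    rw [PathData.curve, if_pos (show (K : ℝ) ≤ ((trailData X y γ K H τ).K : ℝ) from le_rfl), this, div_self hK'.ne', one_mul]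
  · rw [PathData.curve, if_neg (show ¬ x ≤ ((trailData X y γ K H τ).K : ℝ) from not_le.2 h)]
    rfl

theorem Trail.isSolutionPath (hγ : 0 < γ) (hT : Trail X y γ K H τ) (hz : zTilde X y ≠ 0) :
    IsSolutionPath X y γ (trailData X y γ K H τ).curve := by
  have hK := hT.length_pos hγ hz
  have hK' : (0 : ℝ) < K := by exact_mod_cast hK
  have hτK := hT.tau_pos K le_rfl
  refine ⟨?_, ?_, ?_, ?_, ?_⟩
  · have hun : Ici (0 : ℝ) = Icc 0 (K : ℝ) ∪ Ici (K : ℝ) := (Icc_union_Ici_eq_Ici hK'.le).symm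
    rw [hun]
    refine ContinuousOn.union_of_isClosed ?_ ?_ isClosed_Icc isClosed_Ici
    · have hc := continuousOn_interp (trailData X y γ K H τ) K
      have hpos : ∀ x ∈ Icc 0 (K : ℝ), ((trailData X y γ K H τ).interp x).1 ≠ 0 := by
        intro x hx
        obtain ⟨k, hk, h1, h2⟩ := exists_nat_between hK hx.1 hx.2
        rw [hT.interp_eq hk h1 h2]
        exact (hT.pos_of_mem hk (combo_mem_uIcc (by linarith) (by linarith))).ne'
      have h1 : ContinuousOn (fun x => 1 / ((trailData X y γ K H τ).interp x).1) (Icc 0 (K : ℝ)) :=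
        continuousOn_const.div (continuous_fst.comp_continuousOn hc) hpos
      refine (h1.prodMk (h1.smul (continuous_snd.comp_continuousOn hc))).congr ?_
      intro x hx
      rw [PathData.curve, if_pos (show x ≤ ((trailData X y γ K H τ).K : ℝ) from hx.2)]
      rfl
    · have h1 : ContinuousOn (fun x : ℝ => ((K / x) * (1 / τ K),
        (1 / τ K) • bVec γ (line X γ (H K) (zTilde X y) (τ K)))) (Ici (K : ℝ)) := by
        refine ContinuousOn.prodMk ?_ continuousOn_const
        refine ContinuousOn.mul (continuousOn_const.div continuousOn_id ?_) continuousOn_const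
        intro x hx
        exact (lt_of_lt_of_le hK' hx).ne'
      exact h1.congr fun x hx => trail_curve_of_ge hK hx
  · intro x hx
    rcases le_total x K with h | h
    · obtain ⟨k, hk, h1, h2⟩ := exists_nat_between hK hx h
      obtain ⟨t, ht, -, he⟩ := hT.curve_of_le hk h1 h2
      rw [he]
      exact one_div_pos.2 (hT.pos_of_mem hk ht)
    · rw [trail_curve_of_ge hK h]
      have : 0 < x := lt_of_lt_of_le hK' h
      positivity
  · intro x hx
    rcases le_total x K with h | h
    · obtain ⟨k, hk, h1, h2⟩ := exists_nat_between hK hx h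
      obtain ⟨t, ht, -, he⟩ := hT.curve_of_le hk h1 h2
      have htp := hT.pos_of_mem hk ht
      rw [he, isCritical_iff hγ (one_div_pos.2 htp)]
      exact ⟨_, by rw [one_div_one_div, surf_line hγ (hT.good _ hk).det (hT.line_mem hk ht)], rfl⟩
    · rw [trail_curve_of_ge hK h]
      have hx0 : 0 < x := lt_of_lt_of_le hK' h
      have hl : 0 < (K / x) * (1 / τ K) := by positivity
      rw [isCritical_iff hγ hl]
      -- With β frozen and λ multiplied by K/x, the normalized coefficients b = β/λ grow by the
      -- factor x/K ≥ 1.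
      obtain ⟨v, hv1, hv2⟩ := exists_scale (γ := γ) hT.perfect (c := x / K) (by
        rw [le_div_iff₀ hK']; linarith)
      have hs := hT.surf_eq hγ le_rfl
      rw [surf, hT.perfect, zero_add] at hs
      refine ⟨v, ?_, ?_⟩
      · rw [surf, hv1, zero_add, hv2, Matrix.mulVec_smul, hs, smul_smul]
        congr 1
        field_simp
      · rw [hv2, smul_smul]
        field_simp
  · obtain ⟨t, ht, h1, he⟩ := hT.curve_of_le hK (x := 0) (by simp) (by simp)
    have : t = τ 0 := by rw [h1]; simp
    rw [he, this, hT.join 0 hK]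
    have h0 := hT.mem 0 (Nat.zero_le _)
    simp only [hT.eta_zero] at h0 ⊢
    rw [bVec_of_mem_Box_zero h0, smul_zero]
  · have h1 : Tendsto (fun x : ℝ => ((K : ℝ) / x) * (1 / τ K)) atTop (𝓝 0) := by
      have := (tendsto_const_nhds (x := (K : ℝ))).div_atTop tendsto_id
      simpa using this.mul_const (1 / τ K)
    refine h1.congr' ?_
    filter_upwards [eventually_ge_atTop (K : ℝ)] with x hx
    rw [trail_curve_of_ge hK hx]

/-- Vertices are distinct because vertex i lies only in the boxes i and i + 1, while an intermediate
vertex k lies in the boxes k and k + 1. The last vertex differs from the others as the only perfect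
fit. -/
theorem Chain.trail (hγ : 0 < γ) (hC : Chain X y γ K H τ)
    (hg : gVec (line X γ (H K) (zTilde X y) (τ K)) = 0) : Trail X y γ K H τ where
  eta_zero := hC.eta_zero
  tau_zero := hC.tau_zero
  good := hC.good
  tau_pos := hC.tau_pos
  mem := hC.mem
  seg := hC.seg
  tau_ne := hC.tau_ne
  join k hk := hC.line_next hγ hk
  not_perfect := hC.not_perfect
  perfect := hg
  inj := by
    have key : ∀ i k, i < k → k ≤ K →
        line X γ (H i) (zTilde X y) (τ i) ≠ line X γ (H k) (zTilde X y) (τ k) := by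
      intro i k hik hk heq
      rcases hk.eq_or_lt with rfl | hk'
      · rw [← heq] at hg
        exact hC.not_perfect i hik hg
      · have h1 := hC.mem k hk
        have h2 := hC.mem_next hk'
        rw [← heq] at h1 h2
        rcases hC.box_cases (by omega) h1 with h3 | h3
        · have := hC.inj _ hk _ (by omega) h3; omega
        · have := hC.inj _ hk _ (by omega) h3
          rcases hC.box_cases (by omega) h2 with h4 | h4
          · have := hC.inj _ hk' _ (by omega) h4; omega
          · have := hC.inj _ hk' _ (by omega) h4; omega
    intro i hi k hk heq
    rcases lt_trichotomy i k with h | h | h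
    · exact absurd heq (key i k h hk)
    · exact h
    · exact absurd heq.symm (key k i h hi)

end

/-! ### The steps of the algorithm along a chain -/

/-- On a penalized cell b = 0 and |g| = 1 describe the same end. On the cell of the indicator 0
always b = 0, which is why a hit through b requires a nonzero indicator. -/
theorem hit_iff_isTie (hγ : 0 < γ) {i : ℤ} {u : ℝ} (hu : u ∈ cell i) :
    (((|bFun γ u| = 0 ∨ |bFun γ u| = γ) ∧ i ≠ 0) ∨ |gFun u| = 1) ↔ IsTie u := by
  rw [gFun_of_mem hu, bFun_of_mem hu, IsTie]
  have s2 : Int.sign 2 = 1 := rfl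
  have s3 : Int.sign (-2) = -1 := rfl
  rcases mem_cell_iff.1 hu with ⟨rfl, h⟩ | ⟨rfl, h⟩ | ⟨rfl, h⟩ | ⟨rfl, h⟩ | ⟨rfl, h⟩ <;>
    simp only [gSlope, gConst, bSlope, bConst, s2, s3] <;> norm_num [-abs_eq_zero]
  · intro h'
    have : |u| ≤ 1 := abs_le.2 h
    linarith
  · rw [abs_of_nonneg (show 0 ≤ γ * u + -γ by nlinarith), abs_of_nonneg (show 0 ≤ -u + 2 by linarith),
      abs_of_nonneg (show 0 ≤ u by linarith)]
    constructor
    · rintro ((h' | h') | h')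
      · left
        have : γ * (u - 1) = 0 := by linarith
        have := (mul_eq_zero.1 this).resolve_left hγ.ne'
        linarith
      · right
        have : γ * (u - 2) = 0 := by linarith
        have := (mul_eq_zero.1 this).resolve_left hγ.ne'
        linarith
      · left; linarith
    · rintro (h' | h')
      · right; linarith
      · left; right; rw [h']; ring
  · rw [abs_of_nonneg (show 0 ≤ γ * u + -γ by nlinarith), abs_of_nonneg (show 0 ≤ u by linarith)]
    constructor
    · rintro (h' | h')
      · have : γ * (u - 1) = 0 := by linarith
        have := (mul_eq_zero.1 this).resolve_left hγ.ne'
        linarith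
      · right
        have : γ * (u - 2) = 0 := by linarith
        have := (mul_eq_zero.1 this).resolve_left hγ.ne'
        linarith
    · rintro (h' | h')
      · linarith
      · right; rw [h']; ring
  · rw [abs_of_nonpos (show γ * u + γ ≤ 0 by nlinarith), abs_of_nonpos (show -u + -2 ≤ 0 by linarith),
      abs_of_nonpos (show u ≤ 0 by linarith)]
    constructor
    · rintro ((h' | h') | h')
      · left
        have : γ * (u + 1) = 0 := by linarith
        have := (mul_eq_zero.1 this).resolve_left hγ.ne'
        linarith
      · right
        have : γ * (u + 2) = 0 := by linarith
        have := (mul_eq_zero.1 this).resolve_left hγ.ne'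
        linarith
      · left; linarith
    · rintro (h' | h')
      · right; linarith
      · left; right
        have : u = -2 := by linarith
        rw [this]; ring
  · rw [abs_of_nonpos (show γ * u + γ ≤ 0 by nlinarith), abs_of_nonpos (show u ≤ 0 by linarith)]
    constructor
    · rintro (h' | h')
      · have : γ * (u + 1) = 0 := by linarith
        have := (mul_eq_zero.1 this).resolve_left hγ.ne'
        linarith
      · right
        have : γ * (u + 2) = 0 := by linarith
        have := (mul_eq_zero.1 this).resolve_left hγ.ne'
        linarith
    · rintro (h' | h')
      · linarith
      · right
        have : u = -2 := by linarith
        rw [this]; ring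

/-- The slope of the coefficients along the line of `η`. -/
def slopeVec (X : Matrix (Fin n) (Fin p) ℝ) (γ : ℝ) (η : Fin p → ℤ) (z : Fin p → ℝ) : Fin p → ℝ :=
  fun j => bSlope γ (η j) * dir X γ η z j

theorem dir_add_slope (hγ : 0 < γ) (hQ : (Q X γ η).det ≠ 0) (z : Fin p → ℝ) (j : Fin p) :
    gSlope (η j) * dir X γ η z j + (gram X).mulVec (slopeVec X γ η z) j = z j := by
  have := congrFun (surfMatrix_dir hγ hQ z) j
  rw [surfMatrix_mulVec] at this
  exact this

theorem dir_of_eq_zero (hγ : 0 < γ) (hQ : (Q X γ η).det ≠ 0) (z : Fin p → ℝ) {j : Fin p}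
    (hj : η j = 0) : dir X γ η z j = z j - (gram X).mulVec (slopeVec X γ η z) j := by
  have := dir_add_slope hγ hQ z j
  rw [hj] at this
  simp [gSlope] at this
  linarith

/-- Differentiating g + Σb = τz̃ in τ along the line gives, on A(η), the slope equations for db/dτ.
They have no other solution because Q(η) is nonsingular. -/
theorem isSlope_iff (hγ : 0 < γ) (hQ : (Q X γ η).det ≠ 0) (s' : Fin p → ℝ) :
    IsSlope X y γ η s' ↔ s' = slopeVec X γ η (zTilde X y) := by
  have hs0 : ∀ j, η j = 0 → slopeVec X γ η (zTilde X y) j = 0 := by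
    intro j hj; simp [slopeVec, bSlope, hj]
  have hs : IsSlope X y γ η (slopeVec X γ η (zTilde X y)) := by
    refine ⟨?_, hs0⟩
    funext i
    rw [Q_mulVec hs0 i]
    have := dir_add_slope hγ hQ (zTilde X y) i.1
    rw [gSlope_eq hγ i.2] at this
    have h2 : slopeVec X γ η (zTilde X y) i.1 = γ * dir X γ η (zTilde X y) i.1 := by
      simp [slopeVec, bSlope, i.2]
    rw [h2]
    linarith
  constructor
  · rintro ⟨h1, h2⟩
    funext j
    by_cases hj : η j = 0
    · rw [h2 j hj, hs0 j hj]
    · have := Matrix.mulVec_injective_iff_isUnit.2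
        ((Matrix.isUnit_iff_isUnit_det _).2 hQ.isUnit) (h1.trans hs.1.symm)
      exact congrFun this ⟨j, hj⟩
  · rintro rfl; exact hs

theorem bAff_line_sub (z : Fin p → ℝ) (s t : ℝ) :
    bAff γ η (line X γ η z t) - bAff γ η (line X γ η z s) = (t - s) • slopeVec X γ η z := by
  funext j
  simp only [bAff, slopeVec, line_apply, Pi.sub_apply, Pi.smul_apply, smul_eq_mul]
  ring

section
variable {K : ℕ} {H : ℕ → Fin p → ℤ} {τ : ℕ → ℝ}

theorem Trail.gAt_eq (hγ : 0 < γ) (hT : Trail X y γ K H τ) {k : ℕ} (hk : k ≤ K) (j : Fin p) :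
    gAt X y (trailData X y γ K H τ) k j = gFun (line X γ (H k) (zTilde X y) (τ k) j) := by
  have := congrFun (hT.surf_eq hγ hk) j
  rw [surf, Pi.add_apply] at this
  change τ k * zTilde X y j - (gram X).mulVec (bVec γ _) j = gVec _ j
  rw [eq_sub_of_add_eq this]
  rfl

theorem Trail.mem_hitSet (hγ : 0 < γ) (hT : Trail X y γ K H τ) {k : ℕ} (hk : k ≤ K) (j : Fin p) :
    j ∈ hitSet X y γ (trailData X y γ K H τ) k ↔ IsTie (line X γ (H k) (zTilde X y) (τ k) j) := by
  rw [← hit_iff_isTie hγ (hT.mem k hk j), hitSet, mem_ofPred_eq, hT.gAt_eq hγ hk]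
  rfl

/-- The length of the segment up to the boundary in coordinate `l`. -/
theorem Trail.deltaOf_cases (hγ : 0 < γ) (hT : Trail X y γ K H τ)
    {k : ℕ} (hk : k < K) {ξ : ℝ} (hξ : ξ * ξ = 1) {l : Fin p}
    (hd : dir X γ (H (k + 1)) (zTilde X y) l ≠ 0) :
    (deltaOf X y γ (trailData X y γ K H τ) k (H (k + 1)) (slopeVec X γ (H (k + 1)) (zTilde X y)) ξ l
      = ⊤ ∧ ∀ v ∈ cell (H (k + 1) l), ∀ r, 0 ≤ r →
        v + r * (ξ * dir X γ (H (k + 1)) (zTilde X y) l) ∈ cell (H (k + 1) l)) ∨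
    ∃ c, IsTie c ∧ c ∈ cell (H (k + 1) l) ∧ (∀ v ∈ cell (H (k + 1) l),
      0 ≤ (c - v) * (ξ * dir X γ (H (k + 1)) (zTilde X y) l)) ∧
      deltaOf X y γ (trailData X y γ K H τ) k (H (k + 1))
        (slopeVec X γ (H (k + 1)) (zTilde X y)) ξ l =
        (((c - line X γ (H k) (zTilde X y) (τ k) l) /
          (ξ * dir X γ (H (k + 1)) (zTilde X y) l) : ℝ) : EReal) := by
  have hη := hT.good (k + 1) hk
  have kn1 : γ * ((2 : ℝ) - 1) = γ := by ring
  have kn2 : γ * (-(2 : ℝ) + 1) = -γ := by ring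
  set d := dir X γ (H (k + 1)) (zTilde X y) l with hdd
  have hξ0 : ξ ≠ 0 := by rintro rfl; simp at hξ
  set u := line X γ (H k) (zTilde X y) (τ k) l with hu
  have huc : u ∈ cell (H (k + 1) l) := hT.mem_next hk l
  have hgk : gAt X y (trailData X y γ K H τ) k l = gFun u := hT.gAt_eq hγ hk.le l
  have hb : (trailData X y γ K H τ).b k l = bFun γ u := rfl
  have he0 : ξ * d ≠ 0 := mul_ne_zero hξ0 hd
  have hsgn : 0 < ξ * d ∨ ξ * d < 0 := he0.symm.lt_or_gt
  -- Since ξ² = 1, the quotients in `deltaOf` are travel times at the velocity ξd of the parameter.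
  have hdiv : ∀ a, ξ * a / d = a / (ξ * d) := by
    intro a; field_simp; linear_combination a * hξ
  unfold deltaOf
  rw [hb, hgk]
  by_cases h0 : H (k + 1) l = 0
  · right
    have hg : gFun u = u := by rw [gFun_of_mem huc, h0]; simp [gSlope, gConst]
    rw [if_neg (by simpa using h0), ← dir_of_eq_zero hγ hη.det _ h0, ← hdd, hg, h0]
    rcases hsgn with hpos | hneg
    · rw [if_pos hpos]
      refine ⟨1, Or.inl (by simp), by norm_num [mem_cell_iff], ?_, ?_⟩
      · intro v hv
        norm_num [mem_cell_iff] at hv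
        exact mul_nonneg (by linarith) hpos.le
      · rw [hdiv]
    · rw [if_neg (not_lt.2 hneg.le), if_pos hneg]
      refine ⟨-1, Or.inl (by simp), by norm_num [mem_cell_iff], ?_, ?_⟩
      · intro v hv
        norm_num [mem_cell_iff] at hv
        exact mul_nonneg_of_nonpos_of_nonpos (by linarith) hneg.le
      · rw [hdiv]
  · have hs : slopeVec X γ (H (k + 1)) (zTilde X y) l = γ * d := by simp [slopeVec, bSlope, h0, hdd]
    have hξs : ξ * (γ * d) = γ * (ξ * d) := by ring
    have hbu : bFun γ u = γ * (u - ((H (k + 1) l).sign : ℤ)) := by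
      rw [bFun_of_mem huc, bSlope, if_neg h0, bConst]; ring
    have hmul : ∀ a, ξ / (γ * d) * (γ * a) = a / (ξ * d) := by
      intro a; rw [← hdiv]; field_simp
    rw [if_pos h0, hs, hξs]
    have fin : ∀ (c b' : ℝ), γ * (c - ((H (k + 1) l).sign : ℤ)) = b' →
        ((ξ / (γ * d) : ℝ) : EReal) * ((b' : EReal) - (bFun γ u : EReal)) =
          (((c - u) / (ξ * d) : ℝ) : EReal) := by
      intro c b' hb'
      rw [← EReal.coe_sub, ← EReal.coe_mul, hbu, ← hb', ← mul_sub, hmul]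
      congr 2; ring
    have s2 : Int.sign 2 = 1 := rfl
    have s3 : Int.sign (-2) = -1 := rfl
    rcases hsgn with hpos | hneg
    · rw [if_pos (mul_pos hγ hpos)]
      have up : ∀ c : ℝ, IsTie c → c ∈ cell (H (k + 1) l) → (∀ v ∈ cell (H (k + 1) l), v ≤ c) →
          knot γ (H (k + 1) l + 1) = ((γ * (c - ((H (k + 1) l).sign : ℤ)) : ℝ) : EReal) →
          ∃ c, IsTie c ∧ c ∈ cell (H (k + 1) l) ∧ (∀ v ∈ cell (H (k + 1) l), 0 ≤ (c - v) * (ξ * d)) ∧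
          ((ξ / (γ * d) : ℝ) : EReal) * (knot γ (H (k + 1) l + 1) - (bFun γ u : EReal)) =
          (((c - u) / (ξ * d) : ℝ) : EReal) := by
        intro c h1 h2 h3 h4
        refine ⟨c, h1, h2, fun v hv => mul_nonneg (sub_nonneg.2 (h3 v hv)) hpos.le, ?_⟩
        rw [h4]; exact fin c _ rfl
      rcases int_abs_le_two (hη.range l) with h | h | h | h | h
      · exact absurd h h0
      · right; rw [h] at up ⊢
        refine up 2 (Or.inr (by simp)) (by norm_num [mem_cell_iff]) ?_ ?_
        · intro v hv; norm_num [mem_cell_iff] at hv; exact hv.2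
        · simp only [knot, Int.sign_one, Int.cast_one, kn1]; norm_num
      · left; rw [h]
        refine ⟨?_, ?_⟩
        · simp only [knot]
          norm_num
          refine EReal.coe_mul_top_of_pos ?_
          have : 0 < γ * (ξ * d) := mul_pos hγ hpos
          rw [← hξs] at this
          exact (div_pos_iff.2 (by rcases mul_pos_iff.1 this with h | h <;> simp [h]))
        · intro v hv r hr
          norm_num [mem_cell_iff] at hv ⊢
          have := mul_nonneg hr hpos.le
          linarith
      · right; rw [h] at up ⊢
        refine up (-1) (Or.inl (by simp)) (by norm_num [mem_cell_iff]) ?_ ?_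
        · intro v hv; norm_num [mem_cell_iff] at hv; exact hv.2
        · simp [knot]
      · right; rw [h] at up ⊢
        refine up (-2) (Or.inr (by simp)) (by norm_num [mem_cell_iff]) ?_ ?_
        · intro v hv; norm_num [mem_cell_iff] at hv; exact hv
        · simp only [s3, knot, Int.cast_one, Int.cast_neg, sub_neg_eq_add, kn2]; norm_num
    · rw [if_neg (not_lt.2 (mul_neg_of_pos_of_neg hγ hneg).le), if_pos (mul_neg_of_pos_of_neg hγ hneg)]
      have down : ∀ c : ℝ, IsTie c → c ∈ cell (H (k + 1) l) → (∀ v ∈ cell (H (k + 1) l), c ≤ v) →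
          knot γ (H (k + 1) l) = ((γ * (c - ((H (k + 1) l).sign : ℤ)) : ℝ) : EReal) →
          ∃ c, IsTie c ∧ c ∈ cell (H (k + 1) l) ∧ (∀ v ∈ cell (H (k + 1) l), 0 ≤ (c - v) * (ξ * d)) ∧
          ((ξ / (γ * d) : ℝ) : EReal) * (knot γ (H (k + 1) l) - (bFun γ u : EReal)) =
          (((c - u) / (ξ * d) : ℝ) : EReal) := by
        intro c h1 h2 h3 h4
        refine ⟨c, h1, h2, fun v hv =>
          mul_nonneg_of_nonpos_of_nonpos (sub_nonpos.2 (h3 v hv)) hneg.le, ?_⟩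
        rw [h4]; exact fin c _ rfl
      rcases int_abs_le_two (hη.range l) with h | h | h | h | h
      · exact absurd h h0
      · right; rw [h] at down ⊢
        refine down 1 (Or.inl (by simp)) (by norm_num [mem_cell_iff]) ?_ ?_
        · intro v hv; norm_num [mem_cell_iff] at hv; exact hv.1
        · simp [knot]
      · right; rw [h] at down ⊢
        refine down 2 (Or.inr (by simp)) (by norm_num [mem_cell_iff]) ?_ ?_
        · intro v hv; norm_num [mem_cell_iff] at hv; exact hv
        · simp only [s2, knot, Int.cast_one, kn1]; norm_num
      · right; rw [h] at down ⊢
        refine down (-2) (Or.inr (by simp)) (by norm_num [mem_cell_iff]) ?_ ?_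
        · intro v hv; norm_num [mem_cell_iff] at hv; exact hv.1
        · simp only [knot, Int.sign_one, Int.cast_one, Int.sign_neg, Int.cast_neg, sub_neg_eq_add, kn2]; norm_num
      · left; rw [h]
        refine ⟨?_, ?_⟩
        · simp only [knot]
          norm_num
          refine EReal.coe_mul_bot_of_neg ?_
          have : γ * (ξ * d) < 0 := mul_neg_of_pos_of_neg hγ hneg
          rw [← hξs] at this
          exact (div_neg_iff.2 (by rcases mul_neg_iff.1 this with h | h <;> simp [h]))
        · intro v hv r hr
          norm_num [mem_cell_iff] at hv ⊢
          have := mul_nonpos_of_nonneg_of_nonpos hr hneg.le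
          linarith

theorem real_sign_eq_of_mul_pos {σ : ℤ} (hσ : σ = 1 ∨ σ = -1) {a d : ℝ} (h : 0 < (σ : ℝ) * (a * d)) :
    Real.sign a = σ * Real.sign d := by
  rcases hσ with rfl | rfl
  · simp at h
    rcases mul_pos_iff.1 h with ⟨h1, h2⟩ | ⟨h1, h2⟩
    · simp [Real.sign_of_pos, h1, h2]
    · simp [Real.sign_of_neg, h1, h2]
  · simp at h
    rcases mul_neg_iff.1 h with ⟨h1, h2⟩ | ⟨h1, h2⟩
    · simp [Real.sign_of_pos, Real.sign_of_neg, h1, h2]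
    · simp [Real.sign_of_pos, Real.sign_of_neg, h1, h2]

theorem signType_sign_eq {σ : ℤ} (hσ : σ = 1 ∨ σ = -1) {a : ℝ} (h : 0 < (σ : ℝ) * a) :
    ((SignType.sign a : SignType) : ℤ) = σ := by
  rcases hσ with rfl | rfl
  · simp at h; simp [sign_pos h]
  · simp at h; simp [sign_neg h]

theorem Chain.isPlusStep (hγ : 0 < γ) (hC : Chain X y γ K H τ)
    (hg : gVec (line X γ (H K) (zTilde X y) (τ K)) = 0) (hy : Generic X γ (zTilde X y))
    (hz : zTilde X y ≠ 0) {k : ℕ} (hk : k < K) :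
    ∃ j s ξ Δ, IsPlusStep X y γ (trailData X y γ K H τ) k j s ξ Δ := by
  have hT := hC.trail hγ hg
  obtain ⟨j, σ, hσ, htie, hnext⟩ := hC.step k hk
  have hη := hC.good (k + 1) hk
  have hne : τ (k + 1) - τ k ≠ 0 := sub_ne_zero.2 (hC.tau_ne k hk).symm
  set ξ := Real.sign (τ (k + 1) - τ k) with hξ
  set Δ := |τ (k + 1) - τ k| with hΔ
  have hΔpos : 0 < Δ := abs_pos.2 hne
  have hξΔ : ξ * Δ = τ (k + 1) - τ k := by
    rcases lt_or_gt_of_ne hne with h | h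
    · rw [hξ, hΔ, Real.sign_of_neg h, abs_of_neg h]; ring
    · rw [hξ, hΔ, Real.sign_of_pos h, abs_of_pos h]; ring
  have hξξ : ξ * ξ = 1 := by
    rcases lt_or_gt_of_ne hne with h | h
    · rw [hξ, Real.sign_of_neg h]; ring
    · rw [hξ, Real.sign_of_pos h]; ring
  have hHj : H (k + 1) j = H k j + σ := by rw [hnext]; simp
  have hdj : ∀ l, dir X γ (H (k + 1)) (zTilde X y) l ≠ 0 := hy.dir_ne _ hη
  have hmove : ∀ l, line X γ (H (k + 1)) (zTilde X y) (τ (k + 1)) l =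
      line X γ (H k) (zTilde X y) (τ k) l + Δ * (ξ * dir X γ (H (k + 1)) (zTilde X y) l) := by
    intro l
    have := line_sub (X := X) (γ := γ) (η := H (k + 1)) (zTilde X y) (τ (k + 1)) (τ k) l
    rw [← hξΔ, hT.join k hk] at this
    linear_combination this
  have hin : ∀ l, line X γ (H k) (zTilde X y) (τ k) l ∈ cell (H (k + 1) l) := hT.mem_next hk
  have hout : ∀ l, line X γ (H (k + 1)) (zTilde X y) (τ (k + 1)) l ∈ cell (H (k + 1) l) :=
    hT.mem _ hk
  have hdelta := fun l => hT.deltaOf_cases hγ hk hξξ (hdj l)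
  have hle : ∀ l, (Δ : EReal) ≤ deltaOf X y γ (trailData X y γ K H τ) k (H (k + 1))
      (slopeVec X γ (H (k + 1)) (zTilde X y)) ξ l := by
    intro l
    rcases hdelta l with ⟨h, -⟩ | ⟨c, -, -, hc, h⟩
    · rw [h]; exact le_top
    · rw [h, EReal.coe_le_coe_iff]
      have h1 := hc _ (hout l)
      rw [hmove l] at h1
      set e := ξ * dir X γ (H (k + 1)) (zTilde X y) l with he
      have he0 : e ≠ 0 := mul_ne_zero (by rintro h; rw [h] at hξξ; simp at hξξ) (hdj l)
      have hee : 0 < e * e := mul_self_pos.2 he0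
      rw [show ∀ a : ℝ, a / e = a * e / (e * e) from fun a => by field_simp, le_div_iff₀ hee]
      linarith
  obtain ⟨l₀, hl₀⟩ : ∃ l, IsTie (line X γ (H (k + 1)) (zTilde X y) (τ (k + 1)) l) := by
    rcases Nat.lt_or_ge (k + 1) K with h | h
    · obtain ⟨j', σ', h1, -, -⟩ := hC.step (k + 1) h
      exact ⟨j', h1.isTie⟩
    · obtain rfl : k + 1 = K := by omega
      exact hC.exists_tie_last hγ hz
  -- A coordinate tied at the new vertex has moved towards that tie without leaving its cell. So the
  -- tie is the end of the cell ahead of it, and its travel time is exactly the length of the step.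
  have hattain : deltaOf X y γ (trailData X y γ K H τ) k (H (k + 1))
      (slopeVec X γ (H (k + 1)) (zTilde X y)) ξ l₀ = (Δ : EReal) := by
    obtain ⟨σ', hσ'⟩ := exists_crossing (hout l₀) hl₀
    have h1 := hσ'.side _ (hin l₀)
    set e := ξ * dir X γ (H (k + 1)) (zTilde X y) l₀ with he
    have he0 : e ≠ 0 := mul_ne_zero (by rintro h; rw [h] at hξξ; simp at hξξ) (hdj l₀)
    have h2 : 0 ≤ σ' * e := by
      rw [hmove l₀] at h1
      by_contra hneg
      push Not at hneg
      have := mul_pos_of_neg_of_neg hneg (neg_neg_of_pos hΔpos)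
      linarith
    have h3 : (0 : ℝ) < σ' * e := by
      refine lt_of_le_of_ne h2 (Ne.symm (mul_ne_zero ?_ he0))
      rcases hσ'.sign with rfl | rfl <;> simp
    rcases hdelta l₀ with ⟨-, h⟩ | ⟨c, -, hc1, hc, h⟩
    · have h4 := hσ'.side _ (h _ (hout l₀) 1 zero_le_one)
      rw [← he] at h4
      exfalso
      linarith
    · rw [h, EReal.coe_eq_coe_iff]
      have h4 := hc _ (hout l₀)
      have h5 := hσ'.side _ hc1
      have h6 : c = line X γ (H (k + 1)) (zTilde X y) (τ (k + 1)) l₀ := by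
        set v := line X γ (H (k + 1)) (zTilde X y) (τ (k + 1)) l₀
        rcases hσ'.sign with hs | hs <;> rw [hs] at h3 h5 <;> push_cast at h3 h5
        · have : 0 < e := by linarith
          have := nonneg_of_mul_nonneg_left h4 this
          linarith
        · have : e < 0 := by linarith
          have : c - v ≤ 0 := by
            by_contra hcv
            push Not at hcv
            have := mul_neg_of_pos_of_neg hcv this
            linarith
          linarith
      rw [h6, hmove l₀, ← he]
      field_simp
      ring
  refine ⟨j, slopeVec X γ (H (k + 1)) (zTilde X y), ξ, Δ, ?_, ?_, ?_, ?_, ?_, hξ, ?_, ?_, hΔpos, ?_, ?_⟩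
  · ext l
    rw [hT.mem_hitSet hγ hk.le, mem_singleton_iff]
    exact ⟨htie l, by rintro rfl; exact hσ.isTie⟩
  · intro l hl
    change H (k + 1) l = H k l
    rw [hnext]; simp [hl]
  · change H (k + 1) j = _
    rw [hHj, nextEta, hT.gAt_eq hγ hk.le]
    change H k j + σ = if H k j = 0 then _ else H k j + _
    split_ifs with h0
    · rw [h0, zero_add, signType_sign_eq hσ.sign]
      have h1 := hσ.mem
      have h2 := hσ.mem_next
      rw [h0] at h1 h2
      rw [gFun_of_mem h1]
      rcases hσ.sign with hs | hs <;> rw [hs] at h2 ⊢ <;> norm_num [mem_cell_iff, gSlope, gConst] at h2 ⊢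
      · linarith [h2.1]
      · linarith [h2.2]
    -- As η 0 = 0, a nonzero old indicator implies k ≥ 1, so there is a previous vertex. On the
    -- segment from it, b_j moved towards the facet now being crossed, and the crossing continues in
    -- that direction.
    · obtain ⟨m, rfl⟩ : ∃ m, k = m + 1 := by
        rcases k with _ | m
        · rw [hC.eta_zero] at h0; exact absurd rfl h0
        · exact ⟨m, rfl⟩
      have hm : m < K := by omega
      simp only [Nat.add_sub_cancel]
      congr 1
      symm
      refine signType_sign_eq hσ.sign ?_
      change 0 < (σ : ℝ) * (bVec γ (line X γ (H (m + 1)) (zTilde X y) (τ (m + 1))) j -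
        bVec γ (line X γ (H m) (zTilde X y) (τ m)) j)
      rw [← hT.join m hm, hT.bVec_eq hm left_mem_uIcc, hT.bVec_eq hm right_mem_uIcc]
      have h1 := hσ.side _ (hT.line_mem hm left_mem_uIcc j)
      have h2 := line_sub (X := X) (γ := γ) (η := H (m + 1)) (zTilde X y) (τ m) (τ (m + 1)) j
      have h3 : line X γ (H (m + 1)) (zTilde X y) (τ m) j -
          line X γ (H (m + 1)) (zTilde X y) (τ (m + 1)) j ≠ 0 := by
        rw [h2]
        exact mul_ne_zero (sub_ne_zero.2 (hC.tau_ne m hm)) (hy.dir_ne _ (hC.good _ hm) j)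
      simp only [bAff, bSlope, if_neg h0]
      set a := line X γ (H (m + 1)) (zTilde X y) (τ m) j
      set b := line X γ (H (m + 1)) (zTilde X y) (τ (m + 1)) j
      have h4 : (σ : ℝ) * (a - b) < 0 := by
        refine lt_of_le_of_ne h1 (mul_ne_zero ?_ h3)
        rcases hσ.sign with rfl | rfl <;> simp
      nlinarith
  · intro s'
    exact isSlope_iff hγ hη.det s'
  · have hpos : 0 < (σ : ℝ) * ((τ (k + 1) - τ k) * dir X γ (H (k + 1)) (zTilde X y) j) := by
      have h1 := hσ.side_next _ (by rw [← hHj]; exact hout j)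
      rw [← hT.join k hk, line_sub] at h1
      refine lt_of_le_of_ne h1 (Ne.symm (mul_ne_zero ?_ (mul_ne_zero hne (hdj j))))
      rcases hσ.sign with rfl | rfl <;> simp
    have h2 := real_sign_eq_of_mul_pos hσ.sign hpos
    rw [hξ, h2]
    change _ = xiOf X y (H k) (H (k + 1)) _ j
    unfold xiOf
    split_ifs with h0
    · rw [hHj, add_sub_cancel_left, slopeVec, bSlope, if_neg h0]
      rcases lt_or_gt_of_ne (hdj j) with h | h
      · rw [Real.sign_of_neg h, Real.sign_of_neg (mul_neg_of_pos_of_neg hγ h)]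
      · rw [Real.sign_of_pos h, Real.sign_of_pos (mul_pos hγ h)]
    · push Not at h0
      -- The new indicator at j is 0 here, so the crossing sign is opposite to the old indicator.
      have h3 : H k j = -σ := by omega
      rw [← neg_sub, ← dir_of_eq_zero hγ hη.det _ h0, h3, Real.sign_neg]
      push_cast; ring
  · exact le_antisymm (le_iInf hle) ((iInf_le _ l₀).trans hattain.le)
  · intro l hl
    rw [hT.mem_hitSet hγ hk]
    rcases hdelta l with ⟨h, -⟩ | ⟨c, hc1, -, -, h⟩
    · have h' := h.symm.trans hl
      exact absurd h' (EReal.coe_ne_top _).symm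
    · have h' := h.symm.trans hl
      rw [EReal.coe_eq_coe_iff] at h'
      have he0 : ξ * dir X γ (H (k + 1)) (zTilde X y) l ≠ 0 :=
        mul_ne_zero (by rintro h; rw [h] at hξξ; simp at hξξ) (hdj l)
      rw [div_eq_iff he0] at h'
      have : line X γ (H (k + 1)) (zTilde X y) (τ (k + 1)) l = c := by rw [hmove l]; linarith
      rw [this]; exact hc1
  · change τ (k + 1) = τ k + ξ * Δ
    rw [hξΔ]; ring
  · change bVec γ (line X γ (H (k + 1)) (zTilde X y) (τ (k + 1))) =
      bVec γ (line X γ (H k) (zTilde X y) (τ k)) + (τ (k + 1) - τ k) • _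
    rw [← hT.join k hk, hT.bVec_eq hk left_mem_uIcc, hT.bVec_eq hk right_mem_uIcc,
      ← bAff_line_sub]
    abel

theorem Chain.isPlusOutput (hγ : 0 < γ) (hC : Chain X y γ K H τ)
    (hg : gVec (line X γ (H K) (zTilde X y) (τ K)) = 0) (hy : Generic X γ (zTilde X y))
    (hz : zTilde X y ≠ 0) : IsPlusOutput X y γ (trailData X y γ K H τ) where
  eta_zero := hC.eta_zero
  b_zero := ((hC.trail hγ hg).isPath hγ hz).b_zero
  tau_zero := hC.tau_zero
  step _ hk := hC.isPlusStep hγ hg hy hz hk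
  tau_pos k hk := hC.tau_pos k hk

end

/-! ### The parameters of a solution path -/

/-- A solution path, in terms of `τ = 1 / lam` and the parameters of its points. -/
structure ParamPath (X : Matrix (Fin n) (Fin p) ℝ) (y : Fin n → ℝ) (γ : ℝ)
    (v w : ℝ → ℝ × (Fin p → ℝ)) : Prop where
  continuousOn : ContinuousOn w (Ici 0)
  pos : ∀ x, 0 ≤ x → 0 < (w x).1
  surf_eq : ∀ x, 0 ≤ x → surf X γ (w x).2 = (w x).1 • zTilde X y
  eq : ∀ x, 0 ≤ x → v x = (1 / (w x).1, (1 / (w x).1) • bVec γ (w x).2)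
  lim : Tendsto (fun x => (w x).1) atTop atTop
  start : bVec γ (w 0).2 = 0

/-- At each point some parameter exists. It is recovered from g = τz̃ - Σb and b by the continuous
map `paramOf`, so the choice is unique and continuous in x. -/
theorem IsSolutionPath.exists_paramPath (hγ : 0 < γ) {v : ℝ → ℝ × (Fin p → ℝ)}
    (hv : IsSolutionPath X y γ v) : ∃ w, ParamPath X y γ v w := by
  set w : ℝ → ℝ × (Fin p → ℝ) := fun x => (1 / (v x).1,
    paramOf γ ((1 / (v x).1) • zTilde X y - (gram X).mulVec ((1 / (v x).1) • (v x).2))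
      ((1 / (v x).1) • (v x).2)) with hw
  have key : ∀ x, 0 ≤ x → surf X γ (w x).2 = (w x).1 • zTilde X y ∧
      (1 / (v x).1) • (v x).2 = bVec γ (w x).2 := by
    intro x hx
    have hl := hv.pos x hx
    obtain ⟨u, hu, hb⟩ := (isCritical_iff hγ hl).1 (hv.critical x hx)
    have hb' : (1 / (v x).1) • (v x).2 = bVec γ u := by
      rw [hb, smul_smul, one_div_mul_cancel hl.ne', one_smul]
    have hwu : (w x).2 = u := by
      simp only [hw]
      rw [hb', ← hu, surf, add_sub_cancel_right, paramOf_gVec_bVec hγ]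
    rw [hwu]
    exact ⟨hu, hb'⟩
  have hc1 : ContinuousOn (fun x => 1 / (v x).1) (Ici 0) :=
    continuousOn_const.div (continuous_fst.comp_continuousOn hv.continuousOn)
      fun x hx => (hv.pos x hx).ne'
  have hc2 : ContinuousOn (fun x => (1 / (v x).1) • (v x).2) (Ici 0) :=
    hc1.smul (continuous_snd.comp_continuousOn hv.continuousOn)
  refine ⟨w, ?_, ?_, fun x hx => (key x hx).1, ?_, ?_, ?_⟩
  · refine hc1.prodMk (continuous_paramOf.comp_continuousOn (f := fun x =>
      ((1 / (v x).1) • zTilde X y - (gram X).mulVec ((1 / (v x).1) • (v x).2),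
        (1 / (v x).1) • (v x).2)) (ContinuousOn.prodMk ?_ hc2))
    exact (hc1.smul continuousOn_const).sub ((continuous_mulVec_const _).comp_continuousOn hc2)
  · exact fun x hx => one_div_pos.2 (hv.pos x hx)
  · intro x hx
    rw [← (key x hx).2]
    simp only [hw, one_div_one_div, smul_smul, mul_one_div_cancel (hv.pos x hx).ne', one_smul]
  · simp only [hw, one_div]
    refine tendsto_inv_nhdsGT_zero.comp (tendsto_nhdsWithin_iff.2 ⟨hv.lim, ?_⟩)
    filter_upwards [eventually_ge_atTop 0] with x hx using hv.pos x hx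
  · rw [← (key 0 le_rfl).2, hv.start, smul_zero]

/-- Gluing along a path through finitely many closed sets. -/
theorem exists_glued {α : Type*} [TopologicalSpace α] {S : Set ℝ} (hS : IsClosed S) {w : ℝ → α}
    (hw : ContinuousOn w S) {N : ℕ} {E : Fin N → Set α} (hE : ∀ k, IsClosed (E k))
    {φ : Fin N → α → ℝ} (hφ : ∀ k, Continuous (φ k))
    (hcov : ∀ x ∈ S, ∃ k, w x ∈ E k)
    (hag : ∀ x ∈ S, ∀ i k, w x ∈ E i → w x ∈ E k → φ i (w x) = φ k (w x)) :
    ∃ Φ : ℝ → ℝ, ContinuousOn Φ S ∧ ∀ x ∈ S, ∀ k, w x ∈ E k → Φ x = φ k (w x) := by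
  classical
  have hval : ∀ x ∈ S, ∀ k, w x ∈ E k →
      (if h : ∃ k, w x ∈ E k then φ h.choose (w x) else 0) = φ k (w x) := by
    intro x hx k hk
    have h : ∃ k, w x ∈ E k := ⟨k, hk⟩
    rw [dif_pos h]
    exact hag x hx _ _ h.choose_spec hk
  refine ⟨fun x => if h : ∃ k, w x ∈ E k then φ h.choose (w x) else 0, ?_, hval⟩
  have hSu : S = ⋃ k, S ∩ w ⁻¹' E k := by
    ext x
    simp only [mem_iUnion, mem_inter_iff, mem_preimage]
    exact ⟨fun hx => (hcov x hx).imp fun k hk => ⟨hx, hk⟩, fun ⟨k, hk⟩ => hk.1⟩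
  rw [hSu]
  refine (locallyFinite_of_finite _).continuousOn_iUnion
    (fun k => hw.preimage_isClosed_of_isClosed hS (hE k)) fun k => ?_
  refine (((hφ k).comp_continuousOn hw).mono inter_subset_left).congr ?_
  intro x hx
  exact hval x hx.1 k hx.2

/-- There are finitely many nonempty boxes and they are closed, so those missing u also miss a
neighbourhood of u. -/
theorem eventually_Box (u : Fin p → ℝ) : ∀ᶠ u' in 𝓝 u, ∀ η, u' ∈ Box η → u ∈ Box η := by
  have : ∀ᶠ u' in 𝓝 u, ∀ η ∈ {η : Fin p → ℤ | ∀ j, |η j| ≤ 2}, u' ∈ Box η → u ∈ Box η := by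
    rw [eventually_all_finite finite_indicators]
    intro η _
    by_cases h : u ∈ Box η
    · exact Eventually.of_forall fun _ _ => h
    · filter_upwards [(isClosed_Box η).isOpen_compl.mem_nhds h] with u' hu' hu'' using
        absurd hu'' hu'
  filter_upwards [this] with u' h η hη using h η (range_of_mem_Box hη) hη

theorem abs_le_one_of_bFun_eq_zero (hγ : 0 < γ) {u : ℝ} (h : bFun γ u = 0) : |u| ≤ 1 := by
  obtain ⟨i, hi⟩ := exists_mem_cell u
  rw [bFun_of_mem hi] at h
  have s2 : Int.sign 2 = 1 := rfl
  have s3 : Int.sign (-2) = -1 := rfl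
  rw [abs_le]
  rcases mem_cell_iff.1 hi with ⟨rfl, h'⟩ | ⟨rfl, h'⟩ | ⟨rfl, h'⟩ | ⟨rfl, h'⟩ | ⟨rfl, h'⟩ <;>
    norm_num [bSlope, bConst, s2, s3] at h ⊢
  · exact h'
  all_goals
    first
    | have h2 : u - 1 = 0 := by
        refine (mul_eq_zero.1 (show γ * (u - 1) = 0 by linarith)).resolve_left hγ.ne'
      constructor <;> linarith
    | have h2 : u + 1 = 0 := by
        refine (mul_eq_zero.1 (show γ * (u + 1) = 0 by linarith)).resolve_left hγ.ne'
      constructor <;> linarith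

theorem mem_Box_zero_of_bVec (hγ : 0 < γ) {u : Fin p → ℝ} (h : bVec γ u = 0) : u ∈ Box 0 :=
  mem_Box_zero.2 fun j => abs_le_one_of_bFun_eq_zero hγ (congrFun h j)

/-! ### The arc traced by a chain -/

/-- The coordinate along the `k`-th segment of a chain. -/
def arcCoord (τ : ℕ → ℝ) : ℕ → ℝ → ℝ
  -- Vertex k has coordinate k on both adjacent segments, and the trivial solutions have coordinates
  -- in (-1, 0].
  | 0, t => t / τ 0 - 1
  | k + 1, t => k + (t - τ k) / (τ (k + 1) - τ k)

theorem continuous_arcCoord (τ : ℕ → ℝ) (k : ℕ) : Continuous (arcCoord τ k) := by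
  cases k <;> unfold arcCoord <;> fun_prop

section
variable {K : ℕ} {H : ℕ → Fin p → ℤ} {τ : ℕ → ℝ} {u : Fin p → ℝ} {t : ℝ}

theorem Chain.arcCoord_self (hC : Chain X y γ K H τ) {k : ℕ} (hk : k ≤ K) :
    arcCoord τ k (τ k) = k := by
  rcases k with _ | k
  · simp [arcCoord, (hC.tau_pos 0 hk).ne']
  · have := sub_ne_zero.2 (hC.tau_ne k hk).symm
    simp [arcCoord, div_self this]

/-- Segments meet facets only at their ends, so a point of the chain with a tie is a vertex. -/
theorem Chain.tie_vertex (hγ : 0 < γ) (hC : Chain X y γ K H τ) (hy : Generic X γ (zTilde X y))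
    (hz : zTilde X y ≠ 0) (ht : 0 < t) (hs : surf X γ u = t • zTilde X y) {i : ℕ} (hi : i ≤ K)
    (hu : u ∈ Box (H i)) {j : Fin p} (hj : IsTie (u j)) :
    (t = τ i ∧ u = line X γ (H i) (zTilde X y) (τ i)) ∨
      ∃ l, i = l + 1 ∧ t = τ l ∧ u = line X γ (H l) (zTilde X y) (τ l) := by
  have hl := eq_line hγ (hC.good i hi).det hu hs
  rw [hl] at hu hj
  rcases hC.eq_vertex hγ hy hz hi ht hu hj with h | ⟨h1, h2⟩
  · left; exact ⟨h, by rw [hl, h]⟩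
  · right
    obtain ⟨l, rfl⟩ : ∃ l, i = l + 1 := ⟨i - 1, by omega⟩
    simp only [Nat.add_sub_cancel] at h2
    exact ⟨l, rfl, h2, by rw [hl, h2, hC.line_next hγ hi]⟩

/-- A perfect fit over a generic direction has a tie by `Generic.exists_tie`, hence is a vertex, and
only the last vertex is a perfect fit. -/
theorem Chain.eq_last_of_perfect (hγ : 0 < γ) (hC : Chain X y γ K H τ)
    (hy : Generic X γ (zTilde X y)) (hz : zTilde X y ≠ 0) (ht : 0 < t)
    (hs : surf X γ u = t • zTilde X y) {i : ℕ} (hi : i ≤ K) (hu : u ∈ Box (H i))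
    (hg : gVec u = 0) : i = K ∧ t = τ K := by
  have hl := eq_line hγ (hC.good i hi).det hu hs
  obtain ⟨j, hj1, hj2⟩ := hy.exists_tie hγ (hC.good i hi) ht.ne' (hl ▸ hu) (hl ▸ hg)
  have htie : IsTie (u j) := by
    right
    rw [hl, hj2, abs_mul, ← Int.cast_abs, hj1]
    simp
  rcases hC.tie_vertex hγ hy hz ht hs hi hu htie with ⟨h1, h2⟩ | ⟨l, rfl, h1, h2⟩
  · have : i = K := by
      by_contra hne
      exact hC.not_perfect i (by omega) (h2 ▸ hg)
    exact ⟨this, by rw [h1, this]⟩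
  · exact absurd (h2 ▸ hg) (hC.not_perfect l hi)

/-- A point in two different boxes has a tie, so it is a vertex, and the only boxes of the chain at
a vertex are the two consecutive ones. -/
theorem Chain.eq_vertex_of_mem_two (hγ : 0 < γ) (hC : Chain X y γ K H τ)
    (hy : Generic X γ (zTilde X y)) (hz : zTilde X y ≠ 0) (ht : 0 < t)
    (hs : surf X γ u = t • zTilde X y) {i k : ℕ} (hik : i < k) (hk : k ≤ K)
    (hu : u ∈ Box (H i)) (hu' : u ∈ Box (H k)) : k = i + 1 ∧ t = τ i := by
  obtain ⟨j, hj⟩ : ∃ j, IsTie (u j) := by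
    by_contra hcon
    push Not at hcon
    have : H k = H i := funext fun j => not_isTie_imp_eq (hu j) (hcon j) (hu' j)
    have := hC.inj k hk i (by omega) this
    omega
  rcases hC.tie_vertex hγ hy hz ht hs (by omega : i ≤ K) hu hj with ⟨h1, h2⟩ | ⟨l, rfl, h1, h2⟩
  · rw [h2] at hu'
    rcases hC.box_cases (by omega) hu' with h | h
    · have := hC.inj k hk i (by omega) h; omega
    · exact ⟨hC.inj k hk (i + 1) (by omega) h, h1⟩
  · rw [h2] at hu'
    rcases hC.box_cases (by omega) hu' with h | h
    · have := hC.inj k hk l (by omega) h; omega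
    · have := hC.inj k hk (l + 1) (by omega) h; omega

/-- Near a point of a chain that is not a perfect fit, the boxes are those of the chain. -/
theorem Chain.eventually_mem (hγ : 0 < γ) (hC : Chain X y γ K H τ)
    (hy : Generic X γ (zTilde X y)) (hz : zTilde X y ≠ 0)
    (hgK : gVec (line X γ (H K) (zTilde X y) (τ K)) = 0) (ht : 0 < t)
    (hs : surf X γ u = t • zTilde X y) {i : ℕ} (hi : i ≤ K) (hu : u ∈ Box (H i))
    (hg : gVec u ≠ 0) : ∀ᶠ u' in 𝓝 u, ∃ k ≤ K, u' ∈ Box (H k) := by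
  -- Nearby parameters lie only in boxes that contain u. These are one box if u has no tie, and
  -- otherwise the two boxes at a vertex, which is not the last one because u is not a perfect fit.
  filter_upwards [eventually_Box u] with u' hu'
  obtain ⟨η, hη⟩ := exists_mem_Box u'
  suffices h : ∃ k ≤ K, η = H k by
    obtain ⟨k, hk, rfl⟩ := h; exact ⟨k, hk, hη⟩
  have hη' := hu' η hη
  by_cases hj : ∃ j, IsTie (u j)
  · obtain ⟨j, hj⟩ := hj
    have fin : ∀ l ≤ K, u = line X γ (H l) (zTilde X y) (τ l) → ∃ k ≤ K, η = H k := by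
      intro l hl he
      have hlK : l < K := by
        refine lt_of_le_of_ne hl ?_
        rintro rfl
        exact hg (he ▸ hgK)
      rw [he] at hη'
      rcases hC.box_cases hlK hη' with h | h
      · exact ⟨l, hl, h⟩
      · exact ⟨l + 1, hlK, h⟩
    rcases hC.tie_vertex hγ hy hz ht hs hi hu hj with ⟨-, h2⟩ | ⟨l, rfl, -, h2⟩
    · exact fin i hi h2
    · exact fin l (by omega) h2
  · push Not at hj
    exact ⟨i, hi, funext fun j => not_isTie_imp_eq (hu j) (hj j) (hη' j)⟩

/-- The perfect fits beyond the end of a chain. -/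
def rayPiece (X : Matrix (Fin n) (Fin p) ℝ) (y : Fin n → ℝ) (γ : ℝ) (K : ℕ)
    (H : ℕ → Fin p → ℤ) (τ : ℕ → ℝ) : Set (ℝ × (Fin p → ℝ)) :=
  {q | τ K ≤ q.1 ∧ gVec q.2 = 0 ∧
    bVec γ q.2 = (q.1 / τ K) • bVec γ (line X γ (H K) (zTilde X y) (τ K))}

theorem isClosed_rayPiece : IsClosed (rayPiece X y γ K H τ) := by
  refine (isClosed_le continuous_const continuous_fst).inter ((isClosed_eq
    (continuous_gVec.comp continuous_snd) continuous_const).inter (isClosed_eq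
    (continuous_bVec.comp continuous_snd) ?_))
  fun_prop

theorem Chain.arcCoord_zero_le (hγ : 0 < γ) (hC : Chain X y γ K H τ)
    (hgK : gVec (line X γ (H K) (zTilde X y) (τ K)) = 0) (hz : zTilde X y ≠ 0) (ht : 0 < t)
    (hs : surf X γ u = t • zTilde X y) (hu : u ∈ Box (H 0)) :
    arcCoord τ 0 t ≤ 0 ∧ t ≤ τ 0 ∧ bVec γ u = 0 := by
  have hl := eq_line hγ (hC.good 0 (Nat.zero_le _)).det hu hs
  have h1 := ((hC.trail hγ hgK).tau_le_zero hγ hz ht.le).1 (hl ▸ hu)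
  refine ⟨?_, h1, ?_⟩
  · rw [arcCoord, sub_nonpos, div_le_one (hC.tau_pos 0 (Nat.zero_le _))]; exact h1
  · rw [hC.eta_zero] at hu; exact bVec_of_mem_Box_zero hu

theorem Chain.arcCoord_succ (hγ : 0 < γ) (hC : Chain X y γ K H τ)
    (hgK : gVec (line X γ (H K) (zTilde X y) (τ K)) = 0) (ht : 0 < t)
    (hs : surf X γ u = t • zTilde X y) {k : ℕ} (hk : k < K) (hu : u ∈ Box (H (k + 1))) :
    k ≤ arcCoord τ (k + 1) t ∧ arcCoord τ (k + 1) t ≤ k + 1 ∧ t ∈ uIcc (τ k) (τ (k + 1)) ∧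
      (trailData X y γ K H τ).curve (arcCoord τ (k + 1) t) = (1 / t, (1 / t) • bVec γ u) := by
  have hT := hC.trail hγ hgK
  have hl := eq_line hγ (hC.good _ hk).det hu hs
  have hm := hT.mem_seg hk ht.le (hl ▸ hu)
  have hne := sub_ne_zero.2 (hC.tau_ne k hk).symm
  have hr : 0 ≤ (t - τ k) / (τ (k + 1) - τ k) ∧ (t - τ k) / (τ (k + 1) - τ k) ≤ 1 := by
    rcases mem_uIcc.1 hm with h | h
    · have : 0 < τ (k + 1) - τ k := lt_of_le_of_ne (by linarith) hne.symm
      exact ⟨div_nonneg (by linarith) this.le, (div_le_one this).2 (by linarith)⟩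
    · have : τ (k + 1) - τ k < 0 := lt_of_le_of_ne (by linarith) hne
      exact ⟨div_nonneg_of_nonpos (by linarith) this.le, (div_le_one_of_neg this).2 (by linarith)⟩
  have h1 : (k : ℝ) ≤ arcCoord τ (k + 1) t := by rw [arcCoord]; linarith
  have h2 : arcCoord τ (k + 1) t ≤ k + 1 := by rw [arcCoord]; linarith
  refine ⟨h1, h2, hm, ?_⟩
  obtain ⟨t', -, ht', he⟩ := hT.curve_of_le hk h1 h2
  have : t' = t := by
    rw [ht', arcCoord]
    field_simp
    ring
  rw [he, this, hl]

theorem curve_of_rayPiece (hK : 0 < K) (hτ : 0 < τ K) (hu : (t, u) ∈ rayPiece X y γ K H τ) :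
    (K : ℝ) ≤ K * t / τ K ∧
      (trailData X y γ K H τ).curve (K * t / τ K) = (1 / t, (1 / t) • bVec γ u) := by
  obtain ⟨h1, -, h3⟩ := hu
  simp only at h1 h3
  have hK' : (0 : ℝ) < K := by exact_mod_cast hK
  have ht : 0 < t := lt_of_lt_of_le hτ h1
  have h4 : (K : ℝ) ≤ K * t / τ K := by rw [le_div_iff₀ hτ]; nlinarith
  refine ⟨h4, ?_⟩
  rw [trail_curve_of_ge hK h4, h3, smul_smul]
  congr 1
  · field_simp
  · congr 1; field_simp

theorem Chain.tau_le_sum (hC : Chain X y γ K H τ) {k : ℕ} (hk : k ≤ K) :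
    τ k ≤ ∑ i ∈ Finset.range (K + 1), τ i :=
  Finset.single_le_sum (f := τ) (fun i hi => (hC.tau_pos i (by simpa [Nat.lt_succ_iff] using hi)).le)
    (by simpa [Nat.lt_succ_iff] using hk)

/-- The sum serves merely as a common upper bound of the τ-values on the chain. Since τ → ∞ along a
solution path, the path must leave the chain. -/
theorem Chain.le_sum (hγ : 0 < γ) (hC : Chain X y γ K H τ)
    (hgK : gVec (line X γ (H K) (zTilde X y) (τ K)) = 0) (hz : zTilde X y ≠ 0) (ht : 0 < t)
    (hs : surf X γ u = t • zTilde X y) {k : ℕ} (hk : k ≤ K) (hu : u ∈ Box (H k)) :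
    t ≤ ∑ i ∈ Finset.range (K + 1), τ i := by
  rcases k with _ | k
  · exact (hC.arcCoord_zero_le hγ hgK hz ht hs hu).2.1.trans (hC.tau_le_sum hk)
  · rcases mem_uIcc.1 (hC.arcCoord_succ hγ hgK ht hs hk hu).2.2.1 with h | h
    · exact h.2.trans (hC.tau_le_sum hk)
    · exact h.2.trans (hC.tau_le_sum (by omega))

end

/-! ### Uniqueness of the main branch -/

section
variable {K : ℕ} {H : ℕ → Fin p → ℤ} {τ : ℕ → ℝ} {u : Fin p → ℝ} {t : ℝ}
  {v w : ℝ → ℝ × (Fin p → ℝ)}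

theorem Chain.curve_zero (hγ : 0 < γ) (hC : Chain X y γ K H τ)
    (hgK : gVec (line X γ (H K) (zTilde X y) (τ K)) = 0) (hz : zTilde X y ≠ 0) :
    (trailData X y γ K H τ).curve 0 ∈ trivialRay X y := by
  have hT := hC.trail hγ hgK
  refine ⟨?_, (hT.isSolutionPath hγ hz).start⟩
  obtain ⟨t, -, h1, he⟩ := hT.curve_of_le (hT.length_pos hγ hz) (x := 0) (by simp) (by simp)
  have : t = τ 0 := by rw [h1]; simp
  rw [he, this, hC.tau_zero, one_div_one_div]

/-- The coordinates along the segments, and the one along the final ray, glue to a continuous real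
function Φ on the path. Its value tells which point of the curve is being visited, nonpositive
values meaning trivial solutions. -/
theorem Chain.exists_coord (hγ : 0 < γ) (hC : Chain X y γ K H τ)
    (hgK : gVec (line X γ (H K) (zTilde X y) (τ K)) = 0) (hy : Generic X γ (zTilde X y))
    (hz : zTilde X y ≠ 0) (hw : ParamPath X y γ v w) {S : Set ℝ} (hS : IsClosed S)
    (hS0 : S ⊆ Ici 0)
    (hcov : ∀ x ∈ S, (∃ k ≤ K, (w x).2 ∈ Box (H k)) ∨ w x ∈ rayPiece X y γ K H τ) :
    ∃ Φ : ℝ → ℝ, ContinuousOn Φ S ∧ ∀ x ∈ S,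
      ((v x ∈ trivialRay X y ∧ Φ x ≤ 0) ∨
        (0 ≤ Φ x ∧ v x = (trailData X y γ K H τ).curve (Φ x))) ∧
      ((∃ k ≤ K, (w x).2 ∈ Box (H k)) → Φ x ≤ K) ∧
      (w x ∈ rayPiece X y γ K H τ → Φ x = K * (w x).1 / τ K) ∧
      (bVec γ (w x).2 = 0 → Φ x ≤ 0) := by
  have hK := (hC.trail hγ hgK).length_pos hγ hz
  have hτK := hC.tau_pos K le_rfl
  let E : Fin (K + 2) → Set (ℝ × (Fin p → ℝ)) := fun k =>
    if k.1 ≤ K then Prod.snd ⁻¹' Box (H k.1) else rayPiece X y γ K H τ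
  let φ : Fin (K + 2) → ℝ × (Fin p → ℝ) → ℝ := fun k q =>
    if k.1 ≤ K then arcCoord τ k.1 q.1 else K * q.1 / τ K
  have E1 : ∀ k (hk : k ≤ K), E ⟨k, by omega⟩ = Prod.snd ⁻¹' Box (H k) := fun k hk => if_pos hk
  have E2 : E ⟨K + 1, by omega⟩ = rayPiece X y γ K H τ := if_neg (by simp)
  have φ1 : ∀ k (hk : k ≤ K) q, φ ⟨k, by omega⟩ q = arcCoord τ k q.1 := fun k hk q => if_pos hk
  have φ2 : ∀ q, φ ⟨K + 1, by omega⟩ q = K * q.1 / τ K := fun q => if_neg (by simp)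
  have hEc : ∀ k, IsClosed (E k) := by
    intro k
    simp only [E]
    split_ifs
    · exact (isClosed_Box _).preimage continuous_snd
    · exact isClosed_rayPiece
  have hφc : ∀ k, Continuous (φ k) := by
    intro k
    simp only [φ]
    split_ifs
    · exact (continuous_arcCoord τ _).comp continuous_fst
    · fun_prop
  -- Two pieces overlap only at a common vertex, or at the last vertex where the ray begins, and
  -- there the coordinates agree.
  have hag2 : ∀ x ∈ S, ∀ i k : ℕ, i < k → ∀ (hi : i < K + 2) (hk : k < K + 2),
      w x ∈ E ⟨i, hi⟩ → w x ∈ E ⟨k, hk⟩ → φ ⟨i, hi⟩ (w x) = φ ⟨k, hk⟩ (w x) := by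
    intro x hx i k hik hi hk h1 h2
    have hx0 := hS0 hx
    rw [E1 i (by omega)] at h1
    rw [φ1 i (by omega)]
    rcases Nat.lt_or_ge K k with h | h
    · obtain rfl : k = K + 1 := by omega
      rw [E2] at h2
      rw [φ2]
      obtain ⟨rfl, h4⟩ := hC.eq_last_of_perfect hγ hy hz (hw.pos x hx0) (hw.surf_eq x hx0)
        (by omega) h1 h2.2.1
      rw [h4, hC.arcCoord_self le_rfl, mul_div_cancel_right₀ _ hτK.ne']
    · rw [E1 k h] at h2
      rw [φ1 k h]
      obtain ⟨rfl, h4⟩ := hC.eq_vertex_of_mem_two hγ hy hz (hw.pos x hx0) (hw.surf_eq x hx0)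
        hik h h1 h2
      rw [h4, hC.arcCoord_self (by omega)]
      simp [arcCoord]
  obtain ⟨Φ, hΦc, hΦ⟩ := exists_glued hS (hw.continuousOn.mono hS0) hEc hφc (by
    intro x hx
    rcases hcov x hx with ⟨k, hk, h⟩ | h
    · exact ⟨⟨k, by omega⟩, by rw [E1 k hk]; exact h⟩
    · exact ⟨⟨K + 1, by omega⟩, by rw [E2]; exact h⟩) (by
    intro x hx i k h1 h2
    rcases lt_trichotomy i k with h | h | h
    · exact hag2 x hx i k h i.2 k.2 h1 h2
    · rw [h]
    · exact (hag2 x hx k i h k.2 i.2 h2 h1).symm)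
  have hbox : ∀ x ∈ S, ∀ k ≤ K, (w x).2 ∈ Box (H k) → Φ x = arcCoord τ k (w x).1 := by
    intro x hx k hk h
    rw [hΦ x hx ⟨k, by omega⟩ (by rw [E1 k hk]; exact h), φ1 k hk]
  have hray : ∀ x ∈ S, w x ∈ rayPiece X y γ K H τ → Φ x = K * (w x).1 / τ K := by
    intro x hx h
    rw [hΦ x hx ⟨K + 1, by omega⟩ (by rw [E2]; exact h), φ2]
  refine ⟨Φ, hΦc, fun x hx => ?_⟩
  have hx0 := hS0 hx
  have hp := hw.pos x hx0
  have hs := hw.surf_eq x hx0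
  refine ⟨?_, ?_, hray x hx, ?_⟩
  · rcases hcov x hx with ⟨k, hk, h⟩ | h
    · rw [hbox x hx k hk h, hw.eq x hx0]
      rcases k with _ | k
      · left
        obtain ⟨h1, h2, h3⟩ := hC.arcCoord_zero_le hγ hgK hz hp hs h
        refine ⟨⟨?_, ?_⟩, h1⟩
        · rw [hC.tau_zero] at h2
          exact (le_one_div hp (iSup_abs_pos hz)).1 h2
        · change _ • bVec γ (w x).2 = 0
          rw [h3, smul_zero]
      · right
        obtain ⟨h1, -, -, h4⟩ := hC.arcCoord_succ hγ hgK hp hs hk h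
        exact ⟨le_trans (Nat.cast_nonneg k) h1, h4.symm⟩
    · right
      obtain ⟨h1, h2⟩ := curve_of_rayPiece (t := (w x).1) (u := (w x).2) hK hτK h
      rw [hray x hx h, h2, hw.eq x hx0]
      exact ⟨le_trans (Nat.cast_nonneg K) h1, rfl⟩
  · rintro ⟨k, hk, h⟩
    rw [hbox x hx k hk h]
    rcases k with _ | k
    · exact (hC.arcCoord_zero_le hγ hgK hz hp hs h).1.trans (Nat.cast_nonneg K)
    · refine (hC.arcCoord_succ hγ hgK hp hs hk h).2.1.trans ?_
      exact_mod_cast hk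
  · intro h
    have h0 := mem_Box_zero_of_bVec hγ h
    rw [← hC.eta_zero] at h0
    rw [hbox x hx 0 (Nat.zero_le _) h0]
    exact (hC.arcCoord_zero_le hγ hgK hz hp hs h0).1

/-- Equality of graphs by the intermediate value theorem. -/
theorem image_union_eq {S D : Set ℝ} {c : ℝ → ℝ × (Fin p → ℝ)} {R : Set (ℝ × (Fin p → ℝ))}
    {Φ : ℝ → ℝ} (hS : IsPreconnected S) (hΦ : ContinuousOn Φ S) (h0 : (0 : ℝ) ∈ S)
    (hΦ0 : Φ 0 ≤ 0) (hD : ∀ d ∈ D, 0 ≤ d ∧ ∃ x ∈ S, d ≤ Φ x) (hc : c 0 ∈ R)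
    (hv : ∀ x ∈ S, (v x ∈ R ∧ Φ x ≤ 0) ∨ (Φ x ∈ D ∧ v x = c (Φ x))) :
    v '' S ∪ R = c '' D ∪ R := by
  apply Subset.antisymm
  · rintro q (⟨x, hx, rfl⟩ | hq)
    · rcases hv x hx with h | ⟨h1, h2⟩
      · exact Or.inr h.1
      · exact Or.inl ⟨_, h1, h2.symm⟩
    · exact Or.inr hq
  · rintro q (⟨d, hd, rfl⟩ | hq)
    · obtain ⟨hd0, x, hx, hdx⟩ := hD d hd
      obtain ⟨x', hx', rfl⟩ := hS.intermediate_value h0 hx hΦ ⟨hΦ0.trans hd0, hdx⟩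
      rcases hv x' hx' with h | h
      · rw [le_antisymm h.2 hd0]; exact Or.inr hc
      · exact Or.inl ⟨x', hx', h.2⟩
    · exact Or.inr hq

theorem ParamPath.mem_start (hγ : 0 < γ) (hC : Chain X y γ K H τ) (hw : ParamPath X y γ v w) :
    (w 0).2 ∈ Box (H 0) := by
  rw [hC.eta_zero]; exact mem_Box_zero_of_bVec hγ hw.start

/-- A solution path does not leave the chain before the first perfect fit. -/
theorem ParamPath.mem_chain (hγ : 0 < γ) (hC : Chain X y γ K H τ)
    (hgK : gVec (line X γ (H K) (zTilde X y) (τ K)) = 0) (hy : Generic X γ (zTilde X y))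
    (hz : zTilde X y ≠ 0) (hw : ParamPath X y γ v w) {T : ℝ}
    (hT : ∀ x, 0 ≤ x → x < T → gVec (w x).2 ≠ 0) :
    ∀ x ∈ Icc 0 T, ∃ k ≤ K, (w x).2 ∈ Box (H k) := by
  set s : Set ℝ := {x | ∃ k ≤ K, (w x).2 ∈ Box (H k)} with hs
  have hcl : IsClosed (s ∩ Icc 0 T) := by
    have h1 : IsClosed {u : Fin p → ℝ | ∃ k ≤ K, u ∈ Box (H k)} := by
      have : {u : Fin p → ℝ | ∃ k ≤ K, u ∈ Box (H k)} = ⋃ k ∈ Finset.range (K + 1), Box (H k) := by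
        ext u; simp
      rw [this]
      exact isClosed_biUnion_finset fun k _ => isClosed_Box _
    have h2 : ContinuousOn (fun x => (w x).2) (Icc 0 T) :=
      (continuous_snd.comp_continuousOn hw.continuousOn).mono Icc_subset_Ici_self
    rw [inter_comm]
    exact h2.preimage_isClosed_of_isClosed isClosed_Icc h1
  -- Continuity method: membership in the boxes of the chain is closed and, before a perfect fit,
  -- also persists to the right.
  refine hcl.Icc_subset_of_forall_mem_nhdsWithin ⟨0, Nat.zero_le _, hw.mem_start hγ hC⟩ ?_
  rintro x ⟨⟨i, hi, hx⟩, hx0, hxT⟩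
  have hev := hC.eventually_mem hγ hy hz hgK (hw.pos x hx0) (hw.surf_eq x hx0) hi hx (hT x hx0 hxT)
  have hcont : Tendsto (fun x => (w x).2) (𝓝[>] x) (𝓝 (w x).2) :=
    ((continuous_snd.comp_continuousOn hw.continuousOn) x hx0).mono_left
      (nhdsWithin_mono _ fun x' hx' => le_trans hx0 (le_of_lt hx'))
  exact hcont.eventually hev

theorem ParamPath.exists_first (hγ : 0 < γ) (hC : Chain X y γ K H τ)
    (hgK : gVec (line X γ (H K) (zTilde X y) (τ K)) = 0) (hy : Generic X γ (zTilde X y))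
    (hz : zTilde X y ≠ 0) (hw : ParamPath X y γ v w) :
    ∃ T, 0 ≤ T ∧ gVec (w T).2 = 0 ∧ ∀ x, 0 ≤ x → x < T → gVec (w x).2 ≠ 0 := by
  set s : Set ℝ := Ici 0 ∩ (fun x => gVec (w x).2) ⁻¹' {0} with hs
  have hcl : IsClosed s :=
    (continuous_gVec.comp_continuousOn (continuous_snd.comp_continuousOn hw.continuousOn)
      ).preimage_isClosed_of_isClosed isClosed_Ici isClosed_singleton
  -- Without a perfect fit the path would stay in the chain forever, where τ is bounded.
  have hne : s.Nonempty := by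
    by_contra hcon
    have hno : ∀ x, 0 ≤ x → gVec (w x).2 ≠ 0 := fun x hx h => hcon ⟨x, hx, h⟩
    obtain ⟨x, hx1, hx2⟩ := ((hw.lim.eventually_gt_atTop (∑ i ∈ Finset.range (K + 1), τ i)).and
      (eventually_ge_atTop 0)).exists
    obtain ⟨k, hk, hm⟩ := hw.mem_chain hγ hC hgK hy hz (T := x) (fun x hx _ => hno x hx) x
      ⟨hx2, le_rfl⟩
    exact absurd hx1 (not_lt.2
      (hC.le_sum hγ hgK hz (hw.pos x hx2) (hw.surf_eq x hx2) hk hm))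
  have hbb : BddBelow s := ⟨0, fun x hx => hx.1⟩
  have hT := hcl.isLeast_csInf hne hbb
  exact ⟨sInf s, hT.1.1, hT.1.2, fun x hx hlt h => absurd (hT.2 ⟨hx, h⟩) (not_le.2 hlt)⟩

theorem ParamPath.graph_eq (hγ : 0 < γ) (hC : Chain X y γ K H τ)
    (hgK : gVec (line X γ (H K) (zTilde X y) (τ K)) = 0) (hy : Generic X γ (zTilde X y))
    (hz : zTilde X y ≠ 0) (hw : ParamPath X y γ v w) {T : ℝ} (hT0 : 0 ≤ T)
    (hTg : gVec (w T).2 = 0) (hT : ∀ x, 0 ≤ x → x < T → gVec (w x).2 ≠ 0) :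
    v '' Icc 0 T ∪ trivialRay X y =
      (trailData X y γ K H τ).curve '' Icc 0 (K : ℝ) ∪ trivialRay X y := by
  have hmem := hw.mem_chain hγ hC hgK hy hz hT
  obtain ⟨Φ, hΦc, hΦ⟩ := hC.exists_coord hγ hgK hy hz hw isClosed_Icc
    (fun x hx => hx.1) (fun x hx => Or.inl (hmem x hx))
  have h0 : (0 : ℝ) ∈ Icc 0 T := ⟨le_rfl, hT0⟩
  have hT1 : T ∈ Icc 0 T := ⟨hT0, le_rfl⟩
  have hΦT : Φ T = K := by
    obtain ⟨i, hi, hx⟩ := hmem T hT1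
    obtain ⟨rfl, h4⟩ := hC.eq_last_of_perfect hγ hy hz (hw.pos T hT0) (hw.surf_eq T hT0) hi hx hTg
    have hτ := hC.tau_pos i le_rfl
    rw [(hΦ T hT1).2.2.1 ⟨h4.ge, hTg, ?_⟩, h4, mul_div_cancel_right₀ _ hτ.ne']
    rw [h4, div_self hτ.ne', one_smul, ← h4,
      ← eq_line hγ (hC.good i le_rfl).det hx (hw.surf_eq T hT0)]
  refine image_union_eq isPreconnected_Icc hΦc h0 ((hΦ 0 h0).2.2.2 hw.start)
    (fun d hd => ⟨hd.1, T, hT1, hd.2.trans hΦT.ge⟩) (hC.curve_zero hγ hgK hz) fun x hx => ?_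
  rcases (hΦ x hx).1 with h | h
  · exact Or.inl h
  · exact Or.inr ⟨⟨h.1, (hΦ x hx).2.1 (hmem x hx)⟩, h.2⟩

/-! ### The whole graph, if the columns of the final support are linearly independent -/

theorem two_le_of_extreme {i : ℤ} (hi : |i| = 2) {a : ℝ} (ha : a ∈ cell i) : 2 ≤ |a| := by
  rcases (abs_eq (by norm_num)).1 hi with rfl | rfl <;> norm_num [mem_cell_iff] at ha
  · exact ha.trans (le_abs_self _)
  · exact (by linarith : (2 : ℝ) ≤ -a).trans (neg_le_abs _)

theorem gFun_eq_zero_of_two_le {a : ℝ} (ha : 2 ≤ |a|) : gFun a = 0 := by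
  rcases le_abs.1 ha with h | h
  · rw [gFun_of_mem (i := 2) (by norm_num [mem_cell_iff]; exact h)]; simp [gSlope, gConst]
  · rw [gFun_of_mem (i := -2) (by norm_num [mem_cell_iff]; linarith)]; simp [gSlope, gConst]

theorem abs_bFun_of_one_le (hγ : 0 < γ) {a : ℝ} (ha : 1 ≤ |a|) :
    |bFun γ a| = γ * (|a| - 1) := by
  rcases le_abs.1 ha with h | h
  · have : bFun γ a = γ * (a - 1) := by
      rcases le_total a 2 with h2 | h2
      · rw [bFun_of_mem (i := 1) (by norm_num [mem_cell_iff]; exact ⟨h, h2⟩)]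
        simp [bSlope, bConst]; ring
      · rw [bFun_of_mem (i := 2) (by norm_num [mem_cell_iff]; exact h2)]
        simp [bSlope, bConst, show Int.sign 2 = 1 from rfl]; ring
    rw [this, abs_mul, abs_of_pos hγ, abs_of_nonneg (by linarith), abs_of_nonneg (by linarith)]
  · have : bFun γ a = γ * (a + 1) := by
      rcases le_total (-2) a with h2 | h2
      · rw [bFun_of_mem (i := -1) (by norm_num [mem_cell_iff]; exact ⟨h2, by linarith⟩)]
        simp [bSlope, bConst]; ring
      · rw [bFun_of_mem (i := -2) (by norm_num [mem_cell_iff]; exact h2)]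
        simp [bSlope, bConst, show Int.sign (-2) = -1 from rfl]; ring
    rw [this, abs_mul, abs_of_pos hγ, abs_of_nonpos (by linarith), abs_of_nonpos (by linarith)]
    ring

theorem bFun_ne_zero_of_two_le (hγ : 0 < γ) {a : ℝ} (ha : 2 ≤ |a|) : bFun γ a ≠ 0 := by
  intro h
  have := abs_le_one_of_bFun_eq_zero hγ h
  linarith

theorem bFun_eq_zero_of_mem_zero {a : ℝ} (ha : a ∈ cell 0) : bFun γ a = 0 := by
  rw [bFun_of_mem ha]; simp [bSlope, bConst]

theorem eq_zero_of_independent_support {b e : Fin p → ℝ}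
    (hind : LinearIndependent ℝ fun (j : {j // b j ≠ 0}) (i : Fin n) => X i j.1)
    (hsupp : ∀ j, b j = 0 → e j = 0) (hXe : X.mulVec e = 0) : e = 0 := by
  have hsum : ∑ j : {j // b j ≠ 0}, e j.1 • (fun i : Fin n => X i j.1) = 0 := by
    funext i
    have h1 := congrFun hXe i
    rw [Matrix.mulVec, dotProduct] at h1
    rw [Finset.sum_apply]
    change ∑ j : {j // b j ≠ 0}, e j.1 * X i j.1 = 0
    have h2 := Fintype.sum_subtype_add_sum_subtype (fun j => b j ≠ 0) fun j => X i j * e j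
    rw [Finset.sum_eq_zero (s := (Finset.univ : Finset {j // ¬ b j ≠ 0})), add_zero] at h2
    · refine Eq.trans ?_ (h2.trans h1)
      exact Finset.sum_congr rfl fun j _ => mul_comm (e j.1) (X i j.1)
    · rintro ⟨j, hj⟩ -
      push Not at hj
      simp only [hsupp j hj, mul_zero]
  have h4 := Fintype.linearIndependent_iff.1 hind (fun j => e j.1) hsum
  funext j
  by_cases hj : b j = 0
  · exact hsupp j hj
  · exact h4 ⟨j, hj⟩

/-- Near a perfect fit with independent support columns, in a box without indicators `±1`, the
solutions are perfect fits. -/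
theorem perfect_of_near (hn : 0 < n) (hγ : 0 < γ) {b : Fin p → ℝ} {c s t' : ℝ} {u' : Fin p → ℝ}
    (hind : LinearIndependent ℝ fun (j : {j // b j ≠ 0}) (i : Fin n) => X i j.1)
    (hs0 : s ≠ 0) (hb : (gram X).mulVec b = s • zTilde X y) (hc : c ≠ 0) (hub : bVec γ u = c • b)
    (hη : ∀ j, |η j| ≠ 1) (hu : u ∈ Box η) (hu' : u' ∈ Box η)
    (hs : surf X γ u' = t' • zTilde X y) : gVec u' = 0 ∧ bVec γ u' = (t' / s) • b := by
  have hdich : ∀ j, (2 ≤ |u j| ∧ 2 ≤ |u' j|) ∨ (u j ∈ cell 0 ∧ u' j ∈ cell 0) := by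
    intro j
    have h1 := hu j
    have h2 := hu' j
    rcases int_abs_le_two (range_of_mem_Box hu j) with h | h | h | h | h
    · rw [h] at h1 h2; exact Or.inr ⟨h1, h2⟩
    · exact absurd (by simp [h]) (hη j)
    · exact Or.inl ⟨two_le_of_extreme (by simp [h]) h1, two_le_of_extreme (by simp [h]) h2⟩
    · exact absurd (by simp [h]) (hη j)
    · exact Or.inl ⟨two_le_of_extreme (by simp [h]) h1, two_le_of_extreme (by simp [h]) h2⟩
  have hsupp : ∀ j, b j = 0 → bVec γ u' j = 0 := by
    intro j hj
    rcases hdich j with h | h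
    · refine absurd ?_ (bFun_ne_zero_of_two_le hγ h.1)
      have := congrFun hub j
      rw [Pi.smul_apply, hj, smul_zero] at this
      exact this
    · exact bFun_eq_zero_of_mem_zero h.2
  have hg : ∀ j, b j ≠ 0 → gVec u' j = 0 := by
    intro j hj
    rcases hdich j with h | h
    · exact gFun_eq_zero_of_two_le h.2
    · exfalso
      have := congrFun hub j
      rw [Pi.smul_apply, smul_eq_mul] at this
      exact mul_ne_zero hc hj (this.symm.trans (bFun_eq_zero_of_mem_zero h.1))
  -- The deviation e from the scaled perfect fit satisfies g + Σe = 0. It is supported where b is,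
  -- and there g = 0, so e'Σe = 0 and Xe = 0; independence of the support columns gives e = 0.
  set e := bVec γ u' - (t' / s) • b with he
  have hge : gVec u' + (gram X).mulVec e = 0 := by
    rw [he, Matrix.mulVec_sub, Matrix.mulVec_smul, hb, smul_smul, div_mul_cancel₀ _ hs0, ← hs, surf]
    abel
  have hdot : e ⬝ᵥ gVec u' = 0 := by
    refine Finset.sum_eq_zero fun j _ => ?_
    by_cases hj : b j = 0
    · simp [he, hj, hsupp j hj]
    · simp [hg j hj]
  have hXe : X.mulVec e = 0 := by
    have h1 : e ⬝ᵥ (gram X).mulVec e = 0 := by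
      have := congrArg (e ⬝ᵥ ·) hge
      simpa [dotProduct_add, hdot] using this
    rw [dotProduct_gram_mulVec] at h1
    have hn' : (1 / (n : ℝ)) ≠ 0 := by positivity
    exact dotProduct_self_eq_zero.1 ((mul_eq_zero.1 h1).resolve_left hn')
  have he0 : e = 0 :=
    eq_zero_of_independent_support hind (fun j hj => by simp [he, hj, hsupp j hj]) hXe
  refine ⟨?_, sub_eq_zero.1 (he ▸ he0)⟩
  rw [he0, Matrix.mulVec_zero, add_zero] at hge
  exact hge

end

theorem zero_or_two_le_of_gFun_eq_zero {a : ℝ} (h : gFun a = 0) : a = 0 ∨ 2 ≤ |a| := by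
  obtain ⟨i, hi⟩ := exists_mem_cell a
  rcases int_abs_le_two (abs_le_two_of_mem_cell hi) with rfl | rfl | rfl | rfl | rfl
  · left; rw [gFun_of_mem hi] at h; simpa [gSlope, gConst] using h
  · right
    rw [eq_two_of_gFun_eq_zero hi rfl (by rw [← gFun_of_mem hi]; exact h)]; norm_num
  · exact Or.inr (two_le_of_extreme rfl hi)
  · right
    rw [eq_two_of_gFun_eq_zero hi rfl (by rw [← gFun_of_mem hi]; exact h)]; norm_num
  · exact Or.inr (two_le_of_extreme rfl hi)

theorem abs_eq_two_of_gFun_eq_zero {i : ℤ} {a : ℝ} (hi : |i| = 1) (ha : a ∈ cell i)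
    (h : gFun a = 0) : |a| = 2 := by
  rw [eq_two_of_gFun_eq_zero ha hi (by rw [← gFun_of_mem ha]; exact h), abs_mul, ← Int.cast_abs, hi]
  simp

section
variable {K : ℕ} {H : ℕ → Fin p → ℤ} {τ : ℕ → ℝ} {u : Fin p → ℝ} {t : ℝ}
  {v w : ℝ → ℝ × (Fin p → ℝ)}

/-- If the columns of the final support are independent, then only one coefficient is at the knot
`γ` at the end of a chain. -/
theorem Chain.two_unique (hn : 0 < n) (hγ : 0 < γ) (hC : Chain X y γ K H τ)
    (hy : Generic X γ (zTilde X y))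
    (hind : LinearIndependent ℝ fun (j : {j // bVec γ (line X γ (H K) (zTilde X y) (τ K)) j ≠ 0})
      (i : Fin n) => X i j.1) {i j : Fin p}
    (hi : |line X γ (H K) (zTilde X y) (τ K) i| = 2)
    (hj : |line X γ (H K) (zTilde X y) (τ K) j| = 2) : i = j := by
  by_contra hij
  obtain ⟨hiA, hjA, α, β, -, hβ, hrel⟩ := hy.tie_relation hn hγ (hC.good K le_rfl)
    (hC.tau_pos K le_rfl).ne' hij (Or.inr hi) (Or.inr hj)
  -- All columns in play have nonzero coefficients and are independent. Hence some w is orthogonal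
  -- to x_j and to the extreme columns but not to x_i, contradicting the proportional correlations
  -- forced by two simultaneous ties.
  obtain ⟨w, h1, h2⟩ := exists_orthogonal (X := X) (A := insert j (extremes (H K)))
    (x := X.mulVec (Pi.single i 1)) (by
      intro c hc h
      have hiA' : i ∉ insert j (extremes (H K)) := by simp [hij, hiA]
      have := eq_zero_of_independent_support (e := c - Pi.single i 1) hind (by
        intro k hk
        have hki : k ≠ i := by
          rintro rfl
          exact bFun_ne_zero_of_two_le hγ hi.ge hk
        have hkA : k ∉ insert j (extremes (H K)) := by
          intro hkA
          rcases Finset.mem_insert.1 hkA with rfl | hkA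
          · exact bFun_ne_zero_of_two_le hγ hj.ge hk
          · exact bFun_ne_zero_of_two_le hγ
              (two_le_of_extreme (mem_extremes.1 hkA) (hC.mem K le_rfl k)) hk
        simp [hc k hkA, hki]) (by rw [Matrix.mulVec_sub, h, sub_self])
      have := congrFun this i
      simp [hc i hiA'] at this)
  rw [← transpose_mulVec_eq] at h2
  have := hrel w fun k hk => h1 k (Finset.mem_insert_of_mem hk)
  rw [h1 j (Finset.mem_insert_self _ _), h2] at this
  simp at this
  exact hβ this

/-- Solutions near the ray cannot leave it except back into the last box. At the beginning of the
ray the only tie is one coefficient at its knot, so any other nearby box has that coordinate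
extreme. Further out no coefficient is at a knot. In both cases `perfect_of_near` applies. -/
theorem Chain.eventually_mem_ray (hn : 0 < n) (hγ : 0 < γ) (hC : Chain X y γ K H τ)
    (hgK : gVec (line X γ (H K) (zTilde X y) (τ K)) = 0) (hy : Generic X γ (zTilde X y))
    (hind : LinearIndependent ℝ fun (j : {j // bVec γ (line X γ (H K) (zTilde X y) (τ K)) j ≠ 0})
      (i : Fin n) => X i j.1) {q : ℝ × (Fin p → ℝ)} (hq : q ∈ rayPiece X y γ K H τ) :
    ∀ᶠ q' in 𝓝 q, surf X γ q'.2 = q'.1 • zTilde X y →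
      q'.2 ∈ Box (H K) ∨ q' ∈ rayPiece X y γ K H τ := by
  obtain ⟨h1, h2, h3⟩ := hq
  set V := line X γ (H K) (zTilde X y) (τ K) with hV
  have hτ := hC.tau_pos K le_rfl
  have hVm : V ∈ Box (H K) := hC.mem K le_rfl
  have hgram : (gram X).mulVec (bVec γ V) = τ K • zTilde X y := by
    have := surf_line hγ (hC.good K le_rfl).det hVm
    rwa [surf, ← hV, hgK, zero_add] at this
  have ht : 0 < q.1 := lt_of_lt_of_le hτ h1
  have hc : q.1 / τ K ≠ 0 := (div_pos ht hτ).ne'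
  have hbox := (continuous_snd.tendsto q).eventually (eventually_Box q.2)
  rcases h1.eq_or_lt with h1 | h1
  · have hqV : q.2 = V := by
      refine eq_of_gVec_bVec hγ (h2.trans hgK.symm) ?_
      rw [h3, ← h1, div_self hτ.ne', one_smul]
    filter_upwards [hbox, (continuous_fst.tendsto q).eventually (lt_mem_nhds ht)] with q' hq' hpos hs
    obtain ⟨η, hη⟩ := exists_mem_Box q'.2
    by_cases he : η = H K
    · left; rwa [← he]
    right
    have hVη := hq' η hη
    rw [hqV] at hVη
    obtain ⟨j, hj⟩ := Function.ne_iff.1 he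
    obtain ⟨j₀, hj1, hj2⟩ := hy.exists_tie hγ (hC.good K le_rfl) hτ.ne' hVm hgK
    change V j₀ = _ at hj2
    have hj3 : |V j₀| = 2 := by
      rw [hj2, abs_mul, ← Int.cast_abs, hj1]; simp
    have htie : ∀ l, IsTie (V l) → l = j₀ := by
      intro l hl
      refine hC.two_unique hn hγ hy hind ?_ hj3
      rcases hl with hl | hl
      · rcases zero_or_two_le_of_gFun_eq_zero (congrFun hgK l) with h | h
        · rw [h] at hl; simp at hl
        · linarith
      · exact hl
    obtain rfl : j = j₀ := by
      by_contra hne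
      exact hj (not_isTie_imp_eq (hVm j) (fun h => hne (htie j h)) (hVη j))
    have hj4 : |η j| = 2 := by
      have h5 := hVη j
      rw [hj2] at h5
      rcases (abs_eq zero_le_one).1 hj1 with h | h <;> rw [h] at hj h5 <;>
        rcases int_abs_le_two (range_of_mem_Box hVη j) with h6 | h6 | h6 | h6 | h6 <;>
        first
        | (simp [h6]; done)
        | exact absurd h6 hj
        | (exfalso; rw [h6] at hj h5; norm_num [mem_cell_iff] at hj h5; done)
    have hη1 : ∀ l, |η l| ≠ 1 := by
      intro l hl
      have h5 := abs_eq_two_of_gFun_eq_zero hl (hVη l) (congrFun hgK l)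
      obtain rfl := htie l (Or.inr h5)
      omega
    obtain ⟨h5, h6⟩ := perfect_of_near hn hγ hind hτ.ne' hgram one_ne_zero (one_smul ℝ _).symm
      hη1 hVη hη hs
    refine ⟨?_, h5, h6⟩
    -- The coefficient that was at the knot now satisfies |b_j| ≥ γ. Comparison with its value at
    -- the vertex gives τ ≥ τ K, so the point lies on the ray itself and not on its backward
    -- extension.
    have h7 := congrArg abs (congrFun h6 j)
    rw [Pi.smul_apply, smul_eq_mul, abs_mul] at h7
    change |bFun γ (q'.2 j)| = |q'.1 / τ K| * |bFun γ (V j)| at h7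
    have h8 := two_le_of_extreme hj4 (hη j)
    rw [abs_bFun_of_one_le hγ (by linarith), abs_bFun_of_one_le hγ (by linarith), hj3, abs_of_pos (div_pos hpos hτ)] at h7
    refine (one_le_div hτ).1 ?_
    by_contra hlt
    push Not at hlt
    nlinarith
  · filter_upwards [hbox, (continuous_fst.tendsto q).eventually (lt_mem_nhds h1)] with q' hq' hlt hs
    right
    obtain ⟨η, hη⟩ := exists_mem_Box q'.2
    have hqη := hq' η hη
    -- Strictly beyond the vertex the nonzero coefficients exceed γ in modulus, so none is at a
    -- knot.
    have hη1 : ∀ l, |η l| ≠ 1 := by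
      intro l hl
      have h5 := abs_eq_two_of_gFun_eq_zero hl (hqη l) (congrFun h2 l)
      have h6 := congrArg abs (congrFun h3 l)
      rw [Pi.smul_apply, smul_eq_mul, abs_mul, abs_of_pos (div_pos ht hτ)] at h6
      change |bFun γ (q.2 l)| = q.1 / τ K * |bFun γ (V l)| at h6
      have h7 : 1 < q.1 / τ K := (one_lt_div hτ).2 h1
      rw [abs_bFun_of_one_le hγ (by linarith), h5] at h6
      rcases zero_or_two_le_of_gFun_eq_zero (congrFun hgK l) with h | h
      · rw [h, bFun_eq_zero_of_mem_zero (by norm_num [mem_cell_iff])] at h6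
        norm_num at h6
        linarith
      · rw [abs_bFun_of_one_le hγ (by linarith)] at h6
        have h8 : γ * 1 ≤ γ * (|V l| - 1) := mul_le_mul_of_nonneg_left (by linarith) hγ.le
        nlinarith
    obtain ⟨h5, h6⟩ := perfect_of_near hn hγ hind hτ.ne' hgram hc h3 hη1 hqη hη hs
    exact ⟨le_of_lt hlt, h5, h6⟩

theorem ParamPath.mem_chain_or_ray (hn : 0 < n) (hγ : 0 < γ) (hC : Chain X y γ K H τ)
    (hgK : gVec (line X γ (H K) (zTilde X y) (τ K)) = 0) (hy : Generic X γ (zTilde X y))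
    (hz : zTilde X y ≠ 0)
    (hind : LinearIndependent ℝ fun (j : {j // bVec γ (line X γ (H K) (zTilde X y) (τ K)) j ≠ 0})
      (i : Fin n) => X i j.1) (hw : ParamPath X y γ v w) {x : ℝ} (hx : 0 ≤ x) :
    (∃ k ≤ K, (w x).2 ∈ Box (H k)) ∨ w x ∈ rayPiece X y γ K H τ := by
  set P : Set (ℝ × (Fin p → ℝ)) := {q | (∃ k ≤ K, q.2 ∈ Box (H k)) ∨ q ∈ rayPiece X y γ K H τ}
  have hcl : IsClosed (w ⁻¹' P ∩ Icc 0 x) := by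
    have h1 : IsClosed P := by
      have : P = (⋃ k ∈ Finset.range (K + 1), Prod.snd ⁻¹' Box (H k)) ∪ rayPiece X y γ K H τ := by
        ext u; simp [P]
      rw [this]
      exact (isClosed_biUnion_finset fun k _ => (isClosed_Box _).preimage continuous_snd).union
        isClosed_rayPiece
    rw [inter_comm]
    exact (hw.continuousOn.mono Icc_subset_Ici_self).preimage_isClosed_of_isClosed isClosed_Icc h1
  have := hcl.Icc_subset_of_forall_mem_nhdsWithin
    (Or.inl ⟨0, Nat.zero_le _, hw.mem_start hγ hC⟩) (by
    rintro x' ⟨hx', hx0, hxT⟩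
    have hcont : Tendsto w (𝓝[>] x') (𝓝 (w x')) :=
      (hw.continuousOn x' hx0).mono_left
        (nhdsWithin_mono _ fun x'' hx'' => le_trans hx0 (le_of_lt hx''))
    have hsol : ∀ᶠ x'' in 𝓝[>] x', surf X γ (w x'').2 = (w x'').1 • zTilde X y := by
      filter_upwards [self_mem_nhdsWithin] with x'' hx''
      exact hw.surf_eq x'' (hx0.trans (le_of_lt hx''))
    have hray : w x' ∈ rayPiece X y γ K H τ → w ⁻¹' P ∈ 𝓝[>] x' := by
      intro hr
      filter_upwards [hcont.eventually (hC.eventually_mem_ray hn hγ hgK hy hind hr), hsol]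
        with x'' h1 h2
      rcases h1 h2 with h | h
      · exact Or.inl ⟨K, le_rfl, h⟩
      · exact Or.inr h
    rcases hx' with ⟨i, hi, hx'⟩ | hr
    · have hp := hw.pos x' hx0
      have hs := hw.surf_eq x' hx0
      by_cases hg : gVec (w x').2 = 0
      · obtain ⟨rfl, h4⟩ := hC.eq_last_of_perfect hγ hy hz hp hs hi hx' hg
        refine hray ⟨h4.ge, hg, ?_⟩
        rw [h4, div_self (hC.tau_pos i le_rfl).ne', one_smul, ← h4,
          ← eq_line hγ (hC.good i le_rfl).det hx' hs]
      · have hev := hC.eventually_mem hγ hy hz hgK hp hs hi hx' hg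
        filter_upwards [((continuous_snd.tendsto _).comp hcont).eventually hev] with x'' h
        exact Or.inl h
    · exact hray hr)
  exact this ⟨hx, le_rfl⟩

theorem Chain.isUniqueBranch (hn : 0 < n) (hγ : 0 < γ) (hC : Chain X y γ K H τ)
    (hgK : gVec (line X γ (H K) (zTilde X y) (τ K)) = 0) (hy : Generic X γ (zTilde X y))
    (hz : zTilde X y ≠ 0) : IsUniqueBranch X y γ (trailData X y γ K H τ) := by
  intro v hv
  obtain ⟨w, hw⟩ := hv.exists_paramPath hγ
  have hperf : ∀ x, 0 ≤ x → (PerfectFit X y (v x).2 ↔ gVec (w x).2 = 0) := by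
    intro x hx
    rw [hw.eq x hx]
    exact perfectFit_iff_gVec hn (hw.pos x hx) (hw.surf_eq x hx)
  constructor
  · obtain ⟨T, hT0, hTg, hT⟩ := hw.exists_first hγ hC hgK hy hz
    exact ⟨T, hT0, (hperf T hT0).2 hTg, fun x h1 h2 h => hT x h1 h2 ((hperf x h1).1 h),
      hw.graph_eq hγ hC hgK hy hz hT0 hTg hT⟩
  · intro hind
    have hmem := fun x hx => hw.mem_chain_or_ray hn hγ hC hgK hy hz hind (x := x) hx
    obtain ⟨Φ, hΦc, hΦ⟩ := hC.exists_coord hγ hgK hy hz hw isClosed_Ici (fun x hx => hx)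
      (fun x hx => hmem x hx)
    have hτ := hC.tau_pos K le_rfl
    have hK : (0 : ℝ) < K := by exact_mod_cast (hC.trail hγ hgK).length_pos hγ hz
    refine image_union_eq isPreconnected_Ici hΦc self_mem_Ici ((hΦ 0 self_mem_Ici).2.2.2 hw.start)
      (fun d hd => ⟨hd, ?_⟩) (hC.curve_zero hγ hgK hz) fun x hx => (hΦ x hx).1
    obtain ⟨x, hx1, hx2, hx3⟩ := ((hw.lim.eventually_gt_atTop
      (∑ i ∈ Finset.range (K + 1), τ i)).and ((hw.lim.eventually_ge_atTop (d * τ K / K)).and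
      (eventually_ge_atTop 0))).exists
    refine ⟨x, hx3, ?_⟩
    rcases hmem x hx3 with ⟨k, hk, h⟩ | h
    · exact absurd hx1 (not_lt.2 (hC.le_sum hγ hgK hz (hw.pos x hx3) (hw.surf_eq x hx3) hk h))
    · rw [(hΦ x hx3).2.2.1 h, le_div_iff₀ hτ]
      rw [div_le_iff₀ hK] at hx2
      linarith

end

/-! ### Walks and their limits -/

/-- A sequence of adjacent segments, possibly degenerate or repeated, that leads from the trivial
solutions to a perfect fit. -/
structure Walk (X : Matrix (Fin n) (Fin p) ℝ) (y : Fin n → ℝ) (γ : ℝ) (K : ℕ)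
    (H : ℕ → Fin p → ℤ) (τ : ℕ → ℝ) : Prop where
  eta_zero : H 0 = 0
  tau_zero : τ 0 = 1 / ⨆ j, |zTilde X y j|
  good : ∀ k ≤ K, Good X γ (H k)
  tau_pos : ∀ k ≤ K, 0 < τ k
  mem : ∀ k ≤ K, line X γ (H k) (zTilde X y) (τ k) ∈ Box (H k)
  seg : ∀ k < K, ival X γ (H (k + 1)) (zTilde X y) = uIcc (τ k) (τ (k + 1))
  join : ∀ k < K, line X γ (H (k + 1)) (zTilde X y) (τ k) = line X γ (H k) (zTilde X y) (τ k)
  perfect : gVec (line X γ (H K) (zTilde X y) (τ K)) = 0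

section
variable {K : ℕ} {H : ℕ → Fin p → ℤ} {τ : ℕ → ℝ}

theorem Chain.walk (hγ : 0 < γ) (hC : Chain X y γ K H τ)
    (hg : gVec (line X γ (H K) (zTilde X y) (τ K)) = 0) : Walk X y γ K H τ where
  eta_zero := hC.eta_zero
  tau_zero := hC.tau_zero
  good := hC.good
  tau_pos := hC.tau_pos
  mem := hC.mem
  seg := hC.seg
  join _ hk := hC.line_next hγ hk
  perfect := hg

theorem Walk.congr {H' : ℕ → Fin p → ℤ} (hW : Walk X y γ K H τ) (h : ∀ k ≤ K, H' k = H k) :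
    Walk X y γ K H' τ where
  eta_zero := by rw [h 0 (Nat.zero_le _), hW.eta_zero]
  tau_zero := hW.tau_zero
  good k hk := by rw [h k hk]; exact hW.good k hk
  tau_pos := hW.tau_pos
  mem k hk := by rw [h k hk]; exact hW.mem k hk
  seg k hk := by rw [h _ hk]; exact hW.seg k hk
  join k hk := by rw [h _ hk, h k hk.le]; exact hW.join k hk
  perfect := by rw [h K le_rfl]; exact hW.perfect

/-- The interval of the indicator 0 contains τ = 0, whereas later segments have positive ends. -/
theorem Walk.eta_succ_ne_zero (hγ : 0 < γ) (hW : Walk X y γ K H τ) (hz : zTilde X y ≠ 0) {k : ℕ}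
    (hk : k < K) : H (k + 1) ≠ 0 := by
  intro h0
  have hg := hW.good (k + 1) hk
  have hs := hW.seg k hk
  rw [h0] at hg hs
  rw [ival_zero hγ hg hz] at hs
  have h1 : (0 : ℝ) ∈ Icc 0 (1 / ⨆ j, |zTilde X y j|) :=
    ⟨le_rfl, (one_div_pos.2 (iSup_abs_pos hz)).le⟩
  rw [hs, mem_uIcc] at h1
  have h2 := hW.tau_pos k hk.le
  have h3 := hW.tau_pos (k + 1) hk
  rcases h1 with h | h <;> linarith [h.1]

/-- A walk whose data agree with those of a shorter sequence up to step `i` stops there if it has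
reached a perfect fit. -/
theorem Walk.truncate (hW : Walk X y γ K H τ) {i : ℕ} (hi : i ≤ K)
    (hg : gVec (line X γ (H i) (zTilde X y) (τ i)) = 0) : Walk X y γ i H τ where
  eta_zero := hW.eta_zero
  tau_zero := hW.tau_zero
  good k hk := hW.good k (hk.trans hi)
  tau_pos k hk := hW.tau_pos k (hk.trans hi)
  mem k hk := hW.mem k (hk.trans hi)
  seg k hk := hW.seg k (lt_of_lt_of_le hk hi)
  join k hk := hW.join k (lt_of_lt_of_le hk hi)
  perfect := hg

theorem Walk.surf_eq (hγ : 0 < γ) (hW : Walk X y γ K H τ) {k : ℕ} (hk : k ≤ K) :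
    surf X γ (line X γ (H k) (zTilde X y) (τ k)) = τ k • zTilde X y :=
  surf_line hγ (hW.good k hk).det (hW.mem k hk)

/-- Cutting out a loop. -/
theorem Walk.shortcut (hγ : 0 < γ) (hz : zTilde X y ≠ 0) (hW : Walk X y γ K H τ) {i k : ℕ}
    (hik : i < k) (hk : k ≤ K)
    (h : line X γ (H i) (zTilde X y) (τ i) = line X γ (H k) (zTilde X y) (τ k)) :
    ∃ K' < K, ∃ H' τ', Walk X y γ K' H' τ' := by
  have hτ : τ i = τ k := by
    refine eq_of_smul_eq hz ?_
    rw [← hW.surf_eq hγ (by omega), ← hW.surf_eq hγ hk, h]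
  set m := k - i with hm
  have e1 : ∀ l ≤ i, (if l ≤ i then l else l + m) = l := fun l hl => if_pos hl
  have e2 : ∀ l, i < l → (if l ≤ i then l else l + m) = l + m := fun l hl => if_neg (by omega)
  -- The reindexing omits the steps i + 1, …, k; the step after i uses the segment that followed k.
  set f : ℕ → ℕ := fun l => if l ≤ i then l else l + m with hf
  have hfK : ∀ l ≤ K - m, f l ≤ K := by
    intro l hl; simp only [hf]; split_ifs <;> omega
  have hstep : ∀ l < K - m, (f (l + 1) = f l + 1 ∧ f l < K) ∨
      (l = i ∧ f l = i ∧ f (l + 1) = k + 1 ∧ k < K) := by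
    intro l hl
    simp only [hf]
    split_ifs <;> omega
  refine ⟨K - m, by omega, fun l => H (f l), fun l => τ (f l), ?_, ?_, fun l hl => hW.good _ (hfK l hl),
    fun l hl => hW.tau_pos _ (hfK l hl), fun l hl => hW.mem _ (hfK l hl), ?_, ?_, ?_⟩
  · rw [show f 0 = 0 from e1 0 (Nat.zero_le _)]; exact hW.eta_zero
  · rw [show f 0 = 0 from e1 0 (Nat.zero_le _)]; exact hW.tau_zero
  · intro l hl
    rcases hstep l hl with ⟨h1, h2⟩ | ⟨-, h1, h2, h3⟩
    · simp only [h1]; exact hW.seg _ h2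
    · simp only [h1, h2, hτ]; exact hW.seg _ h3
  · intro l hl
    rcases hstep l hl with ⟨h1, h2⟩ | ⟨-, h1, h2, h3⟩
    · simp only [h1]; exact hW.join _ h2
    · simp only [h1, h2]; rw [h, hτ]; exact hW.join _ h3
  · rcases Nat.lt_or_ge i (K - m) with h1 | h1
    · have : f (K - m) = K := by rw [show f (K - m) = K - m + m from e2 _ h1]; omega
      simp only [this]; exact hW.perfect
    · have h2 : f (K - m) = i := by rw [show f (K - m) = K - m from e1 _ (by omega)]; omega
      have h3 : k = K := by omega
      simp only [h2]; rw [h, h3]; exact hW.perfect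

/-- Induction on the length: the walk is stopped at an earlier perfect fit, or cut between two equal
vertices. A degenerate segment is a loop of one step, so what remains has distinct consecutive τ. -/
theorem Walk.exists_trail (hγ : 0 < γ) (hz : zTilde X y ≠ 0) (hW : Walk X y γ K H τ) :
    ∃ K' H' τ', Trail X y γ K' H' τ' := by
  induction K using Nat.strong_induction_on generalizing H τ with
  | _ K ih =>
  by_cases h1 : ∃ i < K, gVec (line X γ (H i) (zTilde X y) (τ i)) = 0
  · obtain ⟨i, hi, hg⟩ := h1
    exact ih i hi (hW.truncate hi.le hg)
  by_cases h2 : ∃ i k, i < k ∧ k ≤ K ∧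
      line X γ (H i) (zTilde X y) (τ i) = line X γ (H k) (zTilde X y) (τ k)
  · obtain ⟨i, k, hik, hk, h⟩ := h2
    obtain ⟨K', hK', H', τ', hW'⟩ := hW.shortcut hγ hz hik hk h
    exact ih K' hK' hW'
  push Not at h1 h2
  refine ⟨K, H, τ, hW.eta_zero, hW.tau_zero, hW.good, hW.tau_pos, hW.mem, hW.seg, ?_, hW.join, ?_,
    h1, hW.perfect⟩
  · intro k hk h
    exact h2 k (k + 1) (by omega) hk (by rw [← hW.join k hk, h])
  · intro i hi k hk h
    rcases lt_trichotomy i k with h' | h' | h'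
    · exact absurd h (h2 i k h' hk)
    · exact h'
    · exact absurd h.symm (h2 k i h' hi)

end

theorem iSup_abs_eq_norm [Nonempty (Fin p)] (z : Fin p → ℝ) : ⨆ j, |z j| = ‖z‖ := by
  apply le_antisymm
  · exact ciSup_le fun j => norm_le_pi_norm z j
  · refine (pi_norm_le_iff_of_nonempty z).2 fun j => ?_
    exact le_ciSup (f := fun j => |z j|) (finite_range _).bddAbove j

theorem nonempty_of_ne_zero {z : Fin p → ℝ} (hz : z ≠ 0) : Nonempty (Fin p) :=
  ⟨(Function.ne_iff.1 hz).choose⟩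

section
variable {ι : Type*} {F : Filter ι} {Z : ι → Fin p → ℝ} {z : Fin p → ℝ}

theorem tendsto_line (hZ : Tendsto Z F (𝓝 z)) {s : ι → ℝ} {t : ℝ} (hs : Tendsto s F (𝓝 t)) :
    Tendsto (fun i => line X γ η (Z i) (s i)) F (𝓝 (line X γ η z t)) :=
  ((continuous_line (X := X) (γ := γ) (η := η)).tendsto (t, z)).comp (f := fun i => (s i, Z i))
    (hs.prodMk_nhds hZ)

/-- Interior points of the limit segment belong to the nearby segments. -/
theorem eventually_mem_ival (hZ : Tendsto Z F (𝓝 z)) {s₁ s₀ s₂ : ℝ} (h1 : s₁ ∈ ival X γ η z)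
    (h2 : s₂ ∈ ival X γ η z) (h01 : s₁ < s₀) (h02 : s₀ < s₂) (hpos : 0 < s₀)
    (hne : ∀ᶠ i in F, ∃ s, 0 < s ∧ s ∈ ival X γ η (Z i)) : ∀ᶠ i in F, s₀ ∈ ival X γ η (Z i) := by
  have h0 : s₀ ∈ ival X γ η z := (convex_ival z).ordConnected.out h1 h2 ⟨h01.le, h02.le⟩
  have hlim : ∀ j, Tendsto (fun i => line X γ η (Z i) s₀ j) F (𝓝 (line X γ η z s₀ j)) := fun j =>
    ((continuous_apply j).tendsto _).comp (tendsto_line hZ tendsto_const_nhds)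
  have key : ∀ j, ∀ᶠ i in F, line X γ η (Z i) s₀ j ∈ cell (η j) := by
    intro j
    by_cases hj : IsTie (line X γ η z s₀ j)
    · obtain ⟨σ, hσ⟩ := exists_crossing (h0.2 j) hj
      have e1 := hσ.side _ (h1.2 j)
      have e2 := hσ.side _ (h2.2 j)
      rw [line_sub] at e1 e2
      -- An interior point of the limit segment with a tie has this coordinate constant along the
      -- line, with the tie value as base value.
      have hd : (σ : ℝ) * dir X γ η z j = 0 := by
        have h1' : 0 < s₀ - s₁ := sub_pos.2 h01
        have h2' : 0 < s₂ - s₀ := sub_pos.2 h02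
        apply le_antisymm <;> nlinarith
      have hd' : dir X γ η z j = 0 := by
        rcases hσ.sign with rfl | rfl <;> simpa using hd
      have hbase : line X γ η z s₀ j = base X γ η j := by rw [line_apply, hd', mul_zero, zero_add]
      filter_upwards [(hlim j).eventually hσ.near, hne] with i hi ⟨s, hs, hsi⟩
      refine hi ?_
      have e3 := hσ.side _ (hsi.2 j)
      rw [hbase, line_apply, add_sub_cancel_right] at e3 ⊢
      -- The base does not depend on z, so every nearby line starts at the tie at τ = 0. One point
      -- of the nearby segment with s > 0 reveals on which side the coordinate moves, and then the
      -- same side is taken at s₀.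
      have e4 : (σ : ℝ) * dir X γ η (Z i) j ≤ 0 := by
        by_contra hcon
        push Not at hcon
        nlinarith [mul_pos hs hcon]
      nlinarith
    · exact (hlim j).eventually (eventually_mem_cell (h0.2 j) hj)
  filter_upwards [eventually_all.2 key] with i hi
  exact ⟨hpos.le, hi⟩

/-- Ends converge into the limit interval because boxes are closed. Conversely, if the limit
interval extended beyond both limits, a point strictly in between would belong to the nearby
intervals but lie outside their ends. -/
theorem ival_eq_of_tendsto [F.NeBot] (hZ : Tendsto Z F (𝓝 z)) {a b : ι → ℝ} {A B : ℝ}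
    (ha : Tendsto a F (𝓝 A)) (hb : Tendsto b F (𝓝 B)) (hA : 0 ≤ A) (hB : 0 ≤ B)
    (hpos : ∀ᶠ i in F, 0 < a i)
    (h : ∀ᶠ i in F, ival X γ η (Z i) = uIcc (a i) (b i)) : ival X γ η z = uIcc A B := by
  have hmemA : A ∈ ival X γ η z := by
    refine ⟨hA, (isClosed_Box η).mem_of_tendsto (tendsto_line hZ ha) ?_⟩
    filter_upwards [h] with i hi
    have : a i ∈ ival X γ η (Z i) := by rw [hi]; exact left_mem_uIcc
    exact this.2
  have hmemB : B ∈ ival X γ η z := by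
    refine ⟨hB, (isClosed_Box η).mem_of_tendsto (tendsto_line hZ hb) ?_⟩
    filter_upwards [h] with i hi
    have : b i ∈ ival X γ η (Z i) := by rw [hi]; exact right_mem_uIcc
    exact this.2
  have hne : ∀ᶠ i in F, ∃ s, 0 < s ∧ s ∈ ival X γ η (Z i) := by
    filter_upwards [h, hpos] with i hi hi'
    exact ⟨a i, hi', by rw [hi]; exact left_mem_uIcc⟩
  apply Subset.antisymm
  · intro t ht
    have hM : max A B ∈ ival X γ η z := by rcases max_choice A B with h | h <;> rw [h] <;> assumption
    have hm : min A B ∈ ival X γ η z := by rcases min_choice A B with h | h <;> rw [h] <;> assumption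
    rw [uIcc, mem_Icc]
    constructor
    · by_contra hlt
      push Not at hlt
      have hlt' := lt_min_iff.1 hlt
      have hs0 : 0 < (t + min A B) / 2 := by have := ht.1; linarith
      have hev := eventually_mem_ival hZ ht hm (s₀ := (t + min A B) / 2) (by linarith) (by linarith)
        hs0 hne
      obtain ⟨i, hi, hi1, hi2, hi3⟩ := (hev.and (h.and ((ha.eventually (lt_mem_nhds
        (show (t + min A B) / 2 < A by linarith [min_le_left A B]))).and (hb.eventually (lt_mem_nhds
        (show (t + min A B) / 2 < B by linarith [min_le_right A B])))))).exists
      rw [hi1, mem_uIcc] at hi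
      rcases hi with h | h <;> linarith [h.1]
    · by_contra hlt
      push Not at hlt
      have hlt' := max_lt_iff.1 hlt
      have hs0 : 0 < (t + max A B) / 2 := by have := ht.1; linarith [le_max_left A B]
      have hev := eventually_mem_ival hZ hM ht (s₀ := (t + max A B) / 2) (by linarith) (by linarith)
        hs0 hne
      obtain ⟨i, hi, hi1, hi2, hi3⟩ := (hev.and (h.and ((ha.eventually (gt_mem_nhds
        (show A < (t + max A B) / 2 by linarith [le_max_left A B]))).and (hb.eventually (gt_mem_nhds
        (show B < (t + max A B) / 2 by linarith [le_max_right A B])))))).exists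
      rw [hi1, mem_uIcc] at hi
      rcases hi with h | h <;> linarith [h.2]
  · exact (convex_ival z).ordConnected.uIcc_subset hmemA hmemB

end

theorem exists_limit_or_tendsto_atTop {ι : Type*} (𝒰 : Ultrafilter ι) {f : ι → ℝ}
    (h0 : ∀ᶠ i in (𝒰 : Filter ι), 0 < f i) :
    (∃ t, Tendsto f 𝒰 (𝓝 t)) ∨ Tendsto f 𝒰 atTop := by
  by_cases h : ∃ M, ∀ᶠ i in (𝒰 : Filter ι), f i ≤ M
  · left
    obtain ⟨M, hM⟩ := h
    obtain ⟨t, -, ht⟩ := (isCompact_Icc (a := (0 : ℝ)) (b := M)).ultrafilter_le_nhds' (𝒰.map f) (by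
      rw [Ultrafilter.mem_map]
      filter_upwards [h0, hM] with i h1 h2 using ⟨h1.le, h2⟩)
    exact ⟨t, ht⟩
  · right
    push Not at h
    refine tendsto_atTop.2 fun M => ?_
    exact (h M).mono fun _ => le_of_lt

/-- A limit of walks contains a walk. -/
theorem Walk.limit (hn : 0 < n) (hγ : 0 < γ) (hX : Nondegenerate X) {ι : Type*} (𝒰 : Ultrafilter ι)
    {Y : ι → Fin n → ℝ} (hY : Tendsto (fun i => zTilde X (Y i)) 𝒰 (𝓝 (zTilde X y)))
    (hz : zTilde X y ≠ 0) {K : ℕ} {H : ℕ → Fin p → ℤ} {τ : ι → ℕ → ℝ}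
    (hW : ∀ᶠ i in (𝒰 : Filter ι), Walk X (Y i) γ K H (τ i)) : ∃ K' T, Walk X y γ K' H T := by
  have hne := nonempty_of_ne_zero hz
  have hzi : ∀ᶠ i in (𝒰 : Filter ι), zTilde X (Y i) ≠ 0 := hY.eventually_ne hz
  obtain ⟨i₀, hW₀, hz₀⟩ := (hW.and hzi).exists
  have hgood := hW₀.good
  have hpos : ∀ k ≤ K, ∀ᶠ i in (𝒰 : Filter ι), 0 < τ i k := fun k hk => hW.mono fun i h => h.tau_pos k hk
  have hjoin : ∀ k < K, ∀ t, Tendsto (fun i => τ i k) 𝒰 (𝓝 t) →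
      line X γ (H (k + 1)) (zTilde X y) t = line X γ (H k) (zTilde X y) t := by
    intro k hk t ht
    refine tendsto_nhds_unique (tendsto_line hY ht) ((tendsto_line hY ht).congr' ?_)
    filter_upwards [hW] with i hi using (hi.join k hk).symm
  have hlim0 : Tendsto (fun i => τ i 0) 𝒰 (𝓝 (1 / ⨆ j, |zTilde X y j|)) := by
    have h1 : Tendsto (fun i => 1 / ‖zTilde X (Y i)‖) 𝒰 (𝓝 (1 / ‖zTilde X y‖)) :=
      tendsto_const_nhds.div hY.norm (norm_ne_zero_iff.2 hz)
    rw [iSup_abs_eq_norm]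
    refine h1.congr' ?_
    filter_upwards [hW] with i hi
    rw [hi.tau_zero, iSup_abs_eq_norm]
  obtain ⟨k, hk, hlims, t, ht, hg⟩ : ∃ k ≤ K, (∀ i ≤ k, ∃ t, Tendsto (fun ε => τ ε i) 𝒰 (𝓝 t)) ∧
      ∃ t, Tendsto (fun ε => τ ε k) 𝒰 (𝓝 t) ∧ gVec (line X γ (H k) (zTilde X y) t) = 0 := by
    by_contra hcon
    push Not at hcon
    have hall : ∀ k ≤ K, ∀ i ≤ k, ∃ t, Tendsto (fun ε => τ ε i) 𝒰 (𝓝 t) := by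
      intro k
      induction k with
      | zero =>
        intro _ i hi
        obtain rfl : i = 0 := by omega
        exact ⟨_, hlim0⟩
      | succ k ih =>
        intro hk i hi
        rcases Nat.lt_or_ge i (k + 1) with h | h
        · exact ih (by omega) i (by omega)
        obtain rfl : i = k + 1 := by omega
        rcases exists_limit_or_tendsto_atTop 𝒰 (hpos (k + 1) hk) with h1 | h1
        · exact h1
        -- If the next turning point escapes to infinity, the limit segment is unbounded and hence
        -- consists of perfect fits. Its starting point is then a perfect fit with convergent
        -- predecessors, against the assumption.
        exfalso
        obtain ⟨t, ht⟩ := ih (by omega) k le_rfl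
        refine hcon k (by omega) (ih (by omega)) t ht ?_
        rw [← hjoin k hk t ht]
        refine gVec_eq_zero_of_unbounded hn hγ (hgood _ hk) fun s hs => ?_
        rcases hs.eq_or_lt with rfl | hs
        · refine (isClosed_Box _).mem_of_tendsto (tendsto_line hY ht) ?_
          filter_upwards [hW] with i hi
          have : τ i k ∈ ival X γ (H (k + 1)) (zTilde X (Y i)) := by
            rw [hi.seg k hk]; exact left_mem_uIcc
          exact this.2
        · refine (isClosed_Box _).mem_of_tendsto (tendsto_line hY tendsto_const_nhds) ?_
          filter_upwards [hW, h1.eventually_ge_atTop s, ht.eventually (gt_mem_nhds hs)]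
            with i hi hi1 hi2
          have : s ∈ ival X γ (H (k + 1)) (zTilde X (Y i)) := by
            rw [hi.seg k hk]; exact mem_uIcc.2 (Or.inl ⟨hi2.le, hi1⟩)
          exact this.2
    obtain ⟨t, ht⟩ := hall K le_rfl K le_rfl
    refine hcon K le_rfl (hall K le_rfl) t ht ?_
    refine tendsto_nhds_unique ((continuous_gVec.tendsto _).comp (tendsto_line hY ht))
      (tendsto_const_nhds.congr' ?_)
    filter_upwards [hW] with i hi using hi.perfect.symm
  choose! T hT using hlims
  obtain rfl : T k = t := tendsto_nhds_unique (hT k le_rfl) ht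
  have hT0 : T 0 = 1 / ⨆ j, |zTilde X y j| := tendsto_nhds_unique (hT 0 (Nat.zero_le _)) hlim0
  have hmem : ∀ l ≤ k, line X γ (H l) (zTilde X y) (T l) ∈ Box (H l) := fun l hl =>
    (isClosed_Box _).mem_of_tendsto (tendsto_line hY (hT l hl))
      (hW.mono fun i hi => hi.mem l (hl.trans hk))
  have hnn : ∀ l ≤ k, 0 ≤ T l := fun l hl =>
    ge_of_tendsto (hT l hl) ((hpos l (hl.trans hk)).mono fun i hi => hi.le)
  refine ⟨k, T, hW₀.eta_zero, hT0, fun l hl => hgood l (hl.trans hk), ?_, hmem, ?_, ?_, hg⟩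
  · intro l hl
    rcases l with _ | l
    · rw [hT0]; exact one_div_pos.2 (iSup_abs_pos hz)
    · refine lt_of_le_of_ne (hnn _ hl) fun h0 => ?_
      refine zero_notMem_ival hn hγ hX (hgood (l + 1) (hl.trans hk))
        (hW₀.eta_succ_ne_zero hγ hz₀ (by omega)) (zTilde X y) ⟨le_rfl, ?_⟩
      rw [h0]; exact hmem _ hl
  · intro l hl
    exact ival_eq_of_tendsto hY (hT l hl.le) (hT (l + 1) hl) (hnn l hl.le) (hnn _ hl)
      (hpos l (by omega)) (hW.mono fun i hi => hi.seg l (by omega))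
  · intro l hl
    exact hjoin l (by omega) _ (hT l hl.le)

/-- For every response there is a trail. -/
theorem exists_trail (hn : 0 < n) (hp : 0 < p) (hγ : 0 < γ) (hX : Nondegenerate X)
    (hΓ : γ ∉ excSet X) (hz : zTilde X y ≠ 0) : ∃ K H τ, Trail X y γ K H τ := by
  obtain ⟨y₁, hy₁⟩ := exists_generic hn hγ hX
  set 𝒰 : Ultrafilter ℝ := Ultrafilter.of (𝓝[>] (0 : ℝ))
  have h𝒰 : (𝒰 : Filter ℝ) ≤ 𝓝[>] 0 := Ultrafilter.of_le _
  set N := (finite_indicators (p := p)).toFinset.card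
  have : Finite {η : Fin p → ℤ // ∀ j, |η j| ≤ 2} := finite_indicators.to_subtype
  -- The length and the indicators of a chain form an element of a finite type, so along the
  -- ultrafilter they can be taken independent of ε.
  have hex : ∀ᶠ ε in (𝒰 : Filter ℝ), ∃ d : Fin N × (Fin N → {η : Fin p → ℤ // ∀ j, |η j| ≤ 2}),
      ∃ τ, Walk X (y + ε • y₁) γ d.1 (fun k => if h : k < N then (d.2 ⟨k, h⟩).1 else 0) τ := by
    filter_upwards [h𝒰 (eventually_generic hn hγ hX hy₁ y)] with ε hε
    obtain ⟨K, H, τ, hC, hg⟩ := exists_chain hn hp hγ hX hΓ hε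
    have hK := hC.length_le
    refine ⟨(⟨K, hK⟩, fun k => if h : k.1 ≤ K then ⟨H k, (hC.good k h).range⟩ else ⟨0, by simp⟩), τ,
      (hC.walk hγ hg).congr ?_⟩
    intro k hk
    rw [dif_pos (show k < N from lt_of_le_of_lt hk hK)]
    simp [hk]
  rw [Ultrafilter.eventually_exists_iff] at hex
  obtain ⟨d, hd⟩ := hex
  obtain ⟨τ, hτ⟩ := hd.choice
  have hY : Tendsto (fun ε : ℝ => zTilde X (y + ε • y₁)) 𝒰 (𝓝 (zTilde X y)) := by
    have h1 : Tendsto (fun ε : ℝ => zTilde X y + ε • zTilde X y₁) (𝓝 0)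
        (𝓝 (zTilde X y + (0 : ℝ) • zTilde X y₁)) := by
      refine Continuous.tendsto ?_ 0
      fun_prop
    rw [zero_smul, add_zero] at h1
    refine (h1.mono_left (h𝒰.trans nhdsWithin_le_nhds)).congr fun ε => ?_
    rw [zTilde_add, zTilde_smul]
  obtain ⟨K', T, hW⟩ := Walk.limit hn hγ hX 𝒰 hY hz hτ
  obtain ⟨K, H, τ, hT⟩ := hW.exists_trail hγ hz
  exact ⟨K, H, τ, hT⟩

/-! ### Local minimizers -/

theorem mcp_of_le (hγ : 0 < γ) {l : ℝ} (hl : 0 < l) {t : ℝ} (h0 : 0 ≤ t) (h1 : t ≤ γ * l) :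
    mcp γ l t = l * t - t ^ 2 / (2 * γ) := by
  have hgl : 0 < γ * l := mul_pos hγ hl
  have : ∫ x in (0 : ℝ)..t, max (1 - x / (γ * l)) 0 = ∫ x in (0 : ℝ)..t, (1 - x / (γ * l)) := by
    refine intervalIntegral.integral_congr fun x hx => ?_
    rw [uIcc_of_le h0] at hx
    exact max_eq_left (sub_nonneg.2 ((div_le_one hgl).2 (hx.2.trans h1)))
  rw [mcp, this, intervalIntegral.integral_sub (by simp) (by
    exact (continuous_id.div_const _).intervalIntegrable _ _), intervalIntegral.integral_div]
  simp
  field_simp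

theorem mcp_const (hγ : 0 < γ) {l : ℝ} (hl : 0 < l) {s t : ℝ} (hs : γ * l ≤ s) (ht : γ * l ≤ t) :
    mcp γ l s = mcp γ l t := by
  have hgl : 0 < γ * l := mul_pos hγ hl
  have hc : Continuous fun x : ℝ => max (1 - x / (γ * l)) 0 := by fun_prop
  have hz : ∫ x in s..t, max (1 - x / (γ * l)) 0 = 0 := by
    rw [intervalIntegral.integral_congr (g := fun _ => 0)]
    · simp
    intro x hx
    have : γ * l ≤ x := (le_min hs ht).trans hx.1
    exact max_eq_right (sub_nonpos.2 ((one_le_div hgl).2 this))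
  have := intervalIntegral.integral_add_adjacent_intervals
    (hc.intervalIntegrable (μ := volume) 0 s) (hc.intervalIntegrable (μ := volume) s t)
  rw [hz, add_zero] at this
  rw [mcp, mcp, this]

/-- The penalty near a coefficient that is not at a knot. -/
theorem eventually_mcp_eq (hγ : 0 < γ) {l : ℝ} (hl : 0 < l) {i : ℤ} {u : ℝ} (hi : i ≠ 0)
    (hu : u ∈ cell i) (ht : ¬ IsTie u) : ∀ᶠ x in 𝓝 (l * bFun γ u),
      mcp γ l |x| = mcp γ l |l * bFun γ u| + l * gFun u * (x - l * bFun γ u)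
        - vCoef γ i * (x - l * bFun γ u) ^ 2 / 2 := by
  have s2 : Int.sign 2 = 1 := rfl
  have s3 : Int.sign (-2) = -1 := rfl
  have h1 : u ≠ 1 := by rintro rfl; exact ht (Or.inl (by simp))
  have h2 : u ≠ -1 := by rintro rfl; exact ht (Or.inl (by simp))
  have h3 : u ≠ 2 := by rintro rfl; exact ht (Or.inr (by simp))
  have h4 : u ≠ -2 := by rintro rfl; exact ht (Or.inr (by simp))
  have hgl : 0 < γ * l := mul_pos hγ hl
  rw [gFun_of_mem hu, bFun_of_mem hu]
  rcases mem_cell_iff.1 hu with ⟨rfl, h⟩ | ⟨rfl, h⟩ | ⟨rfl, h⟩ | ⟨rfl, h⟩ | ⟨rfl, h⟩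
  · exact absurd rfl hi
  · have hl1 : 1 < u := lt_of_le_of_ne h.1 h1.symm
    have hl2 : u < 2 := lt_of_le_of_ne h.2 h3
    have e : l * (bSlope γ 1 * u + bConst γ 1) = γ * l * (u - 1) := by simp [bSlope, bConst]; ring
    have hp : 0 < γ * l * (u - 1) := mul_pos hgl (by linarith)
    have hlt : γ * l * (u - 1) < γ * l := by nlinarith
    rw [e]
    filter_upwards [lt_mem_nhds hp, gt_mem_nhds hlt] with x hx1 hx2
    rw [abs_of_pos hx1, abs_of_pos hp, mcp_of_le hγ hl hx1.le hx2.le, mcp_of_le hγ hl hp.le hlt.le]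
    simp [gSlope, gConst, vCoef]
    field_simp
    ring
  · have hl2 : 2 < u := lt_of_le_of_ne h h3.symm
    have e : l * (bSlope γ 2 * u + bConst γ 2) = γ * l * (u - 1) := by
      simp [bSlope, bConst, s2]; ring
    have hlt : γ * l < γ * l * (u - 1) := by nlinarith
    rw [e]
    filter_upwards [lt_mem_nhds hlt] with x hx
    rw [mcp_const hγ hl (hx.le.trans (le_abs_self x)) (hlt.le.trans (le_abs_self _))]
    simp [gSlope, gConst, vCoef]
  · have hl1 : u < -1 := lt_of_le_of_ne h.2 h2
    have hl2 : -2 < u := lt_of_le_of_ne h.1 h4.symm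
    have e : l * (bSlope γ (-1) * u + bConst γ (-1)) = γ * l * (u + 1) := by
      simp [bSlope, bConst]; ring
    have hp : γ * l * (u + 1) < 0 := by nlinarith
    have hlt : -(γ * l) < γ * l * (u + 1) := by nlinarith
    rw [e]
    filter_upwards [gt_mem_nhds hp, lt_mem_nhds hlt] with x hx1 hx2
    rw [abs_of_neg hx1, abs_of_neg hp, mcp_of_le hγ hl (by linarith) (by linarith),
      mcp_of_le hγ hl (by linarith) (by linarith)]
    simp [gSlope, gConst, vCoef]
    field_simp
    ring
  · have hl2 : u < -2 := lt_of_le_of_ne h h4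
    have e : l * (bSlope γ (-2) * u + bConst γ (-2)) = γ * l * (u + 1) := by
      simp [bSlope, bConst, s3]; ring
    have hlt : γ * l * (u + 1) < -(γ * l) := by nlinarith
    rw [e]
    filter_upwards [gt_mem_nhds hlt] with x hx
    rw [mcp_const hγ hl ((by linarith : γ * l ≤ -x).trans (neg_le_abs x))
      ((by linarith : γ * l ≤ -(γ * l * (u + 1))).trans (neg_le_abs _))]
    simp [gSlope, gConst, vCoef]

/-- The kink λ|x| dominates the concave quadratic term near 0 and gives inactive coefficients a
positive first-order cost. -/
theorem eventually_mcp_zero (hγ : 0 < γ) {l : ℝ} (hl : 0 < l) :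
    ∀ᶠ x in 𝓝 (0 : ℝ), mcp γ l |x| = mcp γ l 0 + l * |x| - x ^ 2 / (2 * γ) := by
  have hgl : 0 < γ * l := mul_pos hγ hl
  filter_upwards [lt_mem_nhds (neg_lt_zero.2 hgl), gt_mem_nhds hgl] with x h1 h2
  rw [mcp_of_le hγ hl (abs_nonneg x) (abs_lt.2 ⟨h1, h2⟩).le, mcp_of_le hγ hl le_rfl hgl.le, sq_abs]
  ring

theorem dotProduct_gram_mulVec_comm (a b : Fin p → ℝ) :
    a ⬝ᵥ (gram X).mulVec b = b ⬝ᵥ (gram X).mulVec a := by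
  have ht : (gram X).transpose = gram X := by
    rw [gram, Matrix.transpose_smul, Matrix.transpose_mul, Matrix.transpose_transpose]
  rw [Matrix.dotProduct_mulVec, ← Matrix.mulVec_transpose, ht, dotProduct_comm]

theorem loss_add (hn : 0 < n) (l : ℝ) (β h : Fin p → ℝ) :
    loss X y γ l (β + h) = (∑ i, (y i - X.mulVec β i) ^ 2) / (2 * (n : ℝ))
      - h ⬝ᵥ (zTilde X y - (gram X).mulVec β) + h ⬝ᵥ (gram X).mulVec h / 2
      + ∑ j, mcp γ l |β j + h j| := by
  have hn' : (n : ℝ) ≠ 0 := by positivity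
  rw [loss]
  congr 1
  have e1 : ∀ v : Fin n → ℝ, ∑ i, v i ^ 2 = v ⬝ᵥ v := fun v =>
    Finset.sum_congr rfl fun i _ => by ring
  have e2 : zTilde X y - (gram X).mulVec β =
      (1 / (n : ℝ)) • X.transpose.mulVec (y - X.mulVec β) := by
    funext j
    have := zTilde_sub (X := X) (y := y) β j
    rw [Pi.sub_apply, ← this, Pi.smul_apply, smul_eq_mul]
    ring
  have e5 : ∀ r v : Fin n → ℝ, (r - v) ⬝ᵥ (r - v) = r ⬝ᵥ r - 2 * (v ⬝ᵥ r) + v ⬝ᵥ v := by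
    intro r v
    rw [sub_dotProduct, dotProduct_sub, dotProduct_sub, dotProduct_comm r v]
    ring
  have e3 := e1 (y - X.mulVec (β + h))
  have e4 := e1 (y - X.mulVec β)
  simp only [Pi.sub_apply] at e3 e4
  rw [e3, e4, e2, dotProduct_gram_mulVec, dotProduct_smul, Matrix.dotProduct_mulVec,
    Matrix.vecMul_transpose, Matrix.mulVec_add, ← sub_sub, e5, smul_eq_mul]
  field_simp

/-- A sufficient condition for a local minimum, at parameters strictly inside their cells. -/
theorem isLocalMin_loss (hn : 0 < n) (hγ : 0 < γ) (hQ : (Q X γ η).PosDef) {l : ℝ} (hl : 0 < l)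
    {u : Fin p → ℝ} (hu : u ∈ Box η) (ht : ∀ j, ¬ IsTie (u j))
    (hs : surf X γ u = (1 / l) • zTilde X y) : IsLocalMin (loss X y γ l) (l • bVec γ u) := by
  set β := l • bVec γ u with hβ
  have hgrad : zTilde X y - (gram X).mulVec β = l • gVec u := by
    have : zTilde X y = l • surf X γ u := by
      rw [hs, smul_smul, mul_one_div_cancel hl.ne', one_smul]
    rw [this, hβ, Matrix.mulVec_smul, surf, smul_add, add_sub_cancel_right]
  -- The displacement is split into its active part a and its inactive part d. Curvature controls
  -- the former and the kink at 0 the latter.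
  set a : (Fin p → ℝ) → Fin p → ℝ := fun b j => if η j = 0 then 0 else b j - β j with ha
  have hac : Continuous a := by
    refine continuous_pi fun j => ?_
    simp only [ha]
    split_ifs
    · exact continuous_const
    · fun_prop
  have ha0 : a β = 0 := by funext j; simp [ha]
  have hβ0 : ∀ j, η j = 0 → β j = 0 := by
    intro j hj
    have := hu j
    rw [hj] at this
    simp [hβ, bVec, bFun_eq_zero_of_mem_zero this]
  have hc1 : ∀ j, Tendsto (fun b : Fin p → ℝ => b j) (𝓝 β) (𝓝 (β j)) := fun j =>
    (continuous_apply j).tendsto β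
  -- For an inactive j the absence of ties gives |g_j| < 1. The slack λ(1 - |g_j|) then absorbs both
  -- the concavity of the penalty and the interaction with the active displacement, which tend to 0.
  have key : ∀ᶠ b in 𝓝 β, ∀ j,
      (η j ≠ 0 → mcp γ l |b j| = mcp γ l |β j| + l * gVec u j * (b j - β j)
        - vCoef γ (η j) * (b j - β j) ^ 2 / 2) ∧
      (η j = 0 → mcp γ l |b j| = mcp γ l 0 + l * |b j| - b j ^ 2 / (2 * γ) ∧
        |b j| / (2 * γ) + |(gram X).mulVec (a b) j| ≤ l * (1 - |gVec u j|)) := by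
    refine eventually_all.2 fun j => ?_
    by_cases hj : η j = 0
    · have h1 := hc1 j
      rw [hβ0 j hj] at h1
      have hlt : |gVec u j| < 1 := by
        have h2 := hu j
        rw [hj] at h2
        have h3 : gVec u j = u j := by rw [gVec, gFun_of_mem h2]; simp [gSlope, gConst]
        rw [h3]
        refine lt_of_le_of_ne ?_ fun h => ht j (Or.inl h)
        norm_num [mem_cell_iff] at h2
        exact abs_le.2 h2
      have hcont : Continuous fun b : Fin p → ℝ =>
          |b j| / (2 * γ) + |(gram X).mulVec (a b) j| := by
        have := (continuous_apply j).comp ((continuous_mulVec_const (gram X)).comp hac)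
        exact ((continuous_apply j).abs.div_const _).add this.abs
      have h4 := hcont.tendsto β
      rw [ha0, hβ0 j hj, Matrix.mulVec_zero] at h4
      simp only [abs_zero, zero_div, Pi.zero_apply, add_zero] at h4
      filter_upwards [h1.eventually (eventually_mcp_zero hγ hl),
        h4.eventually (gt_mem_nhds (mul_pos hl (sub_pos.2 hlt)))] with b hb1 hb2
      exact ⟨fun h => absurd hj h, fun _ => ⟨hb1, hb2.le⟩⟩
    · filter_upwards [(hc1 j).eventually (eventually_mcp_eq hγ hl hj (hu j) (ht j))] with b hb
      exact ⟨fun _ => hb, fun h => absurd h hj⟩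
  filter_upwards [key] with b hb
  set h := b - β with hh
  have hbβ : b = β + h := by rw [hh]; abel
  have hβz : loss X y γ l β = loss X y γ l (β + 0) := by rw [add_zero]
  rw [hβz, hbβ, loss_add hn, loss_add hn, hgrad]
  simp only [zero_dotProduct, Pi.zero_apply, add_zero, sub_zero, zero_div]
  set d : Fin p → ℝ := fun j => if η j = 0 then b j else 0 with hd
  have had : h = a b + d := by
    funext j
    simp only [hh, ha, hd, Pi.sub_apply, Pi.add_apply]
    split_ifs with hj
    · rw [hβ0 j hj]; ring
    · ring
  have hquad : h ⬝ᵥ (gram X).mulVec h = a b ⬝ᵥ (gram X).mulVec (a b) +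
      2 * (d ⬝ᵥ (gram X).mulVec (a b)) + d ⬝ᵥ (gram X).mulVec d := by
    rw [had, Matrix.mulVec_add, add_dotProduct, dotProduct_add, dotProduct_add,
      dotProduct_gram_mulVec_comm (a b) d]
    ring
  -- Nonnegativity of the quadratic form of Q(η) at a says that the curvature of the least squares
  -- term is at least the concavity of the penalty.
  have hQa : ∑ j, vCoef γ (η j) * a b j ^ 2 ≤ a b ⬝ᵥ (gram X).mulVec (a b) := by
    have h1 := hQ.posSemidef.dotProduct_mulVec_nonneg fun j : {j // η j ≠ 0} => a b j.1
    have h2 : (Q X γ η).mulVec (fun j : {j // η j ≠ 0} => a b j.1) =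
        fun i : {j // η j ≠ 0} => (gram X).mulVec (a b) i.1 - vCoef γ (η i.1) * a b i.1 := by
      funext i
      exact Q_mulVec (fun j hj => by simp [ha, hj]) i
    rw [h2] at h1
    have h3 := Fintype.sum_subtype_add_sum_subtype (fun j => η j ≠ 0) fun j =>
      a b j * ((gram X).mulVec (a b) j - vCoef γ (η j) * a b j)
    rw [Finset.sum_eq_zero (s := (Finset.univ : Finset {j // ¬ η j ≠ 0})), add_zero] at h3
    · have h4 : 0 ≤ ∑ j, a b j * ((gram X).mulVec (a b) j - vCoef γ (η j) * a b j) := by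
        rw [← h3]; exact h1
      simp only [mul_sub, Finset.sum_sub_distrib] at h4
      have h5 : ∑ j, a b j * (vCoef γ (η j) * a b j) = ∑ j, vCoef γ (η j) * a b j ^ 2 :=
        Finset.sum_congr rfl fun j _ => by ring
      rw [h5] at h4
      exact sub_nonneg.1 h4
    · rintro ⟨j, hj⟩ -
      push Not at hj
      simp [ha, hj]
  have hpsd : 0 ≤ d ⬝ᵥ (gram X).mulVec d := dotProduct_gram_nonneg d
  have hmain : ∑ j, mcp γ l |β j| ≤ -(h ⬝ᵥ l • gVec u) +
      (∑ j, vCoef γ (η j) * a b j ^ 2) / 2 + d ⬝ᵥ (gram X).mulVec (a b) +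
      ∑ j, mcp γ l |β j + h j| := by
    simp only [dotProduct, ← Finset.sum_neg_distrib, Finset.sum_div, ← Finset.sum_add_distrib]
    refine Finset.sum_le_sum fun j _ => ?_
    have e1 : β j + h j = b j := by rw [hbβ]; rfl
    rw [e1]
    by_cases hj : η j = 0
    · obtain ⟨h1, h2⟩ := (hb j).2 hj
      have hv : vCoef γ (η j) = 0 := by rw [hj]; simp [vCoef]
      have hhj : h j = b j := by rw [hh, Pi.sub_apply, hβ0 j hj, sub_zero]
      have hdj : d j = b j := by simp [hd, hj]
      rw [h1, hβ0 j hj, hv, hhj, hdj, abs_zero, Pi.smul_apply, smul_eq_mul]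
      have h3 : -(b j * (gram X).mulVec (a b) j) ≤ |b j| * |(gram X).mulVec (a b) j| := by
        rw [← abs_mul]; exact neg_le_abs _
      have h4 : b j * (l * gVec u j) ≤ l * (|b j| * |gVec u j|) := by
        rw [← abs_mul]
        have := mul_le_mul_of_nonneg_left (le_abs_self (b j * gVec u j)) hl.le
        linarith
      have h5 := mul_le_mul_of_nonneg_left h2 (abs_nonneg (b j))
      have h6 : b j ^ 2 / (2 * γ) = |b j| * (|b j| / (2 * γ)) := by
        rw [← mul_div_assoc, abs_mul_abs_self, sq]
      rw [h6]
      nlinarith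
    · have h1 := (hb j).1 hj
      have haj : a b j = h j := by simp [ha, hj, hh]
      have hdj : d j = 0 := by simp [hd, hj]
      have hbj : b j - β j = h j := rfl
      rw [h1, haj, hdj, hbj, Pi.smul_apply, smul_eq_mul]
      apply le_of_eq
      ring
  rw [hquad]
  linarith

/-- If an affine function attains its maximum over `s` at `x`, but is not constant on `s`, then `x`
is not in the relative interior of `s`. -/
theorem notMem_intrinsicInterior {V : Type*} [NormedAddCommGroup V] [NormedSpace ℝ V] {s : Set V}
    (φ : V →ᵃ[ℝ] ℝ) {x x' : V} (hmax : ∀ v ∈ s, φ v ≤ φ x) (hx' : x' ∈ s) (hne : φ x' ≠ φ x) :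
    x ∉ intrinsicInterior ℝ s := by
  intro hx
  obtain ⟨w, hw, rfl⟩ := mem_intrinsicInterior.1 hx
  have hx'm : x' ∈ affineSpan ℝ s := subset_affineSpan ℝ s hx'
  let f : ℝ → affineSpan ℝ s := fun t => ⟨AffineMap.lineMap (w : V) x' t,
    AffineMap.lineMap_mem t w.2 hx'm⟩
  have hf : Continuous f := by
    refine Continuous.subtype_mk ?_ _
    exact AffineMap.lineMap_continuous
  have hf0 : f 0 = w := Subtype.ext (by simp [f])
  -- A relatively interior point can be moved slightly away from x' without leaving s, and there the
  -- affine function would exceed its maximum.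
  have hev : ∀ᶠ t in 𝓝 (0 : ℝ), (f t : V) ∈ s := by
    have h1 := hf.tendsto 0
    rw [hf0] at h1
    filter_upwards [h1.eventually (mem_interior_iff_mem_nhds.1 hw)] with t ht using ht
  obtain ⟨t, ht, hlt⟩ := ((hev.filter_mono nhdsWithin_le_nhds).and
    (self_mem_nhdsWithin : Iio (0 : ℝ) ∈ 𝓝[<] 0)).exists
  have h1 := hmax _ ht
  have h2 : φ (f t) = (φ x' - φ w) * t + φ w := by
    change φ (AffineMap.lineMap (w : V) x' t) = _
    rw [AffineMap.apply_lineMap, AffineMap.lineMap_apply]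
    simp only [vsub_eq_sub, vadd_eq_add, smul_eq_mul]
    ring
  have h3 : φ x' < φ w := lt_of_le_of_ne (hmax _ hx') hne
  have h4 : t < 0 := hlt
  rw [h2] at h1
  nlinarith

/-- The parameter of the `j`-th coordinate, as an affine function on `H ⊕ H*`. -/
def coordAff (X : Matrix (Fin n) (Fin p) ℝ) (γ : ℝ) (η : Fin p → ℤ) (j : Fin p) :
    ((Fin p → ℝ) × (Fin p → ℝ)) →ᵃ[ℝ] ℝ :=
  if η j = 0 then
    ((LinearMap.proj j).comp (LinearMap.fst ℝ (Fin p → ℝ) (Fin p → ℝ)) -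
      (LinearMap.proj j).comp ((gram X).mulVecLin.comp (LinearMap.snd ℝ (Fin p → ℝ) (Fin p → ℝ)))).toAffineMap
  else
    (γ⁻¹ • (LinearMap.proj j).comp (LinearMap.snd ℝ (Fin p → ℝ) (Fin p → ℝ))).toAffineMap +
      AffineMap.const ℝ _ (((η j).sign : ℤ) : ℝ)

theorem coordAff_apply (hγ : 0 < γ) {u : Fin p → ℝ} (hu : u ∈ Box η) (j : Fin p) :
    coordAff X γ η j (surf X γ u, bVec γ u) = u j := by
  have huj := hu j
  unfold coordAff
  split_ifs with hj
  · rw [hj] at huj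
    simp only [LinearMap.coe_toAffineMap, LinearMap.sub_apply, LinearMap.comp_apply,
      LinearMap.fst_apply, LinearMap.snd_apply, LinearMap.proj_apply, Matrix.mulVecLin_apply]
    rw [surf, Pi.add_apply, add_sub_cancel_right, gVec, gFun_of_mem huj]
    simp [gSlope, gConst]
  · simp only [AffineMap.coe_add, Pi.add_apply, LinearMap.coe_toAffineMap, LinearMap.smul_apply,
      LinearMap.comp_apply, LinearMap.snd_apply, LinearMap.proj_apply, AffineMap.const_apply]
    change γ⁻¹ • bFun γ (u j) + _ = _
    rw [bFun_of_mem huj, bSlope, if_neg hj, bConst, smul_eq_mul]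
    field_simp
    ring

theorem exists_ne_mem_cell {i : ℤ} (hi : |i| ≤ 2) (c : ℝ) : ∃ c' ∈ cell i, c' ≠ c := by
  have : ∃ a b : ℝ, a ∈ cell i ∧ b ∈ cell i ∧ a ≠ b := by
    rcases int_abs_le_two hi with rfl | rfl | rfl | rfl | rfl
    · exact ⟨0, 1, by norm_num [mem_cell_iff], by norm_num [mem_cell_iff], by norm_num⟩
    · exact ⟨1, 2, by norm_num [mem_cell_iff], by norm_num [mem_cell_iff], by norm_num⟩
    · exact ⟨2, 3, by norm_num [mem_cell_iff], by norm_num [mem_cell_iff], by norm_num⟩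
    · exact ⟨-1, -2, by norm_num [mem_cell_iff], by norm_num [mem_cell_iff], by norm_num⟩
    · exact ⟨-2, -3, by norm_num [mem_cell_iff], by norm_num [mem_cell_iff], by norm_num⟩
  obtain ⟨a, b, ha, hb, hab⟩ := this
  by_cases h : a = c
  · exact ⟨b, hb, fun h' => hab (h.trans h'.symm)⟩
  · exact ⟨a, ha, h⟩

/-- At an interior point of a segment that is not contained in the relative boundary of its
parallelepiped there are no ties. -/
theorem not_isTie_of_openSegment (hγ : 0 < γ) (hr : ∀ j, |η j| ≤ 2)
    {s : Set ((Fin p → ℝ) × (Fin p → ℝ))} (hs : s ⊆ S X γ η) (hb : ¬ s ⊆ intrinsicFrontier ℝ (S X γ η))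
    {q₁ q₂ : (Fin p → ℝ) × (Fin p → ℝ)} (hseg : s = segment ℝ q₁ q₂) {u : Fin p → ℝ}
    (hu : u ∈ Box η) (hq : (surf X γ u, bVec γ u) ∈ openSegment ℝ q₁ q₂) (j : Fin p) :
    ¬ IsTie (u j) := by
  intro htie
  refine hb fun r hrs => ?_
  obtain ⟨σ, hσ⟩ := exists_crossing (hu j) htie
  -- At a tie this affine function attains its maximum over S(η). Attained inside a segment, the
  -- maximum is attained on all of it, so the whole segment would lie in the relative boundary.
  set φ : ((Fin p → ℝ) × (Fin p → ℝ)) →ᵃ[ℝ] ℝ := (σ : ℝ) • coordAff X γ η j with hφ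
  have hval : ∀ v ∈ Box η, φ (surf X γ v, bVec γ v) = σ * v j := by
    intro v hv
    rw [hφ, AffineMap.coe_smul, Pi.smul_apply, coordAff_apply hγ hv, smul_eq_mul]
  have hle : ∀ v ∈ S X γ η, φ v ≤ σ * u j := by
    intro v hv
    obtain ⟨w, hw, rfl⟩ := (mem_S_iff hγ hr).1 hv
    rw [hval w hw]
    have := hσ.side _ (hw j)
    linarith
  have hconst : ∀ v ∈ s, φ v = σ * u j := by
    have h1 : φ q₁ ≤ σ * u j := hle _ (hs (by rw [hseg]; exact left_mem_segment ℝ _ _))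
    have h2 : φ q₂ ≤ σ * u j := hle _ (hs (by rw [hseg]; exact right_mem_segment ℝ _ _))
    obtain ⟨a, b, ha, hb', hab, he⟩ := hq
    have hcomb : ∀ a b : ℝ, a + b = 1 → φ (a • q₁ + b • q₂) = a * φ q₁ + b * φ q₂ := by
      intro a b hab
      have := Convex.combo_affine_apply (f := φ) (x := q₁) (y := q₂) hab
      simpa using this
    have h3 := hcomb a b hab
    rw [he, hval u hu] at h3
    have h4 : φ q₁ = σ * u j := by
      refine le_antisymm h1 ?_
      have hbe : b = 1 - a := by linarith
      subst hbe
      nlinarith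
    have h5 : φ q₂ = σ * u j := by
      rw [h4] at h3
      have hbe : a = 1 - b := by linarith
      subst hbe
      have : b * (φ q₂ - σ * u j) = 0 := by linarith
      have := (mul_eq_zero.1 this).resolve_left hb'.ne'
      linarith
    intro v hv
    rw [hseg] at hv
    obtain ⟨a, b, ha, hb', hab, rfl⟩ := hv
    rw [hcomb a b hab, h4, h5, ← add_mul, hab, one_mul]
  rw [← intrinsicClosure_sdiff_intrinsicInterior]
  refine ⟨subset_intrinsicClosure (hs hrs), ?_⟩
  -- Changing only the j-th parameter within its cell shows that the function is not constant on
  -- S(η).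
  obtain ⟨c', hc', hne⟩ := exists_ne_mem_cell (hr j) (u j)
  have hup : Function.update u j c' ∈ Box η := by
    intro l
    by_cases hl : l = j
    · subst hl; simpa using hc'
    · simpa [hl] using hu l
  refine notMem_intrinsicInterior φ (x' := (surf X γ (Function.update u j c'),
    bVec γ (Function.update u j c'))) (fun v hv => (hle v hv).trans (hconst r hrs).ge)
    ((mem_S_iff hγ hr).2 ⟨_, hup, rfl⟩) ?_
  rw [hval _ hup, hconst r hrs]
  intro h
  apply hne
  have hσ0 : (σ : ℝ) ≠ 0 := by rcases hσ.sign with rfl | rfl <;> simp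
  have := mul_left_cancel₀ hσ0 h
  simpa using this

theorem IsPath.isLocalMin (hn : 0 < n) (hγ : 0 < γ) {D : PathData p} (hD : IsPath X y γ D) {k : ℕ}
    (hk1 : 1 ≤ k) (hk : k ≤ D.K) (hQ : (Q X γ (D.η k)).PosDef)
    (hb : ¬ ell X γ (D.η k) (zTilde X y) ⊆ intrinsicFrontier ℝ (S X γ (D.η k))) {x : ℝ}
    (hx1 : (k : ℝ) - 1 < x) (hx2 : x < k) :
    IsLocalMin (loss X y γ (D.curve x).1) (D.curve x).2 := by
  obtain ⟨m, rfl⟩ : ∃ m, k = m + 1 := ⟨k - 1, by omega⟩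
  push_cast at hx1 hx2
  have hr := hD.eta_range (m + 1) hk
  have hseg := hD.isSegment m hk
  have hi := interp_eq D (k := m) (x := x) (by linarith) hx2.le
  set r := x - m with hrdef
  have hr0 : 0 < r := by rw [hrdef]; linarith
  have hr1 : 0 < 1 - r := by rw [hrdef]; linarith
  have hq : (1 - r) • D.vertex (zTilde X y) m + r • D.vertex (zTilde X y) (m + 1) =
      ((D.interp x).1 • zTilde X y, (D.interp x).2) := by
    rw [hi]
    simp only [PathData.vertex, Prod.smul_mk, Prod.mk_add_mk, smul_smul, add_smul, smul_eq_mul]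
  have hop : ((D.interp x).1 • zTilde X y, (D.interp x).2) ∈
      openSegment ℝ (D.vertex (zTilde X y) m) (D.vertex (zTilde X y) (m + 1)) :=
    ⟨1 - r, r, hr1, hr0, by ring, hq⟩
  have hsub : ell X γ (D.η (m + 1)) (zTilde X y) ⊆ S X γ (D.η (m + 1)) := inter_subset_left
  have hmem : ((D.interp x).1 • zTilde X y, (D.interp x).2) ∈ S X γ (D.η (m + 1)) :=
    hsub (by rw [hseg]; exact openSegment_subset_segment ℝ _ _ hop)
  obtain ⟨u, hu, he⟩ := (mem_S_iff hγ hr).1 hmem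
  have hpos : 0 < (D.interp x).1 := by
    rw [hi]
    simp only [Prod.smul_mk, Prod.mk_add_mk, smul_eq_mul]
    have h1 := hD.tau_pos m (by omega)
    have h2 := hD.tau_pos (m + 1) hk
    positivity
  have hxK : x ≤ D.K := by
    have : ((m + 1 : ℕ) : ℝ) ≤ D.K := by exact_mod_cast hk
    push_cast at this
    linarith
  have hc : D.curve x = (1 / (D.interp x).1, (1 / (D.interp x).1) • bVec γ u) := by
    rw [PathData.curve, if_pos hxK, congrArg Prod.snd he]
  rw [hc]
  refine isLocalMin_loss hn hγ hQ (one_div_pos.2 hpos) hu ?_ ?_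
  · rw [he] at hop
    exact not_isTie_of_openSegment hγ hr hsub hb hseg hu hop
  · rw [one_div_one_div]
    exact (congrArg Prod.fst he).symm

/-! ### Zero sets of polynomial functions -/

section PolyFun

variable {F : Type*} [NormedAddCommGroup F] [NormedSpace ℝ F]

/-- A continuous function whose restriction to every line is a polynomial. -/
structure IsPolyFun (f : F → ℝ) : Prop where
  continuous : Continuous f
  line : ∀ x v : F, ∃ P : Polynomial ℝ, ∀ t : ℝ, f (x + t • v) = P.eval t

namespace IsPolyFun

theorem const (c : ℝ) : IsPolyFun fun _ : F => c :=
  ⟨continuous_const, fun _ _ => ⟨Polynomial.C c, fun _ => by simp⟩⟩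

theorem clm (φ : F →L[ℝ] ℝ) : IsPolyFun fun x => φ x :=
  ⟨φ.continuous, fun x v => ⟨Polynomial.C (φ x) + Polynomial.X * Polynomial.C (φ v), fun t => by
    simp only [map_add, map_smul, smul_eq_mul, Polynomial.eval_add, Polynomial.eval_mul,
      Polynomial.eval_C, Polynomial.eval_X]⟩⟩

variable {f g : F → ℝ}

theorem add (hf : IsPolyFun f) (hg : IsPolyFun g) : IsPolyFun fun x => f x + g x := by
  refine ⟨hf.continuous.add hg.continuous, fun x v => ?_⟩
  obtain ⟨P, hP⟩ := hf.line x v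
  obtain ⟨R, hR⟩ := hg.line x v
  exact ⟨P + R, fun t => by rw [hP, hR, Polynomial.eval_add]⟩

theorem mul (hf : IsPolyFun f) (hg : IsPolyFun g) : IsPolyFun fun x => f x * g x := by
  refine ⟨hf.continuous.mul hg.continuous, fun x v => ?_⟩
  obtain ⟨P, hP⟩ := hf.line x v
  obtain ⟨R, hR⟩ := hg.line x v
  exact ⟨P * R, fun t => by rw [hP, hR, Polynomial.eval_mul]⟩

theorem sub (hf : IsPolyFun f) (hg : IsPolyFun g) : IsPolyFun fun x => f x - g x := by
  simpa [sub_eq_add_neg] using hf.add ((const (-1)).mul hg)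

theorem sum {ι : Type*} {s : Finset ι} {f : ι → F → ℝ} (hf : ∀ i ∈ s, IsPolyFun (f i)) :
    IsPolyFun fun x => ∑ i ∈ s, f i x := by
  classical
  induction s using Finset.induction_on with
  | empty => simpa using const 0
  | insert a s ha ih =>
    simp only [Finset.sum_insert ha]
    exact (hf a (by simp)).add (ih fun i hi => hf i (by simp [hi]))

theorem prod {ι : Type*} {s : Finset ι} {f : ι → F → ℝ} (hf : ∀ i ∈ s, IsPolyFun (f i)) :
    IsPolyFun fun x => ∏ i ∈ s, f i x := by
  classical
  induction s using Finset.induction_on with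
  | empty => simpa using const 1
  | insert a s ha ih =>
    simp only [Finset.prod_insert ha]
    exact (hf a (by simp)).mul (ih fun i hi => hf i (by simp [hi]))

theorem det {ι : Type*} [Fintype ι] [DecidableEq ι] {M : F → Matrix ι ι ℝ}
    (hM : ∀ i j, IsPolyFun fun x => M x i j) : IsPolyFun fun x => (M x).det := by
  simp only [Matrix.det_apply']
  exact sum fun σ _ => (const _).mul (prod fun i _ => hM _ _)

/-- The zero set of a nonzero polynomial function is a null set. -/
theorem ae_ne_zero [MeasurableSpace F] [BorelSpace F] [FiniteDimensional ℝ F] (hf : IsPolyFun f)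
    {x₀ : F} (h₀ : f x₀ ≠ 0) (μ : Measure F) [μ.IsAddHaarMeasure] : ∀ᵐ x ∂μ, f x ≠ 0 := by
  have hmeas : MeasurableSet {q : F × ℝ | f (x₀ + q.2 • q.1) ≠ 0} := by
    have : Continuous fun q : F × ℝ => f (x₀ + q.2 • q.1) := hf.continuous.comp (by fun_prop)
    exact (isOpen_ne_fun this continuous_const).measurableSet
  have h1 : ∀ᵐ v ∂μ, ∀ᵐ t : ℝ, f (x₀ + t • v) ≠ 0 := by
    refine Eventually.of_forall fun v => ?_
    obtain ⟨P, hP⟩ := hf.line x₀ v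
    -- Every line through x₀ carries a nonzero polynomial, since its value at 0 is f x₀. So each
    -- line has finitely many zeros.
    have hP0 : P ≠ 0 := by
      rintro rfl
      exact h₀ (by simpa using hP 0)
    have hfin : {t : ℝ | f (x₀ + t • v) = 0}.Finite := by
      refine (P.roots.toFinset.finite_toSet).subset fun t ht => ?_
      have : P.eval t = 0 := by rw [← hP]; exact ht
      simpa [hP0] using this
    have := hfin.measure_zero volume
    rw [ae_iff]
    simpa using this
  have h2 := (Measure.ae_ae_comm (p := fun v (t : ℝ) => f (x₀ + t • v) ≠ 0) hmeas).1 h1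
  -- By Fubini some single t ≠ 0 works for almost all v, and v ↦ x₀ + tv preserves null sets in both
  -- directions.
  obtain ⟨t, ht, ht0⟩ := (h2.and (Measure.ae_ne volume (0 : ℝ))).exists
  rw [ae_iff] at ht ⊢
  have e1 : {v : F | ¬ f (x₀ + t • v) ≠ 0}
      = (fun v => t • v) ⁻¹' ((fun v => x₀ + v) ⁻¹' {x | ¬ f x ≠ 0}) := rfl
  rw [e1, Measure.addHaar_preimage_smul μ ht0, measure_preimage_add, mul_eq_zero] at ht
  refine ht.resolve_left ?_
  simp [ht0]

end IsPolyFun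

end PolyFun

/-! ### The uniform measure on the sphere -/

open Classical in
/-- The radial projection to the unit sphere. -/
def radial {n : ℕ} (e : Metric.sphere (0 : EuclideanSpace ℝ (Fin n)) 1)
    (x : EuclideanSpace ℝ (Fin n)) : Metric.sphere (0 : EuclideanSpace ℝ (Fin n)) 1 :=
  if h : x = 0 then e else ⟨‖x‖⁻¹ • x, by simp [norm_smul, h]⟩

theorem coe_radial {e : Metric.sphere (0 : EuclideanSpace ℝ (Fin n)) 1}
    {x : EuclideanSpace ℝ (Fin n)} (hx : x ≠ 0) :
    (radial e x : EuclideanSpace ℝ (Fin n)) = ‖x‖⁻¹ • x := by simp [radial, hx]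

theorem measurable_radial (e : Metric.sphere (0 : EuclideanSpace ℝ (Fin n)) 1) :
    Measurable (radial e) := by
  classical
  have h : ∀ x, (radial e x : EuclideanSpace ℝ (Fin n))
      = if x = 0 then (e : EuclideanSpace ℝ (Fin n)) else ‖x‖⁻¹ • x := by
    intro x
    by_cases hx : x = 0 <;> simp [radial, hx]
  have : Measurable fun x => (radial e x : EuclideanSpace ℝ (Fin n)) := by
    simp_rw [h]
    exact Measurable.ite (measurableSet_singleton _) measurable_const (by fun_prop)
  exact this.subtype_mk

/-- The measure of a subset of the sphere is n times the volume of the cone over it in the unit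
ball, and this cone is a preimage under the radial projection. -/
theorem toSphere_eq_map (e : Metric.sphere (0 : EuclideanSpace ℝ (Fin n)) 1) :
    (volume : Measure (EuclideanSpace ℝ (Fin n))).toSphere
      = (((n : ENNReal) • volume).restrict (Metric.ball 0 1 \ {0})).map (radial e) := by
  ext s hs
  rw [Measure.toSphere_apply' _ hs, Measure.map_apply (measurable_radial e) hs,
    Measure.restrict_apply (measurable_radial e hs)]
  simp only [finrank_euclideanSpace, Fintype.card_fin, Measure.smul_apply, smul_eq_mul]
  congr 2
  ext x
  simp only [Set.mem_smul, Set.mem_inter_iff, Set.mem_preimage, Set.mem_sdiff, Metric.mem_ball,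
    dist_zero_right, Set.mem_singleton_iff]
  constructor
  · rintro ⟨r, hr, _, ⟨u, hu, rfl⟩, rfl⟩
    have hu1 : ‖(u : EuclideanSpace ℝ (Fin n))‖ = 1 := by simp
    have hr0 : r ≠ 0 := hr.1.ne'
    have hne : r • (u : EuclideanSpace ℝ (Fin n)) ≠ 0 := by
      rw [← norm_ne_zero_iff, norm_smul, hu1]; simpa using hr0
    refine ⟨?_, ?_, hne⟩
    · convert hu
      refine Subtype.ext ?_
      rw [coe_radial hne, norm_smul, hu1, Real.norm_of_nonneg hr.1.le, mul_one, smul_smul,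
        inv_mul_cancel₀ hr0, one_smul]
    · rw [norm_smul, hu1, Real.norm_of_nonneg hr.1.le, mul_one]; exact hr.2
  · rintro ⟨h1, h2, h3⟩
    refine ⟨‖x‖, ⟨norm_pos_iff.2 h3, h2⟩, _, ⟨_, h1, rfl⟩, ?_⟩
    rw [coe_radial h3, smul_smul, mul_inv_cancel₀ (norm_ne_zero_iff.2 h3), one_smul]

/-- A property of `p` directions holds almost surely if it holds for almost all `p`-tuples of
vectors. -/
theorem ae_sphere (hn : 0 < n)
    {P : (Fin p → Metric.sphere (0 : EuclideanSpace ℝ (Fin n)) 1) → Prop}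
    (hP : MeasurableSet {u | P u})
    (h : ∀ (μ : Measure (Fin p → EuclideanSpace ℝ (Fin n))) [μ.IsAddHaarMeasure],
      ∀ᵐ x ∂μ, ∀ u : Fin p → Metric.sphere (0 : EuclideanSpace ℝ (Fin n)) 1,
        (∀ j, x j ≠ 0) → (∀ j, (u j : EuclideanSpace ℝ (Fin n)) = ‖x j‖⁻¹ • x j) → P u) :
    ∀ᵐ u ∂(Measure.pi fun _ : Fin p =>
      (volume : Measure (EuclideanSpace ℝ (Fin n))).toSphere), P u := by
  have : Nonempty (Fin n) := ⟨⟨0, hn⟩⟩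
  obtain ⟨e0, he0⟩ := exists_norm_eq (EuclideanSpace ℝ (Fin n)) zero_le_one
  let e : Metric.sphere (0 : EuclideanSpace ℝ (Fin n)) 1 := ⟨e0, by simpa using he0⟩
  let ν : Measure (EuclideanSpace ℝ (Fin n)) := (n : ENNReal) • volume
  have : ν.IsAddHaarMeasure := Measure.IsAddHaarMeasure.smul _ (by simpa using hn.ne') (by simp)
  rw [toSphere_eq_map e]
  have hm : ∀ _ : Fin p, Measurable (radial e) := fun _ => measurable_radial e
  have : IsFiniteMeasure (ν.restrict (Metric.ball 0 1 \ {0})) := by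
    refine ⟨?_⟩
    rw [Measure.restrict_apply_univ]
    exact lt_of_le_of_lt (measure_mono sdiff_subset) measure_ball_lt_top
  rw [← Measure.pi_map_pi fun j => (hm j).aemeasurable, ← Measure.restrict_pi_pi]
  have hmap : AEMeasurable (fun (x : Fin p → EuclideanSpace ℝ (Fin n)) j => radial e (x j))
      ((Measure.pi fun _ => ν).restrict (univ.pi fun _ => Metric.ball 0 1 \ {0})) :=
    (measurable_pi_lambda _ fun j => (hm j).comp (measurable_pi_apply j)).aemeasurable
  rw [ae_map_iff hmap hP]
  filter_upwards [ae_restrict_of_ae (h (Measure.pi fun _ => ν)), ae_restrict_mem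
    (MeasurableSet.univ_pi fun _ => Metric.isOpen_ball.measurableSet.diff
      (measurableSet_singleton 0))] with x hx hx'
  have hne : ∀ j, x j ≠ 0 := fun j => (hx' j (mem_univ j)).2
  exact hx _ hne fun j => coe_radial (hne j)

/-! ### Almost all designs are nondegenerate -/

theorem isPolyFun_coord (j : Fin p) (i : Fin n) :
    IsPolyFun fun x : Fin p → EuclideanSpace ℝ (Fin n) => x j i :=
  IsPolyFun.clm ((EuclideanSpace.proj i : EuclideanSpace ℝ (Fin n) →L[ℝ] ℝ).comp
    (ContinuousLinearMap.proj (φ := fun _ : Fin p => EuclideanSpace ℝ (Fin n)) j))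

theorem isPolyFun_inner (j k : Fin p) :
    IsPolyFun fun x : Fin p → EuclideanSpace ℝ (Fin n) => inner ℝ (x j) (x k) := by
  simp only [PiLp.inner_apply, RCLike.inner_apply, conj_trivial]
  exact IsPolyFun.sum fun i _ => (isPolyFun_coord k i).mul (isPolyFun_coord j i)

theorem exists_orthonormal_on {A : Finset (Fin p)} (hA : A.card ≤ n) :
    ∃ σ : Fin p → EuclideanSpace ℝ (Fin n),
      Orthonormal ℝ fun j : {j // j ∈ A} => σ j.1 := by
  have hc : Fintype.card {j // j ∈ A} ≤ Fintype.card (Fin n) := by simpa using hA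
  obtain ⟨f⟩ := Function.Embedding.nonempty_of_card_le hc
  classical
  refine ⟨fun j => if h : j ∈ A then EuclideanSpace.single (f ⟨j, h⟩) 1 else 0, ?_⟩
  have h1 := (EuclideanSpace.orthonormal_single (ι := Fin n) (𝕜 := ℝ)).comp f f.injective
  convert h1 using 2 with j
  simp [j.2]

/-- The Gram determinant is a polynomial in the columns and is nonzero at an orthonormal family. -/
theorem ae_linearIndependent {A : Finset (Fin p)} (hA : A.card ≤ n)
    (μ : Measure (Fin p → EuclideanSpace ℝ (Fin n))) [μ.IsAddHaarMeasure] :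
    ∀ᵐ x ∂μ, LinearIndependent ℝ fun j : {j // j ∈ A} => x j.1 := by
  obtain ⟨σ, hσ⟩ := exists_orthonormal_on hA
  have hp : IsPolyFun fun x : Fin p → EuclideanSpace ℝ (Fin n) =>
      (Matrix.gram ℝ fun j : {j // j ∈ A} => x j.1).det :=
    IsPolyFun.det fun i j => isPolyFun_inner _ _
  filter_upwards [hp.ae_ne_zero (x₀ := σ)
    (Matrix.det_gram_ne_zero_iff_linearIndependent.2 hσ.linearIndependent) μ] with x hx
  exact Matrix.det_gram_ne_zero_iff_linearIndependent.1 hx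

/-- A weight function on `ℝⁿ` such that the vectors `x / N x` do not lie on a fixed hyperplane. -/
structure IsWeight (n p : ℕ) (N : EuclideanSpace ℝ (Fin n) → ℝ) : Prop where
  measurable : Measurable N
  ne_zero : ∀ᵐ x, N x ≠ 0
  inner_ne : ∀ w, w ≠ 0 → ∀ c : ℝ, (1 < p ∨ c = 0) → ∀ᵐ x, inner ℝ w x ≠ c * N x

theorem exists_ne_zero_orthogonal {A : Finset (Fin p)} (hA : A.card < n)
    {x : Fin p → EuclideanSpace ℝ (Fin n)}
    (h : LinearIndependent ℝ fun j : {j // j ∈ A} => x j.1) :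
    ∃ w : EuclideanSpace ℝ (Fin n), w ≠ 0 ∧
      ∀ v ∈ Submodule.span ℝ (Set.range fun j : {j // j ∈ A} => x j.1), inner ℝ w v = 0 := by
  set K := Submodule.span ℝ (Set.range fun j : {j // j ∈ A} => x j.1) with hK
  have hne : Kᗮ ≠ ⊥ := by
    rw [Ne, Submodule.orthogonal_eq_bot_iff]
    intro h0
    have h1 := finrank_span_eq_card h
    rw [← hK, h0, finrank_top, finrank_euclideanSpace, Fintype.card_fin, Fintype.card_coe] at h1
    omega
  obtain ⟨w, hw, hw0⟩ := Submodule.exists_mem_ne_zero_of_ne_bot hne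
  exact ⟨w, hw0, fun v hv => by rw [real_inner_comm]; exact (Submodule.mem_orthogonal _ _).1 hw v hv⟩

/-- Only x_{k₀} is varied and the other columns are fixed. With w ≠ 0 orthogonal to the columns in
A, a dependence would force ⟨w, x_{k₀}⟩ = cN(x_{k₀}) with c determined by the other columns, and the
weight condition excludes this almost surely. -/
theorem ae_linearIndependent_option (hp : 0 < p) {N : EuclideanSpace ℝ (Fin n) → ℝ}
    (hN : IsWeight n p N) {A : Finset (Fin p)} (hA : A.card < n) {k₀ : Fin p} (hk : k₀ ∉ A)
    {η : Fin p → ℤ} (hη : η k₀ ≠ 0)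
    (μ : Measure (Fin p → EuclideanSpace ℝ (Fin n))) [μ.IsAddHaarMeasure] :
    ∀ᵐ x ∂μ, LinearIndependent ℝ fun o : Option {j // j ∈ A} =>
      o.elim (∑ k ∈ Aᶜ, ((η k : ℝ) / N (x k)) • x k) fun j => x j.1 := by
  have hNm := hN.measurable
  have key : ∀ᵐ x ∂μ, (LinearIndependent ℝ fun j : {j // j ∈ A} => x j.1) →
      LinearIndependent ℝ fun o : Option {j // j ∈ A} =>
        o.elim (∑ k ∈ Aᶜ, ((η k : ℝ) / N (x k)) • x k) fun j => x j.1 := by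
    refine ae_mem_of_ae_add_linearMap_mem
      (LinearMap.single ℝ (fun _ : Fin p => EuclideanSpace ℝ (Fin n)) k₀) volume μ
      (s := {x | (LinearIndependent ℝ fun j : {j // j ∈ A} => x j.1) →
      LinearIndependent ℝ fun o : Option {j // j ∈ A} =>
        o.elim (∑ k ∈ Aᶜ, ((η k : ℝ) / N (x k)) • x k) fun j => x j.1}) ?_ ?_
    · refine MeasurableSet.imp ?_ ?_
      · have hm : Measurable fun (x : Fin p → EuclideanSpace ℝ (Fin n)) (j : {j // j ∈ A}) =>
            x j.1 := by fun_prop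
        exact hm isOpen_setOfPred_linearIndependent.measurableSet
      · have hm : Measurable fun (x : Fin p → EuclideanSpace ℝ (Fin n))
            (o : Option {j // j ∈ A}) =>
            o.elim (∑ k ∈ Aᶜ, ((η k : ℝ) / N (x k)) • x k) fun j => x j.1 := by
          refine measurable_pi_lambda _ fun o => ?_
          cases o with
          | none =>
            simp only [Option.elim_none]
            exact Finset.measurable_sum _ fun k _ =>
              (measurable_const.div (hNm.comp (measurable_pi_apply k))).smul
                (measurable_pi_apply k)
          | some j => simpa using measurable_pi_apply j.1
        exact hm isOpen_setOfPred_linearIndependent.measurableSet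
    · intro y
      by_cases hy : LinearIndependent ℝ fun j : {j // j ∈ A} => y j.1
      · obtain ⟨w, hw0, hw⟩ := exists_ne_zero_orthogonal hA hy
        set c : ℝ := -(∑ k ∈ Aᶜ.erase k₀, (η k : ℝ) / N (y k) * inner ℝ w (y k)) / η k₀ with hc
        -- For p = 1 there are no other columns, so c = 0. This is what saves the case n = p = 1 on
        -- the sphere.
        have hc' : 1 < p ∨ c = 0 := by
          by_cases h : 1 < p
          · exact Or.inl h
          · right
            have : Aᶜ.erase k₀ = ∅ := by
              have : Subsingleton (Fin p) := Fin.subsingleton_iff_le_one.2 (by omega)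
              ext k
              simp [Subsingleton.elim k k₀]
            rw [hc, this]; simp
        have h1 := (eventually_add_left_iff volume (y k₀)).2
          (hN.ne_zero.and (hN.inner_ne w hw0 c hc'))
        filter_upwards [h1] with x hx _
        rw [LinearMap.coe_single]
        obtain ⟨x', hx'⟩ : ∃ x' : Fin p → EuclideanSpace ℝ (Fin n), x' = y + Pi.single k₀ x :=
          ⟨_, rfl⟩
        rw [← hx']
        have hxk : x' k₀ = y k₀ + x := by simp [hx']
        have hxl : ∀ l, l ≠ k₀ → x' l = y l := fun l hl => by simp [hx', hl]
        have hxA : (fun j : {j // j ∈ A} => x' j.1) = fun j => y j.1 := by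
          funext j
          exact hxl _ fun h => hk (h ▸ j.2)
        have hform : (fun o : Option {j // j ∈ A} =>
            o.elim (∑ k ∈ Aᶜ, ((η k : ℝ) / N (x' k)) • x' k)
              fun j => x' j.1)
            = fun o => o.casesOn'
              (∑ k ∈ Aᶜ, ((η k : ℝ) / N (x' k)) • x' k)
              (fun j => y j.1) := by
          funext o
          cases o with
          | none => rfl
          | some j => exact congrFun hxA j
        rw [hform, linearIndependent_option']
        refine ⟨hy, fun hmem => ?_⟩
        have h2 := hw _ hmem
        rw [← Finset.add_sum_erase _ _ (Finset.mem_compl.2 hk), inner_add_right,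
          inner_smul_right, hxk, inner_sum] at h2
        have h3 : ∑ k ∈ Aᶜ.erase k₀, inner ℝ w
            (((η k : ℝ) / N (x' k)) • x' k)
            = ∑ k ∈ Aᶜ.erase k₀, (η k : ℝ) / N (y k) * inner ℝ w (y k) :=
          Finset.sum_congr rfl fun k hk => by
            rw [hxl k (Finset.ne_of_mem_erase hk), inner_smul_right]
        rw [h3] at h2
        have hη' : (η k₀ : ℝ) ≠ 0 := by exact_mod_cast hη
        refine hx.2 ?_
        have hNx := hx.1
        rw [hc]
        field_simp at h2 ⊢
        linarith
      · refine Eventually.of_forall fun x h => ?_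
        refine absurd ?_ hy
        convert h using 2 with j
        have : j.1 ≠ k₀ := fun h => hk (h ▸ j.2)
        simp [this]
  filter_upwards [key, ae_linearIndependent hA.le μ] with x h1 h2 using h1 h2

theorem isWeight_one : IsWeight n p fun _ => 1 := by
  refine ⟨measurable_const, by simp, fun w hw c _ => ?_⟩
  have hP : IsPolyFun fun x : EuclideanSpace ℝ (Fin n) => inner ℝ w x - c * 1 :=
    (IsPolyFun.clm (innerSL ℝ w)).sub (IsPolyFun.const _)
  have hw' : (inner ℝ w w : ℝ) ≠ 0 := by simpa using hw
  -- The witness is scaled so that its inner product with w is c + 1.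
  filter_upwards [hP.ae_ne_zero (x₀ := ((c + 1) / inner ℝ w w : ℝ) • w)
    (by rw [inner_smul_right]; field_simp; norm_num) volume] with x hx
  exact sub_ne_zero.1 hx

/-- Squaring turns the equation into a polynomial one. For c ≠ 0 a nonzero vector orthogonal to w
violates it, which needs n ≥ 2; in dimension 1 the norm is proportional to the coordinate on a half
line. -/
theorem isWeight_norm (hn : 0 < n) (h : 2 ≤ n ∨ p = 1) :
    IsWeight n p fun x => ‖x‖ := by
  have : Nonempty (Fin n) := ⟨⟨0, hn⟩⟩
  refine ⟨measurable_norm, ?_, fun w hw c hc => ?_⟩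
  · filter_upwards [Measure.ae_ne volume (0 : EuclideanSpace ℝ (Fin n))] with x hx
    simpa using hx
  have hself : IsPolyFun fun x : EuclideanSpace ℝ (Fin n) => inner ℝ x x := by
    simp only [PiLp.inner_apply, RCLike.inner_apply, conj_trivial]
    refine IsPolyFun.sum fun i _ => ?_
    exact (IsPolyFun.clm (EuclideanSpace.proj i : EuclideanSpace ℝ (Fin n) →L[ℝ] ℝ)).mul
      (IsPolyFun.clm (EuclideanSpace.proj i : EuclideanSpace ℝ (Fin n) →L[ℝ] ℝ))
  have hP : IsPolyFun fun x : EuclideanSpace ℝ (Fin n) =>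
      inner ℝ w x * inner ℝ w x - c ^ 2 * inner ℝ x x :=
    ((IsPolyFun.clm (innerSL ℝ w)).mul (IsPolyFun.clm (innerSL ℝ w))).sub
      ((IsPolyFun.const _).mul hself)
  obtain ⟨x₀, hx₀⟩ : ∃ x₀ : EuclideanSpace ℝ (Fin n),
      inner ℝ w x₀ * inner ℝ w x₀ - c ^ 2 * inner ℝ x₀ x₀ ≠ (0 : ℝ) := by
    by_cases hc0 : c = 0
    · refine ⟨w, ?_⟩
      simpa [hc0] using hw
    · have hn2 : 2 ≤ n := by
        rcases h with h | h
        · exact h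
        · rcases hc with hc | hc
          · omega
          · exact absurd hc hc0
      have hne : (Submodule.span ℝ {w})ᗮ ≠ ⊥ := by
        rw [Ne, Submodule.orthogonal_eq_bot_iff]
        intro h0
        have h1 := finrank_span_singleton (K := ℝ) hw
        rw [h0, finrank_top, finrank_euclideanSpace, Fintype.card_fin] at h1
        omega
      obtain ⟨x, hx, hx0⟩ := Submodule.exists_mem_ne_zero_of_ne_bot hne
      refine ⟨x, ?_⟩
      rw [Submodule.mem_orthogonal_singleton_iff_inner_right.1 hx]
      simpa using ⟨hc0, hx0⟩
  filter_upwards [hP.ae_ne_zero hx₀ volume] with x hx heq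
  apply hx
  rw [heq, real_inner_self_eq_norm_sq]
  ring

/-! ### The matrices `Q(η)` of almost all designs -/

/-- The matrix `Q(η)` of the design with columns `xⱼ`, up to a scaling of rows and columns. -/
def scaledQ (M : EuclideanSpace ℝ (Fin n) → ℝ) (γ : ℝ) (η : Fin p → ℤ)
    (x : Fin p → EuclideanSpace ℝ (Fin n)) : Matrix {j // η j ≠ 0} {j // η j ≠ 0} ℝ :=
  Matrix.of fun i j => inner ℝ (x i.1) (x j.1) - if i = j then vCoef γ (η i.1) * M (x i.1) else 0

/-- Rescaling the columns multiplies the rows and columns of Q(η) by nonzero factors. Removing these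
factors leaves a matrix polynomial in the unnormalized columns when M is. -/
theorem Q_det_ne_zero_of_scaledQ (hn : 0 < n) {M : EuclideanSpace ℝ (Fin n) → ℝ}
    {x : Fin p → EuclideanSpace ℝ (Fin n)} {r : Fin p → ℝ} (hr : ∀ j, r j ≠ 0)
    (hM : ∀ j, r j ^ 2 * M (x j) = n) (hX : ∀ i j, X i j = r j * x j i)
    (h : (scaledQ M γ η x).det ≠ 0) : (Q X γ η).det ≠ 0 := by
  have hn' : (n : ℝ) ≠ 0 := by exact_mod_cast hn.ne'
  have hQ : Q X γ η = Matrix.of fun i j : {j // η j ≠ 0} => (r i.1 / n) *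
      (Matrix.of fun i j : {j // η j ≠ 0} => r j.1 * scaledQ M γ η x i j) i j := by
    ext i j
    have hg : gram X i.1 j.1 = r i.1 / n * (r j.1 * inner ℝ (x i.1) (x j.1)) := by
      simp only [gram, Matrix.smul_apply, Matrix.mul_apply, Matrix.transpose_apply, hX,
        smul_eq_mul, PiLp.inner_apply, RCLike.inner_apply, conj_trivial, Finset.mul_sum]
      exact Finset.sum_congr rfl fun k _ => by ring
    simp only [Q, Matrix.sub_apply, Matrix.submatrix_apply, hg, scaledQ, Matrix.of_apply]
    by_cases hij : i = j
    · subst hij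
      rw [Matrix.diagonal_apply_eq, if_pos rfl]
      have := hM i.1
      field_simp
      linear_combination (vCoef γ (η i.1)) * this
    · rw [Matrix.diagonal_apply_ne _ hij, if_neg hij]; ring
  rw [hQ, Matrix.det_mul_column, Matrix.det_mul_row]
  refine mul_ne_zero ?_ (mul_ne_zero ?_ h)
  · exact Finset.prod_ne_zero_iff.2 fun j _ => div_ne_zero (hr _) hn'
  · exact Finset.prod_ne_zero_iff.2 fun j _ => hr _

theorem ae_scaledQ_det_ne_zero {M : EuclideanSpace ℝ (Fin n) → ℝ}
    (hM : ∀ j, IsPolyFun fun x : Fin p → EuclideanSpace ℝ (Fin n) => M (x j))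
    (h : ∃ x, (scaledQ M γ η x).det ≠ 0)
    (μ : Measure (Fin p → EuclideanSpace ℝ (Fin n))) [μ.IsAddHaarMeasure] :
    ∀ᵐ x ∂μ, (scaledQ M γ η x).det ≠ 0 := by
  obtain ⟨x₀, hx₀⟩ := h
  have hP : IsPolyFun fun x : Fin p → EuclideanSpace ℝ (Fin n) => (scaledQ M γ η x).det := by
    refine IsPolyFun.det fun i j => ?_
    simp only [scaledQ, Matrix.of_apply]
    by_cases hij : i = j
    · simp only [if_pos hij]
      exact (isPolyFun_inner _ _).sub ((IsPolyFun.const _).mul (hM _))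
    · simp only [if_neg hij]
      exact (isPolyFun_inner _ _).sub (IsPolyFun.const 0)
  exact hP.ae_ne_zero hx₀ μ

theorem scaledQ_det_ne_zero {M : EuclideanSpace ℝ (Fin n) → ℝ}
    {x : Fin p → EuclideanSpace ℝ (Fin n)}
    (h : ∀ s : {j // η j ≠ 0} → ℝ, (∀ j : {j // η j ≠ 0},
      ∑ k : {j // η j ≠ 0}, inner ℝ (x j.1) (x k.1) * s k = vCoef γ (η j.1) * M (x j.1) * s j) →
      s = 0) : (scaledQ M γ η x).det ≠ 0 := by
  intro h0
  obtain ⟨s, hs, hs0⟩ := Matrix.exists_mulVec_eq_zero_iff.2 h0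
  refine hs (h s fun j => ?_)
  have := congrFun hs0 j
  simp only [scaledQ, Matrix.mulVec, dotProduct, Matrix.of_apply, sub_mul, ite_mul, zero_mul,
    Finset.sum_sub_distrib, Finset.sum_ite_eq, Finset.mem_univ, if_true, Pi.zero_apply] at this
  linarith

theorem vCoef_of_extreme {j : Fin p} (hj : j ∈ extremes η) : vCoef γ (η j) = 0 := by
  rw [mem_extremes] at hj
  simp [vCoef, hj]

theorem vCoef_of_notMem_extremes (hr : ∀ j, |η j| ≤ 2) {j : Fin p} (h0 : η j ≠ 0)
    (hj : j ∉ extremes η) : vCoef γ (η j) = 1 / γ := by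
  rw [mem_extremes] at hj
  have h1 := hr j
  have h2 : |η j| ≠ 0 := abs_ne_zero.2 h0
  have h3 := abs_nonneg (η j)
  have : |η j| = 1 := by omega
  simp [vCoef, this]

-- Witness: orthonormal extreme columns and zero columns elsewhere. The matrix is then diagonal with
-- entries 1 and -a/γ.
open Classical in
theorem exists_scaledQ_det_ne_zero_const (hγ : 0 < γ) (hr : ∀ j, |η j| ≤ 2)
    (hc : (extremes η).card ≤ n) {a : ℝ} (ha : a ≠ 0) :
    ∃ x : Fin p → EuclideanSpace ℝ (Fin n), (scaledQ (fun _ => a) γ η x).det ≠ 0 := by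
  obtain ⟨σ, hσ⟩ := exists_orthonormal_on hc
  refine ⟨fun j => if j ∈ extremes η then σ j else 0, scaledQ_det_ne_zero fun s hs => ?_⟩
  funext j
  have hj := hs j
  by_cases hje : j.1 ∈ extremes η
  · rw [vCoef_of_extreme hje, Finset.sum_eq_single j] at hj
    · have h1 := hσ.1 ⟨j.1, hje⟩
      simp only [if_pos hje, real_inner_self_eq_norm_sq] at hj
      rw [h1] at hj
      simpa using hj
    · intro k _ hk
      by_cases hke : k.1 ∈ extremes η
      · have h1 := hσ.2 (i := ⟨j.1, hje⟩) (j := ⟨k.1, hke⟩)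
          fun h => hk (Subtype.ext (congrArg (fun q => q.1) h).symm)
        simp only [if_pos hje, if_pos hke]
        rw [h1, zero_mul]
      · simp [if_neg hke]
    · simp
  · rw [vCoef_of_notMem_extremes hr j.2 hje] at hj
    simp only [if_neg hje, inner_zero_left, zero_mul, Finset.sum_const_zero] at hj
    have : 1 / γ * a ≠ 0 := by positivity
    simpa using (mul_eq_zero.1 hj.symm).resolve_left this

-- Witness: orthonormal extreme columns, with every penalized column equal to the extreme column j₁.
-- Row j₁ has the same inner products as each penalized row but no diagonal correction, and their
-- difference makes the penalized entries of a kernel vector vanish.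
open Classical in
theorem exists_scaledQ_det_ne_zero_of_extreme (hγ : 0 < γ) (hr : ∀ j, |η j| ≤ 2)
    (hc : (extremes η).card ≤ n) {j₁ : Fin p} (hj₁ : j₁ ∈ extremes η) :
    ∃ x : Fin p → EuclideanSpace ℝ (Fin n), (scaledQ (fun v => ‖v‖ ^ 2) γ η x).det ≠ 0 := by
  obtain ⟨σ, hσ⟩ := exists_orthonormal_on hc
  have hin : ∀ {j k}, j ∈ extremes η → k ∈ extremes η → inner ℝ (σ j) (σ k)
      = if j = k then (1 : ℝ) else 0 := by
    intro j k hj hk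
    have := orthonormal_iff_ite.1 hσ ⟨j, hj⟩ ⟨k, hk⟩
    simpa using this
  have h0 : η j₁ ≠ 0 := by
    have := mem_extremes.1 hj₁
    intro h; simp [h] at this
  refine ⟨fun j => if j ∈ extremes η then σ j else σ j₁, scaledQ_det_ne_zero fun s hs => ?_⟩
  have hx : ∀ j, (if j ∈ extremes η then σ j else σ j₁)
      = σ (if j ∈ extremes η then j else j₁) := fun j => by split_ifs <;> rfl
  have hm : ∀ j, (if j ∈ extremes η then j else j₁) ∈ extremes η := fun j => by
    split_ifs with h
    · exact h
    · exact hj₁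
  simp only [hx, hin (hm _) (hm _)] at hs
  have hnorm : ∀ j ∈ extremes η, ‖σ j‖ = 1 := fun j hj => hσ.1 ⟨j, hj⟩
  have h1 : ∀ j : {j // η j ≠ 0}, j.1 ∈ extremes η → j.1 ≠ j₁ → s j = 0 := by
    intro j hj hne
    have := hs j
    rw [vCoef_of_extreme hj, Finset.sum_eq_single j] at this
    · simpa using this
    · intro k _ hk
      rw [if_neg, zero_mul]
      rw [if_pos hj]
      split_ifs
      · exact fun h => hk (Subtype.ext h.symm)
      · exact hne
    · simp
  have h2 : ∀ j : {j // η j ≠ 0}, j.1 ∉ extremes η → s j = 0 := by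
    intro j hj
    have e1 := hs ⟨j₁, h0⟩
    have e2 := hs j
    simp only [if_pos hj₁, if_neg hj, vCoef_of_extreme hj₁, hnorm _ hj₁,
      vCoef_of_notMem_extremes hr j.2 hj] at e1 e2
    rw [e1] at e2
    have : 1 / γ * 1 ^ 2 ≠ (0 : ℝ) := by positivity
    simpa using (mul_eq_zero.1 (by simpa using e2.symm : 1 / γ * 1 ^ 2 * s j = 0)).resolve_left this
  funext j
  by_cases hj : j.1 ∈ extremes η
  · by_cases hne : j.1 = j₁
    · have := hs j
      rw [vCoef_of_extreme hj, Finset.sum_eq_single j] at this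
      · simpa using this
      · intro k _ hk
        by_cases hke : k.1 ∈ extremes η
        · rw [h1 k hke fun h => hk (Subtype.ext (h.trans hne.symm)), mul_zero]
        · rw [h2 k hke, mul_zero]
      · simp
    · exact h1 j hj hne
  · exact h2 j hj

-- With all m active columns equal, the matrix is J - I/γ for the all-ones matrix J, singular only
-- if mγ = 1. In that case one column is replaced by an orthogonal one, leaving the blocks 1 - 1/γ
-- and J - I/γ of size m - 1, both nonsingular. As γ ≠ 1, this case has m ≥ 2, hence p ≥ 2 and n ≥
-- 2.
open Classical in
theorem exists_scaledQ_det_ne_zero_of_no_extreme (hn : 0 < n) (hγ : 0 < γ) (hγ1 : γ ≠ 1)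
    (hnp : 2 ≤ n ∨ p = 1) (hr : ∀ j, |η j| ≤ 2) (he : ∀ j, j ∉ extremes η) :
    ∃ x : Fin p → EuclideanSpace ℝ (Fin n), (scaledQ (fun v => ‖v‖ ^ 2) γ η x).det ≠ 0 := by
  set a : EuclideanSpace ℝ (Fin n) := EuclideanSpace.single ⟨0, hn⟩ 1 with ha
  have hna : ‖a‖ = 1 := by simp [ha]
  have haa : inner ℝ a a = (1 : ℝ) := by rw [real_inner_self_eq_norm_sq, hna]; norm_num
  by_cases hk : (Fintype.card {j // η j ≠ 0} : ℝ) * γ = 1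
  · have hcard : Fintype.card {j // η j ≠ 0} ≠ 1 := fun h => hγ1 (by simpa [h] using hk)
    have hcard0 : Fintype.card {j // η j ≠ 0} ≠ 0 := fun h => by simp [h] at hk
    have hle : Fintype.card {j // η j ≠ 0} ≤ p :=
      (Fintype.card_subtype_le _).trans_eq (Fintype.card_fin p)
    have hn2 : 2 ≤ n := by
      rcases hnp with h | h
      · exact h
      · omega
    obtain ⟨j₀⟩ : Nonempty {j // η j ≠ 0} := Fintype.card_pos_iff.1 (Nat.pos_of_ne_zero hcard0)
    set e : EuclideanSpace ℝ (Fin n) := EuclideanSpace.single ⟨1, hn2⟩ 1 with he'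
    have hne : ‖e‖ = 1 := by simp [he']
    have hae : inner ℝ a e = (0 : ℝ) := EuclideanSpace.orthonormal_single.2 (by simp)
    have hea : inner ℝ e a = (0 : ℝ) := by rw [real_inner_comm]; exact hae
    have hee : inner ℝ e e = (1 : ℝ) := by rw [real_inner_self_eq_norm_sq, hne]; norm_num
    refine ⟨fun j => if j = j₀.1 then e else a, scaledQ_det_ne_zero fun s hs => ?_⟩
    have h0 : s j₀ = 0 := by
      have := hs j₀
      rw [Finset.sum_eq_single j₀, vCoef_of_notMem_extremes hr j₀.2 (he _)] at this
      · simp only [if_true, hee, hne] at this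
        have h2 : (1 - 1 / γ) * s j₀ = 0 := by linarith
        refine (mul_eq_zero.1 h2).resolve_left fun h => hγ1 ?_
        field_simp at h
        linarith
      · intro k _ hk
        have : k.1 ≠ j₀.1 := fun h => hk (Subtype.ext h)
        simp [this, hea]
      · simp
    set T := ∑ k : {j // η j ≠ 0}, inner ℝ a (if k.1 = j₀.1 then e else a) * s k with hT
    have h1 : ∀ j : {j // η j ≠ 0}, j ≠ j₀ → s j = γ * T := by
      intro j hj
      have := hs j
      have hj' : j.1 ≠ j₀.1 := fun h => hj (Subtype.ext h)
      simp only [if_neg hj', vCoef_of_notMem_extremes hr j.2 (he _), hna] at this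
      rw [← hT] at this
      rw [this]; field_simp
    have hT0 : T = 0 := by
      have h2 : T = ∑ k ∈ Finset.univ.erase j₀, γ * T := by
        conv_lhs => rw [hT, ← Finset.add_sum_erase _ _ (Finset.mem_univ j₀), h0, mul_zero, zero_add]
        refine Finset.sum_congr rfl fun k hk => ?_
        have hk' := Finset.ne_of_mem_erase hk
        have : k.1 ≠ j₀.1 := fun h => hk' (Subtype.ext h)
        rw [if_neg this, haa, one_mul, h1 k hk']
      rw [Finset.sum_const, Finset.card_erase_of_mem (Finset.mem_univ _), Finset.card_univ,
        nsmul_eq_mul, Nat.cast_sub (Nat.pos_of_ne_zero hcard0), Nat.cast_one] at h2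
      have h3 : γ * T = 0 := by linear_combination h2 + T * hk
      exact (mul_eq_zero.1 h3).resolve_left hγ.ne'
    funext j
    by_cases hj : j = j₀
    · rw [hj, h0]; rfl
    · rw [h1 j hj, hT0, mul_zero]; rfl
  · refine ⟨fun _ => a, scaledQ_det_ne_zero fun s hs => ?_⟩
    simp only [haa, one_mul, hna] at hs
    have h1 : ∀ j, s j = γ * ∑ k, s k := by
      intro j
      rw [hs j, vCoef_of_notMem_extremes hr j.2 (he _)]; field_simp
    have h2 : ∑ k, s k = 0 := by
      have : ∑ k, s k = ∑ k : {j // η j ≠ 0}, γ * ∑ k, s k :=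
        Finset.sum_congr rfl fun k _ => h1 k
      rw [Finset.sum_const, Finset.card_univ, nsmul_eq_mul] at this
      have h3 : ((Fintype.card {j // η j ≠ 0} : ℝ) * γ - 1) * ∑ k, s k = 0 := by
        linear_combination -this
      exact (mul_eq_zero.1 h3).resolve_left (sub_ne_zero.2 hk)
    funext j
    rw [h1 j, h2, mul_zero]; rfl

/-! ### The exceptional set -/

/-- At γ = -1 the diagonal is added instead of subtracted. A kernel vector vanishes off the extremes
and satisfies Xa = 0, so it vanishes because fewer than min(n,p) columns remain. -/
theorem Q_neg_one_det_ne_zero (hn : 0 < n) (hX : Nondegenerate X) (hr : ∀ j, |η j| ≤ 2)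
    (hc : (extremes η).card < min n p) : (Q X (-1) η).det ≠ 0 := by
  classical
  intro h0
  obtain ⟨s, hs, hs0⟩ := Matrix.exists_mulVec_eq_zero_iff.2 h0
  set a : Fin p → ℝ := fun j => if h : η j ≠ 0 then s ⟨j, h⟩ else 0 with ha
  have has : s = fun j => a j.1 := by
    funext j
    simp [ha, j.2]
  have ha0 : ∀ j, η j = 0 → a j = 0 := fun j hj => by simp [ha, hj]
  have h1 : ∀ j, a j * (gram X).mulVec a j = vCoef (-1) (η j) * a j ^ 2 := by
    intro j
    by_cases hj : η j = 0
    · simp [ha0 j hj]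
    · have := congrFun hs0 ⟨j, hj⟩
      rw [has, Q_mulVec ha0, Pi.zero_apply] at this
      linear_combination a j * this
  have h2 : ∀ j, 0 ≤ -(vCoef (-1) (η j) * a j ^ 2) := by
    intro j
    have : vCoef (-1) (η j) ≤ 0 := by
      unfold vCoef
      split_ifs <;> norm_num
    nlinarith [sq_nonneg (a j)]
  have h3 : a ⬝ᵥ (gram X).mulVec a = ∑ j, vCoef (-1) (η j) * a j ^ 2 :=
    Finset.sum_congr rfl fun j _ => h1 j
  rw [dotProduct_gram_mulVec] at h3
  have hn' : (0 : ℝ) < 1 / n := by positivity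
  have h4 : 0 ≤ X.mulVec a ⬝ᵥ X.mulVec a := Finset.sum_nonneg fun i _ => mul_self_nonneg _
  have h5 : ∑ j, -(vCoef (-1) (η j) * a j ^ 2) ≤ 0 := by
    rw [Finset.sum_neg_distrib, ← h3]
    have := mul_nonneg hn'.le h4
    linarith
  have h6 := (Finset.sum_eq_zero_iff_of_nonneg fun j _ => h2 j).1
    (le_antisymm h5 (Finset.sum_nonneg fun j _ => h2 j))
  have h7 : X.mulVec a = 0 := by
    rw [← dotProduct_self_eq_zero]
    rw [Finset.sum_neg_distrib, ← h3] at h5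
    have h8 : 1 / (n : ℝ) * (X.mulVec a ⬝ᵥ X.mulVec a) = 0 := by
      rw [h3]
      exact Finset.sum_eq_zero fun j hj => by
        have := h6 j hj
        linarith
    exact (mul_eq_zero.1 h8).resolve_left hn'.ne'
  have h8 : a = 0 := by
    refine hX.eq_zero_of_support hc.le (fun k hk => ?_) h7
    by_cases hk0 : η k = 0
    · exact ha0 k hk0
    · have := h6 k (Finset.mem_univ k)
      rw [vCoef_of_notMem_extremes hr hk0 hk] at this
      simpa using this
  apply hs
  rw [has, h8]
  rfl

/-- For each η the determinant of Q(η) is a polynomial in 1/γ, nonzero because of its value at γ =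
-1. The convention 0⁻¹ = 0 makes this valid at γ = 0 too. -/
theorem finite_excSet (hn : 0 < n) (hX : Nondegenerate X) : (excSet X).Finite := by
  have hfin : {η : Fin p → ℤ | ∀ j, |η j| ≤ 2}.Finite := by
    refine (Set.Finite.pi' fun _ : Fin p => Set.finite_Icc (-2 : ℤ) 2).subset fun η h j => ?_
    exact abs_le.1 (h j)
  have hsub : excSet X ⊆ ⋃ η ∈ {η : Fin p → ℤ | ∀ j, |η j| ≤ 2},
      {γ | (extremes η).card < min n p ∧ (Q X γ η).det = 0} := by
    rintro γ ⟨η, h1, h2, h3⟩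
    exact Set.mem_biUnion (x := η) h1 ⟨h2, h3⟩
  refine (hfin.biUnion fun η hr => ?_).subset hsub
  by_cases hc : (extremes η).card < min n p
  · have hP : IsPolyFun fun t : ℝ => (Matrix.of fun i j : {j // η j ≠ 0} =>
        gram X i.1 j.1 - t * (if i = j ∧ |η i.1| = 1 then 1 else 0)).det := by
      refine IsPolyFun.det fun i j => ?_
      simp only [Matrix.of_apply]
      exact (IsPolyFun.const _).sub ((IsPolyFun.clm (ContinuousLinearMap.id ℝ ℝ)).mul
        (IsPolyFun.const _))
    obtain ⟨P, hP⟩ := hP.line 0 1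
    have hQ : ∀ γ : ℝ, (Q X γ η).det = P.eval γ⁻¹ := by
      intro γ
      rw [← hP]
      congr 1
      ext i j
      simp only [Q, Matrix.sub_apply, Matrix.submatrix_apply, Matrix.of_apply, vCoef]
      by_cases hij : i = j
      · subst hij
        rw [Matrix.diagonal_apply_eq]
        by_cases h1 : |η i.1| = 1 <;> simp [h1]
      · rw [Matrix.diagonal_apply_ne _ hij]
        simp [hij]
    have hP0 : P ≠ 0 := by
      rintro rfl
      exact Q_neg_one_det_ne_zero hn hX hr hc (by simpa using hQ (-1))
    refine ((P.roots.toFinset.finite_toSet).preimage inv_injective.injOn).subset ?_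
    rintro γ ⟨-, h⟩
    rw [hQ] at h
    simpa [hP0] using h
  · simp [hc]

/-! ### Almost all designs are regular -/

/-- For almost all `x₁, …, x_p`, the design with the columns `κ xⱼ / N(xⱼ)` is nondegenerate, and
`γ` is not exceptional. -/
theorem ae_design (hn : 0 < n) (hp : 0 < p) {N : EuclideanSpace ℝ (Fin n) → ℝ}
    (hN : IsWeight n p N) {κ : ℝ} (hκ : κ ≠ 0) {M : EuclideanSpace ℝ (Fin n) → ℝ}
    (hM : ∀ j, IsPolyFun fun x : Fin p → EuclideanSpace ℝ (Fin n) => M (x j))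
    (hMN : ∀ v, N v ≠ 0 → (κ / N v) ^ 2 * M v = n)
    (hw : ∀ η : Fin p → ℤ, (∀ j, |η j| ≤ 2) → (extremes η).card < min n p →
      ∃ x : Fin p → EuclideanSpace ℝ (Fin n), (scaledQ M γ η x).det ≠ 0)
    (μ : Measure (Fin p → EuclideanSpace ℝ (Fin n))) [μ.IsAddHaarMeasure] :
    ∀ᵐ x ∂μ, (∀ j, N (x j) ≠ 0) → ∀ X : Matrix (Fin n) (Fin p) ℝ,
      (∀ i j, X i j = κ / N (x j) * x j i) → Nondegenerate X ∧ γ ∉ excSet X := by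
  have h1 : ∀ᵐ x ∂μ, ∀ (A : Finset (Fin p)) (η : Fin p → ℤ) (k₀ : Fin p), A.card < n → k₀ ∉ A →
      η k₀ ≠ 0 → LinearIndependent ℝ fun o : Option {j // j ∈ A} =>
        o.elim (∑ k ∈ Aᶜ, ((η k : ℝ) / N (x k)) • x k) fun j => x j.1 := by
    simp only [ae_all_iff]
    intro A η k₀ hA hk hη
    exact ae_linearIndependent_option hp hN hA hk hη μ
  have h2 : ∀ᵐ x ∂μ, ∀ η : Fin p → ℤ, (∀ j, |η j| ≤ 2) → (extremes η).card < min n p →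
      (scaledQ M γ η x).det ≠ 0 := by
    rw [ae_all_iff]
    intro η
    by_cases hη : (∀ j, |η j| ≤ 2) ∧ (extremes η).card < min n p
    · filter_upwards [ae_scaledQ_det_ne_zero hM (hw η hη.1 hη.2) μ] with x hx _ _ using hx
    · exact Eventually.of_forall fun x h h' => absurd ⟨h, h'⟩ hη
  filter_upwards [h1, h2] with x hx1 hx2 hNx X hX
  refine ⟨?_, ?_⟩
  · rintro A hA η - ⟨k₀, hk, hη⟩
    have hli := hx1 A η k₀ (by omega) hk hη
    let w : Option {j // j ∈ A} → ℝˣ := fun o => o.elim (Units.mk0 κ hκ)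
      fun j => Units.mk0 (κ / N (x j.1)) (div_ne_zero hκ (hNx _))
    have h3 := (hli.units_smul w).map' (WithLp.linearEquiv 2 ℝ (Fin n → ℝ)).toLinearMap
      (LinearEquiv.ker _)
    have heq : (fun o : Option {j // j ∈ A} =>
        o.elim (fun i : Fin n => ∑ k ∈ Aᶜ, (η k : ℝ) * X i k) (fun j i => X i j.1))
        = (WithLp.linearEquiv 2 ℝ (Fin n → ℝ)).toLinearMap ∘ (w • fun o : Option {j // j ∈ A} =>
          o.elim (∑ k ∈ Aᶜ, ((η k : ℝ) / N (x k)) • x k) fun j => x j.1) := by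
      funext o i
      cases o with
      | none =>
        change ∑ k ∈ Aᶜ, (η k : ℝ) * X i k
          = κ * (∑ k ∈ Aᶜ, ((η k : ℝ) / N (x k)) • x k : EuclideanSpace ℝ (Fin n)) i
        simp only [WithLp.ofLp_sum, Finset.sum_apply, PiLp.smul_apply, smul_eq_mul,
          Finset.mul_sum, hX]
        exact Finset.sum_congr rfl fun k _ => by ring
      | some j => simp [w, Units.smul_def, hX]
    rw [heq]
    exact h3
  · rintro ⟨η, h3, h4, h5⟩
    exact Q_det_ne_zero_of_scaledQ hn (fun j => div_ne_zero hκ (hNx j)) (fun j => hMN _ (hNx j))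
      hX (hx2 η h3 h4) h5

/-- The linear identification of matrices with `p`-tuples of vectors. -/
def columnsEquiv (n p : ℕ) : (Fin n → Fin p → ℝ) ≃ₗ[ℝ] (Fin p → EuclideanSpace ℝ (Fin n)) where
  toFun X j := WithLp.toLp 2 fun i => X i j
  invFun x i j := x j i
  map_add' _ _ := rfl
  map_smul' _ _ := rfl
  left_inv _ := rfl
  right_inv _ := rfl

/-- No normalization: the weight is N = 1, and the diagonal of `scaledQ` uses the constant M = n. -/
theorem ae_regular (hn : 0 < n) (hp : 0 < p) (hγ : 0 < γ) :
    ∀ᵐ X : Fin n → Fin p → ℝ, Nondegenerate (Matrix.of X) ∧ γ ∉ excSet (Matrix.of X) := by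
  have hn' : (n : ℝ) ≠ 0 := by positivity
  let L := (columnsEquiv n p).toContinuousLinearEquiv
  have hL : (Measure.map L volume).IsAddHaarMeasure := L.isAddHaarMeasure_map volume
  have h := ae_design (γ := γ) hn hp isWeight_one one_ne_zero (M := fun _ => (n : ℝ))
    (fun _ => IsPolyFun.const _) (fun v _ => by simp)
    (fun η hr hc => exists_scaledQ_det_ne_zero_const hγ hr
      (hc.le.trans (min_le_left _ _)) hn')
    (Measure.map L volume)
  filter_upwards [ae_of_ae_map L.continuous.measurable.aemeasurable h] with X hX
  refine hX (fun _ => one_ne_zero) _ fun i j => ?_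
  simp only [div_one, one_mul]
  rfl

theorem continuous_sphereDesign_column (j : Fin p) :
    Continuous fun (u : Fin p → Metric.sphere (0 : EuclideanSpace ℝ (Fin n)) 1) (i : Fin n) =>
      sphereDesign u i j := by
  unfold sphereDesign
  simp only [Matrix.of_apply]
  fun_prop

theorem measurableSet_regular : MeasurableSet
    {u : Fin p → Metric.sphere (0 : EuclideanSpace ℝ (Fin n)) 1 |
      Nondegenerate (sphereDesign u) ∧ γ ∉ excSet (sphereDesign u)} := by
  have hcol := fun j : Fin p => continuous_sphereDesign_column (n := n) j
  have hent : ∀ i j, Continuous fun u : Fin p → Metric.sphere (0 : EuclideanSpace ℝ (Fin n)) 1 =>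
      sphereDesign u i j := fun i j => (continuous_apply i).comp (hcol j)
  have h1 : MeasurableSet {u : Fin p → Metric.sphere (0 : EuclideanSpace ℝ (Fin n)) 1 |
      Nondegenerate (sphereDesign u)} := by
    simp only [Nondegenerate, Set.ofPred_forall]
    refine MeasurableSet.iInter fun A => MeasurableSet.iInter fun _ => MeasurableSet.iInter fun η =>
      MeasurableSet.iInter fun _ => MeasurableSet.iInter fun _ => ?_
    refine IsOpen.measurableSet ?_
    refine (isOpen_setOfPred_linearIndependent (𝕜 := ℝ) (E := Fin n → ℝ)
      (ι := Option {j // j ∈ A})).preimage (continuous_pi fun o => ?_)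
    cases o with
    | none =>
      refine continuous_pi fun i => ?_
      exact continuous_finsetSum _ fun k _ => continuous_const.mul (hent i k)
    | some j => exact hcol j.1
  have h2 : MeasurableSet {u : Fin p → Metric.sphere (0 : EuclideanSpace ℝ (Fin n)) 1 |
      γ ∉ excSet (sphereDesign u)} := by
    have : {u : Fin p → Metric.sphere (0 : EuclideanSpace ℝ (Fin n)) 1 |
        γ ∉ excSet (sphereDesign u)} = {u | ∀ η : Fin p → ℤ, (∀ j, |η j| ≤ 2) →
          (extremes η).card < min n p → (Q (sphereDesign u) γ η).det ≠ 0} := by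
      ext u
      simp [excSet]
    rw [this]
    simp only [Set.ofPred_forall]
    refine MeasurableSet.iInter fun η => MeasurableSet.iInter fun _ =>
      MeasurableSet.iInter fun _ => ?_
    refine IsOpen.measurableSet (isOpen_ne_fun ?_ continuous_const)
    refine Continuous.matrix_det ?_
    unfold Q gram
    refine continuous_matrix fun i j => ?_
    simp only [Matrix.sub_apply, Matrix.submatrix_apply, Matrix.smul_apply, Matrix.mul_apply,
      Matrix.transpose_apply, smul_eq_mul]
    refine (continuous_const.mul (continuous_finsetSum _ fun k _ => ?_)).sub continuous_const
    exact (hent _ _).mul (hent _ _)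
  exact h1.inter h2

/-- Normalized columns √n x/‖x‖ correspond to N = ‖·‖ and M = ‖·‖². The value γ = 1 must be avoided:
then Q(η) = 1 - 1/γ = 0 whenever η has a single nonzero entry and this entry is ±1. -/
theorem ae_sphere_regular (hn : 0 < n) (hp : 0 < p) (hnp : 2 ≤ n ∨ p = 1) (hγ : 0 < γ)
    (hγ1 : γ ≠ 1) :
    ∀ᵐ u ∂(Measure.pi fun _ : Fin p =>
        (volume : Measure (EuclideanSpace ℝ (Fin n))).toSphere),
      Nondegenerate (sphereDesign u) ∧ γ ∉ excSet (sphereDesign u) := by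
  have hn' : (0 : ℝ) < n := by positivity
  refine ae_sphere hn measurableSet_regular fun μ _ => ?_
  have h := ae_design (γ := γ) hn hp (isWeight_norm hn hnp) (Real.sqrt_pos.2 hn').ne'
    (M := fun v => ‖v‖ ^ 2)
    (fun j => by simpa only [real_inner_self_eq_norm_sq] using isPolyFun_inner (n := n) j j)
    (fun v hv => by
      rw [div_pow, Real.sq_sqrt hn'.le]
      field_simp)
    (fun η hr hc => by
      by_cases he : ∃ j, j ∈ extremes η
      · obtain ⟨j, hj⟩ := he
        exact exists_scaledQ_det_ne_zero_of_extreme hγ hr (hc.le.trans (min_le_left _ _)) hj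
      · push Not at he
        exact exists_scaledQ_det_ne_zero_of_no_extreme hn hγ hγ1 hnp hr he)
    μ
  filter_upwards [h] with x hx u hx0 hu
  refine hx (fun j => norm_ne_zero_iff.2 (hx0 j)) _ fun i j => ?_
  simp only [sphereDesign, Matrix.of_apply, hu, PiLp.smul_apply, smul_eq_mul]
  ring

end
end MCPlus

theorem theorem3 (n p : ℕ) (hn : 0 < n) (hp : 0 < p) :
    ∃ Γ₀ : Matrix (Fin n) (Fin p) ℝ → Set ℝ,
      -- (i) existence of the path, for nondegenerate designs
      (∀ X : Matrix (Fin n) (Fin p) ℝ, Nondegenerate X →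
        (Γ₀ X).Finite ∧
        ∀ γ : ℝ, 0 < γ → γ ∉ Γ₀ X → ∀ y : Fin n → ℝ, zTilde X y ≠ 0 →
          ∃ D : PathData p, IsPath X y γ D ∧ IsSolutionPath X y γ D.curve ∧
            (∀ k ≤ D.K, (Q X γ (D.η k)).det ≠ 0) ∧ EndsInPerfectFit X y D) ∧
      -- (ii) almost every design, under the Lebesgue measure
      (∀ γ : ℝ, 0 < γ → ∀ᵐ X : Fin n → Fin p → ℝ,
        Nondegenerate (Matrix.of X) ∧ γ ∉ Γ₀ (Matrix.of X)) ∧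
      -- (iii) almost every design, under the product of the uniform measures on spheres
      (2 ≤ n ∨ p = 1 → ∀ γ : ℝ, 0 < γ → γ ≠ 1 →
        ∀ᵐ u ∂(Measure.pi fun _ : Fin p =>
            (volume : Measure (EuclideanSpace ℝ (Fin n))).toSphere),
          Nondegenerate (sphereDesign u) ∧ γ ∉ Γ₀ (sphereDesign u)) ∧
      -- (iv) for almost every `z̃`: uniqueness, computation by the algorithm, one at a time
      (∀ X : Matrix (Fin n) (Fin p) ℝ, Nondegenerate X →
        ∀ γ : ℝ, 0 < γ → γ ∉ Γ₀ X →
          ∃ H₀ : Set (Fin p → ℝ), volume H₀ = 0 ∧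
            volume {y : Fin n → ℝ | zTilde X y ∈ H₀} = 0 ∧
            ∀ y : Fin n → ℝ, zTilde X y ∉ H₀ →
              ∃ D : PathData p, IsPath X y γ D ∧ IsSolutionPath X y γ D.curve ∧
                (∀ k ≤ D.K, (Q X γ (D.η k)).det ≠ 0) ∧ EndsInPerfectFit X y D ∧
                IsPlusOutput X y γ D ∧ IsUniqueBranch X y γ D) ∧
      -- (v) local minimizers
      (∀ (X : Matrix (Fin n) (Fin p) ℝ) (y : Fin n → ℝ) (γ : ℝ), 0 < γ →
        ∀ D : PathData p, IsPath X y γ D →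
          ∀ k : ℕ, 1 ≤ k → k ≤ D.K → (Q X γ (D.η k)).PosDef →
            ¬ ell X γ (D.η k) (zTilde X y) ⊆ intrinsicFrontier ℝ (S X γ (D.η k)) →
            ∀ x : ℝ, (k : ℝ) - 1 < x → x < k →
              IsLocalMin (loss X y γ (D.curve x).1) (D.curve x).2) := by
  refine ⟨excSet, ?_, fun γ hγ => ae_regular hn hp hγ,
    fun hnp γ hγ hγ1 => ae_sphere_regular hn hp hnp hγ hγ1, ?_, ?_⟩
  · refine fun X hX => ⟨finite_excSet hn hX, fun γ hγ hΓ y hz => ?_⟩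
    obtain ⟨K, H, τ, hT⟩ := exists_trail hn hp hγ hX hΓ hz
    exact ⟨trailData X y γ K H τ, hT.isPath hγ hz, hT.isSolutionPath hγ hz,
      fun k hk => (hT.good k hk).det, hT.endsInPerfectFit hn hγ⟩
  · intro X hX γ hγ hΓ
    obtain ⟨h₁, h₂⟩ := volume_not_generic hn hγ hX
    refine ⟨{z | ¬ Generic X γ z}, h₁, h₂, fun y hy => ?_⟩
    have hy : Generic X γ (zTilde X y) := not_not.1 hy
    have hz := hy.ne_zero hn hp hΓ
    obtain ⟨K, H, τ, hC, hg⟩ := exists_chain hn hp hγ hX hΓ hy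
    have hT := hC.trail hγ hg
    exact ⟨trailData X y γ K H τ, hT.isPath hγ hz, hT.isSolutionPath hγ hz,
      fun k hk => (hT.good k hk).det, hT.endsInPerfectFit hn hγ, hC.isPlusOutput hγ hg hy hz,
      hC.isUniqueBranch hn hγ hg hy hz⟩
  · intro X y γ hγ D hD k hk1 hk hQ hb x hx1 hx2
    exact hD.isLocalMin hn hγ hk1 hk hQ hb hx1 hx2
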